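/- For every classical oracle $\mathcal{O}:\{0,1\}^*\to\{0,1\}$, $$\mathsf{BQP}^{\mathcal{O}}\subseteq\mathsf{MIP}^{\mathcal{O}},$$ where both are classes of promise problems $L=(L_{\mathrm{YES}},L_{\mathrm{NO}})$ (disjoint subsets of $\{0,1\}^*$), defined as follows. $L\in\mathsf{BQP}^{\mathcal{O}}$ if there is a polynomial-time uniform family of quantum circuits $\{C_n\}_{n\ge 0}$ (a deterministic classical machine without oracle produces a description of $C_n$ from $1^n$ in time $\mathrm{poly}(n)$) over the universal gate set $\{H,T,\mathrm{CNOT}\}$ and oracle gates $|z\rangle\mapsto(-1)^{\mathcal{O}(z)}|z\rangle$ acting on arbitrary lists of qubits, such that, when $C_{|x|}$ is run on $|x\rangle|0\cdots0\rangle$ and the first qubit is measured, the outcome is $0$ with probability at least $2/3$ for every $x\in L_{\mathrm{YES}}$ and at most $1/3$ for every $x\in L_{\mathrm{NO}}$. $L\in\mathsf{MIP}^{\mathcal{O}}$ if there are a number $k$ and a probabilistic polynomial-time classical verifier $V$ with oracle access to $\mathcal{O}$, exchanging classical messages with $k$ provers over as many rounds as it likes, such that: 1. (Efficiency) on every input $x$,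 for all outcomes of its coins and all behaviours of the provers, $V^{\mathcal{O}}(x)$ halts within $\mathrm{poly}(|x|)$ steps (hence uses at most $\mathrm{poly}(|x|)$ random coins and at most $\mathrm{poly}(|x|)$ queries to the provers and to $\mathcal{O}$) and accepts or rejects; 2. (Completeness) there are provers $P_1,\dots,P_k$ such that for every $x\in L_{\mathrm{YES}}$ the verifier accepts with probability at least $2/3$; 3. (Soundness) for every $x\in L_{\mathrm{NO}}$ and all provers $\hat P_1,\dots,\hat P_k$, the verifier accepts with probability at most $1/3$. Here provers are computationally unbounded and non-communicating: each reply of a prover is an arbitrary function of $x$ and of the messages that this prover has received so far. -/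

import Mathlib

/-!
Relativized complexity classes for promise problems over bit strings.

* Classical machines are structured programs over finitely many stacks of bits (a fixed program
  mentions finitely many of them).  Every elementary step touches boundedly many bits, so the step
  count agrees with that of multi-tape Turing machines up to polynomial factors.
* Quantum circuits are lists of gates from the universal set {H, T, CNOT}, together with
  phase-oracle gates on arbitrary lists of qubits.
-/

namespace OracleComplexity

/-- A classical oracle: a Boolean function on all finite bit strings. -/
abbrev Oracle : Type := List Bool → Bool

/-- A promise problem: disjoint sets of yes-instances and no-instances. -/
structure PromiseProblem where
  yes : Set (List Bool)
  no : Set (List Bool)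
  disjoint : Disjoint yes no

/-! ### Classical programs with coins, oracle queries and provers -/

/-- Tests on a register: is it non-empty; is its top bit `1`. -/
inductive Test where
  | nonempty (r : ℕ)
  | top (r : ℕ)

/-- Programs over registers `0, 1, 2, …`, each holding a bit string used as a stack.
`flip r` pushes a fresh random coin on `r`.
`query q r` pushes on `r` the oracle's answer to the string in `q`.
`ask i m l r` sends the string in `m` to prover `i` and stores in `r` the first `|l|` bits of its
reply, where `|l|` is the length of the string in register `l`. -/
inductive Cmd where
  | skip
  | push (r : ℕ) (b : Bool)
  | pop (r : ℕ)
  | seq (c d : Cmd)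
  | ite (T : Test) (c d : Cmd)
  | loop (T : Test) (c : Cmd)
  | flip (r : ℕ)
  | query (q r : ℕ)
  | ask (i m l r : ℕ)

/-- Programs that are deterministic and self-contained: no coins, no oracle, no provers. -/
def Cmd.Internal : Cmd → Prop
  | .skip => True
  | .push _ _ => True
  | .pop _ => True
  | .seq c d => c.Internal ∧ d.Internal
  | .ite _ c d => c.Internal ∧ d.Internal
  | .loop _ c => c.Internal
  | .flip _ => False
  | .query _ _ => False
  | .ask _ _ _ _ => False

/-- A computationally unbounded prover: from the common input and the list of all messages that
the verifier has sent to this prover so far (latest last), it determines its reply.  It sees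
nothing of the verifier's conversation with other provers. -/
abbrev Prover : Type := List Bool → List (List Bool) → List Bool

/-- What a program interacts with: an oracle, the common input, and `k` provers. -/
structure Env where
  oracle : Oracle
  input : List Bool
  k : ℕ
  prover : Fin k → Prover

/-- The reply of prover `i` to the messages `h` (empty if there is no prover `i`). -/
def Env.reply (E : Env) (i : ℕ) (h : List (List Bool)) : List Bool :=
  if hi : i < E.k then E.prover ⟨i, hi⟩ E.input h else []

/-- The surroundings of a self-contained computation. -/
def Env.silent : Env where
  oracle := fun _ => false
  input := []
  k := 0
  prover := fun i => i.elim0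

/-- A configuration: register contents, coins not yet used, and, for each prover, the messages
sent to it so far. -/
structure State where
  reg : ℕ → List Bool
  coins : List Bool
  sent : ℕ → List (List Bool)

/-- The start: `x` in register `0`, all other registers empty, nothing sent. -/
def State.init (x coins : List Bool) : State where
  reg := Function.update (fun _ => []) 0 x
  coins := coins
  sent := fun _ => []

/-- Overwrite register `r`. -/
def State.set (s : State) (r : ℕ) (v : List Bool) : State :=
  { s with reg := Function.update s.reg r v }

/-- Record that the message `m` has been sent to prover `i`. -/
def State.record (s : State) (i : ℕ) (m : List Bool) : State :=
  { s with sent := Function.update s.sent i (s.sent i ++ [m]) }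

/-- Truth of a test. -/
def Test.Holds (s : State) : Test → Prop
  | .nonempty r => s.reg r ≠ []
  | .top r => (s.reg r).head? = some true

/-- `Exec E c s s' t`: started in `s`, the program `c` halts in `s'` after `t` steps.
Oracle queries and messages are charged for their length. -/
inductive Exec (E : Env) : Cmd → State → State → ℕ → Prop where
  | skip (s : State) : Exec E .skip s s 1
  | push (r : ℕ) (b : Bool) (s : State) :
      Exec E (.push r b) s (s.set r (b :: s.reg r)) 1
  | pop (r : ℕ) (s : State) :
      Exec E (.pop r) s (s.set r (s.reg r).tail) 1
  | seq {c d : Cmd} {s s' s'' : State} {t t' : ℕ} :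
      Exec E c s s' t → Exec E d s' s'' t' → Exec E (.seq c d) s s'' (t + t')
  | ite_true {T : Test} {c d : Cmd} {s s' : State} {t : ℕ} :
      T.Holds s → Exec E c s s' t → Exec E (.ite T c d) s s' (t + 1)
  | ite_false {T : Test} {c d : Cmd} {s s' : State} {t : ℕ} :
      ¬ T.Holds s → Exec E d s s' t → Exec E (.ite T c d) s s' (t + 1)
  | loop_true {T : Test} {c : Cmd} {s s' s'' : State} {t t' : ℕ} :
      T.Holds s → Exec E c s s' t → Exec E (.loop T c) s' s'' t' →
      Exec E (.loop T c) s s'' (t + t' + 1)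
  | loop_false {T : Test} {c : Cmd} {s : State} :
      ¬ T.Holds s → Exec E (.loop T c) s s 1
  | flip (r : ℕ) (s : State) :
      Exec E (.flip r) s
        { s.set r (s.coins.headD false :: s.reg r) with coins := s.coins.tail } 1
  | query (q r : ℕ) (s : State) :
      Exec E (.query q r) s (s.set r (E.oracle (s.reg q) :: s.reg r)) ((s.reg q).length + 1)
  | ask (i m l r : ℕ) (s : State) :
      Exec E (.ask i m l r) s
        ((s.record i (s.reg m)).set r
          ((E.reply i (s.sent i ++ [s.reg m])).take (s.reg l).length))
        ((s.reg m).length + (s.reg l).length + 1)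

/-- A program has at most one run from a given configuration. -/
theorem Exec.det {E : Env} {c : Cmd} {s s₁ s₂ : State} {t₁ t₂ : ℕ}
    (h₁ : Exec E c s s₁ t₁) (h₂ : Exec E c s s₂ t₂) : s₁ = s₂ ∧ t₁ = t₂ := by
  induction h₁ generalizing s₂ t₂ with
  | skip | push | pop | flip | query | ask => cases h₂; exact ⟨rfl, rfl⟩
  | seq _ _ ih ih' =>
    cases h₂ with
    | seq a b =>
      obtain ⟨rfl, rfl⟩ := ih a
      obtain ⟨rfl, rfl⟩ := ih' b
      exact ⟨rfl, rfl⟩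
  | ite_true hT _ ih =>
    cases h₂ with
    | ite_true _ a => obtain ⟨rfl, rfl⟩ := ih a; exact ⟨rfl, rfl⟩
    | ite_false hF _ => exact absurd hT hF
  | ite_false hF _ ih =>
    cases h₂ with
    | ite_true hT _ => exact absurd hT hF
    | ite_false _ a => obtain ⟨rfl, rfl⟩ := ih a; exact ⟨rfl, rfl⟩
  | loop_true hT _ _ ih ih' =>
    cases h₂ with
    | loop_true _ a b =>
      obtain ⟨rfl, rfl⟩ := ih a
      obtain ⟨rfl, rfl⟩ := ih' b
      exact ⟨rfl, rfl⟩
    | loop_false hF => exact absurd hT hF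
  | loop_false hF =>
    cases h₂ with
    | loop_true hT _ _ => exact absurd hT hF
    | loop_false _ => exact ⟨rfl, rfl⟩

/-! ### Multi-prover interactive proofs -/

/-- On the coin sequence `ω`, the verifier `V` with the oracle `O` and the provers `P` halts on
input `x` with top bit `1` in register `0`; any other output means rejection. -/
def Accepts (O : Oracle) (V : Cmd) {k : ℕ} (P : Fin k → Prover) (x ω : List Bool) : Prop :=
  ∃ s t, Exec ⟨O, x, k, P⟩ V (State.init x ω) s t ∧ (s.reg 0).head? = some true

/-- The acceptance probability over `m` independent fair coins. -/
noncomputable def acceptProb (O : Oracle) (V : Cmd) {k : ℕ} (P : Fin k → Prover)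
    (x : List Bool) (m : ℕ) : ℝ :=
  (Nat.card {ω : Fin m → Bool // Accepts O V P x (List.ofFn ω)} : ℝ) / 2 ^ m

/-- On every input `x`, the verifier halts within `p(|x|)` steps, whatever the coins are and
however the provers behave.  It thus uses at most `p(|x|)` coins and queries. -/
def RunsInTime (O : Oracle) (V : Cmd) (k : ℕ) (p : Polynomial ℕ) : Prop :=
  ∀ (x : List Bool) (P : Fin k → Prover) (ω : Fin (p.eval x.length) → Bool),
    ∃ s t, Exec ⟨O, x, k, P⟩ V (State.init x (List.ofFn ω)) s t ∧ t ≤ p.eval x.length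

/-- Promise problems with a multi-prover interactive proof relative to `O`. -/
def MIP (O : Oracle) : Set PromiseProblem :=
  {L | ∃ (V : Cmd) (k : ℕ) (p : Polynomial ℕ),
    RunsInTime O V k p ∧
    (∃ P : Fin k → Prover, ∀ x ∈ L.yes, 2 / 3 ≤ acceptProb O V P x (p.eval x.length)) ∧
    (∀ x ∈ L.no, ∀ P : Fin k → Prover, acceptProb O V P x (p.eval x.length) ≤ 1 / 3)}

/-! ### Quantum circuits with oracle gates -/

/-- Gates on `w` qubits.  `oracle ws` applies the phase oracle to the qubits listed in `ws`. -/
inductive Gate (w : ℕ) where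
  | H (q : Fin w)
  | T (q : Fin w)
  | CNOT (c t : Fin w) (h : c ≠ t)
  | oracle (ws : List (Fin w))

/-- Amplitudes of a `w`-qubit state in the computational basis. -/
abbrev QState (w : ℕ) : Type := (Fin w → Bool) → ℂ

/-- The action of a gate on amplitudes. -/
noncomputable def Gate.apply (O : Oracle) {w : ℕ} : Gate w → QState w → QState w
  | .H q, ψ => fun z =>
      (ψ (Function.update z q false) + (if z q then -1 else 1) * ψ (Function.update z q true)) /
        (Real.sqrt 2 : ℂ)
  | .T q, ψ => fun z => (if z q then Complex.exp (Complex.I * Real.pi / 4) else 1) * ψ z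
  | .CNOT c t _, ψ => fun z => ψ (Function.update z t (xor (z t) (z c)))
  | .oracle ws, ψ => fun z => (if O (ws.map z) then -1 else 1) * ψ z

/-- A quantum circuit for inputs of length `n`. -/
structure QCircuit (n : ℕ) where
  width : ℕ
  le_width : n ≤ width
  width_pos : 0 < width
  gates : List (Gate width)

/-- The final state on input `x`: the gates are applied in order to `|x, 0, …, 0⟩`. -/
noncomputable def QCircuit.output (O : Oracle) {n : ℕ} (C : QCircuit n) (x : List Bool) :
    QState C.width :=
  C.gates.foldl (fun ψ g => g.apply O ψ)
    (fun z => if z = (fun i : Fin C.width => x.getD (i : ℕ) false) then 1 else 0)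

/-- The probability that measuring the first qubit of the final state yields `0`. -/
noncomputable def QCircuit.acceptProb (O : Oracle) {n : ℕ} (C : QCircuit n) (x : List Bool) : ℝ :=
  ∑ z : Fin C.width → Bool, if z ⟨0, C.width_pos⟩ = false then ‖C.output O x z‖ ^ 2 else 0

/-- A number in unary, with end marker. -/
def encodeNat (m : ℕ) : List Bool := List.replicate m true ++ [false]

/-- The description of a gate: its kind, followed by its qubits. -/
def Gate.encode {w : ℕ} : Gate w → List Bool
  | .H q => encodeNat 0 ++ encodeNat q
  | .T q => encodeNat 1 ++ encodeNat q
  | .CNOT c t _ => encodeNat 2 ++ encodeNat c ++ encodeNat t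
  | .oracle ws => encodeNat 3 ++ encodeNat ws.length ++ ws.flatMap fun q => encodeNat q

/-- The description of a circuit: its width, followed by its gates. -/
def QCircuit.encode {n : ℕ} (C : QCircuit n) : List Bool :=
  encodeNat C.width ++ C.gates.flatMap Gate.encode

/-- A polynomial-time uniform family: one deterministic program without oracle produces from `1ⁿ`
the description of the `n`-th circuit, in time polynomial in `n`. -/
def Uniform (C : ∀ n, QCircuit n) : Prop :=
  ∃ (c : Cmd) (p : Polynomial ℕ), c.Internal ∧ ∀ n : ℕ, ∃ s t,
    Exec Env.silent c (State.init (List.replicate n true) []) s t ∧ t ≤ p.eval n ∧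
      s.reg 0 = (C n).encode

/-- Promise problems decided with bounded error by a uniform family of quantum circuits that may
query `O`. -/
def BQP (O : Oracle) : Set PromiseProblem :=
  {L | ∃ C : ∀ n, QCircuit n, Uniform C ∧
    (∀ x ∈ L.yes, 2 / 3 ≤ (C x.length).acceptProb O x) ∧
    (∀ x ∈ L.no, (C x.length).acceptProb O x ≤ 1 / 3)}

end OracleComplexity

/-! ### Total loop programs and their compilation with polynomial overhead. -/

namespace OracleComplexity

/-! ### Looping programs

`Prog` is a language of total programs: all loops run for a fixed number `N` of iterations.  Every
`Prog` compiles to a `Cmd`, with a running time that is polynomial in `N` and in the size of the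
registers. -/

/-! Two provers can be forced to answer from one fixed table, and a table of all amplitudes of the
computation can be checked locally. The oracle occurs only in diagonal gates, so the check of such a
gate at a basis state needs one oracle query by the verifier; nothing about the oracle is
arithmetized.

The table. Let `ψ` be the final state of the circuit on input `x`, let `p` be its acceptance
probability and `Z` the sign given by the first qubit. The computation is prolonged: after the gates
comes the step `ψ ↦ conj (Z ψ)`, then the same gates in reverse order. Every gate is a symmetric
matrix, so the reversed gates form the transpose of the circuit, and the last amplitude at the input
is `∑ ψ z * conj (Z ψ) z = 2 p - 1` (`QCircuit.foldr_output`). The decision thus hangs on the sign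
of one entry, with a constant gap. Put `ω = exp (i π / 4)`. Since `1 / √2 = (ω + ω⁻¹) / 2`, all
amplitudes times `2 ^ m` lie in `ℤ[ω]` once `m` exceeds the number of steps. Each is given by eight
natural numbers `p j`, read as `∑ p j * ω ^ j`. In the honest table the sum of all `p j ^ 2` of a
layer is exactly `2 ^ (2 m)` (`Lifted.sum_weight`). Hence the basis states partition `[0, 2 ^ (2
m))` into intervals of length `∑ p j ^ 2`. The table also holds the split points of the binary tree
of prefixes and, for each point `r`, a basis state whose interval contains `r`. A uniform `r`
therefore samples a basis state according to its weight.

The check. For every step, one basis state is sampled from the old layer and one from the new. At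
each, the claimed numbers must agree with the interval and satisfy the linear equations of the step.
Whatever the table says, consistently claimed intervals of distinct basis states are disjoint
(`descend_unique`), and the weight bounds the squared modulus of the amplitude up to the factor `4`
(`norm_cval_sq_le`). So if a fraction `β` of the points fails, the states claimed before and after
the step fit together up to `4 √β` (`dist_claimed_le`). Steps are isometries, errors add, and the
first layer is pinned down exactly (`InitOK.claimed_eq`). For a no-instance at least a fraction `N ^
(-4)` of the points must fail (`soundness_test`); for a yes-instance the honest table passes for all
points (`completeness_test`).

The commitment. In each round prover `0` answers all queries and prover `1` at most one of them,
chosen at random. Prover `1` cannot tell which one it is, so its reply to its next message is a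
function `F` that is fixed when the round starts. Either all replies of prover `0` agree with `F`,
or choosing the first disagreement for the cross-check exposes it (`TProg.run_committed`). A round
thus catches a no-instance with inverse polynomial probability from every history. Polynomially many
rounds bring the acceptance probability below `1 / 3` (`count_survivors`, `Prog.protocol_sound`),
while honest provers are always accepted.

The rest implements this in the machine model. The verifier is written in a language whose loops all
run `N` times, for a clock value `N` that is linear in the length of the circuit description; this
makes termination in polynomial time automatic (`Prog.exec_compile`). -/

inductive Prog where
  | nop
  | push (r : ℕ) (b : Bool)
  | pop (r : ℕ)
  | clear (r : ℕ)
  | copy (a b : ℕ)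
  | rev (a b : ℕ)
  | seq (c d : Prog)
  | ite (T : Test) (c d : Prog)
  | rep (c : Prog)
  | flip (r : ℕ)
  | query (q r : ℕ)
  | ask (i m r l : ℕ)

/-- Truth of a test on the contents of the registers. -/
def Test.on (d : ℕ → List Bool) : Test → Bool
  | .nonempty r => !(d r).isEmpty
  | .top r => (d r).headD false

theorem Test.on_iff_holds (T : Test) (s : State) : T.on s.reg = true ↔ T.Holds s := by
  cases T with
  | nonempty r => simp [Test.Holds, Test.on]
  | top r =>
    simp only [Test.Holds, Test.on]
    cases s.reg r <;> simp

/-- The effect of a looping program when loops are run `N` times. -/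
def Prog.run (E : Env) (N : ℕ) : Prog → State → State
  | .nop, s => s
  | .push r b, s => s.set r (b :: s.reg r)
  | .pop r, s => s.set r (s.reg r).tail
  | .clear r, s => s.set r []
  | .copy a b, s => s.set b (s.reg a)
  | .rev a b, s => if a = b then s else s.set b (s.reg a).reverse
  | .seq c d, s => d.run E N (c.run E N s)
  | .ite T c d, s => bif T.on s.reg then c.run E N s else d.run E N s
  | .rep c, s => (c.run E N)^[N] s
  | .flip r, s => { s.set r (s.coins.headD false :: s.reg r) with coins := s.coins.tail }
  | .query q r, s => s.set r (E.oracle (s.reg q) :: s.reg r)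
  | .ask i m l r, s => (s.record i (s.reg m)).set r
      ((E.reply i (s.sent i ++ [s.reg m])).take (s.reg l).length)

/-- A bound on the number of elementary operations. -/
def Prog.ops (N : ℕ) : Prog → ℕ
  | .seq c d => c.ops N + d.ops N
  | .ite _ c d => c.ops N + d.ops N + 1
  | .rep c => N * (c.ops N + 1) + 1
  | _ => 1

/-- The nesting depth of loops. -/
def Prog.height : Prog → ℕ
  | .seq c d => max c.height d.height
  | .ite _ c d => max c.height d.height
  | .rep c => c.height + 1
  | _ => 0

/-- Move register `a`, reversed, on top of register `b`. -/
def Cmd.pour (a b : ℕ) : Cmd :=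
  .loop (.nonempty a) (.seq (.ite (.top a) (.push b true) (.push b false)) (.pop a))

/-- Move register `a`, reversed, on top of both `b` and `c`. -/
def Cmd.pourTwo (a b c : ℕ) : Cmd :=
  .loop (.nonempty a) (.seq (.ite (.top a) (.seq (.push b true) (.push c true))
    (.seq (.push b false) (.push c false))) (.pop a))

def Cmd.clear (r : ℕ) : Cmd := .loop (.nonempty r) (.pop r)

/-- Renaming of registers in tests. -/
def Test.map (f : ℕ → ℕ) : Test → Test
  | .nonempty r => .nonempty (f r)
  | .top r => .top (f r)

/-- The `Cmd`-register that holds register `r` of a looping program. -/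
def dataReg (K r : ℕ) : ℕ := K + 2 * r

/-- System registers: number `0` is scratch space, `2 d + 1` and `2 d + 2` belong to the loops of
nesting depth `d`. -/
def sysReg (K i : ℕ) : ℕ := K + 2 * i + 1

/-- A loop at nesting depth `d` spends the clock `2 d + 1` bit by bit, collects the spent bits in `2
d + 2`, and pours them back at the end. The clock is thus full again whenever an enclosing loop
re-enters. Copying needs the scratch register because pouring destroys its source and reverses it.
-/
def Prog.compile (K : ℕ) : ℕ → Prog → Cmd
  | _, .nop => .skip
  | _, .push r b => .push (dataReg K r) b
  | _, .pop r => .pop (dataReg K r)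
  | _, .clear r => .clear (dataReg K r)
  | _, .copy a b => if a = b then .skip else
      .seq (.clear (dataReg K b)) (.seq (.pour (dataReg K a) (sysReg K 0))
        (.pourTwo (sysReg K 0) (dataReg K a) (dataReg K b)))
  | _, .rev a b => if a = b then .skip else
      .seq (.clear (dataReg K b)) (.seq (.pourTwo (dataReg K a) (sysReg K 0) (dataReg K b))
        (.pour (sysReg K 0) (dataReg K a)))
  | d, .seq c c' => .seq (c.compile K d) (c'.compile K d)
  | d, .ite T c c' => .ite (T.map (dataReg K)) (c.compile K d) (c'.compile K d)
  | d, .rep c => .seq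
      (.loop (.nonempty (sysReg K (2 * d + 1))) (.seq (.pop (sysReg K (2 * d + 1)))
        (.seq (.push (sysReg K (2 * d + 2)) true) (c.compile K (d + 1)))))
      (.loop (.nonempty (sysReg K (2 * d + 2))) (.seq (.pop (sysReg K (2 * d + 2)))
        (.push (sysReg K (2 * d + 1)) true)))
  | _, .flip r => .flip (dataReg K r)
  | _, .query q r => .query (dataReg K q) (dataReg K r)
  | _, .ask i m l r => .ask i (dataReg K m) (dataReg K l) (dataReg K r)

/-- The configuration of a compiled program: registers below `K` hold `low`, the others alternate
between the registers of the looping program and system registers. -/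
def embed (K : ℕ) (low κ : ℕ → List Bool) (s : State) : State where
  reg := fun i => if i < K then low i else
    if (i - K) % 2 = 0 then s.reg ((i - K) / 2) else κ ((i - K) / 2)
  coins := s.coins
  sent := s.sent

section Embed
variable (K : ℕ) (low κ : ℕ → List Bool) (s : State)

@[simp] theorem embed_reg_data (r : ℕ) : (embed K low κ s).reg (dataReg K r) = s.reg r := by
  simp [embed, dataReg]

@[simp] theorem embed_reg_sys (i : ℕ) : (embed K low κ s).reg (sysReg K i) = κ i := by
  have h1 : ¬ (K + 2 * i + 1 < K) := by omega
  have h2 : (K + 2 * i + 1 - K) % 2 = 1 := by omega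
  have h3 : (K + 2 * i + 1 - K) / 2 = i := by omega
  simp [embed, sysReg, h1, h2, h3]

@[simp] theorem embed_set_data (r : ℕ) (v : List Bool) :
    (embed K low κ s).set (dataReg K r) v = embed K low κ (s.set r v) := by
  simp only [embed, State.set, dataReg, State.mk.injEq, and_true]
  funext i
  by_cases h : i = K + 2 * r
  · subst h; simp
  · rw [Function.update_of_ne h]
    split_ifs with h1 h2
    · rfl
    · rw [Function.update_of_ne]; omega
    · rfl

@[simp] theorem embed_set_sys (i : ℕ) (v : List Bool) :
    (embed K low κ s).set (sysReg K i) v = embed K low (Function.update κ i v) s := by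
  simp only [embed, State.set, sysReg, State.mk.injEq, and_true]
  funext j
  by_cases h : j = K + 2 * i + 1
  · have h1 : ¬ (K + 2 * i + 1 < K) := by omega
    have h2 : (K + 2 * i + 1 - K) % 2 = 1 := by omega
    have h3 : (K + 2 * i + 1 - K) / 2 = i := by omega
    subst h; simp [h1, h2, h3]
  · rw [Function.update_of_ne h]
    split_ifs with h1 h2
    · rfl
    · rfl
    · rw [Function.update_of_ne]; omega

@[simp] theorem embed_record (i : ℕ) (m : List Bool) :
    (embed K low κ s).record i m = embed K low κ (s.record i m) := rfl

@[simp] theorem embed_coins : (embed K low κ s).coins = s.coins := rfl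

@[simp] theorem embed_sent : (embed K low κ s).sent = s.sent := rfl

end Embed

@[simp] theorem State.set_reg_same (s : State) (r : ℕ) (v : List Bool) : (s.set r v).reg r = v := by
  simp [State.set]

theorem State.set_reg_ne (s : State) {r r' : ℕ} (v : List Bool) (h : r' ≠ r) :
    (s.set r v).reg r' = s.reg r' := by
  simp [State.set, h]

theorem State.set_reg (s : State) (r r' : ℕ) (v : List Bool) :
    (s.set r v).reg r' = if r' = r then v else s.reg r' := by
  simp [State.set, Function.update_apply]

@[simp] theorem State.set_set (s : State) (r : ℕ) (v w : List Bool) :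
    (s.set r v).set r w = s.set r w := by
  simp [State.set]

@[simp] theorem State.set_self (s : State) (r : ℕ) : s.set r (s.reg r) = s := by
  simp [State.set]

theorem State.set_comm (s : State) {r r' : ℕ} (h : r ≠ r') (v w : List Bool) :
    (s.set r v).set r' w = (s.set r' w).set r v := by
  simp [State.set, Function.update_comm h.symm]

theorem Exec.congr {E : Env} {c : Cmd} {s s' s'' : State} {t t' : ℕ} (h : Exec E c s s' t)
    (hs : s' = s'') (ht : t = t') : Exec E c s s'' t' := by
  subst hs ht; exact h

theorem Exec.clear {E : Env} {s : State} {r : ℕ} :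
    Exec E (.clear r) s (s.set r []) (2 * (s.reg r).length + 1) := by
  generalize hl : s.reg r = l
  induction l generalizing s with
  | nil =>
    have : s.set r [] = s := by rw [← hl]; simp
    rw [this]
    exact Exec.loop_false (by simp [Test.Holds, hl])
  | cons b l ih =>
    have h := Exec.loop_true (E := E) (T := .nonempty r) (c := .pop r) (s := s)
      (by simp [Test.Holds, hl]) (Exec.pop r s) (ih (s := s.set r (s.reg r).tail) (by simp [hl]))
    refine h.congr ?_ ?_
    · simp only [State.set_set]
    · simp only [List.length_cons]; ring

theorem Exec.pour {E : Env} {s : State} {a b : ℕ} (hab : a ≠ b) :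
    Exec E (.pour a b) s ((s.set b ((s.reg a).reverse ++ s.reg b)).set a [])
      (4 * (s.reg a).length + 1) := by
  generalize hl : s.reg a = l
  induction l generalizing s with
  | nil =>
    have : (s.set b (([] : List Bool).reverse ++ s.reg b)).set a [] = s := by
      rw [← hl]; simp [hl]
      simp [← hl]
    rw [this]
    exact Exec.loop_false (by simp [Test.Holds, hl])
  | cons x l ih =>
    have hbody : Exec E (.seq (.ite (.top a) (.push b true) (.push b false)) (.pop a)) s
        ((s.set b (x :: s.reg b)).set a l) 3 := by
      refine Exec.seq (s' := s.set b (x :: s.reg b)) (t := 2) (t' := 1) ?_ ?_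
      · cases x
        · exact Exec.ite_false (by simp [Test.Holds, hl]) (Exec.push b false s)
        · exact Exec.ite_true (by simp [Test.Holds, hl]) (Exec.push b true s)
      · have := Exec.pop (E := E) a (s.set b (x :: s.reg b))
        rwa [State.set_reg_ne _ _ hab, hl] at this
    have h := Exec.loop_true (E := E) (T := .nonempty a) (s := s)
      (by simp [Test.Holds, hl]) hbody
      (ih (s := (s.set b (x :: s.reg b)).set a l) (by simp))
    refine h.congr ?_ ?_
    · rw [State.set_reg_ne _ _ hab.symm, State.set_comm _ hab, State.set_set, State.set_set]
      simp
    · simp only [List.length_cons]; ring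

theorem Exec.pourTwo {E : Env} {s : State} {a b c : ℕ} (hab : a ≠ b) (hac : a ≠ c) (hbc : b ≠ c) :
    Exec E (.pourTwo a b c) s (((s.set b ((s.reg a).reverse ++ s.reg b)).set c
      ((s.reg a).reverse ++ s.reg c)).set a []) (5 * (s.reg a).length + 1) := by
  generalize hl : s.reg a = l
  induction l generalizing s with
  | nil =>
    have : ((s.set b (([] : List Bool).reverse ++ s.reg b)).set c
      (([] : List Bool).reverse ++ s.reg c)).set a [] = s := by
      rw [← hl]; simp [hl]
      simp [← hl]
    rw [this]
    exact Exec.loop_false (by simp [Test.Holds, hl])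
  | cons x l ih =>
    have hbody : Exec E (.seq (.ite (.top a) (.seq (.push b true) (.push c true))
        (.seq (.push b false) (.push c false))) (.pop a)) s
        (((s.set b (x :: s.reg b)).set c (x :: s.reg c)).set a l) 4 := by
      refine Exec.seq (s' := (s.set b (x :: s.reg b)).set c (x :: s.reg c)) (t := 3) (t' := 1) ?_ ?_
      · have hp : ∀ x, Exec E (.seq (.push b x) (.push c x)) s
            ((s.set b (x :: s.reg b)).set c (x :: s.reg c)) 2 := by
          intro x
          have := Exec.seq (Exec.push (E := E) b x s) (Exec.push c x _)
          rwa [State.set_reg_ne _ _ hbc.symm] at this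
        cases x
        · exact Exec.ite_false (by simp [Test.Holds, hl]) (hp _)
        · exact Exec.ite_true (by simp [Test.Holds, hl]) (hp _)
      · have := Exec.pop (E := E) a ((s.set b (x :: s.reg b)).set c (x :: s.reg c))
        rwa [State.set_reg_ne _ _ hac, State.set_reg_ne _ _ hab, hl] at this
    have h := Exec.loop_true (E := E) (T := .nonempty a) (s := s)
      (by simp [Test.Holds, hl]) hbody
      (ih (s := ((s.set b (x :: s.reg b)).set c (x :: s.reg c)).set a l) (by simp))
    refine h.congr ?_ ?_
    · rw [State.set_reg_ne _ _ hab.symm, State.set_reg_ne _ _ hbc, State.set_reg_ne _ _ hac.symm,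
        State.set_comm _ hab, State.set_comm _ hac, State.set_set,
        State.set_comm (s.set b _) hbc.symm, State.set_set, State.set_set]
      simp
    · simp only [List.length_cons]; ring

theorem sysReg_ne_dataReg (K i r : ℕ) : sysReg K i ≠ dataReg K r := by
  simp only [sysReg, dataReg]; omega

theorem dataReg_ne {K a b : ℕ} (h : a ≠ b) : dataReg K a ≠ dataReg K b := by
  simp only [dataReg]; omega

theorem holds_map_embed (K : ℕ) (low κ : ℕ → List Bool) (s : State) (T : Test) :
    (T.map (dataReg K)).Holds (embed K low κ s) ↔ T.Holds s := by
  cases T <;> simp [Test.map, Test.Holds]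

/-- Registers grow by at most one bit per operation. -/
theorem Prog.length_run_le (E : Env) (N : ℕ) (c : Prog) (s : State) (L : ℕ)
    (hL : ∀ r, (s.reg r).length ≤ L) (r : ℕ) : ((c.run E N s).reg r).length ≤ L + c.ops N := by
  induction c generalizing s L r with
  | nop => simpa [Prog.run, Prog.ops] using (hL r).trans (Nat.le_succ L)
  | push r' b =>
    simp only [Prog.run, Prog.ops, State.set_reg]
    split_ifs
    · simpa using hL r'
    · exact (hL r).trans (Nat.le_succ L)
  | pop r' =>
    simp only [Prog.run, Prog.ops, State.set_reg]
    split_ifs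
    · have := hL r'; simp; omega
    · exact (hL r).trans (Nat.le_succ L)
  | clear r' =>
    simp only [Prog.run, Prog.ops, State.set_reg]
    split_ifs
    · simp
    · exact (hL r).trans (Nat.le_succ L)
  | copy a b =>
    simp only [Prog.run, Prog.ops, State.set_reg]
    split_ifs
    · exact (hL a).trans (Nat.le_succ L)
    · exact (hL r).trans (Nat.le_succ L)
  | rev a b =>
    simp only [Prog.run, Prog.ops]
    split_ifs
    · exact (hL r).trans (Nat.le_succ L)
    · simp only [State.set_reg]
      split_ifs
      · simpa using (hL a).trans (Nat.le_succ L)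
      · exact (hL r).trans (Nat.le_succ L)
  | seq c d ihc ihd =>
    simp only [Prog.run, Prog.ops]
    rw [← Nat.add_assoc]
    exact ihd _ _ (ihc _ _ hL) r
  | ite T c d ihc ihd =>
    simp only [Prog.run, Prog.ops]
    cases T.on s.reg
    · exact (ihd _ _ hL r).trans (by omega)
    · exact (ihc _ _ hL r).trans (by omega)
  | rep c ih =>
    have key : ∀ k r, (((c.run E N)^[k] s).reg r).length ≤ L + k * c.ops N := by
      intro k
      induction k with
      | zero => simpa using hL
      | succ k ihk =>
        intro r
        rw [Function.iterate_succ_apply']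
        exact (ih _ _ ihk r).trans (by rw [Nat.succ_mul]; omega)
    exact (key N r).trans (by simp only [Prog.ops, Nat.mul_add]; omega)
  | flip r' =>
    simp only [Prog.run, Prog.ops, State.set_reg]
    split_ifs
    · simpa using hL r'
    · exact (hL r).trans (Nat.le_succ L)
  | query q r' =>
    simp only [Prog.run, Prog.ops, State.set_reg]
    split_ifs
    · simpa using hL r'
    · exact (hL r).trans (Nat.le_succ L)
  | ask i m l r' =>
    simp only [Prog.run, Prog.ops, State.set_reg]
    split_ifs
    · have := hL l; simp; omega
    · exact (hL r).trans (Nat.le_succ L)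

/-- The second half of a compiled loop; `j` is the part of the clock already restored, `k` the part
still to come. -/
theorem Exec.restore_clock {E : Env} {K : ℕ} {low κ : ℕ → List Bool} {s : State} {a b : ℕ}
    (hab : a ≠ b) (k j : ℕ) (hκb : κ b = List.replicate k true) (hκa : κ a = List.replicate j true) :
    Exec E (.loop (.nonempty (sysReg K b)) (.seq (.pop (sysReg K b)) (.push (sysReg K a) true)))
      (embed K low κ s)
      (embed K low (Function.update (Function.update κ b []) a (List.replicate (j + k) true)) s)
      (3 * k + 1) := by
  induction k generalizing κ j with
  | zero =>
    have : Function.update (Function.update κ b []) a (List.replicate (j + 0) true) = κ := by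
      funext i
      by_cases h : i = a
      · subst h; simp [hκa]
      · by_cases h' : i = b
        · subst h'; simp [h, hκb]
        · simp [h, h']
    rw [this]
    exact Exec.loop_false (by simp [Test.Holds, hκb])
  | succ k ih =>
    have h1 := Exec.seq (Exec.pop (E := E) (sysReg K b) (embed K low κ s))
      (Exec.push (E := E) (sysReg K a) true _)
    have h2 := Exec.loop_true (T := .nonempty (sysReg K b)) (by simp [Test.Holds, hκb]) h1
      (by
        simp only [embed_set_sys, embed_reg_sys]
        exact ih (j + 1) (by simp [hab.symm, hκb]) (by simp [hab, hκa, List.replicate_succ]))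
    convert h2 using 1
    · congr 1
      funext i
      by_cases h : i = a
      · subst h; simp; ring_nf
      · by_cases h' : i = b
        · subst h'; simp [h]
        · simp [h, h']
    · ring

/-- Compiled programs do what they should, within the expected time. -/
theorem Prog.exec_compile (E : Env) (N K : ℕ) (low : ℕ → List Bool) (M : ℕ) (c : Prog) (d : ℕ)
    (κ : ℕ → List Bool) (s : State) (L : ℕ) (h0 : κ 0 = [])
    (hκ : ∀ i, d ≤ i → i < d + c.height →
      κ (2 * i + 1) = List.replicate N true ∧ κ (2 * i + 2) = [])
    (hL : ∀ r, (s.reg r).length ≤ L) (hM : L + c.ops N ≤ M) :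
    ∃ t, t ≤ c.ops N * (12 * M + 12) ∧
      Exec E (c.compile K d) (embed K low κ s) (embed K low κ (c.run E N s)) t := by
  -- `L` bounds the registers at the current moment, whereas `M` is fixed and covers the growth
  -- during the entire run. The factor `12 * M + 12` pays for the dearest operations, `copy` and
  -- `rev`, which spend eleven steps per bit.
  induction c generalizing d κ s L with
  | nop => exact ⟨1, by simp only [Prog.ops]; omega, Exec.skip _⟩
  | push r b =>
    refine ⟨1, by simp only [Prog.ops]; omega, ?_⟩
    simpa [Prog.run, Prog.compile] using Exec.push (E := E) (dataReg K r) b (embed K low κ s)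
  | pop r =>
    refine ⟨1, by simp only [Prog.ops]; omega, ?_⟩
    simpa [Prog.run, Prog.compile] using Exec.pop (E := E) (dataReg K r) (embed K low κ s)
  | clear r =>
    have h := Exec.clear (E := E) (r := dataReg K r) (s := embed K low κ s)
    simp only [embed_set_data, embed_reg_data] at h
    refine ⟨_, ?_, h⟩
    have := hL r
    simp [Prog.ops] at hM ⊢; omega
  | copy a b =>
    by_cases hab : a = b
    · subst hab
      refine ⟨1, by simp only [Prog.ops]; omega, ?_⟩
      simpa [Prog.run, Prog.compile] using Exec.skip (E := E) (embed K low κ s)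
    · have h1 := Exec.clear (E := E) (r := dataReg K b) (s := embed K low κ s)
      simp only [embed_set_data] at h1
      have h2 := Exec.pour (E := E) (s := embed K low κ (s.set b []))
        (sysReg_ne_dataReg K 0 a).symm
      have h3 := Exec.pourTwo (E := E) (a := sysReg K 0) (b := dataReg K a) (c := dataReg K b)
        (s := (embed K low (Function.update κ 0 (s.reg a).reverse) ((s.set b []).set a [])))
        (sysReg_ne_dataReg K 0 a) (sysReg_ne_dataReg K 0 b) (dataReg_ne hab)
      simp only [embed_set_data, embed_set_sys, embed_reg_data, embed_reg_sys, h0,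
        State.set_reg_ne _ _ hab, List.append_nil] at h1 h2 h3
      simp only [Prog.compile, if_neg hab]
      refine ⟨_, ?_, Exec.seq h1 (Exec.seq h2 (h3.congr ?_ rfl))⟩
      rotate_left
      · simp only [Prog.run, Function.update_self, List.reverse_reverse, Function.update_idem,
          State.set_reg_same, State.set_reg_ne _ _ (Ne.symm hab), List.append_nil, State.set_set]
        rw [State.set_comm (s.set b []) hab, State.set_set, State.set_comm s (Ne.symm hab) _ _,
          State.set_self]
        congr 1
        rw [← h0, Function.update_eq_self]
      · have := hL b; have := hL a
        simp [Prog.ops] at hM ⊢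
        omega
  | rev a b =>
    by_cases hab : a = b
    · subst hab
      refine ⟨1, by simp only [Prog.ops]; omega, ?_⟩
      simpa [Prog.run, Prog.compile] using Exec.skip (E := E) (embed K low κ s)
    · have h1 := Exec.clear (E := E) (r := dataReg K b) (s := embed K low κ s)
      have h2 := Exec.pourTwo (E := E) (a := dataReg K a) (b := sysReg K 0) (c := dataReg K b)
        (s := (embed K low κ (s.set b [])))
        (sysReg_ne_dataReg K 0 a).symm (dataReg_ne hab) (sysReg_ne_dataReg K 0 b)
      have h3 := Exec.pour (E := E) (a := sysReg K 0) (b := dataReg K a)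
        (s := embed K low (Function.update κ 0 (s.reg a).reverse)
          (((s.set b []).set b (s.reg a).reverse).set a []))
        (sysReg_ne_dataReg K 0 a)
      simp only [embed_set_data, embed_set_sys, embed_reg_data, embed_reg_sys, h0,
        State.set_reg_ne _ _ hab, State.set_reg_same, List.append_nil] at h1 h2 h3
      simp only [Prog.compile, if_neg hab]
      refine ⟨_, ?_, Exec.seq h1 (Exec.seq h2 (h3.congr ?_ rfl))⟩
      rotate_left
      · simp only [Prog.run, if_neg hab, Function.update_self, List.reverse_reverse,
          Function.update_idem, State.set_set]
        rw [State.set_comm s (Ne.symm hab) _ (s.reg a), State.set_self]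
        congr 1
        rw [← h0, Function.update_eq_self]
      · have := hL b; have := hL a
        simp [Prog.ops] at hM ⊢
        omega
  | seq c c' ihc ihd =>
    simp only [Prog.ops, Prog.height] at hM hκ
    obtain ⟨t, ht, h⟩ := ihc d κ s L h0 (fun i hi hi' => hκ i hi (by omega)) hL (by omega)
    obtain ⟨t', ht', h'⟩ := ihd d κ (c.run E N s) (L + c.ops N) h0
      (fun i hi hi' => hκ i hi (by omega)) (Prog.length_run_le E N c s L hL) (by omega)
    exact ⟨t + t', by simp only [Prog.ops, Nat.add_mul]; omega, Exec.seq h h'⟩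
  | ite T c c' ihc ihd =>
    simp only [Prog.ops, Prog.height] at hM hκ
    by_cases hT : T.Holds s
    · obtain ⟨t, ht, h⟩ := ihc d κ s L h0 (fun i hi hi' => hκ i hi (by omega)) hL (by omega)
      refine ⟨t + 1, by simp only [Prog.ops, Nat.add_mul]; omega, ?_⟩
      simp only [Prog.run, (T.on_iff_holds s).2 hT, cond_true]
      exact Exec.ite_true ((holds_map_embed K low κ s T).2 hT) h
    · obtain ⟨t, ht, h⟩ := ihd d κ s L h0 (fun i hi hi' => hκ i hi (by omega)) hL (by omega)
      refine ⟨t + 1, by simp only [Prog.ops, Nat.add_mul]; omega, ?_⟩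
      simp only [Prog.run, Bool.eq_false_iff.2 fun h' => hT ((T.on_iff_holds s).1 h'), cond_false]
      exact Exec.ite_false (fun h' => hT ((holds_map_embed K low κ s T).1 h')) h
  | rep c ih =>
    simp only [Prog.ops, Prog.height] at hM hκ
    obtain ⟨hA, hB⟩ := hκ d le_rfl (by omega)
    have hlen : ∀ k r, (((c.run E N)^[k] s).reg r).length ≤ L + k * c.ops N := by
      intro k
      induction k with
      | zero => simpa using hL
      | succ k ihk =>
        intro r
        rw [Function.iterate_succ_apply']
        exact (Prog.length_run_le E N c _ _ ihk r).trans (by rw [Nat.succ_mul]; omega)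
    -- The two clock registers when `i` iterations are still to come and `j` are done.
    set clk : ℕ → ℕ → ℕ → List Bool := fun i j => Function.update (Function.update κ (2 * d + 1)
      (List.replicate i true)) (2 * d + 2) (List.replicate j true) with hclk
    have hclk1 : ∀ i j, clk i j (2 * d + 1) = List.replicate i true := fun i j => by
      simp [hclk]
    have hclk2 : ∀ i j, clk i j (2 * d + 2) = List.replicate j true := fun i j => by
      simp [hclk]
    have hclk3 : ∀ i j k, k ≠ 2 * d + 1 → k ≠ 2 * d + 2 → clk i j k = κ k := fun i j k h1 h2 => by
      simp [hclk, h1, h2]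
    have main : ∀ i j, i + j = N → ∃ t, t ≤ i * (c.ops N * (12 * M + 12) + 3) + 1 ∧
        Exec E (.loop (.nonempty (sysReg K (2 * d + 1))) (.seq (.pop (sysReg K (2 * d + 1)))
          (.seq (.push (sysReg K (2 * d + 2)) true) (c.compile K (d + 1)))))
          (embed K low (clk i j) ((c.run E N)^[j] s))
          (embed K low (clk 0 N) ((c.run E N)^[N] s)) t := by
      intro i
      induction i with
      | zero =>
        intro j hj
        obtain rfl : j = N := by omega
        exact ⟨1, by simp, Exec.loop_false (by simp [Test.Holds, hclk1])⟩
      | succ i ihi =>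
        intro j hj
        obtain ⟨t, ht, h⟩ := ihi (j + 1) (by omega)
        have hN : (j + 1) * c.ops N ≤ N * c.ops N := Nat.mul_le_mul_right _ (by omega)
        obtain ⟨t', ht', h'⟩ := ih (d + 1) (clk i (j + 1)) ((c.run E N)^[j] s) (L + j * c.ops N)
          (by rw [hclk3 _ _ _ (by omega) (by omega), h0])
          (fun k hk hk' => by
            rw [hclk3 _ _ _ (by omega) (by omega), hclk3 _ _ _ (by omega) (by omega)]
            exact hκ k (by omega) (by omega)) (hlen j)
          (by simp only [Nat.mul_add, Nat.add_mul] at hM hN; omega)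
        rw [Function.iterate_succ_apply'] at h
        have e1 := Exec.pop (E := E) (sysReg K (2 * d + 1))
          (embed K low (clk (i + 1) j) ((c.run E N)^[j] s))
        have e2 := Exec.push (E := E) (sysReg K (2 * d + 2)) true
          (embed K low (Function.update (clk (i + 1) j) (2 * d + 1) (List.replicate i true))
            ((c.run E N)^[j] s))
        have hu : Function.update (Function.update (clk (i + 1) j) (2 * d + 1)
            (List.replicate i true)) (2 * d + 2) (true :: clk (i + 1) j (2 * d + 2)) =
            clk i (j + 1) := by
          funext k
          by_cases k1 : k = 2 * d + 2
          · subst k1; simp [hclk2, List.replicate_succ]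
          · by_cases k2 : k = 2 * d + 1
            · subst k2; simp [hclk1]
            · rw [Function.update_of_ne k1, Function.update_of_ne k2, hclk3 _ _ _ k2 k1,
                hclk3 _ _ _ k2 k1]
        simp only [embed_set_sys, embed_reg_sys, hclk1, List.replicate_succ, List.tail_cons] at e1 e2
        rw [Function.update_of_ne (by omega), hu] at e2
        refine ⟨1 + (1 + t') + t + 1, ?_, Exec.loop_true (by simp [Test.Holds, hclk1])
          (Exec.seq e1 (Exec.seq e2 h')) h⟩
        rw [Nat.succ_mul]; omega
    obtain ⟨t, ht, h⟩ := main N 0 (by omega)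
    have hc0 : clk N 0 = κ := by
      funext k
      by_cases k1 : k = 2 * d + 1
      · subst k1; rw [hclk1, hA]
      · by_cases k2 : k = 2 * d + 2
        · subst k2; rw [hclk2, hB]; rfl
        · exact hclk3 _ _ _ k1 k2
    have h2 := Exec.restore_clock (E := E) (K := K) (low := low) (s := (c.run E N)^[N] s)
      (a := 2 * d + 1) (b := 2 * d + 2) (by omega) N 0 (hclk2 0 N) (hclk1 0 N)
    have hc1 : Function.update (Function.update (clk 0 N) (2 * d + 2) []) (2 * d + 1)
        (List.replicate (0 + N) true) = κ := by
      funext k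
      by_cases k1 : k = 2 * d + 1
      · subst k1; simp [hA]
      · by_cases k2 : k = 2 * d + 2
        · subst k2; simp [hB]
        · rw [Function.update_of_ne k1, Function.update_of_ne k2, hclk3 _ _ _ k1 k2]
    rw [hc1] at h2
    rw [hc0] at h
    refine ⟨t + (3 * N + 1), ?_, Exec.seq h h2⟩
    simp only [Prog.ops]
    have e1 : N * (c.ops N * (12 * M + 12) + 3) = N * c.ops N * (12 * M + 12) + 3 * N := by ring
    have e2 : (N * (c.ops N + 1) + 1) * (12 * M + 12) =
      N * c.ops N * (12 * M + 12) + (12 * (N * M) + 12 * N) + (12 * M + 12) := by ring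
    rw [e2]
    omega
  | flip r =>
    refine ⟨1, by simp only [Prog.ops]; omega, ?_⟩
    have := Exec.flip (E := E) (dataReg K r) (embed K low κ s)
    simp only [embed_set_data, embed_coins, embed_reg_data] at this
    exact this
  | query q r =>
    have := Exec.query (E := E) (dataReg K q) (dataReg K r) (embed K low κ s)
    simp only [embed_set_data, embed_reg_data] at this
    refine ⟨_, ?_, this⟩
    have := hL q
    simp [Prog.ops] at hM ⊢
    omega
  | ask i m l r =>
    have := Exec.ask (E := E) i (dataReg K m) (dataReg K l) (dataReg K r) (embed K low κ s)
    simp only [embed_set_data, embed_reg_data, embed_record, embed_sent] at this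
    refine ⟨_, ?_, this⟩
    have := hL m
    have := hL l
    simp [Prog.ops] at hM ⊢
    omega

end OracleComplexity


/-! ### Forcing two provers to answer according to one function. -/

namespace OracleComplexity

/-! ### Syntactic properties of looping programs -/

/-- The program never writes to register `x`. -/
def Prog.Avoids (x : ℕ) : Prog → Prop
  | .nop => True
  | .push r _ => r ≠ x
  | .pop r => r ≠ x
  | .clear r => r ≠ x
  | .copy _ b => b ≠ x
  | .rev _ b => b ≠ x
  | .seq c d => c.Avoids x ∧ d.Avoids x
  | .ite _ c d => c.Avoids x ∧ d.Avoids x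
  | .rep c => c.Avoids x
  | .flip r => r ≠ x
  | .query _ r => r ≠ x
  | .ask _ _ _ r => r ≠ x

/-- The only way in which the program writes to register `x` is by pushing bits on it. -/
def Prog.OnlyPushes (x : ℕ) : Prog → Prop
  | .nop => True
  | .push _ _ => True
  | .pop r => r ≠ x
  | .clear r => r ≠ x
  | .copy _ b => b ≠ x
  | .rev _ b => b ≠ x
  | .seq c d => c.OnlyPushes x ∧ d.OnlyPushes x
  | .ite _ c d => c.OnlyPushes x ∧ d.OnlyPushes x
  | .rep c => c.OnlyPushes x
  | .flip _ => True
  | .query _ _ => True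
  | .ask _ _ _ r => r ≠ x

/-- The program flips no coins. -/
def Prog.Coinless : Prog → Prop
  | .seq c d => c.Coinless ∧ d.Coinless
  | .ite _ c d => c.Coinless ∧ d.Coinless
  | .rep c => c.Coinless
  | .flip _ => False
  | _ => True

def State.withCoins (s : State) (w : List Bool) : State := { s with coins := w }

@[simp] theorem State.withCoins_reg (s : State) (w : List Bool) : (s.withCoins w).reg = s.reg := rfl

theorem iterate_of_step {α : Type*} {f : α → α} {p : α → Prop} (h : ∀ a, p a → p (f a)) (n : ℕ)
    {a : α} (ha : p a) : p (f^[n] a) := by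
  induction n generalizing a with
  | zero => exact ha
  | succ n ih => exact ih (h a ha)

theorem iterate_invariant {α β : Type*} {f : α → α} {g : α → β} (h : ∀ a, g (f a) = g a) (n : ℕ)
    (a : α) : g (f^[n] a) = g a := by
  induction n generalizing a with
  | zero => rfl
  | succ n ih => rw [Function.iterate_succ_apply, ih, h]

@[simp] theorem State.record_reg (s : State) (i : ℕ) (m : List Bool) :
    (s.record i m).reg = s.reg := rfl

theorem Prog.run_reg_of_avoids {E : Env} {N x : ℕ} {c : Prog} (h : c.Avoids x) (s : State) :
    (c.run E N s).reg x = s.reg x := by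
  induction c generalizing s with
  | seq c d ihc ihd => simp only [Prog.run]; rw [ihd h.2, ihc h.1]
  | ite T c d ihc ihd =>
    simp only [Prog.run]
    cases T.on s.reg
    · exact ihd h.2 s
    · exact ihc h.1 s
  | rep c ih => exact iterate_invariant (g := fun s : State => s.reg x) (ih h) N s
  | rev a b =>
    simp only [Prog.run]
    split_ifs
    · rfl
    · exact State.set_reg_ne _ _ (Ne.symm h)
  | nop => rfl
  | flip r => exact State.set_reg_ne _ _ (Ne.symm h)
  | _ => exact State.set_reg_ne _ _ (Ne.symm h)

/-- Applied to register `2`: a decision to reject is never revoked. -/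
theorem Prog.run_reg_ne_nil {E : Env} {N x : ℕ} {c : Prog} (h : c.OnlyPushes x) (s : State)
    (hs : s.reg x ≠ []) : (c.run E N s).reg x ≠ [] := by
  induction c generalizing s with
  | seq c d ihc ihd => exact ihd h.2 _ (ihc h.1 _ hs)
  | ite T c d ihc ihd =>
    simp only [Prog.run]
    cases T.on s.reg
    · exact ihd h.2 s hs
    · exact ihc h.1 s hs
  | rep c ih => exact iterate_of_step (p := fun s : State => s.reg x ≠ []) (ih h) N hs
  | rev a b =>
    simp only [Prog.run]
    split_ifs
    · exact hs
    · rwa [State.set_reg_ne _ _ (Ne.symm h)]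
  | nop => exact hs
  | push r b => simp only [Prog.run, State.set_reg]; split_ifs <;> simp [hs]
  | query q r => simp only [Prog.run, State.set_reg]; split_ifs <;> simp [hs]
  | flip r => simp only [Prog.run, State.set_reg]; split_ifs <;> simp [hs]
  | _ => simp only [Prog.run]; rwa [State.set_reg_ne _ _ (Ne.symm h)]

/-- Allows the unread coins to be split off from the configuration, so that the coins of successive
rounds can be counted independently. -/
theorem Prog.run_withCoins {E : Env} {N : ℕ} {c : Prog} (h : c.Coinless) (s : State)
    (w : List Bool) : c.run E N (s.withCoins w) = (c.run E N s).withCoins w := by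
  induction c generalizing s with
  | seq c d ihc ihd => simp only [Prog.run]; rw [ihc h.1, ihd h.2]
  | ite T c d ihc ihd =>
    simp only [Prog.run, State.withCoins_reg]
    cases T.on s.reg
    · exact ihd h.2 s
    · exact ihc h.1 s
  | rep c ih =>
    simp only [Prog.run]
    have key : ∀ n, (c.run E N)^[n] (s.withCoins w) = ((c.run E N)^[n] s).withCoins w := by
      intro n
      induction n with
      | zero => rfl
      | succ n ihn => rw [Function.iterate_succ_apply', ihn, ih h, Function.iterate_succ_apply']
    exact key N
  | rev a b => simp only [Prog.run]; split_ifs <;> rfl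
  | flip r => exact h.elim
  | _ => rfl

/-! ### Test programs

`TProg` is the sublanguage in which the verifier's check is written.  Its semantics `eval` refers
to a single function `F` that answers all queries to the provers. -/

inductive TProg where
  | nop
  | push (r : ℕ) (b : Bool)
  | pop (r : ℕ)
  | clear (r : ℕ)
  | copy (a b : ℕ)
  | rev (a b : ℕ)
  | seq (c d : TProg)
  | ite (T : Test) (c d : TProg)
  | rep (c : TProg)
  | query (q r : ℕ)
  | get (m r : ℕ)

/-- Replies are cut to `2 * N` bits, the length of the limiting register `9` in the compiled form.
This keeps all numbers within reach of the fixed loops even when the provers are malicious. -/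
def TProg.eval (O : Oracle) (F : List Bool → List Bool) (N : ℕ) :
    TProg → (ℕ → List Bool) → ℕ → List Bool
  | .nop, d => d
  | .push r b, d => Function.update d r (b :: d r)
  | .pop r, d => Function.update d r (d r).tail
  | .clear r, d => Function.update d r []
  | .copy a b, d => Function.update d b (d a)
  | .rev a b, d => if a = b then d else Function.update d b (d a).reverse
  | .seq c c', d => c'.eval O F N (c.eval O F N d)
  | .ite T c c', d => bif T.on d then c.eval O F N d else c'.eval O F N d
  | .rep c, d => (c.eval O F N)^[N] d
  | .query q r, d => Function.update d r (O (d q) :: d r)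
  | .get m r, d => Function.update d r ((F (d m)).take (2 * N))

/-- A bound on the number of queries to the provers. -/
def TProg.gets (N : ℕ) : TProg → ℕ
  | .seq c d => c.gets N + d.gets N
  | .ite _ c d => c.gets N + d.gets N
  | .rep c => N * c.gets N
  | .get _ _ => 1
  | _ => 0

/-- A bound on the registers in use. -/
def TProg.bound : TProg → ℕ
  | .nop => 0
  | .push r _ => r + 1
  | .pop r => r + 1
  | .clear r => r + 1
  | .copy _ b => b + 1
  | .rev _ b => b + 1
  | .seq c d => max c.bound d.bound
  | .ite _ c d => max c.bound d.bound
  | .rep c => c.bound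
  | .query _ r => r + 1
  | .get _ r => r + 1

/-! ### Compiling test programs: all queries go to prover `0`, one of them also to prover `1`

Register `0` counts the queries that are still to come before the cross-check, register `1` is
non-empty once the cross-check has been made, register `2` is non-empty once the verifier has
decided to reject, and the length of register `9` limits the length of replies. -/

/-- Report failure if registers `7` and `4` have different tops, and pop both. -/
def Prog.compareStep : Prog :=
  .seq (.ite (.nonempty 7)
      (.ite (.nonempty 4)
        (.ite (.top 7) (.ite (.top 4) .nop (.push 2 true)) (.ite (.top 4) (.push 2 true) .nop))
        (.push 2 true))
      (.ite (.nonempty 4) (.push 2 true) .nop))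
    (.seq (.pop 7) (.pop 4))

/-- The comparison loop is run twice because replies may have up to `2 * N` bits. It works on a copy
in register `7`; the reply of prover `0` in register `3` survives. -/
def Prog.crossCheck (m : ℕ) : Prog :=
  .seq (.push 1 true) (.seq (.ask 1 m 9 4) (.seq (.copy 3 7)
    (.seq (.rep .compareStep) (.rep .compareStep))))

/-- The value that is used always comes from prover `0`. The counter influences only whether prover
`1` is asked as well, so up to the cross-check a run depends on the counter in register `0` alone.
-/
def Prog.fetch (m r : ℕ) : Prog :=
  .seq (.ask 0 m 9 3) (.seq
    (.ite (.nonempty 0) (.pop 0) (.ite (.nonempty 1) .nop (.crossCheck m)))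
    (.copy 3 r))

def TProg.toProg : TProg → Prog
  | .nop => .nop
  | .push r b => .push (r + 10) b
  | .pop r => .pop (r + 10)
  | .clear r => .clear (r + 10)
  | .copy a b => .copy (a + 10) (b + 10)
  | .rev a b => .rev (a + 10) (b + 10)
  | .seq c d => .seq c.toProg d.toProg
  | .ite T c d => .ite (T.map (· + 10)) c.toProg d.toProg
  | .rep c => .rep c.toProg
  | .query q r => .query (q + 10) (r + 10)
  | .get m r => .fetch (m + 10) (r + 10)

/-- The registers of a test program within those of a looping program. -/
def State.data (s : State) : ℕ → List Bool := fun r => s.reg (r + 10)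

theorem TProg.toProg_avoids {x : ℕ} (h : x = 5 ∨ x = 6 ∨ x = 8 ∨ x = 9) (c : TProg) :
    c.toProg.Avoids x := by
  induction c with
  | seq _ _ h1 h2 => exact ⟨h1, h2⟩
  | ite _ _ _ h1 h2 => exact ⟨h1, h2⟩
  | rep _ h1 => exact h1
  | nop => trivial
  | get m r =>
    rcases h with rfl | rfl | rfl | rfl <;>
      simp [TProg.toProg, Prog.fetch, Prog.crossCheck, Prog.compareStep, Prog.Avoids]
  | _ => simp only [TProg.toProg, Prog.Avoids]; omega

theorem TProg.toProg_onlyPushes (c : TProg) : c.toProg.OnlyPushes 2 := by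
  induction c with
  | seq _ _ h1 h2 => exact ⟨h1, h2⟩
  | ite _ _ _ h1 h2 => exact ⟨h1, h2⟩
  | rep _ h1 => exact h1
  | nop => trivial
  | get m r =>
    simp [TProg.toProg, Prog.fetch, Prog.crossCheck, Prog.compareStep, Prog.OnlyPushes]
  | _ => simp [TProg.toProg, Prog.OnlyPushes]

theorem TProg.toProg_coinless (c : TProg) : c.toProg.Coinless := by
  induction c with
  | seq _ _ h1 h2 => exact ⟨h1, h2⟩
  | ite _ _ _ h1 h2 => exact ⟨h1, h2⟩
  | rep _ h1 => exact h1
  | get m r =>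
    simp [TProg.toProg, Prog.fetch, Prog.crossCheck, Prog.compareStep, Prog.Coinless]
  | _ => trivial

theorem Test.on_map_data (T : Test) (s : State) : (T.map (· + 10)).on s.reg = T.on s.data := by
  cases T <;> rfl

@[simp] theorem State.data_set (s : State) (r : ℕ) (v : List Bool) :
    (s.set (r + 10) v).data = Function.update s.data r v := by
  funext i
  simp [State.data, State.set_reg, Function.update_apply]

theorem State.data_set_lt (s : State) {r : ℕ} (h : r < 10) (v : List Bool) :
    (s.set r v).data = s.data := by
  funext i
  exact State.set_reg_ne _ _ (by omega)

@[simp] theorem State.sent_set (s : State) (r : ℕ) (v : List Bool) : (s.set r v).sent = s.sent :=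
  rfl

theorem Prog.compareStep_run_eq (E : Env) (N : ℕ) (s : State) (h : s.reg 7 = s.reg 4) :
    Prog.compareStep.run E N s = (s.set 7 (s.reg 7).tail).set 4 (s.reg 4).tail := by
  have e : ∀ b : Prog, ∀ s' : State, s'.reg 7 = s'.reg 4 → (Prog.ite (.nonempty 7)
      (.ite (.nonempty 4)
        (.ite (.top 7) (.ite (.top 4) .nop (.push 2 true)) (.ite (.top 4) (.push 2 true) .nop))
        (.push 2 true))
      (.ite (.nonempty 4) (.push 2 true) .nop)).run E N s' = s' := by
    intro _ s' h'
    simp only [Prog.run, Test.on, h']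
    rcases s'.reg 4 with _ | ⟨_ | _, l⟩ <;> rfl
  simp only [Prog.compareStep]
  rw [Prog.run, e .nop s h]
  simp only [Prog.run]
  rw [State.set_reg_ne _ _ (by decide)]

theorem Prog.compareStep_iterate_eq (E : Env) (N k : ℕ) (s : State) (h : s.reg 7 = s.reg 4) :
    ((Prog.compareStep.run E N)^[k] s).reg 7 = ((Prog.compareStep.run E N)^[k] s).reg 4 ∧
    ∀ r, r ≠ 7 → r ≠ 4 → ((Prog.compareStep.run E N)^[k] s).reg r = s.reg r := by
  induction k generalizing s with
  | zero => exact ⟨h, fun _ _ _ => rfl⟩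
  | succ k ih =>
    rw [Function.iterate_succ_apply, Prog.compareStep_run_eq E N s h]
    obtain ⟨h1, h2⟩ := ih ((s.set 7 (s.reg 7).tail).set 4 (s.reg 4).tail)
      (by rw [State.set_reg_ne _ _ (by decide)]; simp [h])
    refine ⟨h1, fun r h7 h4 => ?_⟩
    rw [h2 r h7 h4, State.set_reg_ne _ _ h4, State.set_reg_ne _ _ h7]

theorem Prog.compareStep_onlyPushes : Prog.compareStep.OnlyPushes 2 := by
  simp [Prog.compareStep, Prog.OnlyPushes]

theorem Prog.compareStep_iterate_onlyPushes (E : Env) (N k : ℕ) (s : State) (h : s.reg 2 ≠ []) :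
    ((Prog.compareStep.run E N)^[k] s).reg 2 ≠ [] := by
  induction k generalizing s with
  | zero => exact h
  | succ k ih => exact ih _ (Prog.run_reg_ne_nil Prog.compareStep_onlyPushes s h)

/-- As long as no difference has been reported the tops agree, so the tails still differ; this
cannot go on once both registers are exhausted. -/
theorem Prog.compareStep_iterate_ne (E : Env) (N k : ℕ) (s : State) (h : s.reg 7 ≠ s.reg 4)
    (h7 : (s.reg 7).length ≤ k) (h4 : (s.reg 4).length ≤ k) :
    ((Prog.compareStep.run E N)^[k] s).reg 2 ≠ [] := by
  induction k generalizing s with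
  | zero =>
    exact absurd ((List.eq_nil_of_length_eq_zero (by omega)).trans
      (List.eq_nil_of_length_eq_zero (by omega)).symm) h
  | succ k ih =>
    rw [Function.iterate_succ_apply]
    by_cases hf : (Prog.compareStep.run E N s).reg 2 ≠ []
    · exact Prog.compareStep_iterate_onlyPushes E N k _ hf
    · have htop : (s.reg 7).tail ≠ (s.reg 4).tail ∧
          Prog.compareStep.run E N s = (s.set 7 (s.reg 7).tail).set 4 (s.reg 4).tail := by
        simp only [Prog.compareStep, Prog.run, Test.on] at hf ⊢
        rcases e7 : s.reg 7 with _ | ⟨a, l⟩ <;> rcases e4 : s.reg 4 with _ | ⟨b, l'⟩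
        · simp [e7, e4] at h
        · simp [e7, e4, State.set_reg] at hf
        · simp [e7, e4, State.set_reg] at hf
        · have hl : a = b → l ≠ l' := fun hab hl => h (by rw [e7, e4, hab, hl])
          cases a <;> cases b <;> simp [e7, e4, State.set_reg] at hf hl ⊢ <;> exact hl
      rw [htop.2]
      refine ih _ ?_ ?_ ?_
      · rw [State.set_reg_ne _ _ (by decide)]; simpa using htop.1
      · rw [State.set_reg_ne _ _ (by decide)]; simp; omega
      · simp; omega

/-- With provers that both answer according to `F`, a test program does what it should. -/
theorem TProg.run_honest {E : Env} {N : ℕ} {F : List Bool → List Bool}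
    (h0 : ∀ h m, E.reply 0 (h ++ [m]) = F m) (h1 : ∀ h m, E.reply 1 (h ++ [m]) = F m)
    (c : TProg) (s : State) (h9 : (s.reg 9).length = 2 * N) :
    (c.toProg.run E N s).data = c.eval E.oracle F N s.data ∧
      (c.toProg.run E N s).reg 2 = s.reg 2 := by
  induction c generalizing s with
  | seq c c' ihc ihd =>
    have h9' := Prog.run_reg_of_avoids (E := E) (N := N)
      (TProg.toProg_avoids (x := 9) (by simp) c) s
    obtain ⟨a1, a2⟩ := ihc s h9
    obtain ⟨b1, b2⟩ := ihd (c.toProg.run E N s) (by rw [h9', h9])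
    exact ⟨by simp only [TProg.toProg, Prog.run, TProg.eval]; rw [b1, a1], by
      simp only [TProg.toProg, Prog.run]; rw [b2, a2]⟩
  | ite T c c' ihc ihd =>
    simp only [TProg.toProg, Prog.run, TProg.eval, Test.on_map_data]
    cases T.on s.data
    · exact ihd s h9
    · exact ihc s h9
  | rep c ih =>
    simp only [TProg.toProg, Prog.run, TProg.eval]
    generalize hn : (c.toProg.run E N)^[N] s = s'
    have key : ∀ n, ((c.toProg.run E N)^[n] s).data = (c.eval E.oracle F N)^[n] s.data ∧
        ((c.toProg.run E N)^[n] s).reg 2 = s.reg 2 ∧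
        (((c.toProg.run E N)^[n] s).reg 9).length = 2 * N := by
      intro n
      induction n with
      | zero => exact ⟨rfl, rfl, h9⟩
      | succ n ihn =>
        obtain ⟨a1, a2, a3⟩ := ihn
        obtain ⟨b1, b2⟩ := ih _ a3
        simp only [Function.iterate_succ_apply']
        refine ⟨by rw [b1, a1], by rw [b2, a2], ?_⟩
        rw [Prog.run_reg_of_avoids (TProg.toProg_avoids (x := 9) (by simp) c), a3]
    rw [← hn]
    exact ⟨(key N).1, (key N).2.1⟩
  | nop => exact ⟨rfl, rfl⟩
  | rev a b =>
    simp only [TProg.toProg, Prog.run, TProg.eval, Nat.add_right_cancel_iff]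
    split_ifs
    · exact ⟨rfl, rfl⟩
    · exact ⟨by simp [State.data], State.set_reg_ne _ _ (by omega)⟩
  | get m r =>
    simp only [TProg.toProg, Prog.fetch, Prog.run, TProg.eval]
    set s1 := (s.record 0 (s.reg (m + 10))).set 3
      ((E.reply 0 (s.sent 0 ++ [s.reg (m + 10)])).take (s.reg 9).length) with hs1
    have e3 : s1.reg 3 = (F (s.data m)).take (2 * N) := by
      rw [hs1, State.set_reg_same, h0, h9]; rfl
    have ed : s1.data = s.data := by rw [hs1, State.data_set_lt _ (by decide)]; rfl
    have e2 : s1.reg 2 = s.reg 2 := by rw [hs1, State.set_reg_ne _ _ (by decide)]; rfl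
    have e9 : s1.reg 9 = s.reg 9 := by rw [hs1, State.set_reg_ne _ _ (by decide)]; rfl
    have key : ∀ s2 : State, s2.reg 3 = s1.reg 3 → s2.data = s1.data → s2.reg 2 = s1.reg 2 →
        (s2.set (r + 10) (s2.reg 3)).data =
          Function.update s.data r ((F (s.data m)).take (2 * N)) ∧
        (s2.set (r + 10) (s2.reg 3)).reg 2 = s.reg 2 := by
      intro s2 a b c
      refine ⟨?_, ?_⟩
      · rw [State.data_set, a, b, e3, ed]
      · rw [State.set_reg_ne _ _ (by omega), c, e2]
    rcases (Test.nonempty 0).on s1.reg with _ | _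
    rotate_left
    · refine key _ ?_ ?_ ?_
      · rw [cond_true, State.set_reg_ne _ _ (by decide)]
      · rw [cond_true, State.data_set_lt _ (by decide)]
      · rw [cond_true, State.set_reg_ne _ _ (by decide)]
    rcases (Test.nonempty 1).on s1.reg with _ | _
    rotate_left
    · exact key _ rfl rfl rfl
    · simp only [cond_false]
      simp only [Prog.crossCheck, Prog.run]
      set s2 := (((s1.set 1 (true :: s1.reg 1)).record 1 _).set 4 _).set 7 _ with hs2
      have f1 : s2.reg 7 = s2.reg 4 := by
        rw [hs2, State.set_reg_same]
        simp only [State.set_reg]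
        simp [State.record, State.set]
        rw [h1, e9, h9, e3, ← ed]
        rfl
      have f2 : ∀ r, r ≠ 1 → r ≠ 4 → r ≠ 7 → s2.reg r = s1.reg r := by
        intro r a b c
        rw [hs2, State.set_reg_ne _ _ c, State.set_reg_ne _ _ b, State.record_reg,
          State.set_reg_ne _ _ a]
      rw [← Function.iterate_add_apply]
      obtain ⟨-, g⟩ := Prog.compareStep_iterate_eq E N (N + N) s2 f1
      refine key _ ?_ ?_ ?_
      · rw [g _ (by decide) (by decide), f2 _ (by decide) (by decide) (by decide)]
      · funext i
        simp only [State.data]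
        rw [g _ (by omega) (by omega), f2 _ (by omega) (by omega) (by omega)]
      · rw [g _ (by decide) (by decide), f2 _ (by decide) (by decide) (by decide)]
  | _ =>
    refine ⟨?_, ?_⟩
    · simp [TProg.toProg, Prog.run, TProg.eval, State.data]
    · simp only [TProg.toProg, Prog.run]
      exact State.set_reg_ne _ _ (by omega)

/-- The common case of all operations that make no query: nothing is deducted from the counter, so
`q = 0` in the first alternative. -/
theorem TProg.run_committed_of_set {E : Env} {N : ℕ} {F : List Bool → List Bool} {s : State}
    (h1 : s.reg 1 = []) (c : TProg) (r : ℕ) (v : List Bool)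
    (hrun : ∀ i, c.toProg.run E N (s.set 0 (List.replicate i true)) =
      (s.set 0 (List.replicate i true)).set (r + 10) v)
    (hdata : Function.update s.data r v = c.eval E.oracle F N s.data) :
    (∃ q ≤ c.gets N, ∃ s' : State,
      (∀ i, c.toProg.run E N (s.set 0 (List.replicate (q + i) true)) =
        s'.set 0 (List.replicate i true)) ∧
      s'.data = c.eval E.oracle F N s.data ∧ s'.sent 1 = s.sent 1 ∧ s'.reg 1 = [] ∧
      s'.reg 9 = s.reg 9) ∨
    ∃ q < c.gets N, (c.toProg.run E N (s.set 0 (List.replicate q true))).reg 2 ≠ [] := by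
  refine Or.inl ⟨0, Nat.zero_le _, s.set (r + 10) v, fun i => ?_, ?_, rfl, ?_, ?_⟩
  · rw [Nat.zero_add, hrun, State.set_comm _ (by omega)]
  · rw [State.data_set, hdata]
  · rw [State.set_reg_ne _ _ (by omega), h1]
  · rw [State.set_reg_ne _ _ (by omega)]

/-- Either all queries of a test program are answered as prover `1` would answer them if they were
its next question, or some choice of the query to be cross-checked reveals the difference. -/
theorem TProg.run_committed {E : Env} {N : ℕ} {F : List Bool → List Bool} (c : TProg) (s : State)
    (h9 : (s.reg 9).length = 2 * N) (h1 : s.reg 1 = [])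
    (hF : ∀ m, F m = E.reply 1 (s.sent 1 ++ [m])) :
    (∃ q ≤ c.gets N, ∃ s' : State,
      (∀ i, c.toProg.run E N (s.set 0 (List.replicate (q + i) true)) =
        s'.set 0 (List.replicate i true)) ∧
      s'.data = c.eval E.oracle F N s.data ∧ s'.sent 1 = s.sent 1 ∧ s'.reg 1 = [] ∧
      s'.reg 9 = s.reg 9) ∨
    ∃ q < c.gets N, (c.toProg.run E N (s.set 0 (List.replicate q true))).reg 2 ≠ [] := by
  induction c generalizing s with
  | seq c c' ihc ihd =>
    simp only [TProg.toProg, Prog.run, TProg.eval, TProg.gets]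
    rcases ihc s h9 h1 hF with ⟨q, hq, s', a1, a2, a3, a4, a5⟩ | ⟨q, hq, h⟩
    · rcases ihd s' (by rw [a5, h9]) a4 (by rw [a3]; exact hF) with
        ⟨q', hq', s'', b1, b2, b3, b4, b5⟩ | ⟨q', hq', h'⟩
      -- The first program uses up exactly `q` of the counter when it agrees with `F`. A counter `q
      -- + q'` therefore reaches the second program as `q'`.
      · refine Or.inl ⟨q + q', by omega, s'', fun i => ?_, by rw [b2, a2], by rw [b3, a3], b4,
          by rw [b5, a5]⟩
        rw [Nat.add_assoc, a1, b1]
      · refine Or.inr ⟨q + q', by omega, ?_⟩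
        rw [a1]; exact h'
    · exact Or.inr ⟨q, by omega, Prog.run_reg_ne_nil (TProg.toProg_onlyPushes c') _ h⟩
  | ite T c c' ihc ihd =>
    have hT : ∀ v, (T.map (· + 10)).on (s.set 0 v).reg = T.on s.data := fun v => by
      rw [Test.on_map_data, State.data_set_lt _ (by decide)]
    simp only [TProg.toProg, Prog.run, TProg.eval, TProg.gets, hT]
    cases T.on s.data
    rotate_left
    · rcases ihc s h9 h1 hF with ⟨q, hq, h⟩ | ⟨q, hq, h⟩
      · exact Or.inl ⟨q, by omega, h⟩
      · exact Or.inr ⟨q, by omega, h⟩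
    · rcases ihd s h9 h1 hF with ⟨q, hq, h⟩ | ⟨q, hq, h⟩
      · exact Or.inl ⟨q, by omega, h⟩
      · exact Or.inr ⟨q, by omega, h⟩
  | rep c ih =>
    simp only [TProg.toProg, Prog.run, TProg.eval, TProg.gets]
    have key : ∀ n, ∀ s : State, (s.reg 9).length = 2 * N → s.reg 1 = [] →
        (∀ m, F m = E.reply 1 (s.sent 1 ++ [m])) →
        (∃ q ≤ n * c.gets N, ∃ s' : State,
          (∀ i, (c.toProg.run E N)^[n] (s.set 0 (List.replicate (q + i) true)) =
            s'.set 0 (List.replicate i true)) ∧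
          s'.data = (c.eval E.oracle F N)^[n] s.data ∧ s'.sent 1 = s.sent 1 ∧ s'.reg 1 = [] ∧
          s'.reg 9 = s.reg 9) ∨
        ∃ q < n * c.gets N,
          ((c.toProg.run E N)^[n] (s.set 0 (List.replicate q true))).reg 2 ≠ [] := by
      intro n
      induction n with
      | zero =>
        intro s h9 h1 hF
        exact Or.inl ⟨0, by simp, s, fun i => by simp, rfl, rfl, h1, rfl⟩
      | succ n ihn =>
        intro s h9 h1 hF
        simp only [Function.iterate_succ_apply]
        rcases ih s h9 h1 hF with ⟨q, hq, s', a1, a2, a3, a4, a5⟩ | ⟨q, hq, h⟩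
        · rcases ihn s' (by rw [a5, h9]) a4 (by rw [a3]; exact hF) with
            ⟨q', hq', s'', b1, b2, b3, b4, b5⟩ | ⟨q', hq', h'⟩
          · refine Or.inl ⟨q + q', by rw [Nat.succ_mul]; omega, s'', fun i => ?_, by rw [b2, a2],
              by rw [b3, a3], b4, by rw [b5, a5]⟩
            rw [Nat.add_assoc, a1, b1]
          · refine Or.inr ⟨q + q', by rw [Nat.succ_mul]; omega, ?_⟩
            rw [a1]; exact h'
        · refine Or.inr ⟨q, by rw [Nat.succ_mul]; omega, ?_⟩
          exact iterate_of_step (p := fun s : State => s.reg 2 ≠ [])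
            (Prog.run_reg_ne_nil (TProg.toProg_onlyPushes c)) n h
    exact key N s h9 h1 hF
  | nop => exact Or.inl ⟨0, by simp, s, fun i => by simp [TProg.toProg, Prog.run], rfl, rfl, h1, rfl⟩
  | rev a b =>
    refine Or.inl ⟨0, by simp, (TProg.rev a b).toProg.run E N s, fun i => ?_, ?_⟩
    · simp only [TProg.toProg, Prog.run, Nat.add_right_cancel_iff]
      split_ifs
      · simp
      · rw [State.set_reg_ne _ _ (by omega), State.set_comm _ (by omega)]; simp
    · simp only [TProg.toProg, Prog.run, Nat.add_right_cancel_iff, TProg.eval]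
      split_ifs
      · exact ⟨rfl, rfl, h1, rfl⟩
      · refine ⟨by simp [State.data], rfl, ?_, ?_⟩
        · rw [State.set_reg_ne _ _ (by omega), h1]
        · rw [State.set_reg_ne _ _ (by omega)]
  | get m r =>
    simp only [TProg.toProg, Prog.fetch, Prog.run, TProg.eval, TProg.gets]
    -- The question to prover `0` does not depend on the counter, hence its reply does not either.
    have ex : ∀ v, ((s.set 0 v).record 0 ((s.set 0 v).reg (m + 10))).set 3
        ((E.reply 0 ((s.set 0 v).sent 0 ++ [(s.set 0 v).reg (m + 10)])).take
          ((s.set 0 v).reg 9).length) =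
        ((s.record 0 (s.reg (m + 10))).set 3
          ((E.reply 0 (s.sent 0 ++ [s.reg (m + 10)])).take (2 * N))).set 0 v := by
      intro v
      simp only [State.set_reg_ne _ _ (show m + 10 ≠ 0 by omega), State.sent_set,
        State.set_reg_ne _ _ (show 9 ≠ 0 by decide), h9]
      rw [State.set_comm (s.record 0 (s.reg (m + 10))) (by decide)]
      rfl
    simp only [ex]
    set s1 := (s.record 0 (s.reg (m + 10))).set 3
      ((E.reply 0 (s.sent 0 ++ [s.reg (m + 10)])).take (2 * N)) with hs1
    have e3 : s1.reg 3 = (E.reply 0 (s.sent 0 ++ [s.reg (m + 10)])).take (2 * N) := by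
      rw [hs1, State.set_reg_same]
    have ed : s1.data = s.data := by rw [hs1, State.data_set_lt _ (by decide)]; rfl
    have e1 : s1.reg 1 = [] := by rw [hs1, State.set_reg_ne _ _ (by decide)]; exact h1
    have e9 : s1.reg 9 = s.reg 9 := by rw [hs1, State.set_reg_ne _ _ (by decide)]; rfl
    have es : s1.sent 1 = s.sent 1 := by simp [hs1, State.record]
    -- If prover `0` agrees with `F` here, one unit of the counter is spent and the commitment of
    -- prover `1` is unchanged, since it has received nothing. Otherwise counter `0` triggers the
    -- cross-check at this very query, and prover `1` replies by `F`.
    by_cases heq : s1.reg 3 = (F (s.data m)).take (2 * N)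
    · refine Or.inl ⟨1, le_rfl, s1.set (r + 10) (s1.reg 3), fun i => ?_, ?_, ?_, ?_, ?_⟩
      · have hh : (Test.nonempty 0).on (s1.set 0 (List.replicate (1 + i) true)).reg = true := by
          simp [Test.on, Nat.add_comm 1 i, List.replicate_succ]
        simp only [hh, cond_true]
        simp only [State.set_reg_same, State.set_set, Nat.add_comm 1 i, List.replicate_succ,
          List.tail_cons]
        rw [State.set_reg_ne _ _ (by decide), State.set_comm _ (by omega)]
      · rw [State.data_set, heq, ed]
      · exact es
      · rw [State.set_reg_ne _ _ (by omega), e1]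
      · rw [State.set_reg_ne _ _ (by omega), e9]
    · refine Or.inr ⟨0, Nat.one_pos, ?_⟩
      have hh : (Test.nonempty 0).on (s1.set 0 (List.replicate 0 true)).reg = false := by
        simp [Test.on]
      have hh' : (Test.nonempty 1).on (s1.set 0 (List.replicate 0 true)).reg = false := by
        simp only [Test.on]
        rw [State.set_reg_ne _ _ (by decide), e1]
        simp
      simp only [hh, hh', cond_false]
      rw [State.set_reg_ne _ _ (by omega)]
      simp only [Prog.crossCheck, Prog.run]
      rw [← Function.iterate_add_apply]
      have hm : s1.reg (m + 10) = s.data m := congrFun ed m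
      have h4 : (E.reply 1 (s1.sent 1 ++ [s1.reg (m + 10)])).take (s1.reg 9).length =
          (F (s.data m)).take (2 * N) := by
        rw [es, hm, ← hF, e9, h9]
      apply Prog.compareStep_iterate_ne
      · rw [State.set_reg_same, State.set_reg_ne _ _ (show 4 ≠ 7 by decide), State.set_reg_same]
        simp only [State.record_reg, State.set_reg_ne _ _ (show m + 10 ≠ 1 by omega),
          State.set_reg_ne _ _ (show m + 10 ≠ 0 by omega), State.sent_set,
          State.set_reg_ne _ _ (show 3 ≠ 4 by decide), State.set_reg_ne _ _ (show 3 ≠ 1 by decide),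
          State.set_reg_ne _ _ (show 3 ≠ 0 by decide), State.set_reg_ne _ _ (show 9 ≠ 1 by decide),
          State.set_reg_ne _ _ (show 9 ≠ 0 by decide), h4]
        exact heq
      · rw [State.set_reg_same]
        simp only [State.record_reg, State.set_reg_ne _ _ (show 3 ≠ 4 by decide),
          State.set_reg_ne _ _ (show 3 ≠ 1 by decide), State.set_reg_ne _ _ (show 3 ≠ 0 by decide),
          e3, List.length_take]
        omega
      · rw [State.set_reg_ne _ _ (show 4 ≠ 7 by decide), State.set_reg_same]
        simp only [State.set_reg_ne _ _ (show 9 ≠ 1 by decide),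
          State.set_reg_ne _ _ (show 9 ≠ 0 by decide), List.length_take, e9, h9]
        omega
  | push r b =>
    exact run_committed_of_set h1 _ r (b :: s.reg (r + 10)) (fun i => by
      simp [TProg.toProg, Prog.run, State.set_reg]) rfl
  | pop r =>
    exact run_committed_of_set h1 _ r ((s.reg (r + 10)).tail) (fun i => by
      simp [TProg.toProg, Prog.run, State.set_reg]) rfl
  | clear r =>
    exact run_committed_of_set h1 _ r ([]) (fun i => by
      simp [TProg.toProg, Prog.run, State.set_reg]) rfl
  | copy a r =>
    exact run_committed_of_set h1 _ r (s.reg (a + 10)) (fun i => by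
      simp [TProg.toProg, Prog.run, State.set_reg]) rfl
  | query q r =>
    exact run_committed_of_set h1 _ r (E.oracle (s.reg (q + 10)) :: s.reg (r + 10)) (fun i => by
      simp [TProg.toProg, Prog.run, State.set_reg]) rfl

end OracleComplexity


/-! ### Arithmetic on binary numbers within test programs. -/

namespace OracleComplexity

/-! ### Binary numbers, least significant bit first -/

def val : List Bool → ℕ
  | [] => 0
  | b :: l => b.toNat + 2 * val l

/-- The `n` lowest binary digits of `v`. -/
def toBits : ℕ → ℕ → List Bool
  | 0, _ => []
  | n + 1, v => decide (v % 2 = 1) :: toBits n (v / 2)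

@[simp] theorem length_toBits (n v : ℕ) : (toBits n v).length = n := by
  induction n generalizing v with
  | zero => rfl
  | succ n ih => simp [toBits, ih]

theorem val_toBits (n v : ℕ) : val (toBits n v) = v % 2 ^ n := by
  induction n generalizing v with
  | zero => simp [toBits, val, Nat.mod_one]
  | succ n ih =>
    rw [toBits, val, ih, pow_succ', Nat.mod_mul]
    congr 1
    rcases Nat.mod_two_eq_zero_or_one v with h | h <;> simp [h]

theorem val_lt (l : List Bool) : val l < 2 ^ l.length := by
  induction l with
  | nil => simp [val]
  | cons b l ih =>
    simp only [val, List.length_cons, pow_succ]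
    cases b <;> simp <;> omega

theorem val_eq_head_add_tail (l : List Bool) : val l = (l.headD false).toNat + 2 * val l.tail := by
  cases l <;> simp [val]

theorem val_append (l l' : List Bool) : val (l ++ l') = val l + 2 ^ l.length * val l' := by
  induction l with
  | nil => simp [val]
  | cons b l ih => simp only [List.cons_append, val, ih, List.length_cons, pow_succ]; ring

@[simp] theorem val_replicate_false (n : ℕ) : val (List.replicate n false) = 0 := by
  induction n with
  | zero => rfl
  | succ n ih => simp [List.replicate_succ, val, ih]

theorem toBits_congr {n v w : ℕ} (h : v % 2 ^ n = w % 2 ^ n) : toBits n v = toBits n w := by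
  induction n generalizing v w with
  | zero => rfl
  | succ n ih =>
    rw [pow_succ', Nat.mod_mul, Nat.mod_mul] at h
    have h2 : v % 2 = w % 2 := by
      have := congrArg (· % 2) h
      simpa using this
    rw [toBits, toBits, h2, ih]
    omega

/-! ### Bitwise scans of two registers -/

def TProg.seqs : List TProg → TProg
  | [] => .nop
  | c :: l => .seq c (seqs l)

/-- Feed two numbers, padded with zeros, to an automaton with two states. -/
def scan (f : Bool → Bool → Bool → Bool × Bool) : ℕ → Bool → List Bool → List Bool →
    List Bool × Bool
  | 0, s, _, _ => ([], s)
  | k + 1, s, a, b =>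
    ((f (a.headD false) (b.headD false) s).1 ::
        (scan f k (f (a.headD false) (b.headD false) s).2 a.tail b.tail).1,
      (scan f k (f (a.headD false) (b.headD false) s).2 a.tail b.tail).2)

def flag (s : Bool) : List Bool := if s then [true] else []

namespace TProg

/-- The scanner reads registers `200` and `201`, keeps its state in register `202` (non-empty for
`true`), and writes its output on register `203`, where it ends up reversed. -/
def scanLeaf (p : Bool × Bool) : TProg :=
  .seq (.push 203 p.1) (.seq (.clear 202) (if p.2 then .push 202 true else .nop))

def scanStep (f : Bool → Bool → Bool → Bool × Bool) : TProg :=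
  .seq (.ite (.top 200)
      (.ite (.top 201)
        (.ite (.nonempty 202) (scanLeaf (f true true true)) (scanLeaf (f true true false)))
        (.ite (.nonempty 202) (scanLeaf (f true false true)) (scanLeaf (f true false false))))
      (.ite (.top 201)
        (.ite (.nonempty 202) (scanLeaf (f false true true)) (scanLeaf (f false true false)))
        (.ite (.nonempty 202) (scanLeaf (f false false true)) (scanLeaf (f false false false)))))
    (.seq (.pop 200) (.pop 201))

/-- Scan registers `a` and `b` over `3 N` digits. -/
def scanRegs (f : Bool → Bool → Bool → Bool × Bool) (s : Bool) (a b : ℕ) : TProg :=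
  seqs [.copy a 200, .copy b 201, if s then .push 202 true else .nop,
    .rep (scanStep f), .rep (scanStep f), .rep (scanStep f)]

def scanEnd : TProg := seqs [.clear 200, .clear 201, .clear 202, .clear 203]

/-- Reject. -/
def fail : TProg := .seq (.clear 0) (.push 0 true)

/-- `dst := a + b` modulo `2 ^ (3 N)`. -/
def add (a b dst : ℕ) : TProg :=
  seqs [scanRegs (fun a b c => (xor (xor a b) c, (a && b) || (c && (a || b)))) false a b,
    .rev 203 dst, scanEnd]

def checkScan (f : Bool → Bool → Bool → Bool) (s : Bool) (a b : ℕ) : TProg :=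
  seqs [scanRegs (fun a b c => (false, f a b c)) s a b, .ite (.nonempty 202) fail .nop, scanEnd]

def checkEq (a b : ℕ) : TProg := checkScan (fun a b c => c || xor a b) false a b

/-- Digits arrive with increasing significance, so a later difference overrides the state. The final
state `true` is a failure: it means `a > b`, and with initial state `true`, as in `checkLt`, it
means `a ≥ b`. -/
def checkLe (a b : ℕ) : TProg := checkScan (fun a b c => if a = b then c else a) false a b

def checkLt (a b : ℕ) : TProg := checkScan (fun a b c => if a = b then c else a) true a b

variable {O : Oracle} {F : List Bool → List Bool} {N : ℕ}

theorem eval_scanLeaf (p : Bool × Bool) (d : ℕ → List Bool) :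
    (scanLeaf p).eval O F N d =
      Function.update (Function.update d 203 (p.1 :: d 203)) 202 (flag p.2) := by
  rcases p with ⟨a, _ | _⟩ <;> simp [scanLeaf, eval, flag]

theorem eval_scanStep (f : Bool → Bool → Bool → Bool × Bool) (d : ℕ → List Bool) (s : Bool)
    (hs : d 202 = flag s) :
    (scanStep f).eval O F N d = Function.update (Function.update (Function.update (Function.update d
      203 ((f ((d 200).headD false) ((d 201).headD false) s).1 :: d 203))
      202 (flag (f ((d 200).headD false) ((d 201).headD false) s).2))
      200 (d 200).tail) 201 (d 201).tail := by
  simp only [scanStep, eval, Test.on, hs]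
  cases (d 200).headD false <;> cases (d 201).headD false <;> cases s <;>
    simp [eval_scanLeaf, flag]

theorem iterate_scanStep (f : Bool → Bool → Bool → Bool × Bool) (k : ℕ) (d : ℕ → List Bool)
    (s : Bool) (hs : d 202 = flag s) :
    ((scanStep f).eval O F N)^[k] d =
      Function.update (Function.update (Function.update (Function.update d
        203 ((scan f k s (d 200) (d 201)).1.reverse ++ d 203))
        202 (flag (scan f k s (d 200) (d 201)).2))
        200 ((d 200).drop k)) 201 ((d 201).drop k) := by
  induction k generalizing d s with
  | zero =>
    funext r
    simp only [Function.iterate_zero, id, scan, Function.update_apply]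
    split_ifs <;> simp_all
  | succ k ih =>
    rw [Function.iterate_succ_apply, eval_scanStep f d s hs, ih _ _ (by simp; rfl)]
    funext r
    simp only [scan, Function.update_apply]
    split_ifs <;> simp_all

/-- All registers from `b` on are empty. -/
def CleanFrom (b : ℕ) (d : ℕ → List Bool) : Prop := ∀ r, b ≤ r → d r = []

theorem CleanFrom.mono {b b' : ℕ} {d : ℕ → List Bool} (h : CleanFrom b d) (hb : b ≤ b') :
    CleanFrom b' d := fun r hr => h r (hb.trans hr)

theorem CleanFrom.update {b r : ℕ} {d : ℕ → List Bool} (h : CleanFrom b d) (hr : r < b)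
    (v : List Bool) : CleanFrom b (Function.update d r v) := fun i hi => by
  rw [Function.update_of_ne (by omega), h i hi]

theorem eval_scanRegs (f : Bool → Bool → Bool → Bool × Bool) (s : Bool) {a b : ℕ}
    (d : ℕ → List Bool) (hd : CleanFrom 200 d) (hb : b < 200) :
    (scanRegs f s a b).eval O F N d =
      Function.update (Function.update (Function.update (Function.update d
        203 (scan f (3 * N) s (d a) (d b)).1.reverse)
        202 (flag (scan f (3 * N) s (d a) (d b)).2))
        200 ((d a).drop (3 * N))) 201 ((d b).drop (3 * N)) := by
  have h2 : d 202 = [] := hd _ (by omega)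
  have h3 : d 203 = [] := hd _ (by omega)
  have e : (scanRegs f s a b).eval O F N d = ((scanStep f).eval O F N)^[3 * N]
      (Function.update (Function.update (Function.update d 200 (d a)) 201 (d b)) 202 (flag s)) := by
    have e3 : 3 * N = N + (N + N) := by ring
    rw [e3, Function.iterate_add_apply, Function.iterate_add_apply]
    simp only [scanRegs, seqs, eval]
    congr 3
    cases s
    · simp only [eval, flag, Bool.false_eq_true, if_false]
      funext r
      simp only [Function.update_apply]
      split_ifs <;> simp_all
    · simp only [eval, flag, if_true]
      funext r
      simp only [Function.update_apply]
      split_ifs <;> simp_all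
  rw [e, iterate_scanStep f _ _ s (by simp)]
  funext r
  simp only [Function.update_apply]
  split_ifs <;> simp_all

theorem eval_scanEnd (d : ℕ → List Bool) (r : ℕ) :
    scanEnd.eval O F N d r = if 200 ≤ r ∧ r < 204 then [] else d r := by
  simp only [scanEnd, seqs, eval, Function.update_apply]
  split_ifs <;> first | rfl | omega

end TProg

theorem scan_add (k : ℕ) (c : Bool) (a b : List Bool) :
    (scan (fun a b c => (xor (xor a b) c, (a && b) || (c && (a || b)))) k c a b).1 =
      toBits k (val a + val b + c.toNat) := by
  induction k generalizing c a b with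
  | zero => rfl
  | succ k ih =>
    rw [scan, ih, toBits, val_eq_head_add_tail a, val_eq_head_add_tail b]
    generalize val a.tail = u, val b.tail = v
    refine congrArg₂ List.cons ?_ (congrArg (toBits k) ?_)
    · cases a.headD false <;> cases b.headD false <;> cases c <;> simp <;> omega
    · cases a.headD false <;> cases b.headD false <;> cases c <;> simp <;> omega

theorem val_eq_zero_of_length {l : List Bool} (h : l.length ≤ 0) : val l = 0 := by
  rw [List.eq_nil_of_length_eq_zero (Nat.le_zero.1 h)]; rfl

theorem scan_eq (k : ℕ) (c : Bool) (a b : List Bool) (ha : a.length ≤ k) (hb : b.length ≤ k) :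
    (scan (fun a b c => (false, c || xor a b)) k c a b).2 = true ↔ c = true ∨ val a ≠ val b := by
  induction k generalizing c a b with
  | zero => simp [scan, val_eq_zero_of_length ha, val_eq_zero_of_length hb]
  | succ k ih =>
    rw [scan, ih _ _ _ (by simp; omega) (by simp; omega), val_eq_head_add_tail a,
      val_eq_head_add_tail b]
    generalize val a.tail = u, val b.tail = v
    cases a.headD false <;> cases b.headD false <;> cases c <;> simp <;> omega

/-- The state acts as the result of comparing the digits below those still to be read: `c = true`
counts like one unit added to `a`. -/
theorem scan_lt (k : ℕ) (c : Bool) (a b : List Bool) (ha : a.length ≤ k) (hb : b.length ≤ k) :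
    (scan (fun a b c => (false, if a = b then c else a)) k c a b).2 = true ↔
      val b < val a + c.toNat := by
  induction k generalizing c a b with
  | zero => cases c <;> simp [scan, val_eq_zero_of_length ha, val_eq_zero_of_length hb]
  | succ k ih =>
    rw [scan, ih _ _ _ (by simp; omega) (by simp; omega), val_eq_head_add_tail a,
      val_eq_head_add_tail b]
    generalize val a.tail = u, val b.tail = v
    cases a.headD false <;> cases b.headD false <;> cases c <;> simp <;> omega

open Classical in
/-- Set the rejection flag unless `P` holds. -/
noncomputable def setBad (d : ℕ → List Bool) (P : Prop) : ℕ → List Bool :=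
  if P then d else Function.update d 0 [true]

theorem setBad_apply {d : ℕ → List Bool} {P : Prop} {r : ℕ} (h : r ≠ 0) : setBad d P r = d r := by
  unfold setBad; split_ifs <;> simp [h]

theorem setBad_of {d : ℕ → List Bool} {P : Prop} (h : P) : setBad d P = d := if_pos h

theorem setBad_of_not {d : ℕ → List Bool} {P : Prop} (h : ¬ P) :
    setBad d P = Function.update d 0 [true] := if_neg h

/-- The composition rule on which the verification of the programs rests. A check changes nothing
but the flag in register `0`, consecutive checks merge into a conjunction, and other operations
commute with the flag. -/
theorem setBad_setBad (d : ℕ → List Bool) (P Q : Prop) :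
    setBad (setBad d P) Q = setBad d (P ∧ Q) := by
  by_cases hP : P <;> by_cases hQ : Q <;> simp [setBad, hP, hQ]

theorem update_setBad (d : ℕ → List Bool) (P : Prop) {r : ℕ} (h : r ≠ 0) (v : List Bool) :
    Function.update (setBad d P) r v = setBad (Function.update d r v) P := by
  by_cases hP : P
  · simp [setBad, hP]
  · simp only [setBad, hP, if_false]; rw [Function.update_comm h.symm]

theorem setBad_congr {d : ℕ → List Bool} {P Q : Prop} (h : P ↔ Q) : setBad d P = setBad d Q := by
  rw [propext h]

theorem setBad_zero_eq_nil {d : ℕ → List Bool} {P : Prop} (h : d 0 = []) :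
    setBad d P 0 = [] ↔ P := by
  by_cases hP : P <;> simp [setBad, hP, h]

namespace TProg

variable {O : Oracle} {F : List Bool → List Bool} {N : ℕ}

theorem CleanFrom.setBad {b : ℕ} {d : ℕ → List Bool} (h : CleanFrom b d) (hb : 0 < b) (P : Prop) :
    CleanFrom b (setBad d P) := fun r hr => by
  rw [setBad_apply (by omega), h r hr]

theorem eval_add {a b dst : ℕ} {d : ℕ → List Bool} (hd : CleanFrom 200 d)
    (hb : b < 200) (hdst : dst < 200) :
    (add a b dst).eval O F N d =
      Function.update d dst (toBits (3 * N) (val (d a) + val (d b))) := by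
  funext r
  simp only [add, seqs, eval, eval_scanEnd]
  rw [eval_scanRegs _ _ d hd hb, scan_add, if_neg (show ¬ 203 = dst by omega)]
  have hr := hd r
  simp only [Function.update_apply]
  split_ifs <;> first | omega | simp_all

theorem eval_checkScan {f : Bool → Bool → Bool → Bool} {s : Bool} {a b : ℕ} {d : ℕ → List Bool}
    (hd : CleanFrom 200 d) (hb : b < 200) :
    (checkScan f s a b).eval O F N d =
      setBad d (¬ (scan (fun a b c => (false, f a b c)) (3 * N) s (d a) (d b)).2 = true) := by
  funext r
  simp only [checkScan, seqs, eval, eval_scanEnd]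
  rw [eval_scanRegs _ _ d hd hb]
  simp only [Test.on]
  have hr := hd r
  cases (scan (fun a b c => (false, f a b c)) (3 * N) s (d a) (d b)).2
  · rw [setBad_of (by simp)]
    simp [fail, eval, flag, Function.update_apply]
    split_ifs <;> first | omega | simp_all
  · rw [setBad_of_not (by simp)]
    simp [fail, eval, flag, Function.update_apply]
    split_ifs <;> first | omega | simp_all

theorem eval_checkEq {a b : ℕ} {d : ℕ → List Bool} (hd : CleanFrom 200 d) (hb : b < 200)
    (hla : (d a).length ≤ 3 * N) (hlb : (d b).length ≤ 3 * N) :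
    (checkEq a b).eval O F N d = setBad d (val (d a) = val (d b)) := by
  rw [checkEq, eval_checkScan hd hb]
  exact setBad_congr (by rw [scan_eq _ _ _ _ hla hlb]; simp)

theorem eval_checkLe {a b : ℕ} {d : ℕ → List Bool} (hd : CleanFrom 200 d) (hb : b < 200)
    (hla : (d a).length ≤ 3 * N) (hlb : (d b).length ≤ 3 * N) :
    (checkLe a b).eval O F N d = setBad d (val (d a) ≤ val (d b)) := by
  rw [checkLe, eval_checkScan hd hb]
  exact setBad_congr (by rw [scan_lt _ _ _ _ hla hlb]; simp)

theorem eval_checkLt {a b : ℕ} {d : ℕ → List Bool} (hd : CleanFrom 200 d) (hb : b < 200)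
    (hla : (d a).length ≤ 3 * N) (hlb : (d b).length ≤ 3 * N) :
    (checkLt a b).eval O F N d = setBad d (val (d a) < val (d b)) := by
  rw [checkLt, eval_checkScan hd hb]
  exact setBad_congr (by rw [scan_lt _ _ _ _ hla hlb]; simp)

/-- One step of `addSq`: register `191` holds the remaining digits of the multiplier and register
`190` the shifted multiplicand. -/
def addSqStep (acc : ℕ) : TProg :=
  seqs [.ite (.top 191) (add acc 190 acc) .nop, .pop 191, .push 190 false]

/-- `acc := acc + p ^ 2` modulo `2 ^ (3 N)`. -/
def addSq (acc p : ℕ) : TProg :=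
  seqs [add acc 190 acc, .copy p 190, .copy p 191, .rep (addSqStep acc), .rep (addSqStep acc),
    .clear 190, .clear 191]

theorem eval_addSqStep {acc : ℕ} {d : ℕ → List Bool} (hd : CleanFrom 200 d) (hacc : acc < 190)
    {v : ℕ} (hv : d acc = toBits (3 * N) v) :
    (addSqStep acc).eval O F N d = Function.update (Function.update (Function.update d
      acc (toBits (3 * N) (v + ((d 191).headD false).toNat * val (d 190))))
      191 (d 191).tail) 190 (false :: d 190) := by
  funext r
  simp only [addSqStep, seqs, eval, Test.on]
  cases (d 191).headD false
  · simp only [cond_false, Bool.toNat_false, zero_mul, add_zero, ← hv, Function.update_eq_self]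
    simp only [Function.update_apply]
    split_ifs <;> simp_all
  · simp only [cond_true, Bool.toNat_true, one_mul]
    rw [eval_add hd (by omega) (by omega)]
    have e : toBits (3 * N) (val (d acc) + val (d 190)) = toBits (3 * N) (v + val (d 190)) := by
      apply toBits_congr
      rw [hv, val_toBits, Nat.mod_add_mod]
    rw [e]
    simp only [Function.update_apply]
    split_ifs <;> first | omega | simp_all

/-- Schoolbook multiplication: after `k` steps the lowest `k` digits of the multiplier have been
used and the multiplicand is shifted by `k` places. -/
theorem iterate_addSqStep {acc : ℕ} (k : ℕ) {d : ℕ → List Bool} (hd : CleanFrom 200 d)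
    (hacc : acc < 190) {v : ℕ} (hv : d acc = toBits (3 * N) v) :
    ((addSqStep acc).eval O F N)^[k] d = Function.update (Function.update (Function.update d
      acc (toBits (3 * N) (v + val ((d 191).take k) * val (d 190))))
      191 ((d 191).drop k)) 190 (List.replicate k false ++ d 190) := by
  induction k generalizing d v with
  | zero =>
    funext r
    simp only [Function.iterate_zero, id, Function.update_apply, List.take_zero, val, zero_mul,
      add_zero]
    split_ifs <;> simp_all
  | succ k ih =>
    rw [Function.iterate_succ_apply, eval_addSqStep hd hacc hv,
      ih (((hd.update (by omega) _).update (by omega) _).update (by omega) _)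
        (v := v + ((d 191).headD false).toNat * val (d 190))
        (by rw [Function.update_of_ne (by omega), Function.update_of_ne (by omega),
          Function.update_self])]
    have e : v + ((d 191).headD false).toNat * val (d 190) +
        val ((d 191).tail.take k) * val (false :: d 190) =
        v + val ((d 191).take (k + 1)) * val (d 190) := by
      cases d 191 with
      | nil => simp [val]
      | cons b l =>
        simp only [val, List.headD_cons, List.tail_cons, List.take_succ_cons, Bool.toNat_false]
        ring
    funext r
    simp only [Function.update_self, Function.update_of_ne (show (191 : ℕ) ≠ 190 by decide), e]
    simp only [Function.update_apply]
    split_ifs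
    · rw [List.replicate_succ', List.append_assoc]; rfl
    · simp
    · rfl
    · rfl

/-- Adding the still empty register `190` at the start only brings the accumulator to exactly `3 *
N` digits, the form that the loop maintains. The factor has at most `2 * N` digits, whence two
passes of the loop. -/
theorem eval_addSq {acc p : ℕ} {d : ℕ → List Bool} (hd : CleanFrom 190 d) (hacc : acc < 190)
    (hp : p < 190) (hne : p ≠ acc) (hlp : (d p).length ≤ 2 * N) :
    (addSq acc p).eval O F N d =
      Function.update d acc (toBits (3 * N) (val (d acc) + val (d p) ^ 2)) := by
  have h0 : d 190 = [] := hd _ le_rfl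
  have h1 : d 191 = [] := hd _ (by omega)
  simp only [addSq, seqs, eval]
  rw [eval_add (hd.mono (by omega)) (by omega) (by omega), ← Function.iterate_add_apply,
    iterate_addSqStep (v := val (d acc)) (N + N) ?_ hacc ?_]
  · have e : val (d acc) + val (List.take (N + N) (d p)) * val (d p) =
        val (d acc) + val (d p) ^ 2 := by
      rw [List.take_of_length_le (by omega)]; ring
    funext r
    simp only [Function.update_apply]
    split_ifs <;> first | omega | simp_all
  · exact (((hd.mono (by omega)).update (by omega) _).update (by omega) _).update (by omega) _
  · rw [Function.update_of_ne (by omega), Function.update_of_ne (by omega), Function.update_self,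
      h0]
    simp [val]

/-- `dst := ∑ r ∈ l, r` modulo `2 ^ (3 N)`. -/
def sumTo (dst : ℕ) : List ℕ → TProg
  | [] => .clear dst
  | r :: l => .seq (sumTo dst l) (add r dst dst)

/-- The sum of the numbers in the registers `l`. -/
def regSum (d : ℕ → List Bool) (l : List ℕ) : ℕ := (l.map fun r => val (d r)).sum

theorem eval_sumTo {dst : ℕ} (l : List ℕ) {d : ℕ → List Bool} (hd : CleanFrom 200 d)
    (hdst : dst < 200) (hl : ∀ r ∈ l, r < 200 ∧ r ≠ dst) :
    ∃ v : List Bool, (sumTo dst l).eval O F N d = Function.update d dst v ∧ v.length ≤ 3 * N ∧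
      val v = regSum d l % 2 ^ (3 * N) := by
  induction l with
  | nil => exact ⟨[], rfl, by simp, by simp [val, regSum]⟩
  | cons r l ih =>
    obtain ⟨v, h1, -, h3⟩ := ih fun r' hr' => hl r' (List.mem_cons_of_mem _ hr')
    obtain ⟨hr, hr'⟩ := hl r List.mem_cons_self
    refine ⟨_, ?_, (length_toBits (3 * N) (val (d r) + val v)).le, ?_⟩
    · simp only [sumTo, eval]
      rw [h1, eval_add (hd.update hdst v) hdst hdst]
      simp [hr']
    · rw [val_toBits, h3, Nat.add_mod_mod]; rfl

def checkSumEq (l l' : List ℕ) : TProg :=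
  seqs [sumTo 180 l, sumTo 181 l', checkEq 180 181, .clear 180, .clear 181]

def checkSumLt (l l' : List ℕ) : TProg :=
  seqs [sumTo 180 l, sumTo 181 l', checkLt 180 181, .clear 180, .clear 181]

theorem update_nil_of_cleanFrom {b r : ℕ} {d : ℕ → List Bool} (h : CleanFrom b d) (hr : b ≤ r) :
    Function.update d r [] = d := by
  rw [← h r hr, Function.update_eq_self]

theorem regSum_update {d : ℕ → List Bool} {l : List ℕ} {r : ℕ} (h : r ∉ l) (v : List Bool) :
    regSum (Function.update d r v) l = regSum d l := by
  unfold regSum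
  congr 1
  apply List.map_congr_left
  intro i hi
  rw [Function.update_of_ne (by rintro rfl; exact h hi)]

/-- Treats equality and strict inequality of sums together. The sums are only compared modulo `2 ^
(3 * N)`; bounds on the summands remove the modulus wherever the test is used. -/
theorem eval_checkSum {chk : TProg} {R : ℕ → ℕ → Prop} {l l' : List ℕ} {d : ℕ → List Bool}
    (hchk : ∀ d : ℕ → List Bool, CleanFrom 200 d → (d 180).length ≤ 3 * N →
      (d 181).length ≤ 3 * N →
      chk.eval O F N d = setBad d (R (val (d 180)) (val (d 181))))
    (hd : CleanFrom 180 d) (hl : ∀ r ∈ l, r < 180) (hl' : ∀ r ∈ l', r < 180) :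
    (seqs [sumTo 180 l, sumTo 181 l', chk, .clear 180, .clear 181]).eval O F N d =
      setBad d (R (regSum d l % 2 ^ (3 * N)) (regSum d l' % 2 ^ (3 * N))) := by
  have hd' : CleanFrom 200 d := hd.mono (by omega)
  obtain ⟨v, h1, h2, h3⟩ := eval_sumTo (O := O) (F := F) (N := N) (dst := 180) l hd' (by omega)
    fun r hr => by have := hl r hr; omega
  obtain ⟨v', h1', h2', h3'⟩ := eval_sumTo (O := O) (F := F) (N := N) (dst := 181) l'
    (hd'.update (r := 180) (by omega) v) (by omega) fun r hr => by have := hl' r hr; omega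
  simp only [seqs, eval]
  rw [h1, h1', hchk _ ?_ (by simpa) (by simpa),
    update_setBad _ _ (by decide), update_setBad _ _ (by decide)]
  swap
  · intro r hr
    rw [Function.update_of_ne (by omega), Function.update_of_ne (by omega), hd' r hr]
  rw [regSum_update (r := 180) (by intro h; have := hl' _ h; omega)] at h3'
  simp only [Function.update_self, Function.update_of_ne (show (180 : ℕ) ≠ 181 by decide), h3, h3']
  congr 1
  rw [Function.update_comm (show (181 : ℕ) ≠ 180 by decide), Function.update_idem,
    Function.update_idem, update_nil_of_cleanFrom hd le_rfl, update_nil_of_cleanFrom hd (by omega)]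

theorem eval_checkSumEq {l l' : List ℕ} {d : ℕ → List Bool} (hd : CleanFrom 180 d)
    (hl : ∀ r ∈ l, r < 180) (hl' : ∀ r ∈ l', r < 180) :
    (checkSumEq l l').eval O F N d =
      setBad d (regSum d l % 2 ^ (3 * N) = regSum d l' % 2 ^ (3 * N)) :=
  eval_checkSum (R := fun a b => a = b)
    (fun _ h h1 h2 => eval_checkEq h (by omega) h1 h2) hd hl hl'

theorem eval_checkSumLt {l l' : List ℕ} {d : ℕ → List Bool} (hd : CleanFrom 180 d)
    (hl : ∀ r ∈ l, r < 180) (hl' : ∀ r ∈ l', r < 180) :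
    (checkSumLt l l').eval O F N d =
      setBad d (regSum d l % 2 ^ (3 * N) < regSum d l' % 2 ^ (3 * N)) :=
  eval_checkSum (R := fun a b => a < b)
    (fun _ h h1 h2 => eval_checkLt h (by omega) h1 h2) hd hl hl'

/-- Check a list of equations between sums of registers. -/
def checkSums : List (List ℕ × List ℕ) → TProg
  | [] => .nop
  | e :: l => .seq (checkSumEq e.1 e.2) (checkSums l)

theorem regSum_setBad {d : ℕ → List Bool} {l : List ℕ} (h : 0 ∉ l) (P : Prop) :
    regSum (setBad d P) l = regSum d l := by
  by_cases hP : P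
  · rw [setBad_of hP]
  · rw [setBad_of_not hP, regSum_update h]

theorem eval_checkSums (l : List (List ℕ × List ℕ)) {d : ℕ → List Bool} (hd : CleanFrom 180 d)
    (hl : ∀ e ∈ l, (∀ r ∈ e.1, 0 < r ∧ r < 180) ∧ ∀ r ∈ e.2, 0 < r ∧ r < 180) :
    (checkSums l).eval O F N d =
      setBad d (∀ e ∈ l, regSum d e.1 % 2 ^ (3 * N) = regSum d e.2 % 2 ^ (3 * N)) := by
  induction l generalizing d with
  | nil => simp [checkSums, eval, setBad]
  | cons e l ih =>
    have he := hl e List.mem_cons_self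
    have hl' := fun e' he' => hl e' (List.mem_cons_of_mem e he')
    simp only [checkSums, eval]
    rw [eval_checkSumEq hd (fun r hr => (he.1 r hr).2) (fun r hr => (he.2 r hr).2),
      ih (hd.setBad (by omega) _) hl', setBad_setBad]
    refine setBad_congr ?_
    simp only [List.forall_mem_cons]
    refine and_congr_right fun _ => forall₂_congr fun e' he' => ?_
    rw [regSum_setBad (fun h => ((hl' e' he').1 0 h).1.ne rfl),
      regSum_setBad (fun h => ((hl' e' he').2 0 h).1.ne rfl)]

end TProg

end OracleComplexity


/-! ### Claims about a basis state: its interval and its eight coefficients. -/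

namespace OracleComplexity

/-! ### Reading the claims of the provers

The provers commit to a function `G` from messages to numbers.  For each layer, with code `ℓ`, and
each prefix `p` of a basis state it provides the number at which the interval of `p` is split into
the intervals of `p 0` and `p 1`, and for each basis state eight numbers, from which the amplitude
is computed. -/

/-- `2 ^ N`. -/
def topNumber (N : ℕ) : List Bool := List.replicate N false ++ [true]

theorem val_topNumber (N : ℕ) : val (topNumber N) = 2 ^ N := by
  simp [topNumber, val_append, val]

theorem length_topNumber (N : ℕ) : (topNumber N).length = N + 1 := by simp [topNumber]

/-- The interval of `z`, found by descending from the interval `[lo, hi)` of the prefix `pre`. -/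
def descend (G : List Bool → List Bool) : List Bool → List Bool → List Bool → List Bool →
    List Bool × List Bool
  | [], _, lo, hi => (lo, hi)
  | b :: z, pre, lo, hi =>
    bif b then descend G z (true :: pre) (G pre) hi else descend G z (false :: pre) lo (G pre)

/-- All splits on the way to `z` are proper. -/
def DescendOK (G : List Bool → List Bool) : List Bool → List Bool → List Bool → List Bool → Prop
  | [], _, _, _ => True
  | b :: z, pre, lo, hi => (val lo ≤ val (G pre) ∧ val (G pre) ≤ val hi) ∧
    bif b then DescendOK G z (true :: pre) (G pre) hi else DescendOK G z (false :: pre) lo (G pre)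

/-- The order results from `loadLeaf`, which pushes the lowest bit first. -/
def indexCode (j : ℕ) : List Bool := [j.testBit 2, j.testBit 1, j.testBit 0]

/-- The `j`-th number attached to the basis state `z`. -/
def leafVal (G : List Bool → List Bool) (l z : List Bool) (j : ℕ) : List Bool :=
  G (indexCode j ++ (z.reverse ++ false :: l))

/-- The root of the tree is `[0, 2 ^ N)`, with `[]` as the numeral `0`. The marker `false` separates
these queries from those for sample points, which carry `true`. -/
def leafIvl (N : ℕ) (G : List Bool → List Bool) (l z : List Bool) : List Bool × List Bool :=
  descend G z (false :: l) [] (topNumber N)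

/-- The claims about `z` are consistent: its interval is obtained by proper splits, and its length
is the squared norm of the eight numbers attached to `z`. -/
def LeafOK (N : ℕ) (G : List Bool → List Bool) (l z : List Bool) : Prop :=
  DescendOK G z (false :: l) [] (topNumber N) ∧
  (∀ j < 8, val (leafVal G l z j) ≤ 2 ^ N) ∧
  (val (leafIvl N G l z).1 + ∑ j ∈ Finset.range 8, val (leafVal G l z j) ^ 2) % 2 ^ (3 * N) =
    val (leafIvl N G l z).2

/-- Overwrite the registers `b, …, b + k - 1`. -/
def fill (d : ℕ → List Bool) (b k : ℕ) (g : ℕ → List Bool) : ℕ → List Bool :=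
  fun r => if b ≤ r ∧ r < b + k then g (r - b) else d r

theorem fill_apply_of_lt {d : ℕ → List Bool} {b k r : ℕ} {g : ℕ → List Bool} (h : r < b) :
    fill d b k g r = d r := if_neg (by omega)

theorem fill_apply_of_le {d : ℕ → List Bool} {b k r : ℕ} {g : ℕ → List Bool} (h : b + k ≤ r) :
    fill d b k g r = d r := if_neg (by omega)

theorem fill_apply_add {d : ℕ → List Bool} {b k j : ℕ} {g : ℕ → List Bool} (h : j < k) :
    fill d b k g (b + j) = g j := by simp [fill, h]

namespace TProg

variable {O : Oracle} {F : List Bool → List Bool} {N : ℕ}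

def descendStep : TProg :=
  .ite (.nonempty 151) (seqs [.get 150 152, checkLe 52 152, checkLe 152 53,
    .ite (.top 151) (.seq (.copy 152 52) (.push 150 true)) (.seq (.copy 152 53) (.push 150 false)),
    .pop 151, .clear 152]) .nop

def loadLeaf (base j : ℕ) : TProg :=
  seqs [.copy 150 154, .push 154 (j.testBit 0), .push 154 (j.testBit 1), .push 154 (j.testBit 2),
    .get 154 (base + j), checkLe (base + j) 6, addSq 153 (base + j), .clear 154]

def loadLeaves (base : ℕ) : ℕ → TProg
  | 0 => .nop
  | k + 1 => .seq (loadLeaves base k) (loadLeaf base k)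

/-- Load all claims about the basis state in register `z` in the layer coded in register `l`, and
check their consistency.  The endpoints of the interval go to registers `52` and `53`, the eight
numbers to registers `base, …, base + 7`. -/
def load (l z base : ℕ) : TProg :=
  seqs [.copy l 150, .push 150 false, .copy z 151, .clear 52, .copy 6 53, .rep descendStep,
    .copy 52 153, loadLeaves base 8, checkEq 153 53, .clear 150, .clear 153]

theorem eval_descendStep {d : ℕ → List Bool} {b : Bool} {z : List Bool} (hd : CleanFrom 152 d)
    (hz : d 151 = b :: z) (h52 : (d 52).length ≤ 3 * N) (h53 : (d 53).length ≤ 3 * N) :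
    descendStep.eval O F N d = setBad (Function.update (Function.update (Function.update d
      150 (b :: d 150)) 151 z) (if b then 52 else 53) ((F (d 150)).take (2 * N)))
      (val (d 52) ≤ val ((F (d 150)).take (2 * N)) ∧
        val ((F (d 150)).take (2 * N)) ≤ val (d 53)) := by
  have hlen : ((F (d 150)).take (2 * N)).length ≤ 3 * N := by simp; omega
  have hd1 : CleanFrom 200 (Function.update d 152 ((F (d 150)).take (2 * N))) :=
    (hd.mono (by omega)).update (by omega) _
  simp only [descendStep, eval, Test.on, hz, List.isEmpty_cons, Bool.not_false, cond_true, seqs]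
  rw [eval_checkLe hd1 (by omega) (by rwa [Function.update_of_ne (by decide)])
      (by rw [Function.update_self]; exact hlen),
    eval_checkLe (hd1.setBad (by omega) _) (by omega)
      (by rw [setBad_apply (by decide), Function.update_self]; exact hlen)
      (by rwa [setBad_apply (by decide), Function.update_of_ne (by decide)]), setBad_setBad]
  generalize hP : (_ ∧ _) = P
  have hP' : P = (val (d 52) ≤ val ((F (d 150)).take (2 * N)) ∧
        val ((F (d 150)).take (2 * N)) ≤ val (d 53)) := by
    rw [← hP]; simp [setBad_apply]
  rw [← hP']
  have h152 := hd 152 le_rfl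
  cases b <;>
  · simp [setBad_apply, hz, update_setBad]
    congr 1
    funext r
    simp only [Function.update_apply]
    split_ifs <;> simp_all

/-- Once register `151` is used up the step does nothing, so surplus iterations are harmless and any
`k` at least the length of `z` will do. -/
theorem iterate_descendStep (k : ℕ) {d : ℕ → List Bool} {z : List Bool} (hd : CleanFrom 152 d)
    (hz : d 151 = z) (hk : z.length ≤ k) (h52 : (d 52).length ≤ 3 * N)
    (h53 : (d 53).length ≤ 3 * N) :
    (descendStep.eval O F N)^[k] d = setBad (Function.update (Function.update (Function.update
      (Function.update d 150 (z.reverse ++ d 150)) 151 [])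
      52 (descend (fun m => (F m).take (2 * N)) z (d 150) (d 52) (d 53)).1)
      53 (descend (fun m => (F m).take (2 * N)) z (d 150) (d 52) (d 53)).2)
      (DescendOK (fun m => (F m).take (2 * N)) z (d 150) (d 52) (d 53)) := by
  induction z generalizing k d with
  | nil =>
    have : descendStep.eval O F N d = d := by simp [descendStep, eval, Test.on, hz]
    rw [Function.iterate_fixed this, setBad_of (by trivial)]
    funext r
    simp only [descend, Function.update_apply]
    split_ifs <;> simp_all
  | cons b z ih =>
    obtain ⟨k, rfl⟩ : ∃ k', k = k' + 1 := ⟨k - 1, by simp at hk; omega⟩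
    rw [Function.iterate_succ_apply, eval_descendStep hd hz h52 h53]
    simp only [List.length_cons, Nat.add_le_add_iff_right] at hk
    have hl : ((F (d 150)).take (2 * N)).length ≤ 3 * N := by simp; omega
    rw [ih k ?_ ?_ hk ?_ ?_]
    · cases b
      · simp [setBad_apply, update_setBad, setBad_setBad, descend, DescendOK]
        congr 1
        funext r
        simp only [Function.update_apply]
        split_ifs <;> simp_all
      · simp [setBad_apply, update_setBad, setBad_setBad, descend, DescendOK]
        congr 1
        funext r
        simp only [Function.update_apply]
        split_ifs <;> simp_all
    · refine CleanFrom.setBad ?_ (by omega) _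
      cases b <;> exact ((hd.update (by omega) _).update (by omega) _).update (by simp) _
    · cases b <;> simp [setBad_apply]
    · cases b <;> simp [setBad_apply, h52]
      omega
    · cases b <;> simp [setBad_apply, h53]
      omega

theorem eval_loadLeaf {base j : ℕ} {d : ℕ → List Bool} (hd : CleanFrom 154 d) (hb : 8 ≤ base)
    (hb' : base + j < 100) (h6 : (d 6).length ≤ 3 * N) :
    (loadLeaf base j).eval O F N d = setBad (Function.update (Function.update d
      (base + j) ((F (indexCode j ++ d 150)).take (2 * N)))
      153 (toBits (3 * N) (val (d 153) + val ((F (indexCode j ++ d 150)).take (2 * N)) ^ 2)))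
      (val ((F (indexCode j ++ d 150)).take (2 * N)) ≤ val (d 6)) := by
  set m := (F (indexCode j ++ d 150)).take (2 * N) with hm
  have hlen : m.length ≤ 2 * N := by simp [hm]
  set d1 := Function.update (Function.update d 154 (indexCode j ++ d 150)) (base + j) m with hd1
  have e : (loadLeaf base j).eval O F N d = (seqs [checkLe (base + j) 6, addSq 153 (base + j),
      .clear 154]).eval O F N d1 := by
    simp only [loadLeaf, seqs, eval, Function.update_self, Function.update_idem]
    rfl
  have c1 : CleanFrom 155 d1 := ((hd.mono (by omega)).update (by omega) _).update (by omega) _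
  have r1 : d1 (base + j) = m := by simp [hd1]
  have r2 : d1 6 = d 6 := by
    rw [hd1, Function.update_of_ne (by omega), Function.update_of_ne (by omega)]
  have r3 : d1 153 = d 153 := by
    rw [hd1, Function.update_of_ne (by omega), Function.update_of_ne (by omega)]
  rw [e]
  simp only [seqs, eval]
  rw [eval_checkLe (c1.mono (by omega)) (by omega) (by rw [r1]; omega) (by rwa [r2]), r1, r2,
    eval_addSq ((c1.mono (by omega)).setBad (by omega) _) (by omega) (by omega) (by omega)
      (by rw [setBad_apply (by omega), r1]; exact hlen),
    setBad_apply (by omega), setBad_apply (by omega), r1, r3, update_setBad _ _ (by omega),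
    update_setBad _ _ (by omega)]
  congr 1
  have h154 := hd 154 le_rfl
  funext r
  simp only [hd1, Function.update_apply]
  split_ifs <;> first | omega | simp_all

theorem eval_loadLeaves {base : ℕ} (k : ℕ) {d : ℕ → List Bool} (hd : CleanFrom 154 d)
    (hb : 8 ≤ base) (hb' : base + k < 100) (h6 : (d 6).length ≤ 3 * N)
    (h153 : (d 153).length ≤ 3 * N) :
    ∃ v : List Bool, v.length ≤ 3 * N ∧ val v = (val (d 153) +
        ∑ j ∈ Finset.range k, val ((F (indexCode j ++ d 150)).take (2 * N)) ^ 2) % 2 ^ (3 * N) ∧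
      (loadLeaves base k).eval O F N d = setBad (Function.update (fill d base k
        fun j => (F (indexCode j ++ d 150)).take (2 * N)) 153 v)
        (∀ j < k, val ((F (indexCode j ++ d 150)).take (2 * N)) ≤ val (d 6)) := by
  induction k with
  | zero =>
    refine ⟨d 153, h153, ?_, ?_⟩
    · rw [Nat.mod_eq_of_lt]
      · simp
      · simpa using (val_lt (d 153)).trans_le (Nat.pow_le_pow_right (by omega) h153)
    · rw [setBad_of (by simp)]
      simp only [loadLeaves, eval]
      funext r
      simp only [Function.update_apply, fill]
      split_ifs <;> first | omega | simp_all
  | succ k ih =>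
    obtain ⟨v, hv, hv', hev⟩ := ih (by omega)
    set d1 := Function.update (fill d base k
        fun j => (F (indexCode j ++ d 150)).take (2 * N)) 153 v with hd1
    have c1 : CleanFrom 154 d1 := by
      refine CleanFrom.update (fun r hr => ?_) (by omega) _
      rw [fill_apply_of_le (by omega), hd r hr]
    have r1 : d1 150 = d 150 := by
      rw [hd1, Function.update_of_ne (by omega), fill_apply_of_le (by omega)]
    have r2 : d1 6 = d 6 := by
      rw [hd1, Function.update_of_ne (by omega), fill_apply_of_lt (by omega)]
    have r3 : d1 153 = v := by simp [hd1]
    refine ⟨_, (length_toBits (3 * N)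
      (val v + val ((F (indexCode k ++ d 150)).take (2 * N)) ^ 2)).le, ?_, ?_⟩
    · rw [val_toBits, hv', Nat.mod_add_mod, Finset.sum_range_succ, Nat.add_assoc]
    · simp only [loadLeaves, eval]
      rw [hev, eval_loadLeaf (c1.setBad (by omega) _) hb (by omega)
        (by rw [setBad_apply (by omega), r2]; exact h6)]
      simp only [setBad_apply (show 150 ≠ 0 by decide), setBad_apply (show 153 ≠ 0 by decide),
        setBad_apply (show 6 ≠ 0 by decide), r1, r2, r3]
      rw [update_setBad _ _ (by omega), update_setBad _ _ (by omega), setBad_setBad]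
      rw [setBad_congr (P := _ ∧ _) (Q := ∀ j < k + 1,
        val ((F (indexCode j ++ d 150)).take (2 * N)) ≤ val (d 6))]
      · congr 1
        funext r
        simp only [hd1, Function.update_apply, fill]
        split_ifs <;> first | omega | simp_all
      · constructor
        · rintro ⟨h, h'⟩ j hj
          rcases Nat.lt_succ_iff_lt_or_eq.1 hj with hj | rfl
          · exact h j hj
          · exact h'
        · exact fun h => ⟨fun j hj => h j (by omega), h k (by omega)⟩

/-- Needed for arbitrary replies: comparisons of endpoints are exact only if the numerals fit into
the `3 * N` digits that are scanned. -/
theorem length_descend_le {G : List Bool → List Bool} {n : ℕ} (hG : ∀ m, (G m).length ≤ n)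
    (z pre lo hi : List Bool) (hlo : lo.length ≤ n) (hhi : hi.length ≤ n) :
    (descend G z pre lo hi).1.length ≤ n ∧ (descend G z pre lo hi).2.length ≤ n := by
  induction z generalizing pre lo hi with
  | nil => exact ⟨hlo, hhi⟩
  | cons b z ih =>
    cases b
    · exact ih _ _ _ hlo (hG _)
    · exact ih _ _ _ (hG _) hhi

/-- Valid for every `F`: a violated condition raises the flag but does not divert the computation,
so the contents of the registers are known in either case. -/
theorem eval_load {l z base : ℕ} {d : ℕ → List Bool} (hd : CleanFrom 150 d) (hN : 0 < N)
    (hz : z < 150) (hb : 8 ≤ base) (hb' : base + 8 ≤ 52) (h6 : d 6 = topNumber N)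
    (hzN : (d z).length ≤ N) :
    (load l z base).eval O F N d = setBad (fill (Function.update (Function.update d
      52 (leafIvl N (fun m => (F m).take (2 * N)) (d l) (d z)).1)
      53 (leafIvl N (fun m => (F m).take (2 * N)) (d l) (d z)).2)
      base 8 (leafVal (fun m => (F m).take (2 * N)) (d l) (d z)))
      (LeafOK N (fun m => (F m).take (2 * N)) (d l) (d z)) := by
  set G : List Bool → List Bool := fun m => (F m).take (2 * N) with hG
  set d1 := Function.update (Function.update (Function.update (Function.update d 150
    (false :: d l)) 151 (d z)) 52 []) 53 (topNumber N) with hd1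
  have e : (load l z base).eval O F N d = (seqs [.rep descendStep, .copy 52 153,
      loadLeaves base 8, checkEq 153 53, .clear 150, .clear 153]).eval O F N d1 := by
    simp only [load, seqs, eval, Function.update_self, Function.update_idem]
    rw [Function.update_of_ne (show (6 : ℕ) ≠ 52 by decide),
      Function.update_of_ne (show (6 : ℕ) ≠ 151 by decide),
      Function.update_of_ne (show (6 : ℕ) ≠ 150 by decide),
      Function.update_of_ne (show z ≠ 150 by omega), h6]
  have hGl : ∀ m, (G m).length ≤ 3 * N := fun m => by simp [hG]; omega
  have htop : (topNumber N).length ≤ 3 * N := by rw [length_topNumber]; omega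
  have c1 : CleanFrom 152 d1 := by
    intro r hr
    simp only [hd1]
    rw [Function.update_of_ne (by omega), Function.update_of_ne (by omega),
      Function.update_of_ne (by omega), Function.update_of_ne (by omega), hd r (by omega)]
  have q150 : d1 150 = false :: d l := by simp [hd1]
  have q151 : d1 151 = d z := by simp [hd1]
  have q52 : d1 52 = [] := by simp [hd1]
  have q53 : d1 53 = topNumber N := by simp [hd1]
  have hlen := length_descend_le hGl (d z) (false :: d l) [] (topNumber N) (by simp) htop
  rw [e]
  simp only [seqs, eval]
  rw [iterate_descendStep N c1 q151 hzN (by simp [q52]) (by rw [q53]; exact htop), q150, q52, q53,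
    update_setBad _ _ (by decide), setBad_apply (by decide)]
  have hivl : descend G (d z) (false :: d l) [] (topNumber N) = leafIvl N G (d l) (d z) := rfl
  rw [← hG, hivl] at *
  set iv := leafIvl N G (d l) (d z) with hiv
  set d2 := Function.update (Function.update (Function.update (Function.update (Function.update d1
    150 ((d z).reverse ++ false :: d l)) 151 []) 52 iv.1) 53 iv.2) 153 iv.1 with hd2
  have e2 : Function.update (Function.update (Function.update (Function.update (Function.update d1
    150 ((d z).reverse ++ false :: d l)) 151 []) 52 iv.1) 53 iv.2) 153
    ((Function.update (Function.update (Function.update (Function.update d1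
    150 ((d z).reverse ++ false :: d l)) 151 []) 52 iv.1) 53 iv.2) 52) = d2 := by
    rw [hd2]; simp
  rw [e2]
  have c2 : CleanFrom 154 d2 := by
    intro r hr
    simp only [hd2]
    rw [Function.update_of_ne (by omega), Function.update_of_ne (by omega),
      Function.update_of_ne (by omega), Function.update_of_ne (by omega),
      Function.update_of_ne (by omega), c1 r (by omega)]
  have p150 : d2 150 = (d z).reverse ++ false :: d l := by simp [hd2]
  have p153 : d2 153 = iv.1 := by simp [hd2]
  have p53 : d2 53 = iv.2 := by simp [hd2]
  have p6 : d2 6 = topNumber N := by simp [hd2, hd1, h6]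
  obtain ⟨v, hv, hv', hev⟩ := eval_loadLeaves (O := O) (F := F) (N := N) (base := base) 8
    (c2.setBad (by omega) (DescendOK G (d z) (false :: d l) [] (topNumber N))) hb (by omega)
    (by rw [setBad_apply (by decide), p6]; exact htop)
    (by rw [setBad_apply (by decide), p153]; exact hlen.1)
  simp only [setBad_apply (show 150 ≠ 0 by decide), setBad_apply (show 153 ≠ 0 by decide),
    setBad_apply (show 6 ≠ 0 by decide), p150, p153, p6] at hv' hev
  rw [hev]
  have hfill : ∀ (d : ℕ → List Bool) (P : Prop) (g : ℕ → List Bool),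
      fill (setBad d P) base 8 g = setBad (fill d base 8 g) P := by
    intro d P g
    funext r
    by_cases hP : P
    · simp [setBad, hP]
    · simp only [setBad, hP, if_false, fill, Function.update_apply]
      split_ifs <;> first | rfl | omega
  rw [hfill, update_setBad _ _ (by decide), setBad_setBad]
  have k53 : Function.update (fill d2 base 8 fun j => List.take (2 * N)
      (F (indexCode j ++ ((d z).reverse ++ false :: d l)))) 153 v 53 = iv.2 := by
    rw [Function.update_of_ne (by decide), fill_apply_of_le (by omega), p53]
  rw [eval_checkEq (CleanFrom.setBad ?_ (by omega) _) (by omega)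
    (by rw [setBad_apply (by decide), Function.update_self]; exact hv)
    (by rw [setBad_apply (by decide), k53]; exact hlen.2),
    setBad_apply (by decide), setBad_apply (by decide), k53, Function.update_self, setBad_setBad,
    update_setBad _ _ (by decide), update_setBad _ _ (by decide), hv', val_topNumber]
  · rw [setBad_congr (P := (_ ∧ _) ∧ _) (Q := LeafOK N G (d l) (d z))]
    · congr 1
      funext r
      have h0 := hd r
      simp only [hd2, hd1, Function.update_apply, fill]
      split_ifs <;> first | omega | rfl | simp_all
    · simp only [LeafOK, and_assoc]
      rfl
  · refine CleanFrom.update (fun r hr => ?_) (by omega) _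
    rw [fill_apply_of_le (by omega), c2 r (by omega)]

end TProg

end OracleComplexity


/-! ### Bit manipulation, parsing of unary numbers, and sampling of basis states. -/

namespace OracleComplexity

/-- The first `n` bits of a string, padded with `0`. -/
def padTake (n : ℕ) (l : List Bool) : List Bool := List.ofFn fun i : Fin n => l.getD i false

theorem length_padTake (n : ℕ) (l : List Bool) : (padTake n l).length = n := by simp [padTake]

theorem padTake_succ (n : ℕ) (l : List Bool) :
    padTake (n + 1) l = l.headD false :: padTake n l.tail := by
  cases l <;> simp [padTake, List.ofFn_succ]

theorem fill_setBad {d : ℕ → List Bool} {b k : ℕ} (hb : 0 < b) (g : ℕ → List Bool) (P : Prop) :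
    fill (setBad d P) b k g = setBad (fill d b k g) P := by
  funext r
  by_cases hP : P
  · simp [setBad, hP]
  · simp only [setBad, hP, if_false, fill, Function.update_apply]
    split_ifs <;> first | rfl | omega

namespace TProg

variable {O : Oracle} {F : List Bool → List Bool} {N : ℕ}

/-! ### Moving bits between registers -/

/-- Clear the registers `b, …, b + k - 1`. -/
def clearRange (b : ℕ) : ℕ → TProg
  | 0 => .nop
  | k + 1 => .seq (clearRange b k) (.clear (b + k))

theorem eval_clearRange (b k : ℕ) (d : ℕ → List Bool) :
    (clearRange b k).eval O F N d = fill d b k fun _ => [] := by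
  induction k with
  | zero => funext r; simp [clearRange, eval, fill]
  | succ k ih =>
    simp only [clearRange, eval, ih]
    funext r
    simp only [Function.update_apply, fill]
    split_ifs <;> first | rfl | omega

def move (a b : ℕ) : TProg :=
  .seq (.ite (.top a) (.push b true) (.push b false)) (.pop a)

theorem eval_move {a b : ℕ} (h : a ≠ b) (d : ℕ → List Bool) :
    (move a b).eval O F N d =
      Function.update (Function.update d b ((d a).headD false :: d b)) a (d a).tail := by
  simp only [move, eval, Test.on]
  cases (d a).headD false <;> simp [h]

def pour (a b : ℕ) : TProg := .rep (.ite (.nonempty a) (move a b) .nop)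

theorem iterate_pour {a b : ℕ} (h : a ≠ b) (k : ℕ) {d : ℕ → List Bool} (hk : (d a).length ≤ k) :
    ((TProg.ite (.nonempty a) (move a b) .nop).eval O F N)^[k] d =
      Function.update (Function.update d b ((d a).reverse ++ d b)) a [] := by
  generalize hl : d a = l at hk ⊢
  induction l generalizing k d with
  | nil =>
    rw [Function.iterate_fixed (by simp [eval, Test.on, hl])]
    funext r
    simp only [Function.update_apply]
    split_ifs <;> simp_all
  | cons x l ih =>
    obtain ⟨k, rfl⟩ : ∃ k', k = k' + 1 := ⟨k - 1, by simp at hk; omega⟩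
    have e : (TProg.ite (.nonempty a) (move a b) .nop).eval O F N d =
        Function.update (Function.update d b (x :: d b)) a l := by
      simp only [eval, Test.on, hl, List.isEmpty_cons, Bool.not_false, cond_true, eval_move h,
        List.headD_cons, List.tail_cons]
    rw [Function.iterate_succ_apply, e, ih k (by simp) (by simpa using hk)]
    funext r
    simp only [Function.update_apply]
    split_ifs <;> simp_all

theorem eval_pour {a b : ℕ} (h : a ≠ b) {d : ℕ → List Bool} (hN : (d a).length ≤ N) :
    (pour a b).eval O F N d =
      Function.update (Function.update d b ((d a).reverse ++ d b)) a [] :=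
  iterate_pour h N hN

/-- Move as many bits from register `a` to register `b` as register `c` is long. -/
def advance (c a b : ℕ) : TProg := .rep (.ite (.nonempty c) (.seq (.pop c) (move a b)) .nop)

theorem iterate_advance {a b c : ℕ} (hab : a ≠ b) (hac : a ≠ c) (hbc : b ≠ c) (k : ℕ)
    {d : ℕ → List Bool} (hk : (d c).length ≤ k) :
    ((TProg.ite (.nonempty c) (.seq (.pop c) (move a b)) .nop).eval O F N)^[k] d =
      Function.update (Function.update (Function.update d
        b ((padTake (d c).length (d a)).reverse ++ d b)) a ((d a).drop (d c).length)) c [] := by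
  generalize hl : d c = l at hk ⊢
  induction l generalizing k d with
  | nil =>
    rw [Function.iterate_fixed (by simp [eval, Test.on, hl])]
    funext r
    simp only [Function.update_apply, padTake]
    split_ifs <;> simp_all
  | cons x l ih =>
    obtain ⟨k, rfl⟩ : ∃ k', k = k' + 1 := ⟨k - 1, by simp at hk; omega⟩
    have e : (TProg.ite (.nonempty c) (.seq (.pop c) (move a b)) .nop).eval O F N d =
        Function.update (Function.update (Function.update d c l) b ((d a).headD false :: d b))
          a (d a).tail := by
      simp only [eval, Test.on, hl, List.isEmpty_cons, Bool.not_false, cond_true, eval_move hab,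
        List.tail_cons, Function.update_of_ne hac, Function.update_of_ne hbc]
    rw [Function.iterate_succ_apply, e, ih k (by simp [hac.symm, hbc.symm]) (by simpa using hk)]
    funext r
    simp only [Function.update_apply, List.length_cons, padTake_succ]
    split_ifs <;> simp_all

theorem eval_advance {a b c : ℕ} (hab : a ≠ b) (hac : a ≠ c) (hbc : b ≠ c) {d : ℕ → List Bool}
    (hN : (d c).length ≤ N) :
    (advance c a b).eval O F N d = Function.update (Function.update (Function.update d
      b ((padTake (d c).length (d a)).reverse ++ d b)) a ((d a).drop (d c).length)) c [] :=
  iterate_advance hab hac hbc N hN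

/-- Register `dst` receives the bits of register `src`, truncated or padded to the length of
register `7`. -/
def fit (src dst : ℕ) : TProg :=
  seqs [.copy src 140, .copy 7 141, advance 141 140 142, .rev 142 dst, .clear 140, .clear 142]

/-- The second alternative is the situation in `sample`, where the source is itself a scratch
register. -/
theorem eval_fit {src dst : ℕ} {d : ℕ → List Bool} (hd : CleanFrom 140 d ∨ src = 143 ∧
    CleanFrom 140 (Function.update d 143 [])) (hdst : dst < 140) (hN : (d 7).length ≤ N) :
    (fit src dst).eval O F N d = Function.update d dst (padTake (d 7).length (d src)) := by
  have h140 : d 140 = [] := by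
    rcases hd with hd | ⟨-, hd⟩
    · exact hd _ le_rfl
    · simpa using hd 140 le_rfl
  have h141 : d 141 = [] := by
    rcases hd with hd | ⟨-, hd⟩
    · exact hd _ (by omega)
    · simpa using hd 141 (by omega)
  have h142 : d 142 = [] := by
    rcases hd with hd | ⟨-, hd⟩
    · exact hd _ (by omega)
    · simpa using hd 142 (by omega)
  simp only [fit, seqs, eval]
  rw [eval_advance (by decide) (by decide) (by decide) (by simpa using hN),
    if_neg (by omega)]
  funext r
  simp only [Function.update_apply]
  split_ifs <;> first | omega | simp_all

/-- Push the bit of register `z` at the position given in unary in register `q`. -/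
def getBit (z q dst : ℕ) : TProg :=
  seqs [.copy z 146, .copy q 147, advance 147 146 148,
    .ite (.top 146) (.push dst true) (.push dst false), .clear 146, .clear 148]

theorem eval_getBit {z q dst : ℕ} {d : ℕ → List Bool} (hd : CleanFrom 140 d) (hq : q < 140)
    (hdst : dst < 140) (hN : (d q).length ≤ N) :
    (getBit z q dst).eval O F N d =
      Function.update d dst ((d z).getD (d q).length false :: d dst) := by
  have h146 := hd 146 (by omega)
  have h147 := hd 147 (by omega)
  have h148 := hd 148 (by omega)
  simp only [getBit, seqs, eval]
  rw [eval_advance (by decide) (by decide) (by decide)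
    (by simpa [show q ≠ 146 by omega] using hN)]
  have hb : ((d z).drop (d q).length).headD false = (d z).getD (d q).length false := by
    simp [List.headD_eq_head?_getD, List.head?_drop]
  simp only [Test.on, Function.update_self, Function.update_of_ne (show q ≠ 146 by omega),
    Function.update_of_ne (show (146 : ℕ) ≠ 147 by omega), hb]
  cases (d z).getD (d q).length false <;>
  · funext r
    simp only [cond_true, cond_false, Function.update_apply]
    split_ifs <;> first | omega | simp_all

/-- Write a bit to the position given in unary in register `q`. -/
def setBit (z q dst : ℕ) (b : Bool) : TProg :=
  seqs [.copy z 146, .copy q 147, advance 147 146 148, .pop 146, .push 146 b, pour 148 146,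
    .copy 146 dst, .clear 146]

theorem padTake_eq_take {n : ℕ} {l : List Bool} (h : n ≤ l.length) : padTake n l = l.take n := by
  apply List.ext_getElem
  · simp [length_padTake, h]
  · intro i h1 h2
    simp only [length_padTake] at h1
    simp [padTake, List.getD_eq_getElem?_getD, List.getElem?_eq_getElem (show i < l.length by omega)]

theorem eval_setBit {z q dst : ℕ} {b : Bool} {d : ℕ → List Bool} (hd : CleanFrom 140 d)
    (hq : q < 140) (hdst : dst < 140) (hN : (d q).length ≤ N) (hl : (d q).length < (d z).length) :
    (setBit z q dst b).eval O F N d =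
      Function.update d dst ((d z).set (d q).length b) := by
  have h146 := hd 146 (by omega)
  have h147 := hd 147 (by omega)
  have h148 := hd 148 (by omega)
  have e : (d z).set (d q).length b =
      (d z).take (d q).length ++ b :: (d z).drop ((d q).length + 1) := by
    rw [List.set_eq_take_append_cons_drop, if_pos hl]
  simp only [setBit, seqs, eval]
  rw [eval_advance (by decide) (by decide) (by decide)
    (by simpa [show q ≠ 146 by omega] using hN), eval_pour (by decide) ?_]
  · simp only [Function.update_self, Function.update_of_ne (show q ≠ 146 by omega),
      Function.update_of_ne (show (146 : ℕ) ≠ 147 by omega), padTake_eq_take hl.le]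
    funext r
    simp only [Function.update_apply]
    split_ifs <;> first | omega | simp_all
  · simp [h148, length_padTake, show q ≠ 146 by omega, hN]

/-- Read a number in unary from register `10`. -/
def readNat (dst : ℕ) : TProg :=
  .seq (.rep (.ite (.top 10) (.seq (.pop 10) (.push dst true)) .nop)) (.pop 10)

theorem eval_readNat {dst m : ℕ} {rest : List Bool} {d : ℕ → List Bool} (hdst : dst ≠ 10)
    (h : d 10 = encodeNat m ++ rest) (hm : m ≤ N) :
    (readNat dst).eval O F N d =
      Function.update (Function.update d 10 rest) dst (List.replicate m true ++ d dst) := by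
  simp only [readNat, eval]
  have key : ∀ k m, m ≤ k → ∀ d : ℕ → List Bool, d 10 = encodeNat m ++ rest →
      (fun d : ℕ → List Bool => bif Test.on d (.top 10) then Function.update
        (Function.update d 10 (d 10).tail) dst (true :: Function.update d 10 (d 10).tail dst)
        else d)^[k] d = Function.update (Function.update d 10 (false :: rest)) dst
          (List.replicate m true ++ d dst) := by
    intro k
    induction k with
    | zero =>
      intro m hm d h
      obtain rfl : m = 0 := by omega
      simp only [encodeNat, List.replicate_zero, List.nil_append, List.singleton_append] at h
      simp [← h]
    | succ k ih =>
      intro m hm d h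
      rw [Function.iterate_succ_apply]
      cases m with
      | zero =>
        have : Test.on d (.top 10) = false := by simp [Test.on, h, encodeNat]
        rw [this, cond_false, ih 0 (by omega) d h]
      | succ m =>
        have : Test.on d (.top 10) = true := by
          simp [Test.on, h, encodeNat, List.replicate_succ]
        rw [this, cond_true, ih m (by omega) _ (by simp [h, hdst.symm, encodeNat,
          List.replicate_succ])]
        funext r
        simp only [Function.update_apply, List.replicate_succ', List.append_assoc]
        split_ifs <;> simp_all
  have := key N m hm d h
  rw [this]
  funext r
  simp only [Function.update_apply]
  split_ifs <;> simp_all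

/-! ### Sampling a basis state -/

/-- The basis state that the prover reports for the point `r` of the layer with code `l`. -/
def _root_.OracleComplexity.sampleState (G : List Bool → List Bool) (w : ℕ) (l r : List Bool) :
    Fin w → Bool := fun i => (G (r.reverse ++ true :: l)).getD i false

/-- The point `r` lies in the interval of `z`. -/
def _root_.OracleComplexity.InIvl (N : ℕ) (G : List Bool → List Bool) (l z r : List Bool) : Prop :=
  val (leafIvl N G l z).1 ≤ val r ∧ val r < val (leafIvl N G l z).2

/-- The prover names the basis state for the point in register `3`; descending to it verifies the
answer. Fitting the reply to the width makes it a basis state whatever the prover says, so that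
uniqueness of the interval applies. -/
def sample (l : ℕ) : TProg :=
  seqs [.copy l 143, .push 143 true, .copy 3 144, pour 144 143, .get 143 143, fit 143 14,
    .clear 143, load l 14 20, checkLe 52 3, checkLt 3 53, clearRange 20 34]

theorem eval_sample {l w : ℕ} {d : ℕ → List Bool} (hd : CleanFrom 14 d) (hN : 0 < N) (hl : l < 14)
    (h6 : d 6 = topNumber N) (h7 : d 7 = List.replicate w true) (hw : w ≤ N)
    (h3 : (d 3).length ≤ N) :
    (sample l).eval O F N d = setBad (Function.update d 14
      (List.ofFn (sampleState (fun m => (F m).take (2 * N)) w (d l) (d 3))))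
      (LeafOK N (fun m => (F m).take (2 * N)) (d l)
        (List.ofFn (sampleState (fun m => (F m).take (2 * N)) w (d l) (d 3))) ∧
      InIvl N (fun m => (F m).take (2 * N)) (d l)
        (List.ofFn (sampleState (fun m => (F m).take (2 * N)) w (d l) (d 3))) (d 3)) := by
  set G : List Bool → List Bool := fun m => (F m).take (2 * N) with hG
  set z := List.ofFn (sampleState G w (d l) (d 3)) with hz
  have hzl : z.length = w := by simp [hz]
  have e : (sample l).eval O F N d = (seqs [load l 14 20, checkLe 52 3, checkLt 3 53,
      clearRange 20 34]).eval O F N (Function.update d 14 z) := by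
    simp only [sample, seqs, eval]
    rw [eval_pour (by decide) (by simpa using h3)]
    simp only [Function.update_self, Function.update_of_ne (show (143 : ℕ) ≠ 144 by decide),
      Function.update_of_ne (show (3 : ℕ) ≠ 143 by decide)]
    rw [eval_fit (Or.inr ⟨rfl, ?_⟩) (by decide) ?_]
    · congr 4
      have h143 := hd 143 (by omega)
      have h144 := hd 144 (by omega)
      have hz' : z = padTake w (G ((d 3).reverse ++ true :: d l)) := rfl
      funext r
      simp only [Function.update_apply]
      split_ifs <;> first | omega | simp_all
    · intro r hr
      have := hd r (by omega)
      simp only [Function.update_apply]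
      split_ifs <;> simp_all
    · simp only [Function.update_apply]
      simp [h7, hw]
  have c1 : CleanFrom 150 (Function.update d 14 z) := (hd.mono (by omega)).update (by omega) _
  have hGl : ∀ m, (G m).length ≤ 3 * N := fun m => by simp [hG]; omega
  have htop : (topNumber N).length ≤ 3 * N := by rw [length_topNumber]; omega
  rw [e]
  simp only [seqs, eval]
  rw [eval_load c1 hN (by omega) (by omega) (by omega) (by simpa using h6)
    (by rw [Function.update_self, hzl]; exact hw)]
  simp only [Function.update_self, Function.update_of_ne (show l ≠ 14 by omega)]
  rw [← hG]
  have hlen := length_descend_le hGl z (false :: d l) [] (topNumber N) (by simp) htop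
  have hivl : descend G z (false :: d l) [] (topNumber N) = leafIvl N G (d l) z := rfl
  rw [hivl] at hlen
  set d2 := fill (Function.update (Function.update (Function.update d 14 z)
      52 (leafIvl N G (d l) z).1) 53 (leafIvl N G (d l) z).2) 20 8 (leafVal G (d l) z) with hd2
  have c2 : CleanFrom 200 d2 := by
    intro r hr
    rw [hd2, fill_apply_of_le (by omega), Function.update_of_ne (by omega),
      Function.update_of_ne (by omega), c1 r (by omega)]
  have q52 : d2 52 = (leafIvl N G (d l) z).1 := by
    rw [hd2, fill_apply_of_le (by omega)]; simp
  have q53 : d2 53 = (leafIvl N G (d l) z).2 := by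
    rw [hd2, fill_apply_of_le (by omega)]; simp
  have q3 : d2 3 = d 3 := by
    rw [hd2, fill_apply_of_lt (by omega)]; simp
  rw [eval_checkLe (c2.setBad (by omega) _) (by omega)
      (by rw [setBad_apply (by decide), q52]; exact hlen.1)
      (by rw [setBad_apply (by decide), q3]; omega), setBad_setBad,
    eval_checkLt (c2.setBad (by omega) _) (by omega)
      (by rw [setBad_apply (by decide), q3]; omega)
      (by rw [setBad_apply (by decide), q53]; exact hlen.2), setBad_setBad,
    eval_clearRange, fill_setBad (by omega)]
  simp only [setBad_apply (show 52 ≠ 0 by decide), setBad_apply (show 53 ≠ 0 by decide),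
    setBad_apply (show 3 ≠ 0 by decide), q52, q53, q3]
  rw [setBad_congr (P := (_ ∧ _) ∧ _) (Q := LeafOK N G (d l) z ∧ InIvl N G (d l) z (d 3))]
  · congr 1
    funext r
    have h0 := hd r
    simp only [hd2, Function.update_apply, fill]
    split_ifs <;> first | omega | rfl | exact (h0 (by omega)).symm
  · rw [and_assoc]; rfl

end TProg

end OracleComplexity


/-! ### The linear equations that relate two consecutive layers. -/

namespace OracleComplexity

/-! ### Checking one step of the computation -/

/-- The signed coefficients of `ω ^ j` in `∑ j < 8, p j * ω ^ j`, where `ω ^ 4 = -1`. -/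
def signed (p : ℕ → ℕ) (j : ℕ) : ℤ := p (j % 8) - p ((j + 4) % 8)

/-- The four basis states involved in the check of a step: `z` and its partner in the old and in
the new layer. -/
def quad (old old' new new' : ℕ → ℕ) : ℕ → ℕ → ℕ
  | 0 => old
  | 1 => old'
  | 2 => new
  | _ => new'

/-- The value of a formal sum of signed coefficients. -/
def evalTerms (p : ℕ → ℕ → ℕ) (e : List (ℕ × ℕ)) : ℤ := (e.map fun t => signed (p t.1) t.2).sum

/-- Computation steps: the gates of the circuit, and the passage to the complex conjugate state
with a sign given by the first qubit. -/
abbrev Step (w : ℕ) : Type := Option (Gate w)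

/-- Signed coefficients change sign under `j ↦ j + 4`, so the shift by `4` turns the equation "new
equals old" into a vanishing sum. A shift of the old coefficients by `s` multiplies the amplitude by
`ω ^ (-s)`: `s = 7` gives `ω`, and `s = 4` gives `-1`. -/
def phaseEqs (s : ℕ) : List (List (ℕ × ℕ)) :=
  (List.range 4).flatMap fun j => [[(2, j), (0, j + s + 4)], [(3, j), (1, j + s + 4)]]

/-- Conjugation sends `ω ^ j` to `ω ^ (-j)`. Of the constant `12`, the part `8` keeps the natural
subtraction exact and the part `4` is the sign that moves the old term to the other side. -/
def conjEqs (s : ℕ) : List (List (ℕ × ℕ)) :=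
  (List.range 4).flatMap fun j => [[(2, j), (0, 12 + s - j)], [(3, j), (1, 12 + s - j)]]

def swapEqs : List (List (ℕ × ℕ)) :=
  (List.range 4).flatMap fun j => [[(2, j), (1, j + 4)], [(3, j), (0, j + 4)]]

/-- These are the Hadamard relations for `1 / √2 = (ω + ω⁻¹) / 2`, multiplied by `2` to avoid
denominators. The shifts `3` and `5` are `7` and `1`, that is, multiplication by `ω` and by `ω⁻¹`,
with reversed sign. -/
def hadamardEqs : List (List (ℕ × ℕ)) :=
  (List.range 4).flatMap fun j =>
    [[(2, j), (2, j), (0, j + 3), (0, j + 5), (1, j + 3), (1, j + 5)],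
      [(3, j), (3, j), (0, j + 3), (0, j + 5), (1, j + 7), (1, j + 1)]]

/-- The two basis states that are involved in the check of a step at `z`. -/
def Step.pair {w : ℕ} : Step w → (Fin w → Bool) → (Fin w → Bool) × (Fin w → Bool)
  | some (.H q), z => (Function.update z q false, Function.update z q true)
  | some (.T _), z => (z, z)
  | some (.CNOT c t _), z => (z, Function.update z t (xor (z t) (z c)))
  | some (.oracle _), z => (z, z)
  | none, z => (z, z)

def Step.eqs (O : Oracle) {w : ℕ} : Step w → (Fin w → Bool) → List (List (ℕ × ℕ))
  | some (.H _), _ => hadamardEqs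
  | some (.T q), z => phaseEqs (if z q then 7 else 0)
  | some (.CNOT _ _ _), _ => swapEqs
  | some (.oracle ws), z => phaseEqs (if O (ws.map z) then 4 else 0)
  | none, z => conjEqs (if (List.ofFn z).headD false then 4 else 0)

/-- The claims about the old layer `l` and the new layer `l'` are consistent at `u` and `u'`, and
satisfy the equations `eqs`. -/
def QuadOK (N : ℕ) (G : List Bool → List Bool) (l l' u u' : List Bool)
    (eqs : List (List (ℕ × ℕ))) : Prop :=
  (LeafOK N G l u ∧ LeafOK N G l u' ∧ LeafOK N G l' u ∧ LeafOK N G l' u') ∧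
  ∀ e ∈ eqs, evalTerms (quad (fun j => val (leafVal G l u j)) (fun j => val (leafVal G l u' j))
    (fun j => val (leafVal G l' u j)) (fun j => val (leafVal G l' u' j))) e = 0

def StepOK (O : Oracle) (N : ℕ) (G : List Bool → List Bool) {w : ℕ} (s : Step w)
    (l l' : List Bool) (z : Fin w → Bool) : Prop :=
  QuadOK N G l l' (List.ofFn (s.pair z).1) (List.ofFn (s.pair z).2) (s.eqs O z)

theorem sum_lt_of_forall_le {l : List (ℕ × ℕ)} {f : ℕ × ℕ → ℕ} {N : ℕ} (hN : 2 ≤ N)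
    (hl : l.length ≤ 8) (h : ∀ t ∈ l, f t ≤ 2 ^ N) : (l.map f).sum < 2 ^ (3 * N) := by
  have h1 : (l.map f).sum ≤ l.length * 2 ^ N := by
    have := List.sum_le_card_nsmul (l.map f) (2 ^ N) fun x hx => by
      obtain ⟨t, ht, rfl⟩ := List.mem_map.1 hx
      exact h t ht
    simpa using this
  calc (l.map f).sum ≤ 8 * 2 ^ N := h1.trans (Nat.mul_le_mul_right _ hl)
    _ < 2 ^ (2 * N) * 2 ^ N := by
        refine Nat.mul_lt_mul_of_pos_right ?_ (by positivity)
        calc 8 < 2 ^ 4 := by norm_num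
          _ ≤ 2 ^ (2 * N) := Nat.pow_le_pow_right (by omega) (by omega)
    _ = 2 ^ (3 * N) := by rw [← pow_add]; congr 1; omega

/-- A signed sum vanishes if its positive and negative parts agree modulo `2 ^ (3 N)`. -/
theorem evalTerms_eq_zero_iff {p : ℕ → ℕ → ℕ} {e : List (ℕ × ℕ)} {N : ℕ} (hN : 2 ≤ N)
    (he : e.length ≤ 8) (h : ∀ c, ∀ j < 8, p c j ≤ 2 ^ N) :
    (e.map fun t => p t.1 (t.2 % 8)).sum % 2 ^ (3 * N) =
      (e.map fun t => p t.1 ((t.2 + 4) % 8)).sum % 2 ^ (3 * N) ↔ evalTerms p e = 0 := by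
  rw [Nat.mod_eq_of_lt (sum_lt_of_forall_le hN he fun t _ => h _ _ (Nat.mod_lt _ (by omega))),
    Nat.mod_eq_of_lt (sum_lt_of_forall_le hN he fun t _ => h _ _ (Nat.mod_lt _ (by omega)))]
  have : evalTerms p e = ((e.map fun t => p t.1 (t.2 % 8)).sum : ℕ) -
      ((e.map fun t => p t.1 ((t.2 + 4) % 8)).sum : ℕ) := by
    unfold evalTerms
    induction e with
    | nil => simp
    | cons t e ih =>
      simp only [List.map_cons, List.sum_cons, Nat.cast_add]
      rw [ih (by simp at he; omega)]
      simp only [signed]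
      ring
  rw [this, sub_eq_zero]
  exact_mod_cast Iff.rfl

namespace TProg

variable {O : Oracle} {F : List Bool → List Bool} {N : ℕ}

/-- The register that holds the coefficient of `ω ^ j` of the basis state `c` of a quadruple. -/
def coeffReg (c j : ℕ) : ℕ := 20 + 8 * c + j % 8

def loadQuad : TProg :=
  seqs [load 12 14 20, load 12 15 28, load 13 14 36, load 13 15 44]

def checkTerms (eqs : List (List (ℕ × ℕ))) : TProg :=
  checkSums (eqs.map fun e => (e.map fun t => coeffReg t.1 t.2, e.map fun t => coeffReg t.1 (t.2 + 4)))

def checkQuad (eqs : List (List (ℕ × ℕ))) : TProg :=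
  seqs [loadQuad, checkTerms eqs, clearRange 14 46]

/-- Formal sums as they occur in the checks. -/
def Wellformed (eqs : List (List (ℕ × ℕ))) : Prop :=
  ∀ e ∈ eqs, e.length ≤ 8 ∧ ∀ t ∈ e, t.1 < 4

theorem eval_seqs_cons (c : TProg) (l : List TProg) (d : ℕ → List Bool) :
    (seqs (c :: l)).eval O F N d = (seqs l).eval O F N (c.eval O F N d) := rfl

theorem eval_seqs_nil (d : ℕ → List Bool) : (seqs []).eval O F N d = d := rfl

theorem eval_seq (c c' : TProg) (d : ℕ → List Bool) :
    (TProg.seq c c').eval O F N d = c'.eval O F N (c.eval O F N d) := by rw [eval]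

theorem eval_ite_of_true {T : Test} {d : ℕ → List Bool} (h : T.on d = true) (c c' : TProg) :
    (TProg.ite T c c').eval O F N d = c.eval O F N d := by rw [eval, h, cond_true]

theorem eval_ite_of_false {T : Test} {d : ℕ → List Bool} (h : T.on d = false) (c c' : TProg) :
    (TProg.ite T c c').eval O F N d = c'.eval O F N d := by rw [eval, h, cond_false]

theorem eval_copy (a b : ℕ) (d : ℕ → List Bool) :
    (TProg.copy a b).eval O F N d = Function.update d b (d a) := by rw [eval]

theorem eval_pop (r : ℕ) (d : ℕ → List Bool) :
    (TProg.pop r).eval O F N d = Function.update d r (d r).tail := by rw [eval]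

theorem eval_push (r : ℕ) (b : Bool) (d : ℕ → List Bool) :
    (TProg.push r b).eval O F N d = Function.update d r (b :: d r) := by rw [eval]

theorem eval_clear (r : ℕ) (d : ℕ → List Bool) :
    (TProg.clear r).eval O F N d = Function.update d r [] := by rw [eval]

theorem eval_rep (c : TProg) (d : ℕ → List Bool) :
    (TProg.rep c).eval O F N d = (c.eval O F N)^[N] d := by rw [eval]

/-- The effect of `load`, apart from the checks. -/
def loaded (N : ℕ) (G : List Bool → List Bool) (l z : List Bool) (base : ℕ) (d : ℕ → List Bool) :
    ℕ → List Bool :=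
  fill (Function.update (Function.update d 52 (leafIvl N G l z).1) 53 (leafIvl N G l z).2)
    base 8 (leafVal G l z)

theorem loaded_apply {G : List Bool → List Bool} {l z : List Bool} {base r : ℕ}
    {d : ℕ → List Bool} (h : ¬ (base ≤ r ∧ r < base + 8)) (h' : ¬ (52 ≤ r ∧ r < 54)) :
    loaded N G l z base d r = d r := by
  rw [loaded, fill, if_neg h, Function.update_of_ne (by omega), Function.update_of_ne (by omega)]

theorem loaded_apply_add {G : List Bool → List Bool} {l z : List Bool} {base j : ℕ}
    {d : ℕ → List Bool} (h : j < 8) : loaded N G l z base d (base + j) = leafVal G l z j :=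
  fill_apply_add h

theorem eval_load_setBad {d : ℕ → List Bool} {l z base : ℕ} (hd : CleanFrom 60 d) (P : Prop)
    (hN : 2 ≤ N) (hl0 : l ≠ 0) (hz : z < 20) (hz0 : z ≠ 0) (hb : 8 ≤ base)
    (hb' : base + 8 ≤ 52) (h6 : d 6 = topNumber N) (hzN : (d z).length ≤ N) :
    (load l z base).eval O F N (setBad d P) =
      setBad (loaded N (fun m => (F m).take (2 * N)) (d l) (d z) base d)
        (P ∧ LeafOK N (fun m => (F m).take (2 * N)) (d l) (d z)) := by
  rw [eval_load ((hd.mono (by omega)).setBad (by omega) P) (by omega) (by omega) hb hb'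
    (by rw [setBad_apply (by omega), h6]) (by rw [setBad_apply hz0]; exact hzN),
    setBad_apply hl0, setBad_apply hz0, update_setBad _ _ (by omega),
    update_setBad _ _ (by omega), fill_setBad (by omega), setBad_setBad]
  rfl

/-- The four loads write to disjoint blocks of eight registers. They share only the endpoints in
registers `52` and `53`, which are not needed afterwards. -/
theorem eval_loadQuad {d : ℕ → List Bool} (hd : CleanFrom 60 d) (hN : 2 ≤ N)
    (h6 : d 6 = topNumber N) (h14 : (d 14).length ≤ N) (h15 : (d 15).length ≤ N)
    {G : List Bool → List Bool} (hG : G = fun m => (F m).take (2 * N)) :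
    ∃ d4 : ℕ → List Bool, loadQuad.eval O F N d = setBad d4
      (((LeafOK N G (d 12) (d 14) ∧ LeafOK N G (d 12) (d 15)) ∧ LeafOK N G (d 13) (d 14)) ∧
        LeafOK N G (d 13) (d 15)) ∧
      (∀ r, ¬ (20 ≤ r ∧ r < 54) → d4 r = d r) ∧
      (∀ j < 8, d4 (20 + j) = leafVal G (d 12) (d 14) j) ∧
      (∀ j < 8, d4 (28 + j) = leafVal G (d 12) (d 15) j) ∧
      (∀ j < 8, d4 (36 + j) = leafVal G (d 13) (d 14) j) ∧
      (∀ j < 8, d4 (44 + j) = leafVal G (d 13) (d 15) j) := by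
  have e1 : (load 12 14 20).eval O F N d = setBad (loaded N G (d 12) (d 14) 20 d)
      (LeafOK N G (d 12) (d 14)) := by
    have := eval_load_setBad (O := O) (F := F) (l := 12) (z := 14) (base := 20) hd True hN
      (by omega) (by omega) (by omega) (by omega) (by omega) h6 h14
    rwa [setBad_of (d := d) trivial, true_and, ← hG] at this
  generalize hd1 : loaded N G (d 12) (d 14) 20 d = d1 at e1
  have f1 : ∀ r, ¬ (20 ≤ r ∧ r < 28) → ¬ (52 ≤ r ∧ r < 54) → d1 r = d r := fun r h h' => by
    rw [← hd1, loaded_apply h h']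
  have g1 : ∀ j < 8, d1 (20 + j) = leafVal G (d 12) (d 14) j := fun j h => by
    rw [← hd1, loaded_apply_add h]
  have e2 := eval_load_setBad (O := O) (F := F) (N := N) (d := d1) (l := 12) (z := 15) (base := 28)
    (fun r hr => by rw [f1 r (by omega) (by omega), hd r hr]) (LeafOK N G (d 12) (d 14)) hN
    (by omega) (by omega) (by omega) (by omega) (by omega)
    (by rw [f1 6 (by omega) (by omega), h6]) (by rw [f1 15 (by omega) (by omega)]; exact h15)
  rw [← hG, f1 12 (by omega) (by omega), f1 15 (by omega) (by omega)] at e2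
  generalize hd2 : loaded N G (d 12) (d 15) 28 d1 = d2 at e2
  have f2 : ∀ r, ¬ (20 ≤ r ∧ r < 36) → ¬ (52 ≤ r ∧ r < 54) → d2 r = d r := fun r h h' => by
    rw [← hd2, loaded_apply (by omega) h', f1 r (by omega) h']
  have g2 : ∀ j < 8, d2 (28 + j) = leafVal G (d 12) (d 15) j := fun j h => by
    rw [← hd2, loaded_apply_add h]
  have e3 := eval_load_setBad (O := O) (F := F) (N := N) (d := d2) (l := 13) (z := 14) (base := 36)
    (fun r hr => by rw [f2 r (by omega) (by omega), hd r hr])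
    (LeafOK N G (d 12) (d 14) ∧ LeafOK N G (d 12) (d 15)) hN
    (by omega) (by omega) (by omega) (by omega) (by omega)
    (by rw [f2 6 (by omega) (by omega), h6]) (by rw [f2 14 (by omega) (by omega)]; exact h14)
  rw [← hG, f2 13 (by omega) (by omega), f2 14 (by omega) (by omega)] at e3
  generalize hd3 : loaded N G (d 13) (d 14) 36 d2 = d3 at e3
  have f3 : ∀ r, ¬ (20 ≤ r ∧ r < 44) → ¬ (52 ≤ r ∧ r < 54) → d3 r = d r := fun r h h' => by
    rw [← hd3, loaded_apply (by omega) h', f2 r (by omega) h']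
  have g3 : ∀ j < 8, d3 (36 + j) = leafVal G (d 13) (d 14) j := fun j h => by
    rw [← hd3, loaded_apply_add h]
  have e4 := eval_load_setBad (O := O) (F := F) (N := N) (d := d3) (l := 13) (z := 15) (base := 44)
    (fun r hr => by rw [f3 r (by omega) (by omega), hd r hr])
    ((LeafOK N G (d 12) (d 14) ∧ LeafOK N G (d 12) (d 15)) ∧ LeafOK N G (d 13) (d 14)) hN
    (by omega) (by omega) (by omega) (by omega) (by omega)
    (by rw [f3 6 (by omega) (by omega), h6]) (by rw [f3 15 (by omega) (by omega)]; exact h15)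
  rw [← hG, f3 13 (by omega) (by omega), f3 15 (by omega) (by omega)] at e4
  generalize hd4 : loaded N G (d 13) (d 15) 44 d3 = d4 at e4
  have h4 : ∀ r, ¬ (44 ≤ r ∧ r < 54) → d4 r = d3 r := fun r h => by
    rw [← hd4, loaded_apply (by omega) (by omega)]
  have h3 : ∀ r, ¬ (36 ≤ r ∧ r < 44) → ¬ (52 ≤ r ∧ r < 54) → d3 r = d2 r := fun r h h' => by
    rw [← hd3, loaded_apply (by omega) h']
  have h2 : ∀ r, ¬ (28 ≤ r ∧ r < 36) → ¬ (52 ≤ r ∧ r < 54) → d2 r = d1 r := fun r h h' => by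
    rw [← hd2, loaded_apply (by omega) h']
  refine ⟨d4, ?_, fun r hr => ?_, fun j hj => ?_, fun j hj => ?_, fun j hj => ?_, fun j hj => ?_⟩
  · rw [loadQuad, eval_seqs_cons, eval_seqs_cons, eval_seqs_cons, eval_seqs_cons, eval_seqs_nil,
      e1, e2, e3, e4]
  · rw [h4 r (by omega), f3 r (by omega) (by omega)]
  · rw [h4 _ (by omega), h3 _ (by omega) (by omega), h2 _ (by omega) (by omega), g1 j hj]
  · rw [h4 _ (by omega), h3 _ (by omega) (by omega), g2 j hj]
  · rw [h4 _ (by omega), g3 j hj]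
  · rw [← hd4, loaded_apply_add hj]

theorem eval_checkQuad {d : ℕ → List Bool} {eqs : List (List (ℕ × ℕ))} (heqs : Wellformed eqs)
    (hd : CleanFrom 60 d)
    (hN : 2 ≤ N) (h6 : d 6 = topNumber N) (h14 : (d 14).length ≤ N) (h15 : (d 15).length ≤ N) :
    (checkQuad eqs).eval O F N d = setBad (fill d 14 46 fun _ => [])
      (QuadOK N (fun m => (F m).take (2 * N)) (d 12) (d 13) (d 14) (d 15) eqs) := by
  set G : List Bool → List Bool := fun m => (F m).take (2 * N) with hG
  obtain ⟨d4, hload, hout, v0, v1, v2, v3⟩ := eval_loadQuad (O := O) hd hN h6 h14 h15 hG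
  have hc4 : CleanFrom 60 d4 := fun r hr => by rw [hout r (by omega), hd r hr]
  simp only [checkQuad, seqs, eval]
  rw [hload, checkTerms, eval_checkSums _ ((hc4.mono (by omega)).setBad (by omega) _) ?_,
    setBad_setBad, eval_clearRange, fill_setBad (by omega)]
  · have e1 : (fill d4 14 46 fun _ => []) = fill d 14 46 fun _ => [] := by
      funext r
      simp only [fill]
      split_ifs with h
      · rfl
      · exact hout r (by omega)
    rw [e1]
    refine setBad_congr ?_
    unfold QuadOK
    rw [and_assoc, and_assoc, and_assoc]
    simp only [and_assoc]
    -- The equations are compared under the assumption that the four leaves are consistent: this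
    -- bounds all coefficients by `2 ^ N`, and congruence modulo `2 ^ (3 * N)` becomes equality.
    refine and_congr_right fun k0 => and_congr_right fun k1 => and_congr_right fun k2 =>
      and_congr_right fun k3 => ?_
    simp only [List.forall_mem_map]
    refine forall₂_congr fun e he => ?_
    obtain ⟨hel, het⟩ := heqs e he
    rw [← evalTerms_eq_zero_iff hN hel]
    · have key : ∀ f : ℕ → ℕ, (∀ n, f n < 8) → ∀ P : Prop,
          regSum (setBad d4 P) (e.map fun t => 20 + 8 * t.1 + f t.2) = (e.map fun t =>
          quad (fun j => val (leafVal G (d 12) (d 14) j))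
            (fun j => val (leafVal G (d 12) (d 15) j))
            (fun j => val (leafVal G (d 13) (d 14) j))
            (fun j => val (leafVal G (d 13) (d 15) j)) t.1 (f t.2)).sum := by
        intro f hf P
        rw [regSum, List.map_map]
        congr 1
        apply List.map_congr_left
        intro t ht
        have ht4 := het t ht
        obtain ⟨c, j⟩ := t
        simp only [Function.comp] at ht4 ⊢
        rw [setBad_apply (by omega)]
        interval_cases c
        · simp only [quad]; rw [← v0 _ (hf j)]
        · simp only [quad]; rw [← v1 _ (hf j)]
        · simp only [quad]; rw [← v2 _ (hf j)]
        · simp only [quad]; rw [← v3 _ (hf j)]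
      have a1 := key (fun n => n % 8) (fun n => Nat.mod_lt _ (by omega))
      have a2 := key (fun n => (n + 4) % 8) (fun n => Nat.mod_lt _ (by omega))
      simp only [coeffReg, a1, a2]
    · intro c j hj
      rcases c with _ | _ | _ | c
      · exact k0.2.1 j hj
      · exact k1.2.1 j hj
      · exact k2.2.1 j hj
      · exact k3.2.1 j hj
  · simp only [List.forall_mem_map]
    intro e he
    have := heqs e he
    refine ⟨fun t ht => ?_, fun t ht => ?_⟩
    all_goals
      have h4 := this.2 t ht
      simp only [coeffReg]
      omega

end TProg

end OracleComplexity


/-! ### The check of a step, for each kind of gate. -/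

namespace OracleComplexity

theorem phaseEqs_eq (s : ℕ) : phaseEqs s =
    [[(2, 0), (0, 0 + s + 4)], [(3, 0), (1, 0 + s + 4)], [(2, 1), (0, 1 + s + 4)],
      [(3, 1), (1, 1 + s + 4)], [(2, 2), (0, 2 + s + 4)], [(3, 2), (1, 2 + s + 4)],
      [(2, 3), (0, 3 + s + 4)], [(3, 3), (1, 3 + s + 4)]] := rfl

theorem conjEqs_eq (s : ℕ) : conjEqs s =
    [[(2, 0), (0, 12 + s - 0)], [(3, 0), (1, 12 + s - 0)], [(2, 1), (0, 12 + s - 1)],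
      [(3, 1), (1, 12 + s - 1)], [(2, 2), (0, 12 + s - 2)], [(3, 2), (1, 12 + s - 2)],
      [(2, 3), (0, 12 + s - 3)], [(3, 3), (1, 12 + s - 3)]] := rfl

namespace TProg

variable {O : Oracle} {F : List Bool → List Bool} {N : ℕ}

theorem wellformed_phaseEqs (s : ℕ) : Wellformed (phaseEqs s) := by
  simp [Wellformed, phaseEqs_eq]
  and_intros <;> intro a b h <;> omega

theorem wellformed_conjEqs (s : ℕ) : Wellformed (conjEqs s) := by
  simp [Wellformed, conjEqs_eq]
  and_intros <;> intro a b h <;> omega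

theorem wellformed_swapEqs : Wellformed swapEqs := by
  unfold Wellformed; decide

theorem wellformed_hadamardEqs : Wellformed hadamardEqs := by
  unfold Wellformed; decide

/-- While a gate is parsed, only register `10` and registers `14` to `59` change. All of the latter
are cleared at the end, so intermediate contents may be forgotten. -/
theorem eval_checkQuad_of {d d' : ℕ → List Bool} {eqs : List (List (ℕ × ℕ))}
    {rest u u' : List Bool} (heqs : Wellformed eqs) (hN : 2 ≤ N) (h6 : d 6 = topNumber N)
    (hd : CleanFrom 60 d) (h : ∀ r, r ≠ 10 → ¬ (14 ≤ r ∧ r < 60) → d' r = d r) (h10 : d' 10 = rest)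
    (h14 : d' 14 = u) (h15 : d' 15 = u') (hu : u.length ≤ N) (hu' : u'.length ≤ N) :
    (checkQuad eqs).eval O F N d' =
      setBad (fill (Function.update d 10 rest) 14 46 fun _ => [])
        (QuadOK N (fun m => (F m).take (2 * N)) (d 12) (d 13) u u' eqs) := by
  rw [eval_checkQuad heqs (fun r hr => by rw [h r (by omega) (by omega), hd r hr]) hN
    (by rw [h 6 (by omega) (by omega), h6]) (by rw [h14]; exact hu) (by rw [h15]; exact hu'),
    h 12 (by omega) (by omega), h 13 (by omega) (by omega), h14, h15]
  congr 1
  funext r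
  simp only [fill, Function.update_apply]
  split_ifs with h1 h2
  · rfl
  · rw [h2, h10]
  · exact h r h2 h1

/-- The registers as they are when the kind of a gate has been read. -/
def GateRead {w : ℕ} (N : ℕ) (z : Fin w → Bool) (d : ℕ → List Bool) : Prop :=
  (∀ r, 15 ≤ r → r ≠ 17 → d r = []) ∧ d 14 = List.ofFn z ∧ d 6 = topNumber N ∧ w ≤ N ∧ 3 ≤ N

def hadamardCheck : TProg :=
  seqs [readNat 18, setBit 14 18 15 true, setBit 14 18 14 false, checkQuad hadamardEqs]

theorem set_ofFn {w : ℕ} (z : Fin w → Bool) (q : Fin w) (b : Bool) :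
    (List.ofFn z).set q b = List.ofFn (Function.update z q b) := by
  apply List.ext_getElem
  · simp
  · intro i h1 h2
    simp only [List.length_set, List.length_ofFn] at h1
    rw [List.getElem_set, List.getElem_ofFn, List.getElem_ofFn]
    by_cases h : (q : ℕ) = i
    · subst h; simp
    · rw [if_neg h, Function.update_of_ne (fun h' => h (by rw [← h']))]

theorem getD_ofFn {w : ℕ} (z : Fin w → Bool) (q : Fin w) : (List.ofFn z).getD q false = z q := by
  rw [List.getD_eq_getElem _ _ (by simp), List.getElem_ofFn]

theorem eval_hadamardCheck {w : ℕ} {z : Fin w → Bool} {d : ℕ → List Bool} {rest : List Bool}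
    (hd : GateRead N z d) (q : Fin w) (h10 : d 10 = encodeNat q ++ rest) :
    hadamardCheck.eval O F N d = setBad (fill (Function.update d 10 rest) 14 46 fun _ => [])
      (StepOK O N (fun m => (F m).take (2 * N)) (some (.H q)) (d 12) (d 13) z) := by
  obtain ⟨hc, h14, h6, hw, hN⟩ := hd
  have hq := q.2
  rw [hadamardCheck, eval_seqs_cons, eval_readNat (by decide) h10 (by omega), hc 18 (by omega)
    (by omega), List.append_nil, eval_seqs_cons, eval_setBit ?_ (by omega) (by omega) ?_ ?_,
    eval_seqs_cons, eval_setBit ?_ (by omega) (by omega) ?_ ?_, eval_seqs_cons, eval_seqs_nil,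
    eval_checkQuad_of (d := d) (rest := rest) (u := List.ofFn (Function.update z q false))
      (u' := List.ofFn (Function.update z q true)) wellformed_hadamardEqs (by omega) h6
      (fun r hr => hc r (by omega) (by omega))]
  · rfl
  · intro r h1 h2
    simp only [Function.update_apply]
    split_ifs <;> first | omega | rfl
  · simp
  · simp [h14, set_ofFn]
  · simp [h14, set_ofFn]
  · simpa
  · simpa
  · intro r hr
    simp only [Function.update_apply]
    split_ifs <;> first | omega | exact hc r (by omega) (by omega)
  · simp; omega
  · simp [h14]
  · intro r hr
    simp only [Function.update_apply]
    split_ifs <;> first | omega | exact hc r (by omega) (by omega)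
  · simp; omega
  · simp [h14]

/-- Check the equations for multiplication by `ω ^ s` or `1`, depending on the bit in register
`16`. -/
def phaseCheck (s : ℕ) : TProg :=
  .seq (.copy 14 15)
    (.ite (.top 16) (checkQuad (phaseEqs s)) (checkQuad (phaseEqs 0)))

theorem eval_phaseCheck {w s : ℕ} {b : Bool} {z : Fin w → Bool} {d d' : ℕ → List Bool}
    {rest l : List Bool} (hd : GateRead N z d) (h16 : d' 16 = b :: l) (h10 : d' 10 = rest)
    (h14 : d' 14 = d 14) (h : ∀ r, r ≠ 10 → ¬ (14 ≤ r ∧ r < 60) → d' r = d r) :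
    (phaseCheck s).eval O F N d' = setBad (fill (Function.update d 10 rest) 14 46 fun _ => [])
      (QuadOK N (fun m => (F m).take (2 * N)) (d 12) (d 13) (List.ofFn z) (List.ofFn z)
        (phaseEqs (if b then s else 0))) := by
  obtain ⟨hc, h14', h6, hw, hN⟩ := hd
  have key : ∀ s, (checkQuad (phaseEqs s)).eval O F N (Function.update d' 15 (d' 14)) =
      setBad (fill (Function.update d 10 rest) 14 46 fun _ => [])
      (QuadOK N (fun m => (F m).take (2 * N)) (d 12) (d 13) (List.ofFn z) (List.ofFn z)
        (phaseEqs s)) := fun s => by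
    refine eval_checkQuad_of (wellformed_phaseEqs s) (by omega) h6
      (fun r hr => hc r (by omega) (by omega)) ?_ (by simpa) (by simp [h14, h14'])
      (by simp [h14, h14']) (by simpa) (by simpa)
    intro r h1 h2
    rw [Function.update_of_ne (by omega), h r h1 h2]
  have e : Test.on (Function.update d' 15 (d' 14)) (.top 16) = b := by
    simp [Test.on, h16]
  rw [phaseCheck, eval_seq, eval_copy]
  cases b
  · rw [eval_ite_of_false e]
    exact key 0
  · rw [eval_ite_of_true e]
    exact key s

def tCheck : TProg := seqs [readNat 18, getBit 14 18 16, phaseCheck 7]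

theorem eval_tCheck {w : ℕ} {z : Fin w → Bool} {d : ℕ → List Bool} {rest : List Bool}
    (hd : GateRead N z d) (q : Fin w) (h10 : d 10 = encodeNat q ++ rest) :
    tCheck.eval O F N d = setBad (fill (Function.update d 10 rest) 14 46 fun _ => [])
      (StepOK O N (fun m => (F m).take (2 * N)) (some (.T q)) (d 12) (d 13) z) := by
  have hd' := hd
  obtain ⟨hc, h14, h6, hw, hN⟩ := hd'
  have hq := q.2
  rw [tCheck, eval_seqs_cons, eval_readNat (by decide) h10 (by omega), hc 18 (by omega)
    (by omega), List.append_nil, eval_seqs_cons, eval_getBit ?_ (by omega) (by omega) ?_,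
    eval_seqs_cons, eval_seqs_nil,
    eval_phaseCheck (b := z q) (rest := rest) (l := []) hd]
  · rfl
  · rw [Function.update_self]
    simp [h14, getD_ofFn, -List.getD_eq_getElem?_getD, hc 16]
  · simp
  · simp
  · intro r h1 h2
    simp only [Function.update_apply]
    split_ifs <;> first | omega | rfl
  · intro r hr
    simp only [Function.update_apply]
    split_ifs <;> first | omega | exact hc r (by omega) (by omega)
  · simp; omega

def cnotCheck : TProg :=
  seqs [readNat 18, readNat 19, getBit 14 18 16, getBit 14 19 54,
    .ite (.top 16) (.ite (.top 54) (setBit 14 19 15 false) (setBit 14 19 15 true)) (.copy 14 15),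
    checkQuad swapEqs]

theorem eval_cnotCheck {w : ℕ} {z : Fin w → Bool} {d : ℕ → List Bool} {rest : List Bool}
    (hd : GateRead N z d) (c t : Fin w) (hct : c ≠ t)
    (h10 : d 10 = encodeNat c ++ (encodeNat t ++ rest)) :
    cnotCheck.eval O F N d = setBad (fill (Function.update d 10 rest) 14 46 fun _ => [])
      (StepOK O N (fun m => (F m).take (2 * N)) (some (.CNOT c t hct)) (d 12) (d 13) z) := by
  obtain ⟨hc, h14, h6, hw, hN⟩ := hd
  have hc' := c.2
  have ht' := t.2
  obtain ⟨d0, hd0⟩ : ∃ d0 : ℕ → List Bool, d0 = Function.update (Function.update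
      (Function.update d 10 rest) 18 (List.replicate c true)) 19 (List.replicate t true) := ⟨_, rfl⟩
  have c0 : ∀ r, 15 ≤ r → r ≠ 17 → r ≠ 18 → r ≠ 19 → d0 r = [] := fun r h1 h2 h3 h4 => by
    rw [hd0, Function.update_of_ne h4, Function.update_of_ne h3, Function.update_of_ne (by omega),
      hc r h1 h2]
  have u14 : d0 14 = List.ofFn z := by simp [hd0, h14]
  have u18 : d0 18 = List.replicate c true := by simp [hd0]
  have u19 : d0 19 = List.replicate t true := by simp [hd0]
  obtain ⟨d1, hd1⟩ : ∃ d1 : ℕ → List Bool, d1 = Function.update (Function.update d0 16 [z c])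
      54 [z t] := ⟨_, rfl⟩
  have c1 : CleanFrom 60 d1 := fun r hr => by
    rw [hd1, Function.update_of_ne (by omega), Function.update_of_ne (by omega),
      c0 r (by omega) (by omega) (by omega) (by omega)]
  have e1 : cnotCheck.eval O F N d = (seqs [.ite (.top 16) (.ite (.top 54) (setBit 14 19 15 false)
      (setBit 14 19 15 true)) (.copy 14 15), checkQuad swapEqs]).eval O F N d1 := by
    have a1 : (readNat 19).eval O F N ((readNat 18).eval O F N d) = d0 := by
      rw [eval_readNat (by decide) h10 (by omega),
        eval_readNat (rest := rest) (m := t) (by decide) (by simp) (by omega), hd0,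
        hc 18 (by omega) (by omega), List.append_nil, Function.update_of_ne (by decide),
        Function.update_of_ne (by decide), hc 19 (by omega) (by omega), List.append_nil]
      congr 1
      rw [Function.update_comm (by decide), Function.update_idem]
    have a2 : (getBit 14 18 16).eval O F N d0 = Function.update d0 16 [z c] := by
      rw [eval_getBit (fun r hr => c0 r (by omega) (by omega) (by omega) (by omega)) (by omega)
        (by omega) (by rw [u18, List.length_replicate]; omega), u14, u18, List.length_replicate,
        getD_ofFn, c0 16 (by omega) (by omega) (by omega) (by omega)]
    have a3 : (getBit 14 19 54).eval O F N (Function.update d0 16 [z c]) = d1 := by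
      rw [eval_getBit ?_ (by omega) (by omega) ?_, Function.update_of_ne (by decide),
        Function.update_of_ne (by decide), Function.update_of_ne (by decide), u14, u19,
        List.length_replicate, getD_ofFn, c0 54 (by omega) (by omega) (by omega) (by omega), hd1]
      · intro r hr
        rw [Function.update_of_ne (by omega),
          c0 r (by omega) (by omega) (by omega) (by omega)]
      · rw [Function.update_of_ne (by decide), u19, List.length_replicate]; omega
    rw [cnotCheck, eval_seqs_cons, eval_seqs_cons, a1, eval_seqs_cons, a2, eval_seqs_cons, a3]
  have v14 : d1 14 = List.ofFn z := by simp [hd1, u14]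
  have v19 : d1 19 = List.replicate t true := by simp [hd1, u19]
  have v16 : d1 16 = [z c] := by simp [hd1]
  have v54 : d1 54 = [z t] := by simp [hd1]
  have e2 : (TProg.ite (.top 16) (.ite (.top 54) (setBit 14 19 15 false)
      (setBit 14 19 15 true)) (.copy 14 15)).eval O F N d1 = Function.update d1 15
      (List.ofFn (Function.update z t (xor (z t) (z c)))) := by
    have hs : ∀ b, (setBit 14 19 15 b).eval O F N d1 =
        Function.update d1 15 (List.ofFn (Function.update z t b)) := fun b => by
      rw [eval_setBit (c1.mono (by omega)) (by omega) (by omega) (by simp [v19]; omega)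
        (by simp [v19, v14]), v14, v19, List.length_replicate, set_ofFn]
    have t16 : Test.on d1 (.top 16) = z c := by rw [Test.on, v16, List.headD_cons]
    have t54 : Test.on d1 (.top 54) = z t := by rw [Test.on, v54, List.headD_cons]
    cases hzc : z c <;> rw [hzc] at t16
    · rw [eval_ite_of_false t16, eval_copy, v14, Bool.xor_false, Function.update_eq_self]
    · rw [eval_ite_of_true t16]
      cases hzt : z t <;> rw [hzt] at t54
      · rw [eval_ite_of_false t54, hs]; rfl
      · rw [eval_ite_of_true t54, hs]; rfl
  rw [e1, eval_seqs_cons, e2, eval_seqs_cons, eval_seqs_nil,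
    eval_checkQuad_of (d := d) (rest := rest) (u := List.ofFn z)
      (u' := List.ofFn (Function.update z t (xor (z t) (z c)))) wellformed_swapEqs (by omega) h6
      (fun r hr => hc r (by omega) (by omega))]
  · rfl
  · intro r h1 h2
    rw [Function.update_of_ne (by omega), hd1, Function.update_of_ne (by omega),
      Function.update_of_ne (by omega), hd0, Function.update_of_ne (by omega),
      Function.update_of_ne (by omega), Function.update_of_ne h1]
  · simp [hd1, hd0]
  · simp [v14]
  · simp
  · simpa
  · simpa

def oracleArgStep : TProg :=
  .ite (.nonempty 18) (seqs [.pop 18, readNat 19, getBit 14 19 55, .clear 19]) .nop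

/-- The only place where the oracle is consulted. The gate is diagonal, so its action at a basis
state is determined by one query, made by the verifier. Bits are collected by pushing, hence the
reversal before the query. -/
def oracleCheck : TProg :=
  seqs [readNat 18, .rep oracleArgStep, .rev 55 54, .query 54 16, phaseCheck 4]

theorem iterate_oracleArgStep {w : ℕ} {z : Fin w → Bool} (k : ℕ) {ws : List (Fin w)}
    {rest : List Bool} {d : ℕ → List Bool} (hd : CleanFrom 60 d) (h14 : d 14 = List.ofFn z)
    (hw : w ≤ N) (h10 : d 10 = ws.flatMap (fun q => encodeNat q) ++ rest) (hk : ws.length ≤ k)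
    (h18 : d 18 = List.replicate ws.length true) (h19 : d 19 = []) :
    (oracleArgStep.eval O F N)^[k] d = Function.update (Function.update (Function.update d
      10 rest) 18 []) 55 ((ws.map z).reverse ++ d 55) := by
  induction ws generalizing k d with
  | nil =>
    rw [Function.iterate_fixed (by
      rw [oracleArgStep, eval_ite_of_false (by simp [Test.on, h18]), eval])]
    funext r
    simp only [Function.update_apply]
    split_ifs <;> simp_all
  | cons q ws ih =>
    obtain ⟨k, rfl⟩ : ∃ k', k = k' + 1 := ⟨k - 1, by simp at hk; omega⟩
    have hq := q.2
    have e : oracleArgStep.eval O F N d = Function.update (Function.update (Function.update d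
        10 (ws.flatMap (fun q => encodeNat q) ++ rest)) 18 (List.replicate ws.length true))
        55 (z q :: d 55) := by
      have hT : Test.on d (.nonempty 18) = true := by simp [Test.on, h18]
      have e0 : oracleArgStep.eval O F N d =
          (seqs [.pop 18, readNat 19, getBit 14 19 55, .clear 19]).eval O F N d := by
        rw [oracleArgStep, eval_ite_of_true hT]
      rw [e0, eval_seqs_cons, eval_pop, eval_seqs_cons,
        eval_readNat (m := q) (rest := ws.flatMap (fun q => encodeNat q) ++ rest) (by decide)
          (by simp [h10]) (by omega), eval_seqs_cons, eval_getBit ?_ (by omega) (by omega) ?_,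
        eval_seqs_cons, eval_clear, eval_seqs_nil]
      · funext r
        have z1 := getD_ofFn z q
        simp only [Function.update_apply]
        split_ifs <;> simp_all
      · intro r hr
        simp only [Function.update_apply]
        split_ifs <;> first | omega | exact hd r (by omega)
      · simp [h19]; omega
    rw [Function.iterate_succ_apply, e, ih k]
    · funext r
      simp only [Function.update_apply]
      split_ifs <;> simp_all
    · intro r hr
      simp only [Function.update_apply]
      split_ifs <;> first | omega | exact hd r (by omega)
    · simp [h14]
    · simp
    · simpa using hk
    · simp
    · simp [h19]

theorem eval_oracleCheck {w : ℕ} {z : Fin w → Bool} {d : ℕ → List Bool} {rest : List Bool}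
    (hd : GateRead N z d) (ws : List (Fin w)) (hws : ws.length ≤ N)
    (h10 : d 10 = encodeNat ws.length ++ (ws.flatMap (fun q => encodeNat q) ++ rest)) :
    oracleCheck.eval O F N d = setBad (fill (Function.update d 10 rest) 14 46 fun _ => [])
      (StepOK O N (fun m => (F m).take (2 * N)) (some (.oracle ws)) (d 12) (d 13) z) := by
  have hd' := hd
  obtain ⟨hc, h14, h6, hw, hN⟩ := hd'
  rw [oracleCheck, eval_seqs_cons, eval_readNat (by decide) h10 (by omega), hc 18 (by omega)
    (by omega), List.append_nil, eval_seqs_cons, eval,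
    iterate_oracleArgStep (z := z) (ws := ws) (rest := rest) N ?_ (by simp [h14]) hw (by simp) hws
    (by simp) (by simp [hc 19]), eval_seqs_cons, eval, if_neg (by decide), eval_seqs_cons, eval,
    eval_seqs_cons, eval_seqs_nil,
    eval_phaseCheck (b := O (ws.map z)) (rest := rest) (l := []) hd]
  · rfl
  · simp [hc 16, hc 55]
  · simp
  · simp
  · intro r h1 h2
    simp only [Function.update_apply]
    split_ifs <;> first | omega | rfl
  · intro r hr
    simp only [Function.update_apply]
    split_ifs <;> first | omega | exact hc r (by omega) (by omega)

/-- Read a gate and check the corresponding step at the basis state in register `14`. -/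
def gateCheck : TProg :=
  .seq (readNat 17) (.ite (.nonempty 17)
    (.seq (.pop 17) (.ite (.nonempty 17)
      (.seq (.pop 17) (.ite (.nonempty 17) oracleCheck cnotCheck)) tCheck)) hadamardCheck)

theorem eval_gateCheck {w : ℕ} (g : Gate w) {z : Fin w → Bool} {d : ℕ → List Bool}
    {rest : List Bool} (hd : CleanFrom 15 d) (hN : 3 ≤ N) (h6 : d 6 = topNumber N) (hw : w ≤ N)
    (h10 : d 10 = g.encode ++ rest) (h14 : d 14 = List.ofFn z) (hg : g.encode.length ≤ N) :
    gateCheck.eval O F N d = setBad (Function.update (Function.update d 10 rest) 14 [])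
      (StepOK O N (fun m => (F m).take (2 * N)) (some g) (d 12) (d 13) z) := by
  have read : ∀ m rest', m ≤ 3 → d 10 = encodeNat m ++ rest' → (readNat 17).eval O F N d =
      Function.update (Function.update d 10 rest') 17 (List.replicate m true) := by
    intro m rest' hm h
    rw [eval_readNat (by decide) h (by omega), hd 17 (by omega), List.append_nil]
  have hread : ∀ rest' v, GateRead N z (Function.update (Function.update d 10 rest') 17 v) := by
    intro rest' v
    refine ⟨fun r h1 h2 => ?_, by simp [h14], by simp [h6], hw, hN⟩
    rw [Function.update_of_ne h2, Function.update_of_ne (by omega), hd r h1]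
  have fin : ∀ (rest' v : List Bool) (P : Prop),
      setBad (fill (Function.update (Function.update (Function.update d 10 rest') 17 v) 10 rest)
        14 46 fun _ => []) P = setBad (Function.update (Function.update d 10 rest) 14 []) P := by
    intro rest' v P
    congr 1
    funext r
    have := hd r
    simp only [fill, Function.update_apply]
    split_ifs <;> first | omega | rfl | exact (this (by omega)).symm
  have on_cons : ∀ (d' : ℕ → List Bool) (v : List Bool),
      Test.on (Function.update d' 17 (true :: v)) (.nonempty 17) = true := fun d' v => by
    simp [Test.on]
  have on_nil : ∀ d' : ℕ → List Bool,
      Test.on (Function.update d' 17 []) (.nonempty 17) = false := fun d' => by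
    simp [Test.on]
  have pop : ∀ (d' : ℕ → List Bool) (v : List Bool),
      (TProg.pop 17).eval O F N (Function.update d' 17 (true :: v)) = Function.update d' 17 v :=
    fun d' v => by rw [eval_pop, Function.update_self, Function.update_idem, List.tail_cons]
  have h10' : ∀ rest' v,
      Function.update (Function.update d 10 rest') 17 v 10 = rest' := fun rest' v => by
    rw [Function.update_of_ne (by decide), Function.update_self]
  have h12 : ∀ rest' v,
      Function.update (Function.update d 10 rest') 17 v 12 = d 12 := fun rest' v => by
    rw [Function.update_of_ne (by decide), Function.update_of_ne (by decide)]
  have h13 : ∀ rest' v,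
      Function.update (Function.update d 10 rest') 17 v 13 = d 13 := fun rest' v => by
    rw [Function.update_of_ne (by decide), Function.update_of_ne (by decide)]
  cases g with
  | H q =>
    rw [gateCheck, eval_seq, read 0 (encodeNat q ++ rest) (by omega) (by rw [h10]; rfl),
      List.replicate_zero, eval_ite_of_false (on_nil _),
      eval_hadamardCheck (hread _ _) q (h10' _ _), fin, h12, h13]
  | T q =>
    rw [gateCheck, eval_seq, read 1 (encodeNat q ++ rest) (by omega)
      (by rw [h10, Gate.encode, List.append_assoc]), List.replicate_succ, List.replicate_zero,
      eval_ite_of_true (on_cons _ _), eval_seq, pop, eval_ite_of_false (on_nil _),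
      eval_tCheck (hread _ _) q (h10' _ _), fin, h12, h13]
  | CNOT c t h =>
    rw [gateCheck, eval_seq, read 2 (encodeNat c ++ (encodeNat t ++ rest)) (by omega)
      (by rw [h10, Gate.encode]; simp only [List.append_assoc]), List.replicate_succ,
      List.replicate_succ, List.replicate_zero,
      eval_ite_of_true (on_cons _ _), eval_seq, pop, eval_ite_of_true (on_cons _ _), eval_seq, pop,
      eval_ite_of_false (on_nil _), eval_cnotCheck (hread _ _) c t h (h10' _ _), fin, h12, h13]
  | oracle ws =>
    have hws : ws.length ≤ N := by
      simp only [Gate.encode, encodeNat, List.length_append, List.length_replicate] at hg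
      omega
    rw [gateCheck, eval_seq, read 3 (encodeNat ws.length ++ (ws.flatMap (fun q => encodeNat q) ++
      rest)) (by omega) (by rw [h10, Gate.encode]; simp only [List.append_assoc]),
      List.replicate_succ, List.replicate_succ, List.replicate_succ, List.replicate_zero,
      eval_ite_of_true (on_cons _ _), eval_seq, pop, eval_ite_of_true (on_cons _ _), eval_seq, pop,
      eval_ite_of_true (on_cons _ _), eval_oracleCheck (hread _ _) ws hws (h10' _ _), fin, h12,
      h13]

def linkCheck : TProg :=
  .seq (.copy 14 15) (.ite (.top 14) (checkQuad (conjEqs 4)) (checkQuad (conjEqs 0)))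

theorem eval_linkCheck {w : ℕ} {z : Fin w → Bool} {d : ℕ → List Bool}
    (hd : CleanFrom 15 d) (hN : 2 ≤ N) (h6 : d 6 = topNumber N) (hw : w ≤ N)
    (h14 : d 14 = List.ofFn z) :
    linkCheck.eval O F N d = setBad (Function.update d 14 [])
      (StepOK O N (fun m => (F m).take (2 * N)) none (d 12) (d 13) z) := by
  have key : ∀ s, (checkQuad (conjEqs s)).eval O F N (Function.update d 15 (d 14)) =
      setBad (fill (Function.update d 10 (d 10)) 14 46 fun _ => [])
      (QuadOK N (fun m => (F m).take (2 * N)) (d 12) (d 13) (List.ofFn z) (List.ofFn z)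
        (conjEqs s)) := fun s => by
    refine eval_checkQuad_of (wellformed_conjEqs s) (by omega) h6
      (hd.mono (by omega)) ?_ (by simp) (by simp [h14])
      (by simp [h14]) (by simpa) (by simpa)
    intro r h1 h2
    rw [Function.update_of_ne (by omega)]
  have e : Test.on (Function.update d 15 (d 14)) (.top 14) = (List.ofFn z).headD false := by
    simp only [Test.on, Function.update_of_ne (show (14 : ℕ) ≠ 15 by decide), h14]
  have fin : (fill (Function.update d 10 (d 10)) 14 46 fun _ => []) = Function.update d 14 [] := by
    rw [Function.update_eq_self]
    funext r
    have := hd r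
    simp only [fill, Function.update_apply]
    split_ifs <;> first | omega | rfl | exact (this (by omega)).symm
  rw [fin] at key
  rw [linkCheck, eval_seq, eval_copy]
  unfold StepOK
  simp only [Step.pair, Step.eqs]
  cases hz : (List.ofFn z).headD false <;> rw [hz] at e
  · rw [eval_ite_of_false e]
    exact key 0
  · rw [eval_ite_of_true e]
    exact key 4

end TProg

end OracleComplexity


/-! ### The complete test and its logical meaning. -/

namespace OracleComplexity

/-! ### The complete test -/

/-- The layer at time `t`, in the first (`b = 0`) or second (`b = 1`) half of the computation. -/
def layerCode (b : Bool) (t : ℕ) : List Bool := b :: false :: List.replicate t true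

/-- The check of the step from layer `l` to layer `l'` at the basis state that corresponds to the
point `r` of the layer `src`. -/
def SampleOK (O : Oracle) (N : ℕ) (G : List Bool → List Bool) {w : ℕ} (s : Step w)
    (l l' src r : List Bool) : Prop :=
  (LeafOK N G src (List.ofFn (sampleState G w src r)) ∧
    InIvl N G src (List.ofFn (sampleState G w src r)) r) ∧
  StepOK O N G s l l' (sampleState G w src r)

/-- Both layers have to be sampled. Basis states with violated equations must have little weight
before the step and after it, and claims that ignore the equations could put weight on them in
either layer. -/
def StepChecked (O : Oracle) (N : ℕ) (G : List Bool → List Bool) {w : ℕ} (s : Step w)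
    (l l' r : List Bool) : Prop :=
  SampleOK O N G s l l' l r ∧ SampleOK O N G s l l' l' r

/-- The steps of both halves of the computation that apply the gates `gs`, from time `t` on. -/
def GatesOK (O : Oracle) (N : ℕ) (G : List Bool → List Bool) {w : ℕ} (r : List Bool) :
    List (Gate w) → ℕ → Prop
  | [], _ => True
  | g :: gs, t =>
    (StepChecked O N G (some g) (layerCode false t) (layerCode false (t + 1)) r ∧
      StepChecked O N G (some g) (layerCode true (t + 1)) (layerCode true t) r) ∧
    GatesOK O N G r gs (t + 1)

/-- The first layer is concentrated on `z`. -/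
def InitOK (N : ℕ) (G : List Bool → List Bool) (z : List Bool) : Prop :=
  ((LeafOK N G (layerCode false 0) z ∧ val (leafIvl N G (layerCode false 0) z).1 = 0) ∧
    val (leafIvl N G (layerCode false 0) z).2 = 2 ^ N) ∧
  ∀ j < 7, val (leafVal G (layerCode false 0) z (1 + j)) = 0

/-- The amplitude of `z` in the last layer is positive. -/
def FinalOK (N : ℕ) (G : List Bool → List Bool) (z : List Bool) : Prop :=
  LeafOK N G (layerCode true 0) z ∧
  2 * val (leafVal G (layerCode true 0) z 4) + val (leafVal G (layerCode true 0) z 5) +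
      val (leafVal G (layerCode true 0) z 3) <
    2 * val (leafVal G (layerCode true 0) z 0) + val (leafVal G (layerCode true 0) z 1) +
      val (leafVal G (layerCode true 0) z 7)

def TestOK (O : Oracle) (N : ℕ) (G : List Bool → List Bool) {n : ℕ} (C : QCircuit n)
    (x r : List Bool) : Prop :=
  ((InitOK N G (padTake C.width x) ∧ GatesOK O N G r C.gates 0) ∧
    StepChecked O N G (none : Step C.width) (layerCode false C.gates.length)
      (layerCode true C.gates.length) r) ∧
  FinalOK N G (padTake C.width x)

namespace TProg

variable {O : Oracle} {F : List Bool → List Bool} {N : ℕ}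

/-- Check a step at two sampled basis states, one of the old and one of the new layer. -/
def twice (c : TProg) : TProg :=
  seqs [.copy 11 10, sample 12, c, .copy 11 10, sample 13, c]

/-- The registers during the test. -/
structure Testing (N w : ℕ) (z r : List Bool) (d : ℕ → List Bool) : Prop where
  reg_three : d 3 = r
  reg_six : d 6 = topNumber N
  reg_seven : d 7 = List.replicate w true
  reg_eight : d 8 = z
  three_le : 3 ≤ N
  width_le : w ≤ N
  length_le : r.length ≤ N
  length_eq : z.length = w

theorem Testing.congr {w : ℕ} {z r : List Bool} {d d' : ℕ → List Bool} (h : Testing N w z r d)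
    (h3 : d' 3 = d 3) (h6 : d' 6 = d 6) (h7 : d' 7 = d 7) (h8 : d' 8 = d 8) :
    Testing N w z r d' :=
  ⟨h3.trans h.1, h6.trans h.2, h7.trans h.3, h8.trans h.4, h.5, h.6, h.7, h.8⟩

/-- The check `c` consumes the gate description in register `10`; the copy in register `11` serves
for the second run. -/
theorem eval_twice {w : ℕ} {s : Step w} {c : TProg} {code rest z0 : List Bool} {r : List Bool}
    {d : ℕ → List Bool}
    (hc : ∀ (d : ℕ → List Bool) (z : Fin w → Bool), CleanFrom 15 d → Testing N w z0 r d →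
      d 10 = code → d 14 = List.ofFn z →
      c.eval O F N d = setBad (Function.update (Function.update d 10 rest) 14 [])
        (StepOK O N (fun m => (F m).take (2 * N)) s (d 12) (d 13) z))
    (hd : CleanFrom 14 d) (ht : Testing N w z0 r d) (h11 : d 11 = code) :
    (twice c).eval O F N d = setBad (Function.update d 10 rest)
      (StepChecked O N (fun m => (F m).take (2 * N)) s (d 12) (d 13) r) := by
  set G : List Bool → List Bool := fun m => (F m).take (2 * N) with hG
  have hN := ht.three_le
  have one : ∀ (l : ℕ) (v : List Bool) (P : Prop), l < 14 → l ≠ 10 → l ≠ 0 →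
      c.eval O F N ((sample l).eval O F N ((TProg.copy 11 10).eval O F N
        (setBad (Function.update d 10 v) P))) =
        setBad (Function.update d 10 rest) (P ∧ SampleOK O N G s (d 12) (d 13) (d l) r) := by
    intro l v P hl hl10 hl0
    have e0 : (TProg.copy 11 10).eval O F N (setBad (Function.update d 10 v) P) =
        setBad (Function.update d 10 code) P := by
      rw [eval_copy, setBad_apply (by decide), Function.update_of_ne (by decide), h11,
        update_setBad _ _ (by decide), Function.update_idem]
    have hd1 : CleanFrom 14 (setBad (Function.update d 10 code) P) :=
      (hd.update (by omega) _).setBad (by omega) P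
    have g : ∀ i, i ≠ 0 → i ≠ 10 → setBad (Function.update d 10 code) P i = d i := by
      intro i h h'
      rw [setBad_apply h, Function.update_of_ne h']
    rw [e0, eval_sample (w := w) hd1 (by omega) hl ((g 6 (by decide) (by decide)).trans ht.reg_six)
      ((g 7 (by decide) (by decide)).trans ht.reg_seven) ht.width_le
      (by rw [g 3 (by decide) (by decide), ht.reg_three]; exact ht.length_le), ← hG,
      g l hl0 hl10, g 3 (by decide) (by decide), ht.reg_three]
    set z := sampleState G w (d l) r
    have g' : ∀ (i : ℕ) (Q : Prop), i ≠ 0 → i ≠ 10 → i ≠ 14 →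
        setBad (Function.update (setBad (Function.update d 10 code) P) 14 (List.ofFn z)) Q i =
          d i := by
      intro i Q h h' h''
      rw [setBad_apply h, Function.update_of_ne h'', g i h h']
    rw [hc _ z]
    · rw [g' 12 _ (by decide) (by decide) (by decide), g' 13 _ (by decide) (by decide) (by decide),
        update_setBad _ _ (by decide), update_setBad _ _ (by decide), setBad_setBad,
        update_setBad _ _ (by decide), update_setBad _ _ (by decide), update_setBad _ _ (by decide),
        setBad_setBad]
      have e1 : Function.update (Function.update (Function.update (Function.update d 10 code) 14
          (List.ofFn z)) 10 rest) 14 [] = Function.update d 10 rest := by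
        have := hd 14 le_rfl
        funext i
        simp only [Function.update_apply]
        split_ifs <;> simp_all
      rw [e1]
      rfl
    · exact (((hd.mono (by omega)).update (by omega) _).setBad (by omega) P).update
        (by omega) _ |>.setBad (by omega) _
    · exact ht.congr (g' _ _ (by decide) (by decide) (by decide))
        (g' _ _ (by decide) (by decide) (by decide)) (g' _ _ (by decide) (by decide) (by decide))
        (g' _ _ (by decide) (by decide) (by decide))
    · rw [setBad_apply (by decide), Function.update_of_ne (by decide), setBad_apply (by decide),
        Function.update_self]
    · rw [setBad_apply (by decide), Function.update_self]
  have h1 := one 12 (d 10) True (by decide) (by decide) (by decide)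
  rw [setBad_of trivial, Function.update_eq_self, true_and] at h1
  rw [twice, eval_seqs_cons, eval_seqs_cons, eval_seqs_cons, h1, eval_seqs_cons, eval_seqs_cons,
    eval_seqs_cons, eval_seqs_nil, one 13 rest _ (by decide) (by decide) (by decide)]
  rfl

/-- Build the code of a layer; the time is in register `9`. -/
def setLayer (r : ℕ) (next b : Bool) : TProg :=
  seqs [.copy 9 r, if next then .push r true else .nop, .push r false, .push r b]

theorem eval_setLayer {r t : ℕ} {next b : Bool} {d : ℕ → List Bool}
    (h9 : d 9 = List.replicate t true) :
    (setLayer r next b).eval O F N d = Function.update d r (layerCode b (t + next.toNat)) := by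
  rw [setLayer, eval_seqs_cons, eval_seqs_cons, eval_seqs_cons, eval_seqs_cons, eval_seqs_nil,
    eval_copy, h9]
  cases next
  · simp [eval, layerCode]
  · simp [eval, layerCode, List.replicate_succ]

/-- Both halves are checked in one pass over the description. In the second half the same gate leads
from time `t + 1` back to time `t`. -/
def gateStep : TProg :=
  .ite (.nonempty 10) (seqs [.copy 10 11, setLayer 12 false false, setLayer 13 true false,
    twice gateCheck, setLayer 12 true true, setLayer 13 false true, twice gateCheck,
    .push 9 true, clearRange 11 3]) .nop

theorem eval_gateStep {w t : ℕ} {g : Gate w} {z0 r rest : List Bool} {d : ℕ → List Bool}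
    (hd : CleanFrom 11 d) (ht : Testing N w z0 r d) (h9 : d 9 = List.replicate t true)
    (h10 : d 10 = g.encode ++ rest) (hg : g.encode.length ≤ N) :
    gateStep.eval O F N d = setBad (Function.update (Function.update d 10 rest)
      9 (List.replicate (t + 1) true))
      (StepChecked O N (fun m => (F m).take (2 * N)) (some g) (layerCode false t)
          (layerCode false (t + 1)) r ∧
        StepChecked O N (fun m => (F m).take (2 * N)) (some g) (layerCode true (t + 1))
          (layerCode true t) r) := by
  have hne : d 10 ≠ [] := by
    rw [h10]
    cases g <;> simp [Gate.encode, encodeNat]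
  have core : ∀ (d : ℕ → List Bool) (z : Fin w → Bool), CleanFrom 15 d → Testing N w z0 r d →
      d 10 = g.encode ++ rest → d 14 = List.ofFn z →
      gateCheck.eval O F N d = setBad (Function.update (Function.update d 10 rest) 14 [])
        (StepOK O N (fun m => (F m).take (2 * N)) (some g) (d 12) (d 13) z) :=
    fun d z hd ht h10 h14 =>
      eval_gateCheck g hd ht.three_le ht.reg_six ht.width_le h10 h14 hg
  have hT : Test.on d (.nonempty 10) = true := by
    cases h : d 10 with
    | nil => exact absurd h hne
    | cons a l => simp [Test.on, h]
  rw [gateStep, eval_ite_of_true hT, eval_seqs_cons, eval_copy, eval_seqs_cons,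
    eval_setLayer (t := t) (by simpa), eval_seqs_cons, eval_setLayer (t := t) (by simpa),
    eval_seqs_cons, eval_twice core ?_ ?_ (by simp [h10]), eval_seqs_cons,
    eval_setLayer (t := t) (by simpa [setBad_apply]), eval_seqs_cons,
    eval_setLayer (t := t) (by simpa [setBad_apply]),
    eval_seqs_cons, eval_twice core ?_ ?_ (by simp [h10, setBad_apply]), eval_seqs_cons, eval_push,
    eval_seqs_cons, eval_clearRange, eval_seqs_nil]
  · have e : ∀ (a b c d' e : List Bool), fill (Function.update (Function.update (Function.update
        (Function.update (Function.update (Function.update (Function.update (Function.update d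
        11 a) 12 b) 13 c) 10 rest) 12 d') 13 e) 10 rest) 9 (List.replicate (t + 1) true)) 11 3
        (fun _ => []) = Function.update (Function.update d 10 rest)
          9 (List.replicate (t + 1) true) := by
      intro a b c d' e
      funext i
      have := hd i
      simp only [fill, Function.update_apply]
      split_ifs <;> first | omega | rfl | exact (this (by omega)).symm
    simp only [setBad_apply (show 9 ≠ 0 by decide), setBad_apply (show 12 ≠ 0 by decide),
      update_setBad _ _ (show 9 ≠ 0 by decide),
      update_setBad _ _ (show 10 ≠ 0 by decide), update_setBad _ _ (show 12 ≠ 0 by decide),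
      update_setBad _ _ (show 13 ≠ 0 by decide), setBad_setBad,
      fill_setBad (show 0 < 11 by decide), Function.update_self, Function.update_of_ne
      (show (9 : ℕ) ≠ 10 by decide), Function.update_of_ne (show (9 : ℕ) ≠ 11 by decide),
      Function.update_of_ne (show (9 : ℕ) ≠ 12 by decide),
      Function.update_of_ne (show (9 : ℕ) ≠ 13 by decide),
      Function.update_of_ne (show (12 : ℕ) ≠ 13 by decide), h9, ← List.replicate_succ, e]
    rfl
  · refine CleanFrom.update (CleanFrom.update (CleanFrom.setBad ?_ (by omega) _) (by omega) _)
      (by omega) _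
    exact ((((hd.mono (by omega)).update (by omega) _).update (by omega) _).update
      (by omega) _).update (by omega) _
  · exact ht.congr (by simp [setBad_apply]) (by simp [setBad_apply]) (by simp [setBad_apply])
      (by simp [setBad_apply])
  · exact (((hd.mono (by omega)).update (by omega) _).update (by omega) _).update (by omega) _
  · exact ht.congr (by simp) (by simp) (by simp) (by simp)

theorem iterate_gateStep {w : ℕ} {z0 r : List Bool} (gs : List (Gate w)) (k t : ℕ)
    {d : ℕ → List Bool} (hk : gs.length ≤ k)
    (hd : CleanFrom 11 d) (ht : Testing N w z0 r d) (h9 : d 9 = List.replicate t true)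
    (h10 : d 10 = gs.flatMap Gate.encode) (hg : ∀ g ∈ gs, g.encode.length ≤ N) :
    (gateStep.eval O F N)^[k] d = setBad (Function.update (Function.update d 10 [])
      9 (List.replicate (t + gs.length) true))
      (GatesOK O N (fun m => (F m).take (2 * N)) r gs t) := by
  induction gs generalizing k t d with
  | nil =>
    rw [Function.iterate_fixed, setBad_of (by trivial)]
    · funext i
      simp only [Function.update_apply]
      split_ifs <;> simp_all
    · rw [gateStep, eval_ite_of_false (by simp [Test.on, h10]), eval]
  | cons g gs ih =>
    obtain ⟨k, rfl⟩ : ∃ k', k = k' + 1 := ⟨k - 1, by simp at hk; omega⟩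
    rw [Function.iterate_succ_apply, eval_gateStep hd ht h9 (by rw [h10, List.flatMap_cons])
      (hg g List.mem_cons_self), ih k (t + 1) (by simpa using hk)]
    · rw [update_setBad _ _ (by decide), update_setBad _ _ (by decide), setBad_setBad]
      congr 1
      funext i
      simp only [Function.update_apply, List.length_cons,
        show t + 1 + gs.length = t + (gs.length + 1) by omega]
      split_ifs <;> rfl
    · exact ((hd.update (by omega) _).update (by omega) _).setBad (by omega) _
    · exact ht.congr (by simp [setBad_apply]) (by simp [setBad_apply]) (by simp [setBad_apply])
        (by simp [setBad_apply])
    · simp [setBad_apply]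
    · simp [setBad_apply]
    · exact fun g' hg' => hg g' (List.mem_cons_of_mem _ hg')

/-- Register `59` is never written and serves as the number zero. The coefficient of `ω ^ 0` needs
no check: its square has to be the length of the full interval. -/
def initCheck : TProg :=
  seqs [setLayer 12 false false, load 12 8 20, checkEq 52 59, checkEq 53 6,
    checkSums ((List.range 7).map fun j => ([21 + j], [])), clearRange 12 48]

theorem eval_initCheck {w : ℕ} {z0 r : List Bool} {d : ℕ → List Bool}
    (hd : CleanFrom 11 d) (ht : Testing N w z0 r d) (h9 : d 9 = []) :
    initCheck.eval O F N d = setBad d (InitOK N (fun m => (F m).take (2 * N)) z0) := by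
  set G : List Bool → List Bool := fun m => (F m).take (2 * N) with hG
  have hN := ht.three_le
  set d1 := Function.update d 12 (layerCode false 0) with hd1
  have g1 : ∀ i, i ≠ 12 → d1 i = d i := fun i hi => by rw [hd1, Function.update_of_ne hi]
  have c1 : CleanFrom 13 d1 := (hd.mono (by omega)).update (by omega) _
  have e1 : (setLayer 12 false false).eval O F N d = d1 :=
    eval_setLayer (t := 0) (next := false) (b := false) (by simpa using h9)
  have e2 : (load 12 8 20).eval O F N d1 = setBad (loaded N G (layerCode false 0) z0 20 d1)
      (LeafOK N G (layerCode false 0) z0) := by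
    have := eval_load_setBad (O := O) (F := F) (N := N) (l := 12) (z := 8) (base := 20)
      (c1.mono (by omega)) True (by omega) (by omega) (by omega) (by omega) (by omega) (by omega)
      (by rw [g1 6 (by decide), ht.reg_six])
      (by rw [g1 8 (by decide), ht.reg_eight, ht.length_eq]; exact ht.width_le)
    rwa [setBad_of (d := d1) trivial, true_and, ← hG, g1 8 (by decide), ht.reg_eight, hd1,
      Function.update_self, ← hd1] at this
  set d2 := loaded N G (layerCode false 0) z0 20 d1 with hd2
  have g2 : ∀ r, ¬ (20 ≤ r ∧ r < 28) → ¬ (52 ≤ r ∧ r < 54) → d2 r = d1 r := fun r h h' => by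
    rw [hd2, loaded_apply h h']
  have v2 : ∀ j < 8, d2 (20 + j) = leafVal G (layerCode false 0) z0 j := fun j h => by
    rw [hd2, loaded_apply_add h]
  have v52 : d2 52 = (leafIvl N G (layerCode false 0) z0).1 := by
    rw [hd2, loaded, fill_apply_of_le (by omega)]; simp
  have v53 : d2 53 = (leafIvl N G (layerCode false 0) z0).2 := by
    rw [hd2, loaded, fill_apply_of_le (by omega)]; simp
  have c2 : CleanFrom 60 d2 := fun r hr => by rw [g2 r (by omega) (by omega), c1 r (by omega)]
  have v6 : d2 6 = topNumber N := by
    rw [g2 6 (by omega) (by omega), g1 6 (by decide), ht.reg_six]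
  have v59 : d2 59 = [] := by rw [g2 59 (by omega) (by omega), c1 59 (by omega)]
  have hGl : ∀ m, (G m).length ≤ 3 * N := fun m => by simp [hG]; omega
  have htop : (topNumber N).length ≤ 3 * N := by rw [length_topNumber]; omega
  have hlen := length_descend_le hGl z0 (false :: layerCode false 0) [] (topNumber N) (by simp) htop
  have hivl : descend G z0 (false :: layerCode false 0) [] (topNumber N) =
    leafIvl N G (layerCode false 0) z0 := rfl
  rw [hivl] at hlen
  rw [initCheck, eval_seqs_cons, e1, eval_seqs_cons, e2, eval_seqs_cons,
    eval_checkEq ((c2.mono (by omega)).setBad (by omega) _) (by omega)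
      (by rw [setBad_apply (by decide), v52]; exact hlen.1)
      (by rw [setBad_apply (by decide), v59]; simp), setBad_setBad, eval_seqs_cons,
    eval_checkEq ((c2.mono (by omega)).setBad (by omega) _) (by omega)
      (by rw [setBad_apply (by decide), v53]; exact hlen.2)
      (by rw [setBad_apply (by decide), v6]; exact htop), setBad_setBad, eval_seqs_cons,
    eval_checkSums _ ((c2.mono (by omega)).setBad (by omega) _) ?_, setBad_setBad,
    eval_seqs_cons, eval_clearRange, fill_setBad (by omega), eval_seqs_nil]
  · have e3 : (fill d2 12 48 fun _ => []) = d := by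
      funext i
      have := hd i
      simp only [fill]
      split_ifs with h
      · rw [hd i (by omega)]
      · rw [g2 i (by omega) (by omega), g1 i (by omega)]
    rw [e3]
    simp only [setBad_apply (show 52 ≠ 0 by decide), setBad_apply (show 59 ≠ 0 by decide),
      setBad_apply (show 53 ≠ 0 by decide), setBad_apply (show 6 ≠ 0 by decide), v52, v53, v59, v6,
      val_topNumber]
    refine setBad_congr (and_congr_right fun h => ?_)
    simp only [List.forall_mem_map, List.mem_range]
    refine forall₂_congr fun j hj => ?_
    have hle : val (leafVal G (layerCode false 0) z0 (1 + j)) < 2 ^ (3 * N) :=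
      (h.1.1.2.1 (1 + j) (by omega)).trans_lt (Nat.pow_lt_pow_right (by omega) (by omega))
    simp only [regSum, List.map_cons, List.map_nil, List.sum_cons, List.sum_nil, Nat.zero_mod,
      add_zero]
    rw [setBad_apply (by omega), show 21 + j = 20 + (1 + j) by omega, v2 _ (by omega),
      Nat.mod_eq_of_lt hle]
  · simp only [List.forall_mem_map, List.mem_range]
    intro j hj
    refine ⟨fun i hi => ?_, fun i hi => ?_⟩
    · simp only [List.mem_singleton] at hi
      omega
    · simp at hi

/-- Twice the scaled real part is `2 * a 0 + √2 * (a 1 - a 3)` for the signed coefficients `a`. Here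
`√2` is replaced by `1`, which keeps the test integral; the gap in `2 p - 1` absorbs the error. -/
def finalCheck : TProg :=
  seqs [setLayer 12 false true, load 12 8 20, checkSumLt [24, 24, 25, 23] [20, 20, 21, 27]]

theorem eval_finalCheck {w : ℕ} {z0 r : List Bool} {d : ℕ → List Bool} {P : Prop} (h0 : d 0 = [])
    (hd : CleanFrom 10 d) (ht : Testing N w z0 r d) (h9 : d 9 = []) :
    finalCheck.eval O F N (setBad d P) 0 = [] ↔
      P ∧ FinalOK N (fun m => (F m).take (2 * N)) z0 := by
  set G : List Bool → List Bool := fun m => (F m).take (2 * N) with hG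
  have hN := ht.three_le
  set d1 := Function.update d 12 (layerCode true 0) with hd1
  have g1 : ∀ i, i ≠ 12 → d1 i = d i := fun i hi => by rw [hd1, Function.update_of_ne hi]
  have c1 : CleanFrom 13 d1 := (hd.mono (by omega)).update (by omega) _
  have e1 : (setLayer 12 false true).eval O F N (setBad d P) = setBad d1 P := by
    rw [eval_setLayer (t := 0) (next := false) (b := true)
      (by rw [setBad_apply (by decide), h9]; rfl), update_setBad _ _ (by decide)]
    rfl
  have e2 : (load 12 8 20).eval O F N (setBad d1 P) =
      setBad (loaded N G (layerCode true 0) z0 20 d1) (P ∧ LeafOK N G (layerCode true 0) z0) := by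
    have := eval_load_setBad (O := O) (F := F) (N := N) (l := 12) (z := 8) (base := 20)
      (c1.mono (by omega)) P (by omega) (by omega) (by omega) (by omega) (by omega) (by omega)
      (by rw [g1 6 (by decide), ht.reg_six])
      (by rw [g1 8 (by decide), ht.reg_eight, ht.length_eq]; exact ht.width_le)
    rwa [← hG, g1 8 (by decide), ht.reg_eight, hd1,
      Function.update_self, ← hd1] at this
  set d2 := loaded N G (layerCode true 0) z0 20 d1 with hd2
  have g2 : ∀ r, ¬ (20 ≤ r ∧ r < 28) → ¬ (52 ≤ r ∧ r < 54) → d2 r = d1 r := fun r h h' => by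
    rw [hd2, loaded_apply h h']
  have v2 : ∀ j < 8, d2 (20 + j) = leafVal G (layerCode true 0) z0 j := fun j h => by
    rw [hd2, loaded_apply_add h]
  have c2 : CleanFrom 60 d2 := fun r hr => by rw [g2 r (by omega) (by omega), c1 r (by omega)]
  have z2 : d2 0 = [] := by rw [g2 0 (by omega) (by omega), g1 0 (by decide), h0]
  rw [finalCheck, eval_seqs_cons, e1, eval_seqs_cons, e2, eval_seqs_cons,
    eval_checkSumLt ((c2.mono (by omega)).setBad (by omega) _) (by decide) (by decide),
    setBad_setBad, eval_seqs_nil, setBad_zero_eq_nil z2, and_assoc]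
  refine and_congr_right fun _ => and_congr_right fun h => ?_
  have hle : ∀ j < 8, val (leafVal G (layerCode true 0) z0 j) ≤ 2 ^ N := h.2.1
  have hpow : 4 * 2 ^ N < 2 ^ (3 * N) := by
    calc 4 * 2 ^ N = 2 ^ (2 + N) := by rw [pow_add]; norm_num
      _ < 2 ^ (3 * N) := Nat.pow_lt_pow_right (by omega) (by omega)
  have r1 : regSum (setBad d2 (P ∧ LeafOK N G (layerCode true 0) z0)) [24, 24, 25, 23] =
      2 * val (leafVal G (layerCode true 0) z0 4) + val (leafVal G (layerCode true 0) z0 5) +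
      val (leafVal G (layerCode true 0) z0 3) := by
    rw [regSum_setBad (by decide)]
    simp only [regSum, List.map_cons, List.map_nil, List.sum_cons, List.sum_nil,
      ← v2 4 (by omega), ← v2 5 (by omega), ← v2 3 (by omega)]
    ring
  have r2 : regSum (setBad d2 (P ∧ LeafOK N G (layerCode true 0) z0)) [20, 20, 21, 27] =
      2 * val (leafVal G (layerCode true 0) z0 0) + val (leafVal G (layerCode true 0) z0 1) +
      val (leafVal G (layerCode true 0) z0 7) := by
    rw [regSum_setBad (by decide)]
    simp only [regSum, List.map_cons, List.map_nil, List.sum_cons, List.sum_nil,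
      ← v2 0 (by omega), ← v2 1 (by omega), ← v2 7 (by omega)]
    ring
  rw [r1, r2, Nat.mod_eq_of_lt, Nat.mod_eq_of_lt]
  · have := hle 0 (by omega); have := hle 1 (by omega); have := hle 7 (by omega)
    omega
  · have := hle 4 (by omega); have := hle 5 (by omega); have := hle 3 (by omega)
    omega

/-- The complete test.  Initially, registers `1`, `2`, `3` hold the input, the description of the
circuit, and the random string; finally, register `0` is empty unless the test fails. -/
def test : TProg :=
  seqs [.push 6 true, .rep (.push 6 false), .copy 2 10, readNat 7, fit 1 8, initCheck,
    .rep gateStep, setLayer 12 false false, setLayer 13 false true, twice linkCheck,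
    clearRange 9 5, finalCheck]

theorem iterate_push (r k : ℕ) (b : Bool) (d : ℕ → List Bool) :
    ((TProg.push r b).eval O F N)^[k] d = Function.update d r (List.replicate k b ++ d r) := by
  induction k generalizing d with
  | zero => simp
  | succ k ih =>
    rw [Function.iterate_succ_apply, ih, eval_push, Function.update_self, Function.update_idem,
      List.replicate_succ', List.append_assoc]
    rfl

/-- From here on the program is represented by `TestOK` alone. That `N` is at least the length of
the description suffices for all loops, as it bounds the width, the number of gates and the length
of each gate. -/
theorem eval_test {n : ℕ} (C : QCircuit n) {x r : List Bool} {d : ℕ → List Bool} (h0 : d 0 = [])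
    (h1 : d 1 = x) (h2 : d 2 = C.encode) (h3 : d 3 = r) (hd : CleanFrom 4 d) (hN : 3 ≤ N)
    (hC : C.encode.length ≤ N) (hr : r.length ≤ N) :
    test.eval O F N d 0 = [] ↔ TestOK O N (fun m => (F m).take (2 * N)) C x r := by
  set G : List Bool → List Bool := fun m => (F m).take (2 * N) with hG
  have hlen : C.encode.length = C.width + 1 + (C.gates.flatMap Gate.encode).length := by
    simp [QCircuit.encode, encodeNat]
    omega
  have hmem : ∀ g ∈ C.gates, g.encode.length ≤ (C.gates.flatMap Gate.encode).length := by
    intro g hg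
    rw [List.length_flatMap]
    exact List.le_sum_of_mem (List.mem_map.2 ⟨g, hg, rfl⟩)
  have hlength : C.gates.length ≤ (C.gates.flatMap Gate.encode).length := by
    rw [List.length_flatMap]
    have : ∀ l : List (Gate C.width), l.length ≤ (l.map fun g => g.encode.length).sum := by
      intro l
      induction l with
      | nil => simp
      | cons g l ih =>
        have : 1 ≤ g.encode.length := by cases g <;> simp [Gate.encode, encodeNat]
        simp only [List.length_cons, List.map_cons, List.sum_cons]
        omega
    exact this _
  obtain ⟨d1, hd1⟩ : ∃ d1 : ℕ → List Bool, d1 = Function.update (Function.update (Function.update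
    (Function.update d 6 (topNumber N)) 10 (C.gates.flatMap Gate.encode))
    7 (List.replicate C.width true)) 8 (padTake C.width x) := ⟨_, rfl⟩
  have e1 : test.eval O F N d = (seqs [initCheck,
      .rep gateStep, setLayer 12 false false, setLayer 13 false true, twice linkCheck,
      clearRange 9 5, finalCheck]).eval O F N d1 := by
    have a1 : (TProg.rep (.push 6 false)).eval O F N ((TProg.push 6 true).eval O F N d) =
        Function.update d 6 (topNumber N) := by
      rw [eval_push, hd 6 (by omega), eval_rep, iterate_push, Function.update_self,
        Function.update_idem]
      rfl
    have a2 : (readNat 7).eval O F N ((TProg.copy 2 10).eval O F N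
        (Function.update d 6 (topNumber N))) = Function.update (Function.update (Function.update d
        6 (topNumber N)) 10 (C.gates.flatMap Gate.encode)) 7 (List.replicate C.width true) := by
      rw [eval_copy, eval_readNat (m := C.width) (rest := C.gates.flatMap Gate.encode) (by decide)
        (by simp [h2, QCircuit.encode]) (by omega), Function.update_idem,
        Function.update_of_ne (by decide), Function.update_of_ne (by decide), hd 7 (by omega),
        List.append_nil]
    rw [test, eval_seqs_cons, eval_seqs_cons, a1, eval_seqs_cons, eval_seqs_cons, a2,
      eval_seqs_cons, eval_fit (Or.inl ?_) (by decide) ?_, Function.update_self,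
      List.length_replicate, Function.update_of_ne (by decide), Function.update_of_ne (by decide),
      Function.update_of_ne (by decide), h1, hd1]
    · exact (((hd.mono (by omega)).update (by omega) _).update (by omega) _).update (by omega) _
    · rw [Function.update_self, List.length_replicate]; omega
  have c1 : CleanFrom 11 d1 := by
    rw [hd1]
    exact ((((hd.mono (by omega)).update (by omega) _).update (by omega) _).update
      (by omega) _).update (by omega) _
  have t1 : Testing N C.width (padTake C.width x) r d1 :=
    ⟨by simp [hd1, h3], by simp [hd1], by simp [hd1], by simp [hd1], hN, by omega, hr,
      length_padTake _ _⟩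
  have z1 : d1 0 = [] := by simp [hd1, h0]
  have n1 : d1 9 = [] := by simp [hd1, hd 9]
  have m1 : d1 10 = C.gates.flatMap Gate.encode := by simp [hd1]
  obtain ⟨d2, hd2⟩ : ∃ d2 : ℕ → List Bool, d2 = Function.update (Function.update d1 10 [])
    9 (List.replicate C.gates.length true) := ⟨_, rfl⟩
  have e2 : (TProg.rep gateStep).eval O F N (initCheck.eval O F N d1) = setBad d2
      (InitOK N G (padTake C.width x) ∧ GatesOK O N G r C.gates 0) := by
    rw [eval_initCheck c1 t1 n1, eval_rep, iterate_gateStep C.gates N 0 (by omega)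
      (c1.setBad (by omega) _)
      (t1.congr (setBad_apply (by decide)) (setBad_apply (by decide)) (setBad_apply (by decide))
        (setBad_apply (by decide))) (by rw [setBad_apply (by decide), n1]; rfl)
      (by rw [setBad_apply (by decide), m1]) (fun g hg => by have := hmem g hg; omega),
      update_setBad _ _ (by decide), update_setBad _ _ (by decide), setBad_setBad, Nat.zero_add,
      hd2]
  have g2 : ∀ i, i ≠ 9 → i ≠ 10 → d2 i = d1 i := fun i h h' => by
    rw [hd2, Function.update_of_ne h, Function.update_of_ne h']
  have c2 : CleanFrom 10 d2 := fun i hi => by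
    by_cases h : i = 10
    · subst h; rw [hd2]; simp
    · rw [g2 i (by omega) h, c1 i (by omega)]
  have n2 : d2 9 = List.replicate C.gates.length true := by rw [hd2, Function.update_self]
  set P := InitOK N G (padTake C.width x) ∧ GatesOK O N G r C.gates 0 with hP
  obtain ⟨d3, hd3⟩ : ∃ d3 : ℕ → List Bool, d3 = Function.update (Function.update d2 12
    (layerCode false C.gates.length)) 13 (layerCode true C.gates.length) := ⟨_, rfl⟩
  have e3 : (setLayer 13 false true).eval O F N ((setLayer 12 false false).eval O F N
      (setBad d2 P)) = setBad d3 P := by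
    rw [eval_setLayer (r := 12) (t := C.gates.length) (by rw [setBad_apply (by decide), n2]),
      eval_setLayer (r := 13) (t := C.gates.length) (by rw [Function.update_of_ne (by decide),
        setBad_apply (by decide), n2]), update_setBad _ _ (by decide),
      update_setBad _ _ (by decide), hd3]
    rfl
  have g3 : ∀ i, i ≠ 12 → i ≠ 13 → d3 i = d2 i := fun i h h' => by
    rw [hd3, Function.update_of_ne h', Function.update_of_ne h]
  have c3 : CleanFrom 14 d3 := fun i hi => by rw [g3 i (by omega) (by omega), c2 i (by omega)]
  have t3 : Testing N C.width (padTake C.width x) r d3 :=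
    t1.congr (by rw [g3 _ (by decide) (by decide), g2 _ (by decide) (by decide)])
      (by rw [g3 _ (by decide) (by decide), g2 _ (by decide) (by decide)])
      (by rw [g3 _ (by decide) (by decide), g2 _ (by decide) (by decide)])
      (by rw [g3 _ (by decide) (by decide), g2 _ (by decide) (by decide)])
  have h310 : d3 10 = [] := by rw [g3 _ (by decide) (by decide), c2 10 le_rfl]
  set Q := StepChecked O N G (none : Step C.width) (layerCode false C.gates.length)
      (layerCode true C.gates.length) r with hQ
  have e4 : (twice linkCheck).eval O F N (setBad d3 P) = setBad d3 (P ∧ Q) := by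
    rw [eval_twice (w := C.width) (s := none) (code := []) (rest := []) (r := r)
      (z0 := padTake C.width x) ?_ (c3.setBad (by omega) _)
      (t3.congr (setBad_apply (by decide)) (setBad_apply (by decide)) (setBad_apply (by decide))
        (setBad_apply (by decide)))
      (by rw [setBad_apply (by decide), g3 _ (by decide) (by decide), c2 11 (by omega)]),
      update_setBad _ _ (by decide), setBad_setBad, setBad_apply (by decide),
      setBad_apply (by decide)]
    · have e : Function.update d3 10 [] = d3 := by rw [← h310, Function.update_eq_self]
      have e12 : d3 12 = layerCode false C.gates.length := by rw [hd3]; simp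
      have e13 : d3 13 = layerCode true C.gates.length := by rw [hd3]; simp
      rw [e, e12, e13]
    · intro d z hd ht h10 h14
      have e : Function.update d 10 [] = d := by rw [← h10, Function.update_eq_self]
      rw [e]
      exact eval_linkCheck hd (by omega) ht.reg_six ht.width_le h14
  obtain ⟨d4, hd4⟩ : ∃ d4 : ℕ → List Bool, d4 = fill d3 9 5 fun _ => [] := ⟨_, rfl⟩
  have g4 : ∀ i, i < 9 → d4 i = d1 i := fun i h => by
    rw [hd4, fill_apply_of_lt h, g3 i (by omega) (by omega), g2 i (by omega) (by omega)]
  have c4 : CleanFrom 9 d4 := fun i hi => by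
    by_cases h : i < 14
    · rw [hd4, fill, if_pos ⟨hi, h⟩]
    · rw [hd4, fill_apply_of_le (by omega), c3 i (by omega)]
  rw [e1, eval_seqs_cons, eval_seqs_cons, e2, eval_seqs_cons, eval_seqs_cons, e3, eval_seqs_cons,
    e4, eval_seqs_cons, eval_clearRange, fill_setBad (by omega), ← hd4, eval_seqs_cons,
    eval_seqs_nil, eval_finalCheck (w := C.width) (r := r) (z0 := padTake C.width x)
      (by rw [g4 0 (by omega), z1]) (c4.mono (by omega)) ?_ (c4 9 le_rfl)]
  · rfl
  · exact t1.congr (g4 _ (by omega)) (g4 _ (by omega)) (g4 _ (by omega)) (g4 _ (by omega))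

end TProg

end OracleComplexity


/-! ### From claimed numbers to intervals and complex amplitudes. -/

namespace OracleComplexity

/-! ### Intervals of basis states -/

theorem descend_bounds {G : List Bool → List Bool} (z pre lo hi : List Bool)
    (h : DescendOK G z pre lo hi) (hle : val lo ≤ val hi) :
    val lo ≤ val (descend G z pre lo hi).1 ∧
      val (descend G z pre lo hi).1 ≤ val (descend G z pre lo hi).2 ∧
      val (descend G z pre lo hi).2 ≤ val hi := by
  induction z generalizing pre lo hi with
  | nil => exact ⟨le_rfl, hle, le_rfl⟩
  | cons b z ih =>
    obtain ⟨⟨h1, h2⟩, h3⟩ := h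
    cases b
    · obtain ⟨a, b, c⟩ := ih (false :: pre) lo (G pre) h3 h1
      exact ⟨a, b, c.trans h2⟩
    · obtain ⟨a, b, c⟩ := ih (true :: pre) (G pre) hi h3 h2
      exact ⟨h1.trans a, b, c⟩

/-- Two strings part at the first bit in which they differ. One interval then lies below the common
split point and the other above it. Only the splits on these two paths matter, so the rest of the
table may be nonsense. -/
theorem descend_unique {G : List Bool → List Bool} {r : ℕ} (z z' pre lo hi : List Bool)
    (hl : z.length = z'.length) (h : DescendOK G z pre lo hi) (h' : DescendOK G z' pre lo hi)
    (hr : val (descend G z pre lo hi).1 ≤ r ∧ r < val (descend G z pre lo hi).2)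
    (hr' : val (descend G z' pre lo hi).1 ≤ r ∧ r < val (descend G z' pre lo hi).2) : z = z' := by
  induction z generalizing z' pre lo hi with
  | nil => exact (List.eq_nil_of_length_eq_zero hl.symm).symm
  | cons b z ih =>
    obtain _ | ⟨b', z'⟩ := z'
    · simp at hl
    obtain ⟨⟨h1, h2⟩, h3⟩ := h
    obtain ⟨-, h3'⟩ := h'
    have hl' : z.length = z'.length := by simpa using hl
    cases b <;> cases b'
    · rw [ih z' _ _ _ hl' h3 h3' hr hr']
    · have a := descend_bounds z _ _ _ h3 h1
      have b := descend_bounds z' _ _ _ h3' h2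
      simp only [descend, cond_true, cond_false] at hr hr'
      omega
    · have a := descend_bounds z _ _ _ h3 h2
      have b := descend_bounds z' _ _ _ h3' h1
      simp only [descend, cond_true, cond_false] at hr hr'
      omega
    · rw [ih z' _ _ _ hl' h3 h3' hr hr']

section Leaf

variable {N : ℕ} {G : List Bool → List Bool} {l : List Bool}

theorem LeafOK.bounds {z : List Bool} (h : LeafOK N G l z) :
    val (leafIvl N G l z).1 ≤ val (leafIvl N G l z).2 ∧ val (leafIvl N G l z).2 ≤ 2 ^ N := by
  have := (descend_bounds z (false :: l) [] (topNumber N) h.1 (by simp [val])).2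
  rwa [val_topNumber] at this

/-- The modulus disappears because `2 ^ N + 8 * 2 ^ (2 * N) < 16 * 2 ^ (2 * N) ≤ 2 ^ (3 * N)`; the
last inequality is where `4 ≤ N` enters. -/
theorem LeafOK.sum_sq {z : List Bool} (hN : 4 ≤ N) (h : LeafOK N G l z) :
    val (leafIvl N G l z).1 + ∑ j ∈ Finset.range 8, val (leafVal G l z j) ^ 2 =
      val (leafIvl N G l z).2 := by
  rw [← h.2.2, Nat.mod_eq_of_lt]
  have h1 : ∑ j ∈ Finset.range 8, val (leafVal G l z j) ^ 2 ≤ 8 * 2 ^ (2 * N) := by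
    calc _ ≤ ∑ _j ∈ Finset.range 8, 2 ^ (2 * N) := by
          refine Finset.sum_le_sum fun j hj => ?_
          rw [mul_comm 2 N, pow_mul]
          exact Nat.pow_le_pow_left (h.2.1 j (Finset.mem_range.1 hj)) 2
      _ = _ := by simp
  have h2 := h.bounds
  have h3 : (2 : ℕ) ^ N ≤ 2 ^ (2 * N) := Nat.pow_le_pow_right (by omega) (by omega)
  have h4 : 16 * 2 ^ (2 * N) ≤ 2 ^ (3 * N) := by
    rw [show 16 * 2 ^ (2 * N) = 2 ^ (4 + 2 * N) by rw [pow_add]; norm_num]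
    exact Nat.pow_le_pow_right (by omega) (by omega)
  have h5 : 0 < 2 ^ (2 * N) := by positivity
  omega

theorem LeafOK.unique {w : ℕ} {z z' : Fin w → Bool} {r : List Bool}
    (h : LeafOK N G l (List.ofFn z)) (h' : LeafOK N G l (List.ofFn z'))
    (hr : InIvl N G l (List.ofFn z) r) (hr' : InIvl N G l (List.ofFn z') r) : z = z' :=
  List.ofFn_injective (descend_unique _ _ _ _ _ (by simp) h.1 h'.1 hr hr')

end Leaf

theorem val_ofFn_toBits (N k : ℕ) (hk : k < 2 ^ N) :
    val (List.ofFn fun i : Fin N => (toBits N k).getD i false) = k := by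
  have : (List.ofFn fun i : Fin N => (toBits N k).getD i false) = toBits N k := by
    have := TProg.padTake_eq_take (n := N) (l := toBits N k) (by simp)
    rw [padTake] at this
    rw [this, List.take_of_length_le (by simp)]
  rw [this, val_toBits, Nat.mod_eq_of_lt hk]

theorem le_card_interval {N lo hi : ℕ} (h : hi ≤ 2 ^ N) :
    hi - lo ≤ (Finset.univ.filter fun r : Fin N → Bool =>
      lo ≤ val (List.ofFn r) ∧ val (List.ofFn r) < hi).card := by
  rw [← Nat.card_Ico]
  refine Finset.card_le_card_of_injOn (fun k i => (toBits N k).getD i false) ?_ ?_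
  · intro k hk
    have hk := Finset.mem_Ico.1 hk
    simp only [Finset.coe_filter, Finset.mem_univ, true_and, Set.mem_ofPred_eq]
    rw [val_ofFn_toBits N k (by omega)]
    exact hk
  · intro k hk k' hk' he
    have hk := Finset.mem_Ico.1 hk
    have hk' := Finset.mem_Ico.1 hk'
    have := congrArg (fun r : Fin N → Bool => val (List.ofFn r)) he
    simp only [] at this
    rwa [val_ofFn_toBits N k (by omega), val_ofFn_toBits N k' (by omega)] at this

/-! ### Amplitudes from coefficients -/

/-- The eighth root of unity `exp (i π / 4)`. -/
noncomputable def omega : ℂ := Complex.exp (Complex.I * Real.pi / 4)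

theorem omega_sq : omega ^ 2 = Complex.I := by
  rw [omega, ← Complex.exp_nat_mul]
  have : ((2 : ℕ) : ℂ) * (Complex.I * Real.pi / 4) = Real.pi / 2 * Complex.I := by push_cast; ring
  rw [this, Complex.exp_pi_div_two_mul_I]

theorem omega_pow_four : omega ^ 4 = -1 := by
  rw [show 4 = 2 * 2 by rfl, pow_mul, omega_sq, Complex.I_sq]

theorem omega_eq : omega = (Real.sqrt 2 / 2 : ℝ) + (Real.sqrt 2 / 2 : ℝ) * Complex.I := by
  have : Complex.I * Real.pi / 4 = ((Real.pi / 4 : ℝ) : ℂ) * Complex.I := by push_cast; ring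
  rw [omega, this, Complex.exp_mul_I, ← Complex.ofReal_cos, ← Complex.ofReal_sin,
    Real.cos_pi_div_four, Real.sin_pi_div_four]

theorem norm_omega : ‖omega‖ = 1 := by
  have : Complex.I * Real.pi / 4 = ((Real.pi / 4 : ℝ) : ℂ) * Complex.I := by push_cast; ring
  rw [omega, this, Complex.norm_exp_ofReal_mul_I]

theorem sqrt_two_eq : (Real.sqrt 2 : ℂ) = omega - omega ^ 3 := by
  rw [pow_succ, omega_sq, omega_eq]
  push_cast
  linear_combination ((Real.sqrt 2 : ℂ) / 2) * Complex.I_sq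

theorem conj_omega : (starRingEnd ℂ) omega = -omega ^ 3 := by
  rw [pow_succ, omega_sq, omega_eq, map_add, map_mul, Complex.conj_ofReal, Complex.conj_I]
  push_cast
  linear_combination ((Real.sqrt 2 : ℂ) / 2) * Complex.I_sq

theorem sqrt_two_mul_self : (Real.sqrt 2 : ℂ) * Real.sqrt 2 = 2 := by
  rw [← Complex.ofReal_mul, Real.mul_self_sqrt (by norm_num)]; norm_num

/-- The number `∑ j < 4, a j * ω ^ j`. -/
noncomputable def cval (a : ℕ → ℤ) : ℂ := a 0 + a 1 * omega + a 2 * omega ^ 2 + a 3 * omega ^ 3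

theorem cval_of_phaseEqs {p : ℕ → ℕ → ℕ} {s : ℕ} (h : ∀ e ∈ phaseEqs s, evalTerms p e = 0)
    (hs : s = 0 ∨ s = 4 ∨ s = 7) : cval (signed (p 2)) =
      (if s = 0 then 1 else if s = 4 then -1 else omega) * cval (signed (p 0)) := by
  simp only [phaseEqs_eq, List.forall_mem_cons, evalTerms, List.map_cons, List.map_nil,
    List.sum_cons, List.sum_nil] at h
  obtain ⟨h0, -, h1, -, h2, -, h3, -⟩ := h
  have e0 := congrArg (Int.cast : ℤ → ℂ) h0
  have e1 := congrArg (Int.cast : ℤ → ℂ) h1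
  have e2 := congrArg (Int.cast : ℤ → ℂ) h2
  have e3 := congrArg (Int.cast : ℤ → ℂ) h3
  rcases hs with rfl | rfl | rfl <;> norm_num [signed] at e0 e1 e2 e3 <;> norm_num [cval, signed]
  · linear_combination e0 + omega * e1 + omega ^ 2 * e2 + omega ^ 3 * e3
  · linear_combination e0 + omega * e1 + omega ^ 2 * e2 + omega ^ 3 * e3
  · linear_combination e0 + omega * e1 + omega ^ 2 * e2 + omega ^ 3 * e3 -
      ((p 0 3 : ℂ) - p 0 7) * omega_pow_four

theorem cval_of_conjEqs {p : ℕ → ℕ → ℕ} {s : ℕ} (h : ∀ e ∈ conjEqs s, evalTerms p e = 0)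
    (hs : s = 0 ∨ s = 4) : cval (signed (p 2)) =
      (starRingEnd ℂ) ((if s = 0 then 1 else -1) * cval (signed (p 0))) := by
  simp only [conjEqs_eq, List.forall_mem_cons, evalTerms, List.map_cons, List.map_nil,
    List.sum_cons, List.sum_nil] at h
  obtain ⟨h0, -, h1, -, h2, -, h3, -⟩ := h
  have e0 := congrArg (Int.cast : ℤ → ℂ) h0
  have e1 := congrArg (Int.cast : ℤ → ℂ) h1
  have e2 := congrArg (Int.cast : ℤ → ℂ) h2
  have e3 := congrArg (Int.cast : ℤ → ℂ) h3
  rcases hs with rfl | rfl <;> norm_num [signed] at e0 e1 e2 e3 <;>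
    norm_num [cval, signed, conj_omega]
  · linear_combination e0 + omega * e1 + omega ^ 2 * e2 + omega ^ 3 * e3 +
      (((p 0 2 : ℂ) - p 0 6) * (-omega ^ 2) + ((p 0 3 : ℂ) - p 0 7) *
        (omega ^ 5 - omega)) * omega_pow_four
  · linear_combination e0 + omega * e1 + omega ^ 2 * e2 + omega ^ 3 * e3 -
      (((p 0 2 : ℂ) - p 0 6) * (-omega ^ 2) + ((p 0 3 : ℂ) - p 0 7) *
        (omega ^ 5 - omega)) * omega_pow_four

theorem cval_of_swapEqs {p : ℕ → ℕ → ℕ} (h : ∀ e ∈ swapEqs, evalTerms p e = 0) :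
    cval (signed (p 2)) = cval (signed (p 1)) := by
  simp only [swapEqs, List.range, List.range.loop, List.flatMap_cons, List.flatMap_nil,
    List.cons_append, List.nil_append, List.forall_mem_cons, evalTerms, List.map_cons,
    List.map_nil, List.sum_cons, List.sum_nil] at h
  obtain ⟨h0, -, h1, -, h2, -, h3, -⟩ := h
  have e0 := congrArg (Int.cast : ℤ → ℂ) h0
  have e1 := congrArg (Int.cast : ℤ → ℂ) h1
  have e2 := congrArg (Int.cast : ℤ → ℂ) h2
  have e3 := congrArg (Int.cast : ℤ → ℂ) h3
  norm_num [signed] at e0 e1 e2 e3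
  norm_num [cval, signed]
  linear_combination e0 + omega * e1 + omega ^ 2 * e2 + omega ^ 3 * e3

/-- The equations hold coefficientwise; weighting them by powers of `ω` and reducing with `ω ^ 4 =
-1` turns them into an identity with the factor `√2 = ω - ω ^ 3`. -/
theorem cval_of_hadamardEqs {p : ℕ → ℕ → ℕ} (h : ∀ e ∈ hadamardEqs, evalTerms p e = 0) :
    2 * cval (signed (p 2)) =
        Real.sqrt 2 * (cval (signed (p 0)) + cval (signed (p 1))) ∧
      2 * cval (signed (p 3)) =
        Real.sqrt 2 * (cval (signed (p 0)) - cval (signed (p 1))) := by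
  simp only [hadamardEqs, List.range, List.range.loop, List.flatMap_cons, List.flatMap_nil,
    List.cons_append, List.nil_append, List.forall_mem_cons, evalTerms, List.map_cons,
    List.map_nil, List.sum_cons, List.sum_nil] at h
  obtain ⟨h0, k0, h1, k1, h2, k2, h3, k3, -⟩ := h
  have e0 := congrArg (Int.cast : ℤ → ℂ) h0
  have e1 := congrArg (Int.cast : ℤ → ℂ) h1
  have e2 := congrArg (Int.cast : ℤ → ℂ) h2
  have e3 := congrArg (Int.cast : ℤ → ℂ) h3
  have f0 := congrArg (Int.cast : ℤ → ℂ) k0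
  have f1 := congrArg (Int.cast : ℤ → ℂ) k1
  have f2 := congrArg (Int.cast : ℤ → ℂ) k2
  have f3 := congrArg (Int.cast : ℤ → ℂ) k3
  norm_num [signed] at e0 e1 e2 e3 f0 f1 f2 f3
  rw [sqrt_two_eq]
  norm_num [cval, signed]
  constructor
  · linear_combination e0 + omega * e1 + omega ^ 2 * e2 + omega ^ 3 * e3 +
      ((((p 0 1 : ℂ) - p 0 5) + (p 1 1 - p 1 5)) + (((p 0 2 : ℂ) - p 0 6) + (p 1 2 - p 1 6)) *
        omega + (((p 0 3 : ℂ) - p 0 7) + (p 1 3 - p 1 7)) * (omega ^ 2 - 1)) * omega_pow_four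
  · linear_combination f0 + omega * f1 + omega ^ 2 * f2 + omega ^ 3 * f3 +
      ((((p 0 1 : ℂ) - p 0 5) - (p 1 1 - p 1 5)) + (((p 0 2 : ℂ) - p 0 6) - (p 1 2 - p 1 6)) *
        omega + (((p 0 3 : ℂ) - p 0 7) - (p 1 3 - p 1 7)) * (omega ^ 2 - 1)) * omega_pow_four

/-- The factor `4` is Cauchy–Schwarz for the four powers of `ω`. A signed coefficient is a
difference of two nonnegative numbers, so its square is at most the sum of their squares. An upper
bound on amplitudes by sampling weights is all that soundness needs. -/
theorem norm_cval_sq_le (p : ℕ → ℕ) :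
    ‖cval (signed p)‖ ^ 2 ≤ 4 * ∑ j ∈ Finset.range 8, (p j : ℝ) ^ 2 := by
  have h : ‖cval (signed p)‖ ≤ |(signed p 0 : ℝ)| + |(signed p 1 : ℝ)| + |(signed p 2 : ℝ)| +
      |(signed p 3 : ℝ)| := by
    have hn : ∀ (a : ℤ) (k : ℕ), ‖(a : ℂ) * omega ^ k‖ = |(a : ℝ)| := fun a k => by
      rw [norm_mul, norm_pow, norm_omega, one_pow, mul_one, Complex.norm_intCast]
    have h0 := hn (signed p 0) 0
    have h1 := hn (signed p 1) 1
    rw [pow_zero, mul_one] at h0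
    rw [pow_one] at h1
    rw [← h0, ← h1, ← hn (signed p 2) 2, ← hn (signed p 3) 3]
    exact (norm_add_le _ _).trans (add_le_add_left ((norm_add_le _ _).trans
      (add_le_add_left (norm_add_le _ _) _)) _)
  have h' : ‖cval (signed p)‖ ^ 2 ≤ (|(signed p 0 : ℝ)| + |(signed p 1 : ℝ)| +
      |(signed p 2 : ℝ)| + |(signed p 3 : ℝ)|) ^ 2 := pow_le_pow_left₀ (norm_nonneg _) h 2
  have sq : ∀ j, |(signed p j : ℝ)| ^ 2 ≤ (p (j % 8) : ℝ) ^ 2 + (p ((j + 4) % 8) : ℝ) ^ 2 := by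
    intro j
    rw [sq_abs, signed]
    push_cast
    have : (0 : ℝ) ≤ p (j % 8) * p ((j + 4) % 8) := by positivity
    nlinarith
  have s0 : |(signed p 0 : ℝ)| ^ 2 ≤ (p 0 : ℝ) ^ 2 + (p 4 : ℝ) ^ 2 := sq 0
  have s1 : |(signed p 1 : ℝ)| ^ 2 ≤ (p 1 : ℝ) ^ 2 + (p 5 : ℝ) ^ 2 := sq 1
  have s2 : |(signed p 2 : ℝ)| ^ 2 ≤ (p 2 : ℝ) ^ 2 + (p 6 : ℝ) ^ 2 := sq 2
  have s3 : |(signed p 3 : ℝ)| ^ 2 ≤ (p 3 : ℝ) ^ 2 + (p 7 : ℝ) ^ 2 := sq 3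
  simp only [Finset.sum_range_succ, Finset.sum_range_zero]
  generalize |(signed p 0 : ℝ)| = a at *
  generalize |(signed p 1 : ℝ)| = b at *
  generalize |(signed p 2 : ℝ)| = c at *
  generalize |(signed p 3 : ℝ)| = d at *
  nlinarith [sq_nonneg (a - b), sq_nonneg (a - c), sq_nonneg (a - d), sq_nonneg (b - c),
    sq_nonneg (b - d), sq_nonneg (c - d)]

end OracleComplexity


/-! ### Steps as isometries, and the approximate consistency of claimed states. -/

namespace OracleComplexity

/-! ### Computation steps as isometries -/

noncomputable def Step.apply (O : Oracle) {w : ℕ} : Step w → QState w → QState w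
  | some g, ψ => g.apply O ψ
  | none, ψ => fun z =>
      (starRingEnd ℂ) ((if (List.ofFn z).headD false then -1 else 1) * ψ z)

/-- The other basis state that is involved in a step. -/
def Step.partner {w : ℕ} : Step w → (Fin w → Bool) → (Fin w → Bool)
  | some (.H q), z => Function.update z q (!z q)
  | some (.T _), z => z
  | some (.CNOT c t _), z => Function.update z t (xor (z t) (z c))
  | some (.oracle _), z => z
  | none, z => z

variable {O : Oracle} {w : ℕ}

theorem Step.partner_involutive (s : Step w) : Function.Involutive s.partner := by
  intro z
  rcases s with _ | _ | _ | ⟨c, t, h⟩ | _ <;> simp [Step.partner]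
  simp [Function.update_of_ne h]

theorem Step.sum_partner {M : Type*} [AddCommMonoid M] (s : Step w) (S : Finset (Fin w → Bool))
    (hS : ∀ z ∈ S, s.partner z ∈ S) (f : (Fin w → Bool) → M) :
    ∑ z ∈ S, f (s.partner z) = ∑ z ∈ S, f z :=
  Finset.sum_nbij' s.partner s.partner hS hS (fun z _ => s.partner_involutive z)
    (fun z _ => s.partner_involutive z) (fun _ _ => rfl)

theorem Gate.apply_hadamard (q : Fin w) (ψ : QState w) (z : Fin w → Bool) :
    (Gate.H q).apply O ψ z = ((if z q then -1 else 1) * ψ z +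
      ψ (Function.update z q (!z q))) / (Real.sqrt 2 : ℂ) := by
  simp only [Gate.apply]
  cases h : z q
  · rw [show Function.update z q false = z by rw [← h, Function.update_eq_self]]
    simp
  · rw [show Function.update z q true = z by rw [← h, Function.update_eq_self]]
    simp [add_comm]

/-- A step mixes only `z` and its partner. It multiplies by phases, conjugates or swaps the two,
except for the Hadamard gate, where the claim is the parallelogram law. -/
theorem Step.norm_sq_add (s : Step w) (ψ : QState w) (z : Fin w → Bool) :
    ‖s.apply O ψ z‖ ^ 2 + ‖s.apply O ψ (s.partner z)‖ ^ 2 =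
      ‖ψ z‖ ^ 2 + ‖ψ (s.partner z)‖ ^ 2 := by
  rcases s with _ | q | q | ⟨c, t, h⟩ | ws
  · have hs : ∀ z, ‖Step.apply O none ψ z‖ = ‖ψ z‖ := fun z => by
      have : ‖(if (List.ofFn z).headD false = true then (-1 : ℂ) else 1)‖ = 1 := by
        split_ifs <;> simp
      rw [Step.apply, RCLike.norm_conj, norm_mul, this, one_mul]
    rw [hs, hs]
  · simp only [Step.apply, Step.partner, Gate.apply_hadamard, norm_div, div_pow,
      Function.update_self, Function.update_idem, Bool.not_not, Function.update_eq_self]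
    have h2 : ‖(Real.sqrt 2 : ℂ)‖ ^ 2 = 2 := by
      rw [← norm_pow, pow_two, sqrt_two_mul_self]; norm_num
    have par := parallelogram_law_with_norm ℝ (ψ z) (ψ (Function.update z q (!z q)))
    rw [h2]
    cases h : z q <;> rw [h] at par
    · simp only [Bool.false_eq_true, Bool.not_false, if_true, if_false, one_mul, neg_one_mul] at *
      rw [show -ψ (Function.update z q true) + ψ z = ψ z - ψ (Function.update z q true) by ring]
      nlinarith
    · simp only [Bool.false_eq_true, Bool.not_true, if_true, if_false, one_mul, neg_one_mul] at *
      rw [show -ψ z + ψ (Function.update z q false) = -(ψ z - ψ (Function.update z q false)) by ring,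
        norm_neg, show ψ (Function.update z q false) + ψ z = ψ z + ψ (Function.update z q false)
        by ring]
      nlinarith
  · have hT : ‖Complex.exp (Complex.I * Real.pi / 4)‖ = 1 := norm_omega
    have hs : ∀ z, ‖Step.apply O (some (.T q)) ψ z‖ = ‖ψ z‖ := fun z => by
      have : ‖(if z q = true then Complex.exp (Complex.I * Real.pi / 4) else 1)‖ = 1 := by
        split_ifs <;> simp [hT]
      rw [Step.apply, Gate.apply, norm_mul, this, one_mul]
    rw [hs, hs]
  · have := Step.partner_involutive (some (.CNOT c t h)) z
    simp only [Step.apply, Step.partner, Gate.apply] at this ⊢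
    rw [this]
    ring
  · have hs : ∀ z, ‖Step.apply O (some (.oracle ws)) ψ z‖ = ‖ψ z‖ := fun z => by
      have : ‖(if O (ws.map z) = true then (-1 : ℂ) else 1)‖ = 1 := by
        split_ifs <;> simp
      rw [Step.apply, Gate.apply, norm_mul, this, one_mul]
    rw [hs, hs]

/-- Summing the two-point identity counts every basis state twice. The version for a set closed
under partners is what makes the set of bad basis states tractable. -/
theorem Step.sum_norm_sq (s : Step w) (S : Finset (Fin w → Bool))
    (hS : ∀ z ∈ S, s.partner z ∈ S) (ψ : QState w) :
    ∑ z ∈ S, ‖s.apply O ψ z‖ ^ 2 = ∑ z ∈ S, ‖ψ z‖ ^ 2 := by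
  have h := Finset.sum_congr (rfl : S = S) fun z _ => s.norm_sq_add (O := O) ψ z
  rw [Finset.sum_add_distrib, Finset.sum_add_distrib,
    s.sum_partner S hS (fun z => ‖s.apply O ψ z‖ ^ 2), s.sum_partner S hS (fun z => ‖ψ z‖ ^ 2)] at h
  linarith

/-- The matrix of a gate is symmetric. -/
theorem Gate.sum_apply_mul (g : Gate w) (φ ψ : QState w) :
    ∑ z, φ z * g.apply O ψ z = ∑ z, g.apply O φ z * ψ z := by
  have h : ∀ z, φ z * g.apply O ψ z + φ (Step.partner (some g) z) *
      g.apply O ψ (Step.partner (some g) z) = g.apply O φ z * ψ z +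
      g.apply O φ (Step.partner (some g) z) * ψ (Step.partner (some g) z) := by
    intro z
    rcases g with q | q | ⟨c, t, h⟩ | ws
    · simp only [Step.partner, Gate.apply_hadamard,
        Function.update_self, Function.update_idem, Bool.not_not, Function.update_eq_self]
      cases z q <;> simp <;> ring
    · simp only [Step.partner, Gate.apply]
      ring
    · have := Step.partner_involutive (some (.CNOT c t h)) z
      simp only [Step.partner, Gate.apply] at this ⊢
      rw [this]
      ring
    · simp only [Step.partner, Gate.apply]
      ring
  have hs := Finset.sum_congr (rfl : (Finset.univ : Finset (Fin w → Bool)) = Finset.univ)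
    fun z _ => h z
  rw [Finset.sum_add_distrib, Finset.sum_add_distrib,
    Step.sum_partner (some g) _ (fun _ _ => Finset.mem_univ _) (fun z => φ z * g.apply O ψ z),
    Step.sum_partner (some g) _ (fun _ _ => Finset.mem_univ _) (fun z => g.apply O φ z * ψ z)] at hs
  have h2 : (2 : ℂ) ≠ 0 := by norm_num
  rw [← two_mul, ← two_mul] at hs
  exact mul_left_cancel₀ h2 hs

/-- Conjugation is not complex linear, but additivity is enough for preserving distances. -/
theorem Step.apply_sub (s : Step w) (φ ψ : QState w) :
    s.apply O (φ - ψ) = s.apply O φ - s.apply O ψ := by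
  funext z
  rcases s with _ | q | q | ⟨c, t, h⟩ | ws
  · simp only [Step.apply, Pi.sub_apply, ← map_sub]; ring_nf
  · simp only [Step.apply, Gate.apply, Pi.sub_apply]; ring
  · simp only [Step.apply, Gate.apply, Pi.sub_apply]; ring
  · simp only [Step.apply, Gate.apply, Pi.sub_apply]
  · simp only [Step.apply, Gate.apply, Pi.sub_apply]; ring

/-- The Euclidean distance of two states. -/
noncomputable def QState.dist (φ ψ : QState w) : ℝ :=
  Dist.dist (WithLp.toLp 2 φ) (WithLp.toLp 2 ψ)

theorem QState.dist_sq (φ ψ : QState w) : φ.dist ψ ^ 2 = ∑ z, ‖φ z - ψ z‖ ^ 2 := by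
  rw [QState.dist, EuclideanSpace.dist_eq, Real.sq_sqrt (by positivity)]
  simp [dist_eq_norm]

theorem QState.dist_nonneg (φ ψ : QState w) : 0 ≤ φ.dist ψ := _root_.dist_nonneg

theorem QState.dist_triangle (φ ψ χ : QState w) : φ.dist χ ≤ φ.dist ψ + ψ.dist χ :=
  _root_.dist_triangle _ _ _

theorem QState.dist_self (φ : QState w) : φ.dist φ = 0 := _root_.dist_self _

theorem QState.norm_sub_le_dist (φ ψ : QState w) (z : Fin w → Bool) :
    ‖φ z - ψ z‖ ≤ φ.dist ψ := by
  refine abs_le_of_sq_le_sq' ?_ (φ.dist_nonneg ψ) |>.2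
  rw [QState.dist_sq]
  exact Finset.single_le_sum (f := fun z => ‖φ z - ψ z‖ ^ 2) (fun _ _ => by positivity)
    (Finset.mem_univ z)

theorem Step.dist_apply (s : Step w) (φ ψ : QState w) :
    QState.dist (s.apply O φ) (s.apply O ψ) = φ.dist ψ := by
  have h : QState.dist (s.apply O φ) (s.apply O ψ) ^ 2 = φ.dist ψ ^ 2 := by
    rw [QState.dist_sq, QState.dist_sq]
    have := s.sum_norm_sq (O := O) Finset.univ (fun _ _ => Finset.mem_univ _) (φ - ψ)
    rw [s.apply_sub] at this
    exact this
  exact (pow_left_inj₀ (QState.dist_nonneg _ _) (QState.dist_nonneg _ _) two_ne_zero).1 h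

/-! ### The state claimed by the provers -/

section Claimed

variable {G : List Bool → List Bool} {m : ℕ}

open Classical in
/-- The state described by the consistent claims about a layer. -/
noncomputable def claimed (G : List Bool → List Bool) (m : ℕ) (w : ℕ) (l : List Bool) : QState w :=
  fun z => if LeafOK (2 * m) G l (List.ofFn z) then
    cval (signed fun j => val (leafVal G l (List.ofFn z) j)) / 2 ^ m else 0

theorem claimed_of {l : List Bool} {z : Fin w → Bool} (h : LeafOK (2 * m) G l (List.ofFn z)) :
    claimed G m w l z = cval (signed fun j => val (leafVal G l (List.ofFn z) j)) / 2 ^ m :=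
  if_pos h

/-- At a basis state with correct equations the claimed new amplitude is exact. All errors come from
the basis states at which the check fails. -/
theorem StepOK.claimed_eq {s : Step w} {l l' : List Bool} {z : Fin w → Bool}
    (h : StepOK O (2 * m) G s l l' z) :
    claimed G m w l' z = s.apply O (claimed G m w l) z := by
  rcases s with _ | q | q | ⟨c, t, hct⟩ | ws
  · obtain ⟨⟨h1, -, h3, -⟩, he⟩ := h
    have := cval_of_conjEqs he (by split_ifs <;> simp)
    simp only [Step.pair, quad] at this h1 h3
    simp only [Step.apply]
    rw [claimed_of h1, claimed_of h3, this]
    simp only [map_mul, map_div₀, map_pow]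
    have h2 : (starRingEnd ℂ) 2 = 2 := Complex.conj_ofNat 2
    rw [h2]
    split_ifs <;> simp_all <;> ring
  · obtain ⟨⟨h1, h2, h3, h4⟩, he⟩ := h
    obtain ⟨e1, e2⟩ := cval_of_hadamardEqs he
    simp only [Step.pair, quad] at e1 e2 h1 h2 h3 h4
    have hs := sqrt_two_mul_self
    have hs0 : (Real.sqrt 2 : ℂ) ≠ 0 := by
      intro h0; rw [h0] at hs; norm_num at hs
    have alg : ∀ n a b : ℂ, 2 * n = Real.sqrt 2 * (a + b) →
        n / 2 ^ m = (a / 2 ^ m + b / 2 ^ m) / (Real.sqrt 2 : ℂ) := fun n a b h => by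
      rw [eq_div_iff hs0]
      linear_combination (1 / 2) * (Real.sqrt 2 : ℂ) / 2 ^ m * h + (1 / 2) / 2 ^ m * (a + b) * hs
    have key : ∀ b, claimed G m w l' (Function.update z q b) =
        (claimed G m w l (Function.update z q false) + (if b then -1 else 1) *
          claimed G m w l (Function.update z q true)) / (Real.sqrt 2 : ℂ) := by
      intro b
      rw [claimed_of h1, claimed_of h2]
      cases b
      · rw [claimed_of h3, alg _ _ _ e1]
        simp
      · rw [claimed_of h4, alg _ _ _ (by rw [e2, sub_eq_add_neg])]
        simp [neg_div]
    have := key (z q)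
    rwa [Function.update_eq_self] at this
  · obtain ⟨⟨h1, -, h3, -⟩, he⟩ := h
    have := cval_of_phaseEqs he (by split_ifs <;> simp)
    simp only [Step.pair, quad] at this h1 h3
    simp only [Step.apply, Gate.apply]
    rw [claimed_of h1, claimed_of h3, this]
    change _ = (if _ then omega else 1) * _
    split_ifs <;> simp_all <;> ring
  · obtain ⟨⟨h1, h2, h3, -⟩, he⟩ := h
    have := cval_of_swapEqs he
    simp only [Step.pair, quad] at this h1 h2 h3
    simp only [Step.apply, Gate.apply]
    rw [claimed_of h2, claimed_of h3, this]
  · obtain ⟨⟨h1, -, h3, -⟩, he⟩ := h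
    have := cval_of_phaseEqs he (by split_ifs <;> simp)
    simp only [Step.pair, quad] at this h1 h3
    simp only [Step.apply, Gate.apply]
    rw [claimed_of h1, claimed_of h3, this]
    split_ifs <;> simp_all <;> ring

/-- The check at `z` involves the same pair as the check at its partner, up to the order of the two;
the failing basis states are therefore closed under partners. -/
theorem StepOK.partner {N : ℕ} {s : Step w} {l l' : List Bool} {z : Fin w → Bool}
    (h : StepOK O N G s l l' z) : StepOK O N G s l l' (s.partner z) := by
  rcases s with _ | q | q | ⟨c, t, hct⟩ | ws
  · exact h
  · simpa [StepOK, Step.pair, Step.partner, Step.eqs] using h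
  · exact h
  · have hi := Step.partner_involutive (some (.CNOT c t hct)) z
    simp only [Step.partner] at hi
    obtain ⟨⟨h1, h2, h3, h4⟩, he⟩ := h
    simp only [StepOK, Step.pair, Step.partner, Step.eqs] at he h1 h2 h3 h4 ⊢
    rw [hi]
    refine ⟨⟨h2, h1, h4, h3⟩, ?_⟩
    simp only [swapEqs, List.range, List.range.loop, List.flatMap_cons, List.flatMap_nil,
      List.cons_append, List.nil_append, List.forall_mem_cons, evalTerms, List.map_cons,
      List.map_nil, List.sum_cons, List.sum_nil, quad] at he ⊢
    tauto
  · exact h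

/-- The total weight of a set of basis states is bounded by the number of points in their
intervals. -/
theorem sum_claimed_sq_le (hm : 2 ≤ m) {l : List Bool} (S : Finset (Fin w → Bool))
    (B : Finset (Fin (2 * m) → Bool))
    (h : ∀ z ∈ S, LeafOK (2 * m) G l (List.ofFn z) → ∀ r : Fin (2 * m) → Bool,
      InIvl (2 * m) G l (List.ofFn z) (List.ofFn r) → r ∈ B) :
    ∑ z ∈ S, ‖claimed G m w l z‖ ^ 2 ≤ 4 * (B.card / 2 ^ (2 * m)) := by
  classical
  set I : (Fin w → Bool) → Finset (Fin (2 * m) → Bool) := fun z =>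
    Finset.univ.filter fun r => InIvl (2 * m) G l (List.ofFn z) (List.ofFn r) with hI
  set S' := S.filter fun z => LeafOK (2 * m) G l (List.ofFn z) with hS'
  -- The intervals of distinct consistent basis states are disjoint, so their sizes add up within
  -- `B`.
  have h1 : ∑ z ∈ S', (I z).card ≤ B.card := by
    rw [← Finset.card_biUnion]
    · refine Finset.card_le_card fun r hr => ?_
      obtain ⟨z, hz, hr⟩ := Finset.mem_biUnion.1 hr
      obtain ⟨hz, hz'⟩ := Finset.mem_filter.1 hz
      exact h z hz hz' r (Finset.mem_filter.1 hr).2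
    · intro z hz z' hz' hne
      rw [Function.onFun, Finset.disjoint_left]
      intro r hr hr'
      exact hne (LeafOK.unique (Finset.mem_filter.1 hz).2 (Finset.mem_filter.1 hz').2
        (Finset.mem_filter.1 hr).2 (Finset.mem_filter.1 hr').2)
  have h2 : ∀ z ∈ S', ‖claimed G m w l z‖ ^ 2 ≤ 4 * ((I z).card / 2 ^ (2 * m)) := by
    intro z hz
    have hz := (Finset.mem_filter.1 hz).2
    have hsum := hz.sum_sq (by omega)
    have hc := le_card_interval (lo := val (leafIvl (2 * m) G l (List.ofFn z)).1) hz.bounds.2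
    have hle : ∑ j ∈ Finset.range 8, val (leafVal G l (List.ofFn z) j) ^ 2 ≤ (I z).card := by
      refine le_trans ?_ (hc.trans (Finset.card_le_card fun r hr =>
        Finset.mem_filter.2 (Finset.mem_filter.1 hr)))
      omega
    have hle' : ∑ j ∈ Finset.range 8, (val (leafVal G l (List.ofFn z) j) : ℝ) ^ 2 ≤
        (I z).card := by exact_mod_cast hle
    rw [claimed_of hz, norm_div, div_pow, norm_pow, ← pow_mul, mul_comm m 2]
    simp only [Complex.norm_ofNat]
    rw [← mul_div_assoc]
    refine div_le_div_of_nonneg_right ?_ (by positivity)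
    exact (norm_cval_sq_le _).trans (by linarith)
  have h3 : ∑ z ∈ S, ‖claimed G m w l z‖ ^ 2 = ∑ z ∈ S', ‖claimed G m w l z‖ ^ 2 := by
    rw [hS', Finset.sum_filter]
    refine Finset.sum_congr rfl fun z _ => ?_
    split_ifs with hz
    · rfl
    · simp [claimed, hz]
  rw [h3]
  calc _ ≤ ∑ z ∈ S', 4 * (((I z).card : ℝ) / 2 ^ (2 * m)) := Finset.sum_le_sum h2
    _ = 4 * (((∑ z ∈ S', (I z).card : ℕ) : ℝ) / 2 ^ (2 * m)) := by
        rw [← Finset.mul_sum, ← Finset.sum_div]; push_cast; rfl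
    _ ≤ _ := by
        have : ((∑ z ∈ S', (I z).card : ℕ) : ℝ) ≤ B.card := by exact_mod_cast h1
        gcongr

/-- If the check of a step succeeds outside `B`, then the claimed states before and after the step
nearly fit together. -/
theorem dist_claimed_le (hm : 2 ≤ m) {s : Step w} {l l' : List Bool}
    (B : Finset (Fin (2 * m) → Bool))
    (h : ∀ r : Fin (2 * m) → Bool, r ∉ B → StepChecked O (2 * m) G s l l' (List.ofFn r)) :
    QState.dist (claimed G m w l') (s.apply O (claimed G m w l)) ≤
      4 * Real.sqrt (B.card / 2 ^ (2 * m)) := by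
  classical
  -- A point outside `B` in the interval of a consistent `z` forces the sampled basis state to be
  -- `z`, and its check succeeds. Hence the intervals of consistent members of `S` lie in `B`, in
  -- the old layer and in the new one.
  set S : Finset (Fin w → Bool) := Finset.univ.filter fun z => ¬ StepOK O (2 * m) G s l l' z with hS
  have hSp : ∀ z ∈ S, s.partner z ∈ S := by
    intro z hz
    refine Finset.mem_filter.2 ⟨Finset.mem_univ _, fun hz' => (Finset.mem_filter.1 hz).2 ?_⟩
    have := hz'.partner
    rwa [s.partner_involutive z] at this
  have old := sum_claimed_sq_le (G := G) (l := l) hm S B (by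
    intro z hz hl r hr
    by_contra hB
    obtain ⟨⟨h1, h2⟩, h3⟩ := (h r hB).1
    rw [← LeafOK.unique hl h1 hr h2] at h3
    exact (Finset.mem_filter.1 hz).2 h3)
  have new := sum_claimed_sq_le (G := G) (l := l') hm S B (by
    intro z hz hl r hr
    by_contra hB
    obtain ⟨⟨h1, h2⟩, h3⟩ := (h r hB).2
    rw [← LeafOK.unique hl h1 hr h2] at h3
    exact (Finset.mem_filter.1 hz).2 h3)
  -- Because `S` is closed under partners, the image of the old state has the same mass on `S` as
  -- the old state. Outside `S` the two states agree, so the squared distance is at most `2 * 4 β +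
  -- 2 * 4 β = 16 β`, with `β` the density of `B`.
  rw [← s.sum_norm_sq (O := O) S hSp] at old
  refine abs_le_of_sq_le_sq' ?_ (by positivity) |>.2
  rw [QState.dist_sq, mul_pow, Real.sq_sqrt (by positivity)]
  have e : ∑ z, ‖claimed G m w l' z - s.apply O (claimed G m w l) z‖ ^ 2 =
      ∑ z ∈ S, ‖claimed G m w l' z - s.apply O (claimed G m w l) z‖ ^ 2 := by
    rw [hS, Finset.sum_filter]
    refine Finset.sum_congr rfl fun z _ => ?_
    by_cases hz : StepOK O (2 * m) G s l l' z
    · rw [hz.claimed_eq]; simp [hz]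
    · rw [if_pos hz]
  rw [e]
  calc _ ≤ ∑ z ∈ S, (2 * ‖claimed G m w l' z‖ ^ 2 +
        2 * ‖s.apply O (claimed G m w l) z‖ ^ 2) := by
        refine Finset.sum_le_sum fun z _ => ?_
        have h1 := norm_sub_le (claimed G m w l' z) (s.apply O (claimed G m w l) z)
        have h2 := norm_nonneg (claimed G m w l' z - s.apply O (claimed G m w l) z)
        nlinarith [sq_nonneg (‖claimed G m w l' z‖ - ‖s.apply O (claimed G m w l) z‖)]
    _ = 2 * ∑ z ∈ S, ‖claimed G m w l' z‖ ^ 2 +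
        2 * ∑ z ∈ S, ‖s.apply O (claimed G m w l) z‖ ^ 2 := by
        rw [Finset.sum_add_distrib, Finset.mul_sum, Finset.mul_sum]
    _ ≤ _ := by linarith

end Claimed

end OracleComplexity


/-! ### Soundness of the test for a fixed table. -/

namespace OracleComplexity

/-! ### Soundness of the test -/

section Soundness

variable {O : Oracle} {w : ℕ} {G : List Bool → List Bool} {m : ℕ}

theorem dist_foldl_apply (gs : List (Gate w)) (φ ψ : QState w) :
    QState.dist (gs.foldl (fun ψ g => g.apply O ψ) φ) (gs.foldl (fun ψ g => g.apply O ψ) ψ) =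
      φ.dist ψ := by
  induction gs generalizing φ ψ with
  | nil => rfl
  | cons g gs ih => rw [List.foldl_cons, List.foldl_cons, ih]; exact Step.dist_apply (some g) φ ψ

theorem dist_foldr_apply (gs : List (Gate w)) (φ ψ : QState w) :
    QState.dist (gs.foldr (fun g ψ => g.apply O ψ) φ) (gs.foldr (fun g ψ => g.apply O ψ) ψ) =
      φ.dist ψ := by
  induction gs with
  | nil => rfl
  | cons g gs ih => rw [List.foldr_cons, List.foldr_cons, ← ih]; exact Step.dist_apply (some g) _ _

/-- The pairing is bilinear, without conjugation. Symmetric gates move across it one at a time, so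
the transpose of the circuit is the same list of gates run backwards, with no inverse gates
required. -/
theorem sum_foldl_mul (gs : List (Gate w)) (φ ψ : QState w) :
    ∑ z, φ z * gs.foldl (fun ψ g => g.apply O ψ) ψ z =
      ∑ z, gs.foldr (fun g ψ => g.apply O ψ) φ z * ψ z := by
  induction gs generalizing ψ with
  | nil => rfl
  | cons g gs ih => rw [List.foldl_cons, ih, List.foldr_cons, Gate.sum_apply_mul]

theorem sum_norm_sq_foldl (gs : List (Gate w)) (ψ : QState w) :
    ∑ z, ‖gs.foldl (fun ψ g => g.apply O ψ) ψ z‖ ^ 2 = ∑ z, ‖ψ z‖ ^ 2 := by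
  induction gs generalizing ψ with
  | nil => rfl
  | cons g gs ih =>
    rw [List.foldl_cons, ih]
    exact Step.sum_norm_sq (some g) _ (fun _ _ => Finset.mem_univ _) ψ

/-- Running the gates forwards, conjugating with a sign, and running them backwards leaves the
amplitude `2 p - 1` at the input, where `p` is the acceptance probability. -/
theorem QCircuit.foldr_output {n : ℕ} (C : QCircuit n) (x : List Bool) :
    C.gates.foldr (fun g ψ => g.apply O ψ) (Step.apply O none (C.output O x))
      (fun i => x.getD i false) = (2 * C.acceptProb O x - 1 : ℝ) := by
  -- With the input as `ψ`, the right-hand side is the amplitude of the input after the backward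
  -- run. The left-hand side pairs the output with the conjugate of its signed copy, which gives `p
  -- - (1 - p)`.
  have h1 := sum_foldl_mul (O := O) C.gates (Step.apply O none (C.output O x))
    (fun z => if z = (fun i : Fin C.width => x.getD (i : ℕ) false) then 1 else 0)
  have h2 := sum_norm_sq_foldl (O := O) C.gates
    (fun z => if z = (fun i : Fin C.width => x.getD (i : ℕ) false) then 1 else 0)
  simp only [mul_ite, mul_one, mul_zero, Finset.sum_ite_eq', Finset.mem_univ, if_true] at h1
  change ∑ z, Step.apply O none (C.output O x) z * C.output O x z = _ at h1
  change ∑ z, ‖C.output O x z‖ ^ 2 = _ at h2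
  have h3 : ∑ z : Fin C.width → Bool, ‖(if z = (fun i : Fin C.width => x.getD (i : ℕ) false)
      then (1 : ℂ) else 0)‖ ^ 2 = 1 := by
    rw [Finset.sum_eq_single (fun i : Fin C.width => x.getD (i : ℕ) false)]
    · simp
    · intro z _ hz; rw [if_neg hz]; simp
    · intro h; exact absurd (Finset.mem_univ _) h
  rw [h3] at h2
  rw [← h1, QCircuit.acceptProb, ← h2, Finset.mul_sum, ← Finset.sum_sub_distrib]
  push_cast
  refine Finset.sum_congr rfl fun z _ => ?_
  have hz : (List.ofFn z).headD false = z ⟨0, C.width_pos⟩ := by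
    rw [List.headD_eq_head?_getD, List.head?_eq_getElem?,
      List.getElem?_eq_getElem (by simpa using C.width_pos)]
    simp
  simp only [Step.apply, hz]
  rw [map_mul, mul_assoc, Complex.conj_mul']
  cases z ⟨0, C.width_pos⟩ <;> simp <;> ring

/-- The interval of `z₀` is everything, so its only nonzero coefficient has square `2 ^ (2 m)`. Any
other consistent basis state has an empty interval by disjointness, and the sum of its squared
coefficients vanishes. -/
theorem InitOK.claimed_eq (hm : 2 ≤ m) {z₀ : Fin w → Bool} (h : InitOK (2 * m) G (List.ofFn z₀)) :
    claimed G m w (layerCode false 0) = fun z => if z = z₀ then 1 else 0 := by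
  obtain ⟨⟨⟨h0, hlo⟩, hhi⟩, hz⟩ := h
  funext z
  have hsum := h0.sum_sq (by omega)
  rw [hlo, hhi] at hsum
  have e : ∀ j, 1 ≤ j → j < 8 → val (leafVal G (layerCode false 0) (List.ofFn z₀) j) = 0 := by
    intro j h1 h8
    have := hz (j - 1) (by omega)
    rwa [show 1 + (j - 1) = j by omega] at this
  split_ifs with hzz
  · subst hzz
    have e0 : val (leafVal G (layerCode false 0) (List.ofFn z) 0) = 2 ^ m := by
      simp only [Finset.sum_range_succ, Finset.sum_range_zero, e 1, e 2, e 3, e 4, e 5, e 6, e 7,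
        Nat.one_le_ofNat, Nat.reduceLT, le_refl] at hsum
      have : val (leafVal G (layerCode false 0) (List.ofFn z) 0) ^ 2 = (2 ^ m) ^ 2 := by
        rw [← pow_mul, mul_comm m 2]; simpa using hsum
      exact Nat.pow_left_injective (by norm_num) this
    rw [claimed_of h0]
    have hs : ∀ j, 1 ≤ j → j < 4 →
        signed (fun j => val (leafVal G (layerCode false 0) (List.ofFn z) j)) j = 0 := by
      intro j h1 h4
      simp only [signed, Nat.mod_eq_of_lt (show j < 8 by omega),
        Nat.mod_eq_of_lt (show j + 4 < 8 by omega)]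
      rw [e j h1 (by omega), e (j + 4) (by omega) (by omega)]
      rfl
    have hs0 : signed (fun j => val (leafVal G (layerCode false 0) (List.ofFn z) j)) 0 = 2 ^ m := by
      simp only [signed, Nat.zero_mod, Nat.zero_add, Nat.mod_eq_of_lt (show 4 < 8 by omega)]
      rw [e 4 (by omega) (by omega), e0]
      simp
    rw [cval, hs 1 (by omega) (by omega), hs 2 (by omega) (by omega), hs 3 (by omega) (by omega),
      hs0]
    simp
  · by_cases hl : LeafOK (2 * m) G (layerCode false 0) (List.ofFn z)
    · have hempty : val (leafIvl (2 * m) G (layerCode false 0) (List.ofFn z)).2 ≤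
          val (leafIvl (2 * m) G (layerCode false 0) (List.ofFn z)).1 := by
        by_contra hlt
        rw [not_le] at hlt
        refine hzz (List.ofFn_injective (descend_unique
          (r := val (leafIvl (2 * m) G (layerCode false 0) (List.ofFn z)).1)
          _ _ _ _ _ (by simp) hl.1 h0.1 ⟨le_rfl, hlt⟩ ⟨?_, ?_⟩))
        · change val (leafIvl (2 * m) G (layerCode false 0) (List.ofFn z₀)).1 ≤ _
          omega
        · change _ < val (leafIvl (2 * m) G (layerCode false 0) (List.ofFn z₀)).2
          rw [hhi]
          exact hlt.trans_le hl.bounds.2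
      have hs := hl.sum_sq (by omega)
      have hzero : ∀ j ∈ Finset.range 8,
          val (leafVal G (layerCode false 0) (List.ofFn z) j) ^ 2 = 0 :=
        (Finset.sum_eq_zero_iff).1 (by omega)
      have hs : ∀ j,
          signed (fun j => val (leafVal G (layerCode false 0) (List.ofFn z) j)) j = 0 := by
        intro j
        have h1 := hzero (j % 8) (Finset.mem_range.2 (Nat.mod_lt _ (by omega)))
        have h2 := hzero ((j + 4) % 8) (Finset.mem_range.2 (Nat.mod_lt _ (by omega)))
        simp only [signed, pow_eq_zero_iff two_ne_zero |>.1 h1, pow_eq_zero_iff two_ne_zero |>.1 h2]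
        rfl
      rw [claimed_of hl, cval, hs, hs, hs, hs]
      simp
    · simp [claimed, hl]

theorem re_cval_div (a : ℕ → ℤ) (m : ℕ) :
    (cval a / 2 ^ m).re = (a 0 + Real.sqrt 2 / 2 * (a 1 - a 3) : ℝ) / 2 ^ m := by
  have h3 : omega ^ 3 = omega - Real.sqrt 2 := by rw [sqrt_two_eq]; ring
  have hre1 : omega.re = Real.sqrt 2 / 2 := by rw [omega_eq]; simp
  have : (2 : ℂ) ^ m = ((2 ^ m : ℝ) : ℂ) := by push_cast; rfl
  rw [this, Complex.div_ofReal_re, cval, h3, omega_sq]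
  congr 1
  simp [hre1]
  ring

/-- The test is the real part with `√2 / 2` replaced by `1 / 2`. Since `|a 1 - a 3| ≤ √2 * 2 ^ m`,
this costs at most about `0.2072 * 1.4143`, which is below `0.32`. -/
theorem FinalOK.lt_re (hm : 2 ≤ m) {z : Fin w → Bool} (h : FinalOK (2 * m) G (List.ofFn z)) :
    -(32 / 100 : ℝ) < (claimed G m w (layerCode true 0) z).re := by
  obtain ⟨hl, hf⟩ := h
  have hsum := hl.sum_sq (by omega)
  have hb := hl.bounds
  rw [claimed_of hl]
  set p : ℕ → ℕ := fun j => val (leafVal G (layerCode true 0) (List.ofFn z) j) with hp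
  have hle : p 0 ^ 2 + p 1 ^ 2 + p 2 ^ 2 + p 3 ^ 2 + p 4 ^ 2 + p 5 ^ 2 + p 6 ^ 2 + p 7 ^ 2 ≤
      (2 ^ m) ^ 2 := by
    rw [← pow_mul, mul_comm m 2]
    simp only [Finset.sum_range_succ, Finset.sum_range_zero] at hsum
    simp only [hp]
    omega
  have hf' : 2 * p 4 + p 5 + p 3 < 2 * p 0 + p 1 + p 7 := hf
  have hre : (cval (signed p) / 2 ^ m).re =
      ((p 0 : ℝ) - p 4 + Real.sqrt 2 / 2 * ((p 1 - p 5) - (p 3 - p 7))) / 2 ^ m := by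
    rw [re_cval_div]
    simp only [signed, Nat.reduceMod, Nat.reduceAdd, Nat.zero_mod]
    push_cast
    ring
  rw [hre, lt_div_iff₀ (by positivity)]
  have hle' : (p 0 : ℝ) ^ 2 + p 1 ^ 2 + p 2 ^ 2 + p 3 ^ 2 + p 4 ^ 2 + p 5 ^ 2 + p 6 ^ 2 + p 7 ^ 2 ≤
      (2 ^ m) ^ 2 := by exact_mod_cast hle
  have hf'' : 2 * (p 4 : ℝ) + p 5 + p 3 < 2 * p 0 + p 1 + p 7 := by exact_mod_cast hf'
  have hq : Real.sqrt 2 / 2 ≤ 0.7072 := by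
    have : Real.sqrt 2 ≤ 1.4144 := Real.sqrt_le_iff.2 ⟨by norm_num, by norm_num⟩
    linarith
  have hq' : 0.7 ≤ Real.sqrt 2 / 2 := by
    have : 1.4 ≤ Real.sqrt 2 := Real.le_sqrt_of_sq_le (by norm_num)
    linarith
  have hP : (0 : ℝ) < 2 ^ m := by positivity
  generalize (2 : ℝ) ^ m = P at *
  generalize Real.sqrt 2 / 2 = q at *
  have p0 : (0 : ℝ) ≤ p 0 := by positivity
  have p1 : (0 : ℝ) ≤ p 1 := by positivity
  have p3 : (0 : ℝ) ≤ p 3 := by positivity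
  have p4 : (0 : ℝ) ≤ p 4 := by positivity
  have p5 : (0 : ℝ) ≤ p 5 := by positivity
  have p7 : (0 : ℝ) ≤ p 7 := by positivity
  generalize (p 0 : ℝ) = a0 at *
  generalize (p 1 : ℝ) = a1 at *
  generalize (p 2 : ℝ) = a2 at *
  generalize (p 3 : ℝ) = a3 at *
  generalize (p 4 : ℝ) = a4 at *
  generalize (p 5 : ℝ) = a5 at *
  generalize (p 6 : ℝ) = a6 at *
  generalize (p 7 : ℝ) = a7 at *
  by_contra hcon
  rw [not_lt] at hcon
  set b := (a1 - a5) - (a3 - a7) with hb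
  have hb1 : b * (q - 1 / 2) < -(32 / 100) * P := by linarith
  have hb0 : b < 0 := by
    by_contra h
    rw [not_lt] at h
    nlinarith
  -- A real part below the bound needs `-b > (0.32 / 0.2072) * P`, more than `1.5 * P`, which
  -- contradicts `b ^ 2 ≤ 2 * P ^ 2`.
  have hb2 : 1.5 * P ≤ -b := by nlinarith
  have hb3 : b ^ 2 ≤ 2 * P ^ 2 := by
    have h1 : (a1 - a5) ^ 2 ≤ a1 ^ 2 + a5 ^ 2 := by nlinarith [mul_nonneg p1 p5]
    have h2 : (a3 - a7) ^ 2 ≤ a3 ^ 2 + a7 ^ 2 := by nlinarith [mul_nonneg p3 p7]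
    have h3 : b ^ 2 ≤ 2 * ((a1 - a5) ^ 2 + (a3 - a7) ^ 2) := by
      rw [hb]; nlinarith [sq_nonneg ((a1 - a5) + (a3 - a7))]
    nlinarith [sq_nonneg a0, sq_nonneg a2, sq_nonneg a4, sq_nonneg a6]
  nlinarith

variable {B : Finset (Fin (2 * m) → Bool)} {δ : ℝ}

/-- Each step contributes at most `δ`, and the later gates, being isometries, do not amplify what
has accumulated. -/
theorem dist_claimed_foldl_le
    (hδ : ∀ (s : Step w) (l l' : List Bool), (∀ r : Fin (2 * m) → Bool, r ∉ B →
      StepChecked O (2 * m) G s l l' (List.ofFn r)) →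
      QState.dist (claimed G m w l') (s.apply O (claimed G m w l)) ≤ δ)
    (gs : List (Gate w)) (t : ℕ)
    (h : ∀ r : Fin (2 * m) → Bool, r ∉ B → GatesOK O (2 * m) G (List.ofFn r) gs t) :
    QState.dist (claimed G m w (layerCode false (t + gs.length)))
        (gs.foldl (fun ψ g => g.apply O ψ) (claimed G m w (layerCode false t))) ≤
        gs.length * δ ∧
      QState.dist (claimed G m w (layerCode true t))
        (gs.foldr (fun g ψ => g.apply O ψ) (claimed G m w (layerCode true (t + gs.length)))) ≤
        gs.length * δ := by
  induction gs generalizing t with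
  | nil => simp [QState.dist_self]
  | cons g gs ih =>
    obtain ⟨i1, i2⟩ := ih (t + 1) fun r hr => (h r hr).2
    have s1 := hδ (some g) _ _ fun r hr => (h r hr).1.1
    have s2 := hδ (some g) _ _ fun r hr => (h r hr).1.2
    rw [show t + 1 + gs.length = t + (g :: gs).length by simp; omega] at i1 i2
    simp only [List.length_cons, Nat.cast_add, Nat.cast_one] at i1 i2 ⊢
    constructor
    · rw [List.foldl_cons]
      refine (QState.dist_triangle _ _ _).trans ((add_le_add i1
        ((dist_foldl_apply gs _ _).trans_le s1)).trans_eq (by ring))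
    · rw [List.foldr_cons]
      refine (QState.dist_triangle _ _ _).trans ((add_le_add s2
        ((Step.dist_apply (O := O) (some g) _ _).trans_le i2)).trans_eq (by ring))

/-- The claimed amplitude of the input in the last layer is close to `2 p - 1`, where `p` is the
acceptance probability. -/
theorem norm_claimed_sub_le {n : ℕ} (C : QCircuit n) (x : List Bool)
    (hδ : ∀ (s : Step C.width) (l l' : List Bool), (∀ r : Fin (2 * m) → Bool, r ∉ B →
      StepChecked O (2 * m) G s l l' (List.ofFn r)) →
      QState.dist (claimed G m C.width l') (s.apply O (claimed G m C.width l)) ≤ δ)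
    (hstart : claimed G m C.width (layerCode false 0) =
      fun z => if z = (fun i : Fin C.width => x.getD i false) then 1 else 0)
    (hgates : ∀ r : Fin (2 * m) → Bool, r ∉ B → GatesOK O (2 * m) G (List.ofFn r) C.gates 0)
    (hlink : ∀ r : Fin (2 * m) → Bool, r ∉ B → StepChecked O (2 * m) G (none : Step C.width)
      (layerCode false C.gates.length) (layerCode true C.gates.length) (List.ofFn r)) :
    ‖claimed G m C.width (layerCode true 0) (fun i => x.getD i false) -
      (2 * C.acceptProb O x - 1 : ℝ)‖ ≤ (2 * C.gates.length + 1) * δ := by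
  obtain ⟨f1, f2⟩ := dist_claimed_foldl_le hδ C.gates 0 hgates
  have f3 := hδ none _ _ hlink
  rw [Nat.zero_add, hstart] at f1
  rw [Nat.zero_add] at f2
  change QState.dist _ (C.output O x) ≤ _ at f1
  have f4 : QState.dist (claimed G m C.width (layerCode true C.gates.length))
      (Step.apply O none (C.output O x)) ≤ δ + C.gates.length * δ :=
    (QState.dist_triangle _ _ _).trans
      (add_le_add f3 ((Step.dist_apply (O := O) none _ _).trans_le f1))
  rw [← dist_foldr_apply (O := O) C.gates] at f4
  have f5 := (QState.dist_triangle _ _ _).trans (add_le_add f2 f4)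
  have f6 := (QState.norm_sub_le_dist _ _ fun i : Fin C.width => x.getD i false).trans f5
  rw [QCircuit.foldr_output] at f6
  exact f6.trans_eq (by ring)

/-- If the acceptance probability of the circuit is small, then a noticeable fraction of the tests
fails. -/
theorem soundness_test {n : ℕ} (C : QCircuit n) (x : List Bool) (hC : C.acceptProb O x ≤ 1 / 3)
    (hm : 400 ≤ 2 * m) (hT : 2 * C.gates.length + 1 ≤ 2 * m)
    (hB : ∀ r : Fin (2 * m) → Bool, r ∉ B → TestOK O (2 * m) G C x (List.ofFn r)) :
    2 ^ (2 * m) ≤ B.card * (2 * m) ^ 4 := by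
  by_contra hlt
  rw [not_le] at hlt
  have hBc : B.card < 2 ^ (2 * m) := by
    refine lt_of_le_of_lt ?_ hlt
    exact Nat.le_mul_of_pos_right _ (by positivity)
  -- The conditions on the first and the last layer do not involve the point; one successful point
  -- yields them.
  obtain ⟨r₀, hr₀⟩ : ∃ r₀, r₀ ∉ B := by
    by_contra hall
    push Not at hall
    have : B = Finset.univ := Finset.eq_univ_iff_forall.2 hall
    rw [this] at hBc
    simp at hBc
  obtain ⟨⟨⟨hstart, -⟩, -⟩, hfinal⟩ := hB r₀ hr₀
  set x₀ : Fin C.width → Bool := fun i => x.getD i false with hx₀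
  have hstart := InitOK.claimed_eq (by omega) (z₀ := x₀) hstart
  have hfinal := FinalOK.lt_re (by omega) (z := x₀) hfinal
  set M : ℝ := 2 * m with hM
  have hM0 : (400 : ℝ) ≤ M := by rw [hM]; exact_mod_cast hm
  -- Density of `B` below `M ^ (-4)` gives this distance per step. With at most `M` steps the total
  -- error is at most `4 / M ≤ 1 / 100`, which explains the bound `400`.
  set δ : ℝ := 4 / M ^ 2 with hδ
  have hdist : ∀ (s : Step C.width) (l l' : List Bool), (∀ r : Fin (2 * m) → Bool, r ∉ B →
      StepChecked O (2 * m) G s l l' (List.ofFn r)) →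
      QState.dist (claimed G m C.width l') (s.apply O (claimed G m C.width l)) ≤ δ := by
    intro s l l' h
    refine (dist_claimed_le (by omega) B h).trans ?_
    have hsq : Real.sqrt ((B.card : ℝ) / 2 ^ (2 * m)) ≤ 1 / M ^ 2 := by
      refine Real.sqrt_le_iff.2 ⟨by positivity, ?_⟩
      rw [div_le_iff₀ (by positivity), div_pow, one_pow, ← pow_mul, div_mul_eq_mul_div, one_mul,
        le_div_iff₀ (by positivity)]
      have : (B.card : ℝ) * (2 * m) ^ 4 < 2 ^ (2 * m) := by exact_mod_cast hlt
      exact this.le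
    calc _ ≤ 4 * (1 / M ^ 2) := mul_le_mul_of_nonneg_left hsq (by norm_num)
      _ = δ := by rw [hδ]; ring
  have f6 := norm_claimed_sub_le C x hdist hstart (fun r hr => (hB r hr).1.1.2)
    fun r hr => (hB r hr).1.2
  have f7 : (2 * C.gates.length + 1 : ℝ) * δ ≤ 1 / 100 := by
    have : (2 * C.gates.length + 1 : ℝ) ≤ M := by rw [hM]; exact_mod_cast hT
    calc _ ≤ M * δ := mul_le_mul_of_nonneg_right this (by positivity)
      _ = 4 / M := by rw [hδ]; field_simp
      _ ≤ 1 / 100 := by rw [div_le_div_iff₀ (by positivity) (by norm_num)]; linarith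
  have f8 := (Complex.abs_re_le_norm _).trans (f6.trans f7)
  rw [Complex.sub_re, Complex.ofReal_re] at f8
  -- The contradiction is `-0.32 < 2 p - 1 + 0.01 ≤ -1 / 3 + 0.01`.
  have := (abs_le.1 f8).2
  linarith

end Soundness

end OracleComplexity


/-! ### Honest claims: partition by weights and exact coefficients. -/

namespace OracleComplexity

/-! ### Subdividing an interval according to weights -/

section Tree

variable {W : List Bool → ℕ} {w : ℕ}

/-- The total weight of the extensions by `k` bits of a list that is given in reverse. -/
def subtreeWeight (W : List Bool → ℕ) : ℕ → List Bool → ℕ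
  | 0, rp => W rp.reverse
  | k + 1, rp => subtreeWeight W k (false :: rp) + subtreeWeight W k (true :: rp)

/-- The total weight of the lists of length `w` that precede the extensions of a list that is given
in reverse. -/
def weightBefore (W : List Bool → ℕ) (w : ℕ) : List Bool → ℕ
  | [] => 0
  | false :: rp => weightBefore W w rp
  | true :: rp => weightBefore W w rp + subtreeWeight W (w - rp.length - 1) (false :: rp)

theorem subtreeWeight_eq_sum (k : ℕ) (rp : List Bool) :
    subtreeWeight W k rp = ∑ f : Fin k → Bool, W (rp.reverse ++ List.ofFn f) := by
  induction k generalizing rp with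
  | zero => simp [subtreeWeight]
  | succ k ih =>
    rw [← (Fin.consEquiv fun _ => Bool).sum_comp, Fintype.sum_prod_type, Fintype.sum_bool,
      subtreeWeight, ih, ih, add_comm]
    simp [Fin.consEquiv, List.ofFn_succ]

/-- Walking down the tree and turning at each split point according to `r`; this is how the honest
prover locates a sample point. -/
theorem exists_weightBefore_le {r : ℕ} (k : ℕ) (rp : List Bool) (hk : k + rp.length = w)
    (h1 : weightBefore W w rp ≤ r) (h2 : r < weightBefore W w rp + subtreeWeight W k rp) :
    ∃ z : List Bool, z.length = k ∧ weightBefore W w (z.reverse ++ rp) ≤ r ∧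
      r < weightBefore W w (z.reverse ++ rp) + W (rp.reverse ++ z) := by
  induction k generalizing rp with
  | zero => exact ⟨[], rfl, by simpa using h1, by simpa [subtreeWeight] using h2⟩
  | succ k ih =>
    have hw : w - rp.length - 1 = k := by omega
    rw [subtreeWeight] at h2
    by_cases hr : r < weightBefore W w rp + subtreeWeight W k (false :: rp)
    · obtain ⟨z, hz, e1, e2⟩ := ih (false :: rp) (by simp; omega) h1 hr
      exact ⟨false :: z, by simp [hz], by simpa using e1, by simpa using e2⟩
    · obtain ⟨z, hz, e1, e2⟩ := ih (true :: rp) (by simp; omega)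
        (by rw [weightBefore, hw]; omega) (by rw [weightBefore, hw]; omega)
      exact ⟨true :: z, by simp [hz], by simpa using e1, by simpa using e2⟩

/-- The honest split at a prefix is the place where the extensions by `true` begin. The invariant is
that the current interval covers exactly the weights of the extensions of the prefix. -/
theorem descend_weight {G : List Bool → List Bool} {l : List Bool}
    (hG : ∀ rp : List Bool, rp.length < w →
      val (G (rp ++ false :: l)) = weightBefore W w (true :: rp))
    (z rp lo hi : List Bool) (hz : z.length + rp.length = w)
    (hlo : val lo = weightBefore W w rp)
    (hhi : val hi = weightBefore W w rp + subtreeWeight W z.length rp) :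
    DescendOK G z (rp ++ false :: l) lo hi ∧
      val (descend G z (rp ++ false :: l) lo hi).1 = weightBefore W w (z.reverse ++ rp) ∧
      val (descend G z (rp ++ false :: l) lo hi).2 =
        weightBefore W w (z.reverse ++ rp) + W (rp.reverse ++ z) := by
  induction z generalizing rp lo hi with
  | nil => simpa [DescendOK, descend, subtreeWeight, hlo] using hhi
  | cons b z ih =>
    rw [List.length_cons] at hz hhi
    have hw : w - rp.length - 1 = z.length := by omega
    have hmid := hG rp (by omega)
    have hmid' := hmid
    rw [weightBefore, hw] at hmid'
    rw [subtreeWeight] at hhi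
    cases b
    · have := ih (false :: rp) lo (G (rp ++ false :: l)) (by simp; omega) hlo hmid'
      simp only [DescendOK, descend, cond_false]
      simpa [show val lo ≤ val (G (rp ++ false :: l)) by omega,
        show val (G (rp ++ false :: l)) ≤ val hi by omega] using this
    · have := ih (true :: rp) (G (rp ++ false :: l)) hi (by simp; omega) hmid
        (by rw [← hmid]; omega)
      simp only [DescendOK, descend, cond_true]
      simpa [show val lo ≤ val (G (rp ++ false :: l)) by omega,
        show val (G (rp ++ false :: l)) ≤ val hi by omega] using this

end Tree

/-! ### Exact amplitudes -/

section Lift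

variable {O : Oracle} {w : ℕ}

/-- Coefficients of amplitudes with respect to powers of `ω`, before and after a step. -/
def Step.lift (O : Oracle) : Step w → ((Fin w → Bool) → ℕ → ℤ) → (Fin w → Bool) → ℕ → ℤ
  | some (.H q), a => fun z j =>
      (a (Function.update z q false) (j + 7) + a (Function.update z q false) (j + 1) +
        (if z q then -1 else 1) *
          (a (Function.update z q true) (j + 7) + a (Function.update z q true) (j + 1))) / 2
  | some (.T q), a => fun z j => a z (j + if z q then 7 else 0)
  | some (.CNOT c t _), a => fun z => a (Function.update z t (xor (z t) (z c)))
  | some (.oracle ws), a => fun z j => a z (j + if O (ws.map z) then 4 else 0)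
  | none, a => fun z j => a z (7 * j + if (List.ofFn z).headD false then 4 else 0)

/-- Coefficients of a state whose amplitudes are multiplied with `2 ^ m`; they are divisible by
`2 ^ k`. -/
structure Lifted (m k : ℕ) (a : (Fin w → Bool) → ℕ → ℤ) : Prop where
  anti : ∀ z j, a z (j + 4) = -a z j
  dvd : ∀ z j, 2 ^ k ∣ a z j
  norm : ∑ z, ∑ j ∈ Finset.range 4, a z j ^ 2 = 2 ^ (2 * m)

variable {m k : ℕ} {a : (Fin w → Bool) → ℕ → ℤ}

theorem Lifted.two_mul_lift_hadamard (h : Lifted m (k + 1) a) (q : Fin w) (z : Fin w → Bool)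
    (j : ℕ) : 2 * Step.lift O (some (.H q)) a z j =
      a (Function.update z q false) (j + 7) + a (Function.update z q false) (j + 1) +
        (if z q then -1 else 1) *
          (a (Function.update z q true) (j + 7) + a (Function.update z q true) (j + 1)) := by
  refine Int.mul_ediv_cancel' ?_
  have h2 : ∀ z j, (2 : ℤ) ∣ a z j := fun z j => (dvd_pow_self 2 (by omega)).trans (h.dvd z j)
  exact ((h2 _ _).add (h2 _ _)).add (((h2 _ _).add (h2 _ _)).mul_left _)

/-- The coefficients themselves undergo an isometry. Multiplication by `ω` is an orthogonal map `S`
of the coefficients with `S ^ 4 = -1`. Hence `(S + S⁻¹) ^ 2 = 2`, and `(S + S⁻¹) / 2` is `1 / √2`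
times an orthogonal map, as the Hadamard gate requires. The other steps permute coefficients up to
sign. -/
theorem Lifted.sum_sq_lift (h : Lifted m (k + 1) a) (s : Step w) (z : Fin w → Bool) :
    ∑ j ∈ Finset.range 4, s.lift O a z j ^ 2 +
        ∑ j ∈ Finset.range 4, s.lift O a (s.partner z) j ^ 2 =
      ∑ j ∈ Finset.range 4, a z j ^ 2 + ∑ j ∈ Finset.range 4, a (s.partner z) j ^ 2 := by
  have anti := h.anti
  have sq : ∀ z j, a z (j + 4) ^ 2 = a z j ^ 2 := fun z j => by rw [anti, neg_sq]
  rcases s with _ | q | q | ⟨c, t, hct⟩ | ws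
  · have e : ∀ z, ∑ j ∈ Finset.range 4, Step.lift O none a z j ^ 2 =
        ∑ j ∈ Finset.range 4, a z j ^ 2 := by
      intro z
      have h0 := sq z 0; have h1 := sq z 1; have h2 := sq z 2; have h3 := sq z 3
      have h4 := sq z 4; have h5 := sq z 5; have h6 := sq z 6; have h7 := sq z 7
      have h8 := sq z 8; have h9 := sq z 9; have h10 := sq z 10; have h11 := sq z 11
      have h13 := sq z 13; have h14 := sq z 14; have h17 := sq z 17; have h21 := sq z 21
      have h18 := sq z 18
      simp only [Step.lift, Finset.sum_range_succ, Finset.sum_range_zero]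
      norm_num at *
      split_ifs <;> norm_num <;> linarith
    rw [e, e]
  · have e := fun z j => h.two_mul_lift_hadamard (O := O) q z j
    have key : ∀ z, z q = false →
        ∑ j ∈ Finset.range 4, Step.lift O (some (.H q)) a z j ^ 2 +
          ∑ j ∈ Finset.range 4, Step.lift O (some (.H q)) a (Function.update z q true) j ^ 2 =
        ∑ j ∈ Finset.range 4, a z j ^ 2 +
          ∑ j ∈ Finset.range 4, a (Function.update z q true) j ^ 2 := by
      intro z hz
      have hu : Function.update z q false = z := by rw [← hz, Function.update_eq_self]
      have e1 := e z
      have e2 := e (Function.update z q true)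
      simp only [hz, hu, Function.update_idem, Function.update_self, Bool.false_eq_true, if_true,
        if_false] at e1 e2
      have per : ∀ z j, a z (j + 8) = a z j := fun z j => by
        rw [show j + 8 = j + 4 + 4 by omega, anti, anti, neg_neg]
      generalize Step.lift O (some (.H q)) a z = n0 at *
      generalize Step.lift O (some (.H q)) a (Function.update z q true) = n1 at *
      have g0 := anti z
      have g1 := anti (Function.update z q true)
      have p0 := per z
      have p1 := per (Function.update z q true)
      generalize a z = o0 at *
      generalize a (Function.update z q true) = o1 at *
      have a0 : 2 * n0 0 = -o0 3 + o0 1 + (-o1 3 + o1 1) := by linarith [e1 0, g0 3, g1 3]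
      have a1 : 2 * n0 1 = o0 0 + o0 2 + (o1 0 + o1 2) := by linarith [e1 1, p0 0, p1 0]
      have a2 : 2 * n0 2 = o0 1 + o0 3 + (o1 1 + o1 3) := by linarith [e1 2, p0 1, p1 1]
      have a3 : 2 * n0 3 = o0 2 - o0 0 + (o1 2 - o1 0) := by
        linarith [e1 3, p0 2, p1 2, g0 0, g1 0]
      have b0 : 2 * n1 0 = -o0 3 + o0 1 - (-o1 3 + o1 1) := by linarith [e2 0, g0 3, g1 3]
      have b1 : 2 * n1 1 = o0 0 + o0 2 - (o1 0 + o1 2) := by linarith [e2 1, p0 0, p1 0]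
      have b2 : 2 * n1 2 = o0 1 + o0 3 - (o1 1 + o1 3) := by linarith [e2 2, p0 1, p1 1]
      have b3 : 2 * n1 3 = o0 2 - o0 0 - (o1 2 - o1 0) := by
        linarith [e2 3, p0 2, p1 2, g0 0, g1 0]
      simp only [Finset.sum_range_succ, Finset.sum_range_zero]
      refine mul_left_cancel₀ (show (4 : ℤ) ≠ 0 by norm_num) ?_
      have hsq : ∀ {x y : ℤ}, 2 * x = y → 4 * x ^ 2 = y ^ 2 := by rintro x _ rfl; ring
      linear_combination hsq a0 + hsq a1 + hsq a2 + hsq a3 + hsq b0 + hsq b1 + hsq b2 + hsq b3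
    cases hz : z q
    · simpa [Step.partner, hz] using key z hz
    · have := key (Function.update z q false) (by simp)
      rw [Function.update_idem, show Function.update z q true = z by
        rw [← hz, Function.update_eq_self]] at this
      simp only [Step.partner, hz, Bool.not_true]
      linarith
  · have e : ∀ z, ∑ j ∈ Finset.range 4, Step.lift O (some (.T q)) a z j ^ 2 =
        ∑ j ∈ Finset.range 4, a z j ^ 2 := by
      intro z
      have h0 := sq z 0; have h1 := sq z 1; have h2 := sq z 2; have h3 := sq z 3
      have h4 := sq z 4; have h5 := sq z 5; have h6 := sq z 6
      simp only [Step.lift, Finset.sum_range_succ, Finset.sum_range_zero]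
      norm_num at *
      split_ifs <;> norm_num <;> linarith
    rw [e, e]
  · have := Step.partner_involutive (some (.CNOT c t hct)) z
    simp only [Step.lift, Step.partner] at this ⊢
    rw [this]
    ring
  · have e : ∀ z, ∑ j ∈ Finset.range 4, Step.lift O (some (.oracle ws)) a z j ^ 2 =
        ∑ j ∈ Finset.range 4, a z j ^ 2 := by
      intro z
      simp only [Step.lift]
      split_ifs <;> simp [sq]
    rw [e, e]

/-- One factor `2` is given up per step to pay for the halving in a Hadamard gate; the other gates
would not need it. -/
theorem Lifted.lift (h : Lifted m (k + 1) a) (s : Step w) : Lifted m k (s.lift O a) where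
  anti z j := by
    rcases s with _ | q | q | ⟨c, t, hct⟩ | ws
    · have e : ∀ n, a z (7 * (j + 4) + n) = -a z (7 * j + n) := fun n => by
        rw [show 7 * (j + 4) + n = 7 * j + n + 4 + 4 + 4 + 4 + 4 + 4 + 4 by ring]
        simp only [h.anti, neg_neg]
      exact e _
    · have e1 := h.two_mul_lift_hadamard (O := O) q z (j + 4)
      have e2 := h.two_mul_lift_hadamard (O := O) q z j
      have e : ∀ z i, a z (j + 4 + i) = -a z (j + i) := fun z i => by
        rw [show j + 4 + i = j + i + 4 by ring, h.anti]
      rw [e, e, e, e] at e1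
      linarith
    · change a z (j + 4 + _) = -a z (j + _)
      rw [← h.anti]; congr 1; omega
    · exact h.anti _ _
    · change a z (j + 4 + _) = -a z (j + _)
      rw [← h.anti]; congr 1; omega
  dvd z j := by
    have hd : ∀ z j, (2 : ℤ) ^ k ∣ a z j := fun z j => (pow_dvd_pow 2 (by omega)).trans (h.dvd z j)
    rcases s with _ | q | q | ⟨c, t, hct⟩ | ws
    · exact hd _ _
    · have e := h.two_mul_lift_hadamard (O := O) q z j
      refine Int.dvd_of_mul_dvd_mul_left (a := 2) (by norm_num) ?_
      rw [e, ← pow_succ']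
      exact ((h.dvd _ _).add (h.dvd _ _)).add (((h.dvd _ _).add (h.dvd _ _)).mul_left _)
    · exact hd _ _
    · exact hd _ _
    · exact hd _ _
  norm := by
    have hs := Finset.sum_congr (rfl : (Finset.univ : Finset (Fin w → Bool)) = Finset.univ)
      fun z _ => h.sum_sq_lift (O := O) s z
    rw [Finset.sum_add_distrib, Finset.sum_add_distrib,
      s.sum_partner _ (fun _ _ => Finset.mem_univ _)
        (fun z => ∑ j ∈ Finset.range 4, s.lift O a z j ^ 2),
      s.sum_partner _ (fun _ _ => Finset.mem_univ _)
        (fun z => ∑ j ∈ Finset.range 4, a z j ^ 2), h.norm] at hs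
    linarith

/-- The honest side of the equations. Everything follows from the sign rule for shifts by `4`;
divisibility by `2` enters only to make the halving in the Hadamard step exact. -/
theorem Lifted.eqs (h : Lifted m (k + 1) a) (s : Step w) (z : Fin w → Bool) {p : ℕ → ℕ → ℕ}
    (h0 : signed (p 0) = a (s.pair z).1) (h1 : signed (p 1) = a (s.pair z).2)
    (h2 : signed (p 2) = s.lift O a (s.pair z).1) (h3 : signed (p 3) = s.lift O a (s.pair z).2) :
    ∀ e ∈ s.eqs O z, evalTerms p e = 0 := by
  have anti := h.anti
  rcases s with _ | q | q | ⟨c, t, hct⟩ | ws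
  · have g := anti z
    simp only [Step.eqs, conjEqs_eq, List.forall_mem_cons, evalTerms, List.map_cons, List.map_nil,
      List.sum_cons, List.sum_nil, h0, h1, h2, h3, Step.pair, Step.lift]
    have c0 := g 0; have c1 := g 1; have c2 := g 2; have c3 := g 3; have c4 := g 4
    have c5 := g 5; have c6 := g 6; have c7 := g 7; have c8 := g 8; have c9 := g 9
    have c10 := g 10; have c11 := g 11; have c12 := g 12; have c13 := g 13; have c14 := g 14
    have c17 := g 17; have c18 := g 18; have c21 := g 21
    rcases Bool.eq_false_or_eq_true ((List.ofFn z).headD false) with hb | hb <;>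
      simp only [hb, Bool.false_eq_true, if_true, if_false] <;> norm_num at c0 c1 c2 c3 c4 c5 c6 c7 c8 c9 c10 c11 c12 c13 c14 c17 c18 c21 ⊢ <;>
      refine ⟨?_, ?_, ?_, ?_⟩ <;> linarith
  · have g0 := anti (Function.update z q false)
    have g1 := anti (Function.update z q true)
    have e1 := h.two_mul_lift_hadamard (O := O) q (Function.update z q false)
    have e2 := h.two_mul_lift_hadamard (O := O) q (Function.update z q true)
    simp only [Function.update_idem, Function.update_self, Bool.false_eq_true, if_true,
      if_false] at e1 e2
    simp only [Step.eqs, hadamardEqs, List.range, List.range.loop, List.flatMap_cons,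
      List.flatMap_nil, List.cons_append, List.nil_append, List.forall_mem_cons, evalTerms,
      List.map_cons, List.map_nil, List.sum_cons, List.sum_nil, h0, h1, h2, h3, Step.pair]
    refine ⟨?_, ?_, ?_, ?_, ?_, ?_, ?_, ?_, by simp⟩
    · linarith [e1 0, g0 3, g0 1, g1 3, g1 1]
    · linarith [e2 0, g0 3, g0 1, g1 3, g1 1]
    · linarith [e1 1, g0 4, g0 2, g1 4, g1 2]
    · linarith [e2 1, g0 4, g0 2, g1 4, g1 2]
    · linarith [e1 2, g0 5, g0 3, g1 5, g1 3]
    · linarith [e2 2, g0 5, g0 3, g1 5, g1 3]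
    · linarith [e1 3, g0 6, g0 4, g1 6, g1 4]
    · linarith [e2 3, g0 6, g0 4, g1 6, g1 4]
  · have g := anti z
    simp only [Step.eqs, phaseEqs_eq, List.forall_mem_cons, evalTerms, List.map_cons, List.map_nil,
      List.sum_cons, List.sum_nil, h0, h1, h2, h3, Step.pair, Step.lift]
    rcases Bool.eq_false_or_eq_true (z q) with hb | hb <;>
      simp only [hb, Bool.false_eq_true, if_true, if_false] <;>
      refine ⟨?_, ?_, ?_, ?_, ?_, ?_, ?_, ?_, by simp⟩
    all_goals linarith [g 0, g 1, g 2, g 3, g 7, g 8, g 9, g 10]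
  · have hp := Step.partner_involutive (some (.CNOT c t hct)) z
    simp only [Step.partner] at hp
    simp only [Step.eqs, swapEqs, List.range, List.range.loop, List.flatMap_cons,
      List.flatMap_nil, List.cons_append, List.nil_append, List.forall_mem_cons, evalTerms,
      List.map_cons, List.map_nil, List.sum_cons, List.sum_nil, h0, h1, h2, h3, Step.pair,
      Step.lift, hp, anti]
    simp
  · have g := anti z
    simp only [Step.eqs, phaseEqs_eq, List.forall_mem_cons, evalTerms, List.map_cons, List.map_nil,
      List.sum_cons, List.sum_nil, h0, h1, h2, h3, Step.pair, Step.lift]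
    rcases Bool.eq_false_or_eq_true (O (ws.map z)) with hb | hb <;>
      simp only [hb, Bool.false_eq_true, if_true, if_false] <;>
      refine ⟨?_, ?_, ?_, ?_, ?_, ?_, ?_, ?_, by simp⟩
    all_goals linarith [g 0, g 1, g 2, g 3, g 4, g 5, g 6, g 7]

end Lift

end OracleComplexity


/-! ### The honest prover passes the test for every sample point. -/

namespace OracleComplexity

/-! ### The honest prover -/

section Honest

variable {O : Oracle} {w m : ℕ}

theorem Lifted.foldl (gs : List (Gate w)) {k : ℕ} {a : (Fin w → Bool) → ℕ → ℤ}
    (h : Lifted m (k + gs.length) a) :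
    Lifted m k (gs.foldl (fun a g => Step.lift O (some g) a) a) := by
  induction gs generalizing a with
  | nil => exact h
  | cons g gs ih => exact ih (Lifted.lift (k := k + gs.length) h (some g))

theorem Lifted.foldr (gs : List (Gate w)) {k : ℕ} {a : (Fin w → Bool) → ℕ → ℤ}
    (h : Lifted m (k + gs.length) a) :
    Lifted m k (gs.foldr (fun g a => Step.lift O (some g) a) a) := by
  induction gs generalizing k with
  | nil => exact h
  | cons g gs ih =>
    exact (ih (k := k + 1) (by rwa [add_right_comm, add_assoc, ← List.length_cons])).lift (some g)

theorem Lifted.mono {k k' : ℕ} (hk : k ≤ k') {a : (Fin w → Bool) → ℕ → ℤ} (h : Lifted m k' a) :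
    Lifted m k a :=
  ⟨h.anti, fun z j => (pow_dvd_pow 2 hk).trans (h.dvd z j), h.norm⟩

/-- Coefficients of a basis state, multiplied with `2 ^ m`. -/
def basisCoeff (m : ℕ) (z₀ : Fin w → Bool) (z : Fin w → Bool) (j : ℕ) : ℤ :=
  if z = z₀ then if j % 8 = 0 then 2 ^ m else if j % 8 = 4 then -2 ^ m else 0 else 0

theorem lifted_basisCoeff (z₀ : Fin w → Bool) : Lifted m m (basisCoeff m z₀) where
  anti z j := by
    unfold basisCoeff
    split_ifs <;> omega
  dvd z j := by
    unfold basisCoeff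
    split_ifs <;> simp
  norm := by
    rw [Finset.sum_eq_single z₀]
    · simp [basisCoeff, Finset.sum_range_succ, ← pow_mul, mul_comm m 2]
    · intro z _ hz
      simp [basisCoeff, hz]
    · simp

variable {n : ℕ}

/-- Coefficients of the state of a layer of the computation. -/
def layerCoeff (O : Oracle) (m : ℕ) (C : QCircuit n) (x : List Bool) (b : Bool) (t : ℕ) :
    (Fin C.width → Bool) → ℕ → ℤ :=
  bif b then
    (C.gates.drop t).foldr (fun g a => Step.lift O (some g) a)
      (Step.lift O none (C.gates.foldl (fun a g => Step.lift O (some g) a)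
        (basisCoeff m fun i => x.getD i false)))
  else (C.gates.take t).foldl (fun a g => Step.lift O (some g) a)
    (basisCoeff m fun i => x.getD i false)

variable {C : QCircuit n} {x : List Bool}

/-- The start has `m` factors `2` to spare and there are `2 T + 1` steps for `T` gates. One factor
is left in every layer, so that the next step is exact too. -/
theorem lifted_layerCoeff (hm : 2 * C.gates.length + 2 ≤ m) (b : Bool) (t : ℕ) :
    Lifted m 1 (layerCoeff O m C x b t) := by
  cases b
  · refine Lifted.foldl _ ((lifted_basisCoeff _).mono ?_)
    rw [List.length_take]
    omega
  · refine Lifted.foldr _ (Lifted.lift (Lifted.foldl _ ((lifted_basisCoeff _).mono ?_)) none)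
    rw [List.length_drop]
    omega

section Layer

variable {G : List Bool → List Bool} {l l' : List Bool} {a : (Fin w → Bool) → ℕ → ℤ} {k : ℕ}

/-- The squared norm of the coefficients of a basis state. -/
def weight (a : (Fin w → Bool) → ℕ → ℤ) (z : List Bool) : ℕ :=
  ∑ j ∈ Finset.range 8, (a (fun i => z.getD i false) j).toNat ^ 2

theorem ofFn_getD {z : List Bool} (hz : z.length = w) :
    List.ofFn (fun i : Fin w => z.getD i false) = z := by
  have := TProg.padTake_eq_take (n := w) (l := z) hz.ge
  rw [padTake] at this
  rw [this, List.take_of_length_le hz.le]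

theorem getD_ofFn' (z : Fin w → Bool) : (fun i : Fin w => (List.ofFn z).getD i false) = z :=
  List.ofFn_injective (ofFn_getD (by simp))

/-- Positions `j` and `j + 4` hold the positive and the negative part of the same integer, of which
at least one is zero. The eight squares therefore sum to the four squared signed coefficients. -/
theorem Lifted.sum_weight (h : Lifted m k a) :
    ∑ z : Fin w → Bool, weight a (List.ofFn z) = 2 ^ (2 * m) := by
  have e : ∀ z : Fin w → Bool, (weight a (List.ofFn z) : ℤ) = ∑ j ∈ Finset.range 4, a z j ^ 2 := by
    intro z
    have hsq : ∀ x : ℤ, (x.toNat : ℤ) ^ 2 + ((-x).toNat : ℤ) ^ 2 = x ^ 2 := fun x => by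
      rcases le_total 0 x with hx | hx
      · rw [Int.toNat_of_nonneg hx, Int.toNat_of_nonpos (neg_nonpos.2 hx)]; simp
      · rw [Int.toNat_of_nonneg (neg_nonneg.2 hx), Int.toNat_of_nonpos hx]; simp
    rw [weight, getD_ofFn']
    simp only [Finset.sum_range_succ, Finset.sum_range_zero, ← hsq (a z _), ← h.anti]
    push_cast
    ring
  have := h.norm
  rw [← Finset.sum_congr rfl fun z _ => e z] at this
  exact_mod_cast this

theorem Lifted.subtreeWeight_nil (h : Lifted m k a) :
    subtreeWeight (weight a) w [] = 2 ^ (2 * m) := by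
  rw [subtreeWeight_eq_sum, ← h.sum_weight]
  rfl

/-- `G` answers truthfully all questions about the layer with code `l`, whose coefficients are
`a`. -/
structure Truthful (m : ℕ) (G : List Bool → List Bool) (l : List Bool)
    (a : (Fin w → Bool) → ℕ → ℤ) : Prop where
  coeff : ∀ (z : Fin w → Bool), ∀ j < 8, val (leafVal G l (List.ofFn z) j) = (a z j).toNat
  split : ∀ rp : List Bool, rp.length < w →
    val (G (rp ++ false :: l)) = weightBefore (weight a) w (true :: rp)
  sample : ∀ r : List Bool, r.length = 2 * m →
    weightBefore (weight a) w (List.ofFn (sampleState G w l r)).reverse ≤ val r ∧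
      val r < weightBefore (weight a) w (List.ofFn (sampleState G w l r)).reverse +
        weight a (List.ofFn (sampleState G w l r))

theorem Truthful.leafIvl_eq (h : Truthful m G l a) (ha : Lifted m k a) (z : Fin w → Bool) :
    DescendOK G (List.ofFn z) (false :: l) [] (topNumber (2 * m)) ∧
      val (leafIvl (2 * m) G l (List.ofFn z)).1 =
        weightBefore (weight a) w (List.ofFn z).reverse ∧
      val (leafIvl (2 * m) G l (List.ofFn z)).2 =
        weightBefore (weight a) w (List.ofFn z).reverse + weight a (List.ofFn z) := by
  have := descend_weight h.split (List.ofFn z) [] [] (topNumber (2 * m)) (by simp) rfl (by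
    rw [val_topNumber, List.length_ofFn, ha.subtreeWeight_nil]; simp [weightBefore])
  simpa [leafIvl] using this

theorem Truthful.sum_leafVal_sq (h : Truthful m G l a) (z : Fin w → Bool) :
    ∑ j ∈ Finset.range 8, val (leafVal G l (List.ofFn z) j) ^ 2 = weight a (List.ofFn z) := by
  rw [weight, getD_ofFn']
  exact Finset.sum_congr rfl fun j hj => by rw [h.coeff z j (Finset.mem_range.1 hj)]

theorem Truthful.leafOK (hm : 0 < m) (h : Truthful m G l a) (ha : Lifted m k a)
    (z : Fin w → Bool) : LeafOK (2 * m) G l (List.ofFn z) := by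
  obtain ⟨h1, h2, h3⟩ := h.leafIvl_eq ha z
  have hb := (descend_bounds _ _ _ _ h1 (by simp [val])).2.2
  change val (leafIvl (2 * m) G l (List.ofFn z)).2 ≤ _ at hb
  rw [val_topNumber] at hb
  have hs := h.sum_leafVal_sq z
  refine ⟨h1, fun j hj => ?_, ?_⟩
  · have : val (leafVal G l (List.ofFn z) j) ^ 2 ≤ weight a (List.ofFn z) := by
      rw [← hs]
      exact Finset.single_le_sum (f := fun j => val (leafVal G l (List.ofFn z) j) ^ 2)
        (fun _ _ => Nat.zero_le _) (Finset.mem_range.2 hj)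
    exact (Nat.le_self_pow two_ne_zero _).trans (this.trans (by omega))
  · rw [hs, h2, ← h3, Nat.mod_eq_of_lt]
    exact hb.trans_lt (Nat.pow_lt_pow_right (by norm_num) (by omega))

theorem Lifted.signed_toNat (ha : Lifted m k a) (h : Truthful m G l a) (z : Fin w → Bool) :
    signed (fun j => val (leafVal G l (List.ofFn z) j)) = a z := by
  have per : ∀ i j, a z (j + 8 * i) = a z j := fun i j => by
    induction i with
    | zero => rfl
    | succ i ih => rw [← ih, show j + 8 * (i + 1) = j + 8 * i + 4 + 4 by ring, ha.anti, ha.anti,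
        neg_neg]
  have hmod : ∀ j, a z (j % 8) = a z j := fun j => by
    rw [← per (j / 8) (j % 8), Nat.mod_add_div]
  funext j
  rw [signed, h.coeff z _ (Nat.mod_lt _ (by omega)), h.coeff z _ (Nat.mod_lt _ (by omega)), hmod,
    hmod, ha.anti, Int.toNat_sub_toNat_neg]

theorem Truthful.sampled (h : Truthful m G l a) (hm : 0 < m) (ha : Lifted m k a)
    {r : List Bool} (hr : r.length = 2 * m) :
    LeafOK (2 * m) G l (List.ofFn (sampleState G w l r)) ∧
      InIvl (2 * m) G l (List.ofFn (sampleState G w l r)) r := by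
  refine ⟨h.leafOK hm ha _, ?_⟩
  obtain ⟨-, h2, h3⟩ := h.leafIvl_eq ha (sampleState G w l r)
  rw [InIvl, h2, h3]
  exact h.sample r hr

theorem Truthful.stepOK {s : Step w} (hm : 0 < m) (h : Truthful m G l a)
    (h' : Truthful m G l' (s.lift O a)) (ha : Lifted m (k + 1) a) (z : Fin w → Bool) :
    StepOK O (2 * m) G s l l' z := by
  have ha' := ha.lift (O := O) s
  exact ⟨⟨h.leafOK hm ha _, h.leafOK hm ha _, h'.leafOK hm ha' _, h'.leafOK hm ha' _⟩,
    ha.eqs s z (ha.signed_toNat h _) (ha.signed_toNat h _) (ha'.signed_toNat h' _)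
      (ha'.signed_toNat h' _)⟩

theorem Truthful.stepChecked {s : Step w} (hm : 0 < m) (h : Truthful m G l a)
    (h' : Truthful m G l' (s.lift O a)) (ha : Lifted m (k + 1) a) {r : List Bool}
    (hr : r.length = 2 * m) : StepChecked O (2 * m) G s l l' r :=
  ⟨⟨h.sampled hm ha hr, h.stepOK hm h' ha _⟩, ⟨h'.sampled hm (ha.lift s) hr, h.stepOK hm h' ha _⟩⟩

end Layer

/-- A reply that depends on the layer, the kind and the rest of the message. -/
def replyBy (resp : Bool → ℕ → Bool → List Bool → List Bool) (msg : List Bool) : List Bool :=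
  match msg.reverse.dropWhile id with
  | _ :: b :: k :: M => resp b (msg.reverse.takeWhile id).length k M.reverse
  | _ => []

/-- Read from the end, the layer code starts with the time in unary, delimited by `false`. Every
message is thus uniquely decodable. -/
theorem replyBy_append (resp : Bool → ℕ → Bool → List Bool → List Bool) (M : List Bool)
    (k b : Bool) (t : ℕ) : replyBy resp (M ++ k :: layerCode b t) = resp b t k M := by
  have e : (M ++ k :: layerCode b t).reverse =
      List.replicate t true ++ false :: b :: k :: M.reverse := by
    simp [layerCode]
  have h1 : (List.replicate t true ++ false :: b :: k :: M.reverse).dropWhile id =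
      false :: b :: k :: M.reverse := by
    induction t with
    | zero => rfl
    | succ t ih => simp [List.replicate_succ]
  have h2 : (List.replicate t true ++ false :: b :: k :: M.reverse).takeWhile id =
      List.replicate t true := by
    induction t with
    | zero => rfl
    | succ t ih => simp [List.replicate_succ]
  rw [replyBy, e, h1, h2]
  simp

open Classical in
/-- A list of length `w` whose interval contains `r`. -/
noncomputable def locate (W : List Bool → ℕ) (w r : ℕ) : List Bool :=
  if h : ∃ z : List Bool, z.length = w ∧ weightBefore W w z.reverse ≤ r ∧
    r < weightBefore W w z.reverse + W z then h.choose else []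

/-- Replies according to coefficients `a` of the layers. -/
noncomputable def truthfulReply (m : ℕ) (a : Bool → ℕ → (Fin w → Bool) → ℕ → ℤ) :
    List Bool → List Bool :=
  replyBy fun b t k M =>
    bif k then
      locate (weight (a b t)) w (val M.reverse)
    -- Questions about splits carry a proper prefix, questions about coefficients `w + 3` bits, so
    -- the length tells them apart.
    else if M.length < w then toBits (4 * m) (weightBefore (weight (a b t)) w (true :: M))
    else toBits (4 * m)
      (a b t (fun i => (M.drop 3).reverse.getD i false) (val (M.take 3).reverse)).toNat

theorem le_subtreeWeight (W : List Bool → ℕ) (k : ℕ) (rp : List Bool) (hk : rp.length + k = w) :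
    weightBefore W w rp + subtreeWeight W k rp ≤ subtreeWeight W w [] := by
  induction rp generalizing k with
  | nil => simp at hk; subst hk; simp [weightBefore]
  | cons b rp ih =>
    rw [List.length_cons] at hk
    have := ih (k + 1) (by omega)
    rw [subtreeWeight] at this
    cases b
    · rw [weightBefore]; omega
    · rw [weightBefore, show w - rp.length - 1 = k by omega]; omega

/-- All numbers in the honest table are at most `2 ^ (2 m)`, and a sampled basis state has `w ≤ 4 m`
bits. The cut of replies to `4 m` bits therefore loses nothing. -/
theorem truthful_truthfulReply (hm : 0 < m) (hw : w ≤ 2 * (2 * m))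
    {a : Bool → ℕ → (Fin w → Bool) → ℕ → ℤ} {b : Bool} {t k : ℕ} (ha : Lifted m k (a b t)) :
    Truthful m (fun msg => (truthfulReply m a msg).take (2 * (2 * m))) (layerCode b t) (a b t) := by
  have hlen : ∀ v, (toBits (4 * m) v).take (2 * (2 * m)) = toBits (4 * m) v := fun v =>
    List.take_of_length_le (by simp; omega)
  have hval : ∀ v, v ≤ 2 ^ (2 * m) → val (toBits (4 * m) v) = v := fun v hv => by
    rw [val_toBits, Nat.mod_eq_of_lt]
    exact hv.trans_lt (Nat.pow_lt_pow_right (by norm_num) (by omega))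
  have hbefore : ∀ rp : List Bool, rp.length ≤ w →
      weightBefore (weight (a b t)) w rp ≤ 2 ^ (2 * m) := fun rp h => by
    have := le_subtreeWeight (weight (a b t)) (w - rp.length) rp
      (Nat.add_sub_cancel' h)
    rw [ha.subtreeWeight_nil] at this
    omega
  refine ⟨fun z j hj => ?_, fun rp hrp => ?_, fun r hr => ?_⟩
  · have hle : (a b t z j).toNat ≤ 2 ^ (2 * m) := by
      have h1 : (a b t z j).toNat ^ 2 ≤ weight (a b t) (List.ofFn z) := by
        rw [weight, getD_ofFn']
        exact Finset.single_le_sum (f := fun j => (a b t z j).toNat ^ 2)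
          (fun _ _ => Nat.zero_le _) (Finset.mem_range.2 hj)
      have h2 : weight (a b t) (List.ofFn z) ≤ 2 ^ (2 * m) := by
        rw [← ha.sum_weight]
        exact Finset.single_le_sum (f := fun z : Fin w → Bool => weight (a b t) (List.ofFn z))
          (fun _ _ => Nat.zero_le _) (Finset.mem_univ z)
      exact (Nat.le_self_pow two_ne_zero _).trans (h1.trans h2)
    have hidx : val (indexCode j).reverse = j := by
      interval_cases j <;> rfl
    rw [leafVal, ← List.append_assoc, truthfulReply, replyBy_append]
    simp only [cond_false]
    rw [if_neg (by simp [indexCode]; omega), hlen,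
      show ∀ l, List.drop 3 (indexCode j ++ l) = l from fun _ => rfl,
      show ∀ l, List.take 3 (indexCode j ++ l) = indexCode j from fun _ => rfl, hidx,
      List.reverse_reverse, getD_ofFn', hval _ hle]
  · rw [truthfulReply, replyBy_append]
    simp only [cond_false]
    rw [if_pos hrp, hlen, hval _ (hbefore _ (by simpa using hrp))]
  · have hex := exists_weightBefore_le (W := weight (a b t)) (w := w) (r := val r) w [] (by simp)
      (Nat.zero_le _) (by
        rw [ha.subtreeWeight_nil, weightBefore, zero_add, ← hr]; exact val_lt r)
    simp only [List.append_nil, List.reverse_nil, List.nil_append] at hex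
    have e : List.ofFn (sampleState (fun msg => (truthfulReply m a msg).take (2 * (2 * m))) w
        (layerCode b t) r) = hex.choose := by
      have hz := hex.choose_spec.1
      rw [← ofFn_getD hz]
      congr 1
      funext i
      rw [sampleState, truthfulReply, replyBy_append]
      simp only [cond_true, List.reverse_reverse]
      rw [locate, dif_pos hex, List.take_of_length_le (hz.trans_le hw)]
    rw [e]
    exact hex.choose_spec.2

theorem gatesOK_of_forall {N : ℕ} {G : List Bool → List Bool} {r : List Bool} (gs : List (Gate w))
    (t : ℕ) (h : ∀ (i : ℕ) (hi : i < gs.length),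
      StepChecked O N G (some gs[i]) (layerCode false (t + i)) (layerCode false (t + i + 1)) r ∧
        StepChecked O N G (some gs[i]) (layerCode true (t + i + 1)) (layerCode true (t + i)) r) :
    GatesOK O N G r gs t := by
  induction gs generalizing t with
  | nil => trivial
  | cons g gs ih =>
    refine ⟨h 0 (by simp), ih (t + 1) fun i hi => ?_⟩
    have := h (i + 1) (by simpa using hi)
    rw [show t + (i + 1) = t + 1 + i by ring] at this
    exact this

/-- For a circuit with large acceptance probability there are replies that pass all tests. -/
theorem completeness_test (C : QCircuit n) (x : List Bool) (hC : 2 / 3 ≤ C.acceptProb O x)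
    (hm : 2 * C.gates.length + 2 ≤ m) (hw : C.width ≤ 2 * m) :
    ∃ F : List Bool → List Bool, ∀ r : List Bool, r.length = 2 * m →
      TestOK O (2 * m) (fun msg => (F msg).take (2 * (2 * m))) C x r := by
  set a := layerCoeff O m C x with ha
  have hL : ∀ b t, Lifted m 1 (a b t) := lifted_layerCoeff hm
  have hT := fun b t => truthful_truthfulReply (by omega) (by omega) (hL b t)
  refine ⟨truthfulReply m a, ?_⟩
  set G := fun msg => (truthfulReply m a msg).take (2 * (2 * m)) with hG
  set x₀ : Fin C.width → Bool := fun i => x.getD i false with hx₀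
  have hfirst : ∀ (i : ℕ) (hi : i < C.gates.length),
      a false (i + 1) = Step.lift O (some C.gates[i]) (a false i) := by
    intro i hi
    simp only [ha, layerCoeff, cond_false]
    rw [List.take_add_one, List.getElem?_eq_getElem hi, List.foldl_append]
    rfl
  have hsecond : ∀ (i : ℕ) (hi : i < C.gates.length),
      a true i = Step.lift O (some C.gates[i]) (a true (i + 1)) := by
    intro i hi
    simp only [ha, layerCoeff, cond_true]
    rw [List.drop_eq_getElem_cons hi, List.foldr_cons]
  have hlink : a true C.gates.length = Step.lift O none (a false C.gates.length) := by
    simp only [ha, layerCoeff, cond_true, cond_false]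
    rw [List.drop_length, List.take_length]
    rfl
  have hgates : ∀ r : List Bool, r.length = 2 * m → GatesOK O (2 * m) G r C.gates 0 := by
    intro r hr
    refine gatesOK_of_forall _ _ fun i hi => ?_
    rw [zero_add]
    refine ⟨(hT false i).stepChecked (by omega) ?_ (hL _ _) hr,
      (hT true (i + 1)).stepChecked (by omega) ?_ (hL _ _) hr⟩
    · rw [← hfirst i hi]; exact hT _ _
    · rw [← hsecond i hi]; exact hT _ _
  have hlinked : ∀ r : List Bool, r.length = 2 * m → StepChecked O (2 * m) G
      (none : Step C.width) (layerCode false C.gates.length) (layerCode true C.gates.length) r := by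
    intro r hr
    refine (hT false C.gates.length).stepChecked (by omega) ?_ (hL _ _) hr
    rw [← hlink]; exact hT _ _
  have hstart : InitOK (2 * m) G (List.ofFn x₀) := by
    have h0 := (hT false 0).leafOK (by omega) (hL _ _) x₀
    have hz : ∀ j, 1 ≤ j → j < 8 → val (leafVal G (layerCode false 0) (List.ofFn x₀) j) = 0 := by
      intro j h1 h8
      rw [(hT false 0).coeff x₀ j h8]
      have : a false 0 x₀ j = if j % 8 = 0 then 2 ^ m else if j % 8 = 4 then -2 ^ m else 0 :=
        if_pos rfl
      rw [this, if_neg (by omega)]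
      split_ifs <;> simp
    have hz0 : val (leafVal G (layerCode false 0) (List.ofFn x₀) 0) = 2 ^ m := by
      rw [(hT false 0).coeff x₀ 0 (by omega)]
      have : a false 0 x₀ 0 = 2 ^ m := if_pos rfl
      rw [this]
      exact Int.toNat_natCast (2 ^ m)
    -- The input carries the whole weight `2 ^ (2 m)`, so its interval can only be the full one.
    have hsum := h0.sum_sq (by omega)
    rw [Finset.sum_range_succ', Finset.sum_eq_zero (fun j hj => by
      rw [hz (j + 1) (by omega) (by have := Finset.mem_range.1 hj; omega), zero_pow two_ne_zero]), hz0, ← pow_mul, mul_comm m 2] at hsum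
    have hb := h0.bounds.2
    exact ⟨⟨⟨h0, by omega⟩, by omega⟩, fun j hj => hz (1 + j) (by omega) (by omega)⟩
  have hfinal : FinalOK (2 * m) G (List.ofFn x₀) := by
    have hl := (hT true 0).leafOK (by omega) (hL _ _) x₀
    -- The soundness analysis is reused with no failing points: the claimed amplitude then equals `2
    -- p - 1` exactly, and no separate computation for the honest table is required.
    have hn := norm_claimed_sub_le (δ := 0) C x (fun s l l' h =>
      (dist_claimed_le (by omega) ∅ h).trans_eq (by simp)) (InitOK.claimed_eq (by omega) hstart)
      (fun r _ => hgates _ (by simp)) fun r _ => hlinked _ (by simp)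
    rw [mul_zero, norm_le_zero_iff, sub_eq_zero, claimed_of hl,
      (hL true 0).signed_toNat (hT true 0)] at hn
    have hre := congrArg Complex.re hn
    rw [re_cval_div, Complex.ofReal_re] at hre
    have hc := fun j hj => (hT true 0).coeff x₀ j hj
    have hnorm : ∑ j ∈ Finset.range 4, a true 0 x₀ j ^ 2 ≤ 2 ^ (2 * m) := by
      rw [← (hL true 0).norm]
      exact Finset.single_le_sum (f := fun z => ∑ j ∈ Finset.range 4, a true 0 z j ^ 2)
        (fun _ _ => Finset.sum_nonneg fun _ _ => sq_nonneg _) (Finset.mem_univ x₀)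
    have anti := (hL true 0).anti x₀
    refine ⟨hl, ?_⟩
    rw [hc _ (by omega), hc _ (by omega), hc _ (by omega), hc _ (by omega), hc _ (by omega),
      hc _ (by omega), show a true 0 x₀ 4 = _ from anti 0, show a true 0 x₀ 5 = _ from anti 1,
      show a true 0 x₀ 7 = _ from anti 3]
    -- The real part is at least `2 ^ m / 3`, and replacing `√2` by `1` costs at most `0.2072 * 1.5
    -- * 2 ^ m`, which is less.
    have hpos : 0 < 2 * a true 0 x₀ 0 + a true 0 x₀ 1 - a true 0 x₀ 3 := by
      generalize a true 0 x₀ = c at *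
      have hsum : (c 0 : ℝ) ^ 2 + c 1 ^ 2 + c 2 ^ 2 + c 3 ^ 2 ≤ (2 ^ m) ^ 2 := by
        rw [← pow_mul, mul_comm m 2]
        simp only [Finset.sum_range_succ, Finset.sum_range_zero, zero_add] at hnorm
        exact_mod_cast hnorm
      have hP : (0 : ℝ) < 2 ^ m := by positivity
      rw [div_eq_iff hP.ne'] at hre
      have hq : Real.sqrt 2 / 2 ≤ 0.7072 := by
        have : Real.sqrt 2 ≤ 1.4144 := Real.sqrt_le_iff.2 ⟨by norm_num, by norm_num⟩
        linarith
      have hq' : 0.7 ≤ Real.sqrt 2 / 2 := by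
        have : 1.4 ≤ Real.sqrt 2 := Real.le_sqrt_of_sq_le (by norm_num)
        linarith
      have hR : (0 : ℝ) < 2 * c 0 + c 1 - c 3 := by
        generalize (2 : ℝ) ^ m = P at *
        generalize Real.sqrt 2 / 2 = q at *
        generalize (c 0 : ℝ) = c0 at *
        generalize (c 1 : ℝ) = c1 at *
        generalize (c 2 : ℝ) = c2 at *
        generalize (c 3 : ℝ) = c3 at *
        have hb : c1 - c3 ≤ 1.5 * P := by
          refine abs_le_of_sq_le_sq' ?_ (by positivity) |>.2
          nlinarith [sq_nonneg (c1 + c3), sq_nonneg c0, sq_nonneg c2]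
        nlinarith
      exact_mod_cast hR
    omega
  exact fun r hr => ⟨⟨⟨hstart, hgates r hr⟩, hlinked r hr⟩, hfinal⟩

end Honest

end OracleComplexity


/-! ### Random choice of the query to be cross-checked. -/

namespace OracleComplexity

/-! ### Choosing a query at random -/

/-- Run a program `N ^ e` times. -/
def Prog.repn (c : Prog) : ℕ → Prog
  | 0 => c
  | e + 1 => .rep (c.repn e)

theorem Prog.run_repn (E : Env) (N e : ℕ) (c : Prog) (s : State) :
    (c.repn e).run E N s = (c.run E N)^[N ^ e] s := by
  induction e generalizing s with
  | zero => simp [Prog.repn]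
  | succ e ih =>
    have : (c.repn e).run E N = (c.run E N)^[N ^ e] := funext ih
    rw [Prog.repn, Prog.run, this, ← Function.iterate_mul, pow_succ]

/-- Halve the number in register `7`, which is written in unary. -/
def Prog.halveStep : Prog :=
  .ite (.nonempty 7) (.seq (.pop 7) (.ite (.nonempty 7) (.seq (.pop 7) (.push 8 true)) .nop)) .nop

def Prog.doubleStep : Prog :=
  .ite (.nonempty 8) (.seq (.pop 8) (.seq (.push 0 true) (.push 0 true))) .nop

/-- Register `7` is halved until it is empty, and each halving appends one random binary digit to
the number in register `0`. Idle iterations flip no coin, so exactly as many coins are used as the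
initial value of register `7` has binary digits. -/
def Prog.selectStep (e : ℕ) : Prog :=
  .ite (.nonempty 7)
    (.seq (.seq (halveStep.repn e) (.seq (.copy 8 7) (.clear 8)))
      (.seq (.seq (.copy 0 8) (.seq (.clear 0) (doubleStep.repn e)))
        (.seq (.flip 8) (.seq (.ite (.top 8) (.push 0 true) .nop) (.pop 8))))) .nop

/-- The number with binary digits `w`, most significant digit first. -/
def ofDigits (u : ℕ) (w : List Bool) : ℕ := w.foldl (fun u c => 2 * u + c.toNat) u

theorem exists_ofDigits (k i : ℕ) (h : i < 2 ^ k) : ∃ w : List Bool, w.length = k ∧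
    ofDigits 0 w = i := by
  induction k generalizing i with
  | zero => exact ⟨[], rfl, by simp at h; subst h; rfl⟩
  | succ k ih =>
    obtain ⟨w, h1, h2⟩ := ih (i / 2) (by rw [pow_succ] at h; omega)
    refine ⟨w ++ [decide (i % 2 = 1)], by simp [h1], ?_⟩
    rw [ofDigits, List.foldl_append]
    change 2 * ofDigits 0 w + _ = i
    rw [h2]
    rcases Nat.mod_two_eq_zero_or_one i with h | h <;> simp [h] <;> omega

section Select

variable {E : Env} {N : ℕ}

theorem Prog.iterate_halveStep (k : ℕ) (s : State) (a b : ℕ) (h : a ≤ k) :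
    (halveStep.run E N)^[k] ((s.set 7 (List.replicate a true)).set 8 (List.replicate b true)) =
      (s.set 7 []).set 8 (List.replicate (b + a / 2) true) := by
  induction k generalizing a b with
  | zero => obtain rfl : a = 0 := by omega
            rfl
  | succ k ih =>
    rw [Function.iterate_succ_apply]
    have e : halveStep.run E N
        ((s.set 7 (List.replicate a true)).set 8 (List.replicate b true)) =
        (s.set 7 (List.replicate (a - 2) true)).set 8
          (List.replicate (if 2 ≤ a then b + 1 else b) true) := by
      rcases a with _ | _ | a
      · simp [halveStep, Prog.run, Test.on, State.set_reg]
      · simp only [halveStep, Prog.run, Test.on, State.set_reg]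
        simp [State.set_comm _ (show 8 ≠ 7 by decide)]
      · simp only [halveStep, Prog.run, Test.on, State.set_reg]
        simp [State.set_comm _ (show 8 ≠ 7 by decide), List.replicate_succ]
    have h2 : (if 2 ≤ a then b + 1 else b) + (a - 2) / 2 = b + a / 2 := by split_ifs <;> omega
    rw [e, ih _ _ (by omega), h2]

theorem Prog.iterate_doubleStep (k : ℕ) (s : State) (a b : ℕ) (h : a ≤ k) :
    (doubleStep.run E N)^[k] ((s.set 8 (List.replicate a true)).set 0 (List.replicate b true)) =
      (s.set 8 []).set 0 (List.replicate (b + 2 * a) true) := by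
  induction k generalizing a b with
  | zero => obtain rfl : a = 0 := by omega
            rfl
  | succ k ih =>
    rw [Function.iterate_succ_apply]
    have e : doubleStep.run E N
        ((s.set 8 (List.replicate a true)).set 0 (List.replicate b true)) =
        (s.set 8 (List.replicate (a - 1) true)).set 0
          (List.replicate (if 1 ≤ a then b + 2 else b) true) := by
      rcases a with _ | a
      · simp [doubleStep, Prog.run, Test.on, State.set_reg]
      · simp only [doubleStep, Prog.run, Test.on, State.set_reg]
        simp [State.set_comm _ (show 0 ≠ 8 by decide), List.replicate_succ]
    have h2 : (if 1 ≤ a then b + 2 else b) + 2 * (a - 1) = b + 2 * a := by split_ifs <;> omega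
    rw [e, ih _ _ (by omega), h2]

theorem Prog.run_selectStep {e a u : ℕ} (ha : 0 < a) (haN : a ≤ N ^ e) (hu : u ≤ N ^ e) (c : Bool)
    (w : List Bool) (s : State) (h8 : s.reg 8 = []) :
    (selectStep e).run E N
        (((s.set 7 (List.replicate a true)).set 0 (List.replicate u true)).withCoins (c :: w)) =
      ((s.set 7 (List.replicate (a / 2) true)).set 0
        (List.replicate (2 * u + c.toNat) true)).withCoins w := by
  have hT : (Test.nonempty 7).on (((s.set 7 (List.replicate a true)).set 0
      (List.replicate u true)).withCoins (c :: w)).reg = true := by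
    simp [Test.on, State.set_reg]; omega
  have e1 : ((s.set 7 (List.replicate a true)).set 0 (List.replicate u true)).withCoins (c :: w) =
      (((s.set 0 (List.replicate u true)).withCoins (c :: w)).set 7 (List.replicate a true)).set 8
        (List.replicate 0 true) := by
    simp only [State.set, State.withCoins, State.mk.injEq, and_true]
    funext i
    simp only [Function.update_apply]
    split_ifs <;> simp_all
  rw [selectStep, Prog.run, hT, cond_true, e1]
  simp only [Prog.run, Prog.run_repn]
  rw [Prog.iterate_halveStep _ _ _ _ haN]
  have e2 : ∀ v, ((((((s.set 0 (List.replicate u true)).withCoins (c :: w)).set 7 []).set 8 v).set 7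
      v).set 8 []) = ((s.withCoins (c :: w)).set 7 v).set 0 (List.replicate u true) := by
    intro v
    simp only [State.set, State.withCoins, State.mk.injEq, and_true]
    funext i
    simp only [Function.update_apply]
    split_ifs <;> simp_all
  simp only [State.set_reg_same, Nat.zero_add]
  rw [e2]
  simp only [State.set_reg_same]
  rw [State.set_comm _ (show 0 ≠ 8 by decide), State.set_set]
  have := Prog.iterate_doubleStep (E := E) (N := N) (N ^ e)
    ((s.withCoins (c :: w)).set 7 (List.replicate (a / 2) true)) u 0 hu
  rw [List.replicate_zero] at this
  rw [this]
  have e3 : ∀ v : List Bool, (((s.withCoins (c :: w)).set 7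
      (List.replicate (a / 2) true)).set 8 []).set 0 v =
      (((s.set 7 (List.replicate (a / 2) true)).set 8 []).set 0 v).withCoins (c :: w) :=
    fun _ => rfl
  rw [e3]
  simp only [State.withCoins, List.headD_cons, List.tail_cons]
  cases c <;>
  · simp only [Test.on, State.set, State.mk.injEq, Function.update_apply, if_true, List.headD_cons,
      cond_true, cond_false, Nat.zero_add, Bool.toNat_true, Bool.toNat_false, Nat.add_zero, and_true]
    clear hT e1 e2 e3 this
    funext i
    simp only [Function.update_apply]
    split_ifs <;> simp_all [List.replicate_succ]

/-- The invariant `hu` limits the number read so far by the digits still to come. It ensures `u ≤ N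
^ e` whenever a digit is appended, so that `N ^ e` iterations suffice for doubling. -/
theorem Prog.iterate_selectStep {e : ℕ} (rest : List Bool) (w : List Bool) (k a u : ℕ)
    (hw : w.length = a.size) (hk : a.size ≤ k) (ha : a ≤ N ^ e)
    (hu : (u + 1) * 2 ^ a.size ≤ 2 * N ^ e) (s : State) (h8 : s.reg 8 = []) :
    ((selectStep e).run E N)^[k] (((s.set 7 (List.replicate a true)).set 0
        (List.replicate u true)).withCoins (w ++ rest)) =
      ((s.set 7 []).set 0 (List.replicate (ofDigits u w) true)).withCoins rest := by
  induction w generalizing k a u with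
  | nil =>
    obtain rfl : a = 0 := by rwa [List.length_nil, eq_comm, Nat.size_eq_zero] at hw
    refine Function.iterate_fixed ?_ k
    simp [selectStep, Prog.run, Test.on, State.set_reg]
  | cons c w ih =>
    have ha0 : 0 < a := Nat.size_pos.1 (by rw [← hw]; simp)
    obtain ⟨k, rfl⟩ : ∃ k', k = k' + 1 := ⟨k - 1, by simp at hw; omega⟩
    have hsize : (a / 2).size + 1 = a.size := by
      have h : ∀ n, (a / 2).size ≤ n ↔ a.size ≤ n + 1 := fun n => by
        rw [Nat.size_le, Nat.size_le, pow_succ]; omega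
      have h1 := (h _).1 le_rfl
      have h2 := (h (a.size - 1)).2 (by omega)
      have := Nat.size_pos.2 ha0
      omega
    rw [← hsize, pow_succ] at hu
    have hp : 0 < 2 ^ (a / 2).size := by positivity
    rw [Function.iterate_succ_apply, List.cons_append, Prog.run_selectStep ha0 ha
      (by nlinarith) c _ s h8]
    refine ih k (a / 2) (2 * u + c.toNat) (by simp at hw; omega) (by omega) (by omega) ?_
    refine le_trans ?_ hu
    rw [mul_comm (2 ^ _) 2, ← mul_assoc]
    refine Nat.mul_le_mul_right _ ?_
    cases c <;> simp <;> omega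

theorem Prog.iterate_flip (r : ℕ) (w rest : List Bool) (s : State) :
    ((Prog.flip r).run E N)^[w.length] (s.withCoins (w ++ rest)) =
      (s.set r (w.reverse ++ s.reg r)).withCoins rest := by
  induction w generalizing s with
  | nil => simp
  | cons c w ih =>
    rw [List.length_cons, Function.iterate_succ_apply]
    have : (Prog.flip r).run E N (s.withCoins (c :: w ++ rest)) =
        (s.set r (c :: s.reg r)).withCoins (w ++ rest) := rfl
    rw [this, ih]
    simp

end Select

end OracleComplexity


/-! ### One round: fresh point, random query number, test. -/

namespace OracleComplexity

/-! ### One round of the protocol -/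

/-- Clear the first `k` registers of a test program. -/
def Prog.clearData : ℕ → Prog
  | 0 => .nop
  | k + 1 => .seq (clearData k) (.clear (k + 10))

/-- Clearing four registers beyond the bound includes the inputs of the test, whatever the bound is.
Registers `5`, `6` and `9` survive the rounds, as does the rejection flag in register `2`. -/
def Prog.setup (e : ℕ) : Prog :=
  .seq (.clear 0) (.seq (.clear 1) (.seq (.clear 7) (.seq (.clear 8)
    (.seq (clearData (TProg.test.bound + 4)) (.seq (.copy 5 11) (.seq (.copy 6 12)
      ((Prog.push 7 true).repn e)))))))

/-- Register `10` is register `0` of the test program. A failed test and a failed cross-check end up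
in the same flag. -/
def Prog.verdict : Prog :=
  .seq TProg.test.toProg (.ite (.nonempty 10) (.push 2 true) .nop)

/-- Test the provers once, with a cross-check of a random query. -/
def Prog.round (e : ℕ) : Prog :=
  .seq (setup e) (.seq (.rep (.flip 13)) (.seq ((selectStep e).repn e) verdict))

/-- The configuration in which the test starts: `r` is the random string, and query number `u` is
to be cross-checked. -/
def State.roundStart (s : State) (r : List Bool) (u : ℕ) : State :=
  { s with reg := fun i =>
      if i = 0 then List.replicate u true else if i = 11 then s.reg 5 else
      if i = 12 then s.reg 6 else if i = 13 then r else
      if i = 1 ∨ i = 7 ∨ i = 8 ∨ (10 ≤ i ∧ i < TProg.test.bound + 14) then [] else s.reg i }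

/-- The invariant of the rounds. -/
structure State.Ready (N : ℕ) (x desc : List Bool) (s : State) : Prop where
  input : s.reg 5 = x
  circuit : s.reg 6 = desc
  limit : s.reg 9 = List.replicate (2 * N) true
  clean : ∀ i, TProg.test.bound + 14 ≤ i → s.reg i = []

section Round

variable {E : Env} {N e : ℕ} {s : State} {x desc : List Bool}

theorem Prog.run_clearData (k : ℕ) (s : State) : (clearData k).run E N s =
    { s with reg := fun i => if 10 ≤ i ∧ i < k + 10 then [] else s.reg i } := by
  induction k with
  | zero =>
    have : (fun i => if 10 ≤ i ∧ i < 0 + 10 then [] else s.reg i) = s.reg :=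
      funext fun i => if_neg (by omega)
    rw [this]
    rfl
  | succ k ih =>
    rw [clearData, Prog.run, ih, Prog.run]
    simp only [State.set, State.mk.injEq, and_true]
    funext i
    rw [Function.update_apply]
    split_ifs <;> first | rfl | omega

theorem Prog.iterate_push (r k : ℕ) (b : Bool) (s : State) :
    ((Prog.push r b).run E N)^[k] s = s.set r (List.replicate k b ++ s.reg r) := by
  induction k generalizing s with
  | zero => simp
  | succ k ih =>
    rw [Function.iterate_succ_apply, ih, Prog.run, State.set_reg_same, State.set_set,
      List.replicate_succ', List.append_assoc]
    rfl

theorem Prog.run_setup (s : State) : (setup e).run E N s =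
    ((s.roundStart [] 0).set 7 (List.replicate (N ^ e) true)) := by
  have h : (setup e).run E N s = ((Prog.push 7 true).repn e).run E N ((Prog.copy 6 12).run E N
      ((Prog.copy 5 11).run E N ((clearData (TProg.test.bound + 4)).run E N
        ((((s.set 0 []).set 1 []).set 7 []).set 8 [])))) := rfl
  rw [h, Prog.run_repn, Prog.iterate_push, Prog.run_clearData]
  simp only [Prog.run, State.set, State.roundStart, State.mk.injEq, and_true]
  funext i
  simp only [Function.update_apply]
  by_cases h7 : i = 7
  · subst h7; simp
  · by_cases h11 : i = 11
    · subst h11; simp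
    · by_cases h12 : i = 12
      · subst h12; simp
      · simp only [h7, h11, h12, if_false, false_or]
        split_ifs <;> first | rfl | omega

theorem Prog.coinless_verdict : verdict.Coinless := ⟨TProg.toProg_coinless _, trivial, trivial⟩

/-- The number of coins is the same in all rounds. The first block is the sample point, reversed
because coins are pushed; the second block gives the query number. -/
theorem Prog.run_round (w₁ w₂ rest : List Bool) (hN : 0 < N) (h1 : w₁.length = N)
    (h2 : w₂.length = (N ^ e).size) (s : State) :
    (round e).run E N (s.withCoins (w₁ ++ (w₂ ++ rest))) =
      (verdict.run E N (s.roundStart w₁.reverse (ofDigits 0 w₂))).withCoins rest := by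
  have hpos : 0 < N ^ e := by positivity
  rw [round, Prog.run, Prog.run_setup, Prog.run, Prog.run, Prog.run, Prog.run_repn]
  have e1 : ((s.withCoins (w₁ ++ (w₂ ++ rest))).roundStart [] 0).set 7
      (List.replicate (N ^ e) true) = ((s.roundStart [] 0).set 7
      (List.replicate (N ^ e) true)).withCoins (w₁ ++ (w₂ ++ rest)) := rfl
  have e2 := Prog.iterate_flip (E := E) (N := N) 13 w₁ (w₂ ++ rest)
    ((s.roundStart [] 0).set 7 (List.replicate (N ^ e) true))
  rw [h1] at e2
  rw [e1, e2]
  have e3 : ((s.roundStart [] 0).set 7 (List.replicate (N ^ e) true)).set 13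
      (w₁.reverse ++ ((s.roundStart [] 0).set 7 (List.replicate (N ^ e) true)).reg 13) =
      ((s.roundStart w₁.reverse 0).set 7 (List.replicate (N ^ e) true)).set 0
        (List.replicate 0 true) := by
    simp only [State.set, State.roundStart, State.mk.injEq, and_true]
    funext i
    simp only [Function.update_apply]
    split_ifs <;> simp_all
  have hsz : 2 ^ (N ^ e).size ≤ 2 * N ^ e := by
    have h := Nat.size_pos.2 hpos
    have := Nat.lt_size.1 (show (N ^ e).size - 1 < (N ^ e).size by omega)
    calc 2 ^ (N ^ e).size = 2 ^ ((N ^ e).size - 1 + 1) := by congr 1; omega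
      _ ≤ _ := by rw [pow_succ']; omega
  rw [e3, Prog.iterate_selectStep rest w₂ (N ^ e) (N ^ e) 0 h2
    (Nat.size_le.2 Nat.lt_two_pow_self) le_rfl (by simpa using hsz) _ (by simp [State.roundStart]),
    Prog.run_withCoins coinless_verdict]
  congr 2
  simp only [State.set, State.roundStart, State.mk.injEq, and_true]
  funext i
  simp only [Function.update_apply]
  split_ifs <;> simp_all

theorem TProg.toProg_avoids_of_bound {c : TProg} {i : ℕ} (h : c.bound ≤ i) :
    c.toProg.Avoids (i + 10) := by
  induction c with
  | seq _ _ h1 h2 => exact ⟨h1 ((le_max_left _ _).trans h), h2 ((le_max_right _ _).trans h)⟩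
  | ite _ _ _ h1 h2 => exact ⟨h1 ((le_max_left _ _).trans h), h2 ((le_max_right _ _).trans h)⟩
  | rep _ h1 => exact h1 h
  | nop => trivial
  | get m r =>
    simp only [TProg.bound] at h
    simp [TProg.toProg, Prog.fetch, Prog.crossCheck, Prog.compareStep, Prog.Avoids]
    omega
  | _ => simp only [TProg.toProg, Prog.Avoids, TProg.bound] at h ⊢; omega

theorem State.Ready.verdict (h : s.Ready N x desc) (r : List Bool) (u : ℕ) :
    (Prog.verdict.run E N (s.roundStart r u)).Ready N x desc := by
  have key : ∀ i, i ≠ 2 → TProg.test.toProg.Avoids i →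
      (Prog.verdict.run E N (s.roundStart r u)).reg i = (s.roundStart r u).reg i := fun i h2 hi =>
    Prog.run_reg_of_avoids (c := Prog.verdict) ⟨hi, Ne.symm h2, trivial⟩ _
  refine ⟨?_, ?_, ?_, fun i hi => ?_⟩
  · rw [key 5 (by decide) (TProg.toProg_avoids (by simp) _)]
    simpa [State.roundStart] using h.input
  · rw [key 6 (by decide) (TProg.toProg_avoids (by simp) _)]
    simpa [State.roundStart] using h.circuit
  · rw [key 9 (by decide) (TProg.toProg_avoids (by simp) _)]
    simpa [State.roundStart] using h.limit
  · obtain ⟨j, rfl⟩ : ∃ j, i = j + 10 := ⟨i - 10, by omega⟩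
    rw [key _ (by omega) (TProg.toProg_avoids_of_bound (by omega))]
    simp only [State.roundStart]
    rw [if_neg (by omega), if_neg (by omega), if_neg (by omega), if_neg (by omega),
      if_neg (by omega), h.clean _ hi]

theorem State.Ready.data_roundStart (h : s.Ready N x desc) (r : List Bool) (u : ℕ) :
    (s.roundStart r u).data 0 = [] ∧ (s.roundStart r u).data 1 = x ∧
      (s.roundStart r u).data 2 = desc ∧ (s.roundStart r u).data 3 = r ∧
      TProg.CleanFrom 4 (s.roundStart r u).data := by
  refine ⟨by simp [State.data, State.roundStart], by simpa [State.data, State.roundStart] using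
    h.input, by simpa [State.data, State.roundStart] using h.circuit,
    by simp [State.data, State.roundStart], fun i hi => ?_⟩
  simp only [State.data, State.roundStart]
  rw [if_neg (by omega), if_neg (by omega), if_neg (by omega), if_neg (by omega)]
  split_ifs with h1
  · rfl
  · exact h.clean _ (by omega)

theorem Prog.run_verdict_reg (s : State) : (verdict.run E N s).reg 2 =
    if (TProg.test.toProg.run E N s).data 0 = [] then (TProg.test.toProg.run E N s).reg 2
    else true :: (TProg.test.toProg.run E N s).reg 2 := by
  rw [verdict, Prog.run]
  generalize TProg.test.toProg.run E N s = t
  simp only [Prog.run, Test.on, State.data]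
  have e : ∀ l, t.reg 10 = l → (bif !l.isEmpty then t.set 2 (true :: t.reg 2) else t).reg 2 =
      if l = [] then t.reg 2 else true :: t.reg 2 := by
    intro l _
    cases l <;> simp
  exact e _ rfl

variable {n : ℕ} {C : QCircuit n} {F : List Bool → List Bool}

theorem State.Ready.verdict_honest (h : s.Ready N x C.encode) (hN : 3 ≤ N)
    (hC : C.encode.length ≤ N) (h0 : ∀ h m, E.reply 0 (h ++ [m]) = F m)
    (h1 : ∀ h m, E.reply 1 (h ++ [m]) = F m) (r : List Bool) (hr : r.length = N) (u : ℕ)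
    (hT : TestOK E.oracle N (fun m => (F m).take (2 * N)) C x r) (h2 : s.reg 2 = []) :
    (Prog.verdict.run E N (s.roundStart r u)).reg 2 = [] := by
  obtain ⟨d0, d1, d2, d3, d4⟩ := h.data_roundStart r u
  obtain ⟨a1, a2⟩ := TProg.run_honest (N := N) h0 h1 TProg.test (s.roundStart r u)
    (by simp [State.roundStart, h.limit])
  rw [Prog.run_verdict_reg, a1, a2,
    if_pos ((TProg.eval_test C d0 d1 d2 d3 d4 hN hC hr.le).2 hT)]
  simpa [State.roundStart] using h2

/-- Each point at which the table of prover `1` fails has a query number that leads to rejection. If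
prover `0` follows the table, the counter `q` equals the number of queries made, so no cross-check
occurs and the test itself fails; otherwise the first deviation is exposed. -/
theorem State.Ready.verdict_committed (h : s.Ready N x C.encode) (hN : 3 ≤ N)
    (hC : C.encode.length ≤ N) (hF : ∀ m, F m = E.reply 1 (s.sent 1 ++ [m])) (r : List Bool)
    (hr : r.length = N) (hT : ¬ TestOK E.oracle N (fun m => (F m).take (2 * N)) C x r) :
    ∃ u ≤ TProg.test.gets N, (Prog.verdict.run E N (s.roundStart r u)).reg 2 ≠ [] := by
  obtain ⟨d0, d1, d2, d3, d4⟩ := h.data_roundStart r 0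
  have hset : ∀ u, s.roundStart r u = (s.roundStart r 0).set 0 (List.replicate u true) := by
    intro u
    simp only [State.set, State.roundStart, State.mk.injEq, and_true]
    funext i
    simp only [Function.update_apply]
    split_ifs <;> rfl
  rcases TProg.run_committed (N := N) TProg.test (s.roundStart r 0) (by simp [State.roundStart, h.limit])
    (by simp [State.roundStart]) hF with ⟨q, hq, s', h1, h2, -⟩ | ⟨q, hq, h1⟩
  · refine ⟨q, hq, ?_⟩
    have := h1 0
    rw [Nat.add_zero] at this
    rw [Prog.run_verdict_reg, hset, this, State.data_set_lt _ (by decide), h2, if_neg]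
    · simp
    · rw [TProg.eval_test C d0 d1 d2 d3 d4 hN hC hr.le]
      exact hT
  · refine ⟨q, hq.le, ?_⟩
    rw [Prog.run_verdict_reg, hset]
    split_ifs
    · exact h1
    · simp

end Round

end OracleComplexity


/-! ### Counting coin sequences and amplification by repetition. -/

namespace OracleComplexity

/-! ### Counting coin sequences -/

/-- The number of coin sequences of length `k` with property `P`. -/
noncomputable def count (k : ℕ) (P : List Bool → Prop) : ℕ :=
  Nat.card {ω : Fin k → Bool // P (List.ofFn ω)}

section Count

variable {P Q : List Bool → Prop}

theorem count_eq_card (k : ℕ) (P : List Bool → Prop)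
    [DecidablePred fun ω : Fin k → Bool => P (List.ofFn ω)] :
    count k P = (Finset.univ.filter fun ω : Fin k → Bool => P (List.ofFn ω)).card := by
  rw [count, Nat.card_eq_fintype_card, Fintype.card_subtype]

theorem count_mono {k : ℕ} (h : ∀ l, l.length = k → P l → Q l) : count k P ≤ count k Q := by
  classical
  rw [count_eq_card, count_eq_card]
  exact Finset.card_le_card fun ω hω => Finset.mem_filter.2
    ⟨Finset.mem_univ _, h _ (by simp) (Finset.mem_filter.1 hω).2⟩

theorem count_true (k : ℕ) : count k (fun _ => True) = 2 ^ k := by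
  classical
  rw [count_eq_card]
  simp

theorem count_le (k : ℕ) : count k P ≤ 2 ^ k := by
  rw [← count_true]
  exact count_mono fun _ _ _ => trivial

theorem count_not (k : ℕ) : count k (fun l => ¬ P l) = 2 ^ k - count k P := by
  classical
  have h := Finset.card_filter_add_card_filter_not (s := (Finset.univ : Finset (Fin k → Bool)))
    (fun ω => P (List.ofFn ω))
  rw [← count_eq_card k P, ← count_eq_card k fun l => ¬ P l, Finset.card_univ, Fintype.card_pi_const,
    Fintype.card_bool] at h
  omega

theorem count_add (a b : ℕ) : count (a + b) P =
    ∑ ω : Fin a → Bool, count b (fun l => P (List.ofFn ω ++ l)) := by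
  classical
  simp only [count_eq_card, Finset.card_filter]
  rw [← (Fin.appendEquiv a b).sum_comp, Fintype.sum_prod_type]
  simp [Fin.appendEquiv, List.ofFn_fin_append]

theorem reverse_ofFn {k : ℕ} (ω : Fin k → Bool) :
    (List.ofFn ω).reverse = List.ofFn (ω ∘ Fin.rev) := by
  refine List.ext_getElem (by simp) fun i h1 h2 => ?_
  simp only [List.getElem_reverse, List.getElem_ofFn, List.length_ofFn, Function.comp_apply]
  congr 1
  ext
  simp [Fin.val_rev]
  omega

theorem count_reverse (k : ℕ) : count k (fun l => P l.reverse) = count k P := by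
  classical
  simp only [count_eq_card, Finset.card_filter, reverse_ofFn]
  exact (Equiv.arrowCongr Fin.revPerm (Equiv.refl Bool)).sum_comp
    fun ω : Fin k → Bool => if P (List.ofFn ω) then 1 else 0

end Count

/-! ### Repeated rounds -/

section Rounds

variable {E : Env} {N e : ℕ} {s : State} {x : List Bool} {n : ℕ} {C : QCircuit n}

/-- The number of coins for one round. -/
def roundCoins (N e : ℕ) : ℕ := N + (N ^ e).size

theorem two_pow_size_le {k : ℕ} (hk : 0 < k) : 2 ^ k.size ≤ 2 * k := by
  have h := Nat.size_pos.2 hk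
  have := Nat.lt_size.1 (show k.size - 1 < k.size by omega)
  calc 2 ^ k.size = 2 ^ (k.size - 1 + 1) := by congr 1; omega
    _ ≤ _ := by rw [pow_succ']; omega

/-- The configuration after one round with coins `l`. -/
def State.afterRound (E : Env) (N : ℕ) (s : State) (l : List Bool) : State :=
  Prog.verdict.run E N (s.roundStart (l.take N).reverse (ofDigits 0 (l.drop N)))

theorem Prog.run_round_withCoins (hN : 0 < N) (l rest : List Bool) (hl : l.length = roundCoins N e)
    (s : State) :
    (round e).run E N (s.withCoins (l ++ rest)) = (s.afterRound E N l).withCoins rest := by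
  have h := Prog.run_round (E := E) (e := e) (l.take N) (l.drop N) rest hN
    (by simp [hl, roundCoins]) (by simp [hl, roundCoins]) s
  rwa [← List.append_assoc, List.take_append_drop] at h

/-- The number of coin sequences on which a round reveals that the circuit should not be
accepted. -/
theorem le_count_caught (h : s.Ready N x C.encode) (hC : C.acceptProb E.oracle x ≤ 1 / 3) {m : ℕ}
    (hNm : N = 2 * m) (hN : 400 ≤ N) (hlen : C.encode.length ≤ N)
    (hT : 2 * C.gates.length + 1 ≤ N) (hgets : TProg.test.gets N < N ^ e) :
    2 ^ roundCoins N e ≤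
      count (roundCoins N e) (fun l => (s.afterRound E N l).reg 2 ≠ []) * (2 * N ^ (e + 4)) := by
  classical
  set F : List Bool → List Bool := fun m => E.reply 1 (s.sent 1 ++ [m]) with hF
  set bad : List Bool → Prop := fun r =>
    ¬ TestOK E.oracle N (fun m => (F m).take (2 * N)) C x r with hbad
  have h1 : 2 ^ N ≤ count N bad * N ^ 4 := by
    rw [count_eq_card]
    subst hNm
    refine soundness_test (G := fun a => (F a).take (2 * (2 * m))) C x hC hN hT fun r hr => ?_
    by_contra hcon
    exact hr (Finset.mem_filter.2 ⟨Finset.mem_univ _, hcon⟩)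
  have hpos : 0 < N ^ e := by positivity
  -- Only one revealing query number is counted for each bad point; it is among the numbers that the
  -- second block of coins can produce, since it is below `N ^ e`.
  have h2 : count N bad ≤ count (roundCoins N e) (fun l => (s.afterRound E N l).reg 2 ≠ []) := by
    rw [← count_reverse, roundCoins, count_add, count_eq_card, Finset.card_filter]
    refine Finset.sum_le_sum fun ω _ => ?_
    split_ifs with hω
    · obtain ⟨u, hu, hu2⟩ := h.verdict_committed (by omega) hlen (fun _ => rfl) _ (by simp) hω
      obtain ⟨w, hw, rfl⟩ := exists_ofDigits (N ^ e).size u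
        ((hu.trans_lt hgets).trans (Nat.lt_size_self _))
      rw [count, Nat.one_le_iff_ne_zero, ← Nat.pos_iff_ne_zero, Nat.card_pos_iff]
      refine ⟨⟨fun i => w.getD i false, ?_⟩, inferInstance⟩
      rw [ofFn_getD hw, State.afterRound, List.take_left' (by simp), List.drop_left' (by simp)]
      exact hu2
    · exact Nat.zero_le _
  calc 2 ^ roundCoins N e = 2 ^ N * 2 ^ (N ^ e).size := pow_add _ _ _
    _ ≤ count N bad * N ^ 4 * (2 * N ^ e) := Nat.mul_le_mul h1 (two_pow_size_le hpos)
    _ = count N bad * (2 * N ^ (e + 4)) := by ring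
    _ ≤ _ := Nat.mul_le_mul_right _ h2

theorem Prog.iterate_round_reg_ne_nil (k : ℕ) (s : State) (hs : s.reg 2 ≠ []) :
    (((round e).run E N)^[k] s).reg 2 ≠ [] := by
  refine iterate_of_step (p := fun s : State => s.reg 2 ≠ []) (fun s hs => ?_) k hs
  have hrep : ∀ (c : Prog) (k : ℕ), c.OnlyPushes 2 → (c.repn k).OnlyPushes 2 := by
    intro c k hc
    induction k with
    | zero => exact hc
    | succ k ih => exact ih
  have hclear : ∀ k, (clearData k).OnlyPushes 2 := by
    intro k
    induction k with
    | zero => trivial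
    | succ k ih => exact ⟨ih, by simp [Prog.OnlyPushes]⟩
  have hsetup : (setup e).OnlyPushes 2 := by
    have h := hrep (.push 7 true) e trivial
    simp [setup, Prog.OnlyPushes, hclear, h]
  have h1 := hrep halveStep e (by simp [halveStep, Prog.OnlyPushes])
  have h2 := hrep doubleStep e (by simp [doubleStep, Prog.OnlyPushes])
  have hselect := hrep (selectStep e) e (by simp [selectStep, Prog.OnlyPushes, h1, h2])
  have hverdict : verdict.OnlyPushes 2 := ⟨TProg.toProg_onlyPushes _, trivial, trivial⟩
  exact Prog.run_reg_ne_nil (c := round e) ⟨hsetup, trivial, hselect, hverdict⟩ s hs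

/-- Conditioning on the coins of the first round: those that raise the flag contribute nothing, the
others lead to another ready configuration. The hypothesis covers all ready configurations, so it
does not matter how the provers use the history. -/
theorem count_survivors (D : ℕ) (hN : 0 < N) (hD : ∀ s : State, s.Ready N x C.encode →
      2 ^ roundCoins N e ≤
        count (roundCoins N e) (fun l => (s.afterRound E N l).reg 2 ≠ []) * D)
    (k : ℕ) (s : State) (h : s.Ready N x C.encode) :
    D ^ k * count (k * roundCoins N e)
        (fun l => (((Prog.round e).run E N)^[k] (s.withCoins l)).reg 2 = []) ≤
      (D - 1) ^ k * 2 ^ (k * roundCoins N e) := by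
  classical
  induction k generalizing s with
  | zero => simpa using count_le 0
  | succ k ih =>
    have hstep : ∀ ω : Fin (roundCoins N e) → Bool,
        D ^ k * count (k * roundCoins N e) (fun l => (((Prog.round e).run E N)^[k + 1]
          (s.withCoins (List.ofFn ω ++ l))).reg 2 = []) ≤
        if (s.afterRound E N (List.ofFn ω)).reg 2 = [] then
          (D - 1) ^ k * 2 ^ (k * roundCoins N e) else 0 := by
      intro ω
      simp only [Function.iterate_succ_apply, Prog.run_round_withCoins hN _ _ (List.length_ofFn)]
      split_ifs with hω
      · exact ih _ (h.verdict _ _)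
      · rw [Nat.le_zero, mul_eq_zero, count]
        right
        rw [Nat.card_eq_zero]
        left
        exact ⟨fun ⟨l, hl⟩ => Prog.iterate_round_reg_ne_nil k
          ((s.afterRound E N (List.ofFn ω)).withCoins (List.ofFn l)) hω hl⟩
    have hcount : count (roundCoins N e) (fun l => (s.afterRound E N l).reg 2 = []) * D ≤
        (D - 1) * 2 ^ roundCoins N e := by
      have h1 := hD s h
      have h2 := count_not (P := fun l => (s.afterRound E N l).reg 2 = []) (roundCoins N e)
      have h3 := count_le (P := fun l => (s.afterRound E N l).reg 2 = []) (roundCoins N e)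
      rw [h2] at h1
      rw [Nat.sub_mul, one_mul]
      have h4 : count (roundCoins N e) (fun l => (s.afterRound E N l).reg 2 = []) * D ≤
          2 ^ roundCoins N e * D := Nat.mul_le_mul_right _ h3
      rw [Nat.sub_mul] at h1
      have h5 : 2 ^ roundCoins N e * D = D * 2 ^ roundCoins N e := mul_comm _ _
      omega
    rw [Nat.succ_mul, add_comm (k * roundCoins N e), count_add, pow_succ', mul_assoc, Finset.mul_sum]
    calc _ ≤ D * ∑ ω : Fin (roundCoins N e) → Bool,
          (if (s.afterRound E N (List.ofFn ω)).reg 2 = [] then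
            (D - 1) ^ k * 2 ^ (k * roundCoins N e) else 0) :=
          Nat.mul_le_mul_left _ (Finset.sum_le_sum fun ω _ => hstep ω)
      _ = count (roundCoins N e) (fun l => (s.afterRound E N l).reg 2 = []) * D *
          ((D - 1) ^ k * 2 ^ (k * roundCoins N e)) := by
          rw [← Finset.sum_filter, Finset.sum_const, smul_eq_mul, count_eq_card (roundCoins N e)
            fun l => (s.afterRound E N l).reg 2 = []]
          ring
      _ ≤ (D - 1) * 2 ^ roundCoins N e * ((D - 1) ^ k * 2 ^ (k * roundCoins N e)) :=
          Nat.mul_le_mul_right _ hcount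
      _ = _ := by rw [pow_add]; ring

/-- From `1 - 1 / D ≤ exp (-1 / D)`, and `exp 2 ≥ 3` by `1 + x ≤ exp x`. -/
theorem three_mul_pow_le {D R : ℕ} (hD : 0 < D) (hR : 2 * D ≤ R) : 3 * (D - 1) ^ R ≤ D ^ R := by
  have hD' : (0 : ℝ) < D := by exact_mod_cast hD
  have h1 : ((D - 1 : ℕ) : ℝ) / D ≤ Real.exp (-(1 / D)) := by
    rw [Nat.cast_sub hD, Nat.cast_one, sub_div, div_self hD'.ne']
    have := Real.add_one_le_exp (-(1 / D : ℝ))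
    linarith
  have h2 : (((D - 1 : ℕ) : ℝ) / D) ^ R ≤ 1 / 3 := by
    calc _ ≤ Real.exp (-(1 / D)) ^ R := pow_le_pow_left₀ (by positivity) h1 R
      _ = Real.exp (-(R / D)) := by rw [← Real.exp_nat_mul]; congr 1; ring
      _ ≤ Real.exp (-2) := by
          refine Real.exp_le_exp.2 (neg_le_neg ?_)
          rw [le_div_iff₀ hD']
          exact_mod_cast hR
      _ ≤ 1 / 3 := by
          rw [Real.exp_neg, ← one_div]
          refine one_div_le_one_div_of_le (by norm_num) ?_
          have := Real.add_one_le_exp (2 : ℝ)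
          linarith
  rw [div_pow, div_le_iff₀ (by positivity)] at h2
  have : (3 : ℝ) * ((D - 1 : ℕ) : ℝ) ^ R ≤ (D : ℝ) ^ R := by linarith
  exact_mod_cast this

theorem Prog.iterate_round_honest {F : List Bool → List Bool} (hN : 3 ≤ N)
    (hlen : C.encode.length ≤ N) (h0 : ∀ h m, E.reply 0 (h ++ [m]) = F m)
    (h1 : ∀ h m, E.reply 1 (h ++ [m]) = F m)
    (hT : ∀ r : List Bool, r.length = N →
      TestOK E.oracle N (fun m => (F m).take (2 * N)) C x r)
    (k : ℕ) (s : State) (h : s.Ready N x C.encode) (h2 : s.reg 2 = []) (l : List Bool)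
    (hl : k * roundCoins N e ≤ l.length) :
    (((round e).run E N)^[k] (s.withCoins l)).reg 2 = [] := by
  induction k generalizing s l with
  | zero => exact h2
  | succ k ih =>
    rw [Nat.succ_mul] at hl
    rw [Function.iterate_succ_apply, ← List.take_append_drop (roundCoins N e) l,
      Prog.run_round_withCoins (by omega) _ _ (by simp; omega)]
    refine ih _ (h.verdict _ _) ?_ _ (by simp; omega)
    refine h.verdict_honest hN hlen h0 h1 _ ?_ _ (hT _ ?_) h2 <;>
      simp [roundCoins] at hl ⊢ <;> omega

end Rounds

end OracleComplexity


/-! ### Polynomial bounds, embedding of the circuit generator, and clocks. -/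

namespace OracleComplexity

/-! ### Polynomial bounds -/

theorem eval_mono_nat (p : Polynomial ℕ) {a b : ℕ} (h : a ≤ b) : p.eval a ≤ p.eval b := by
  rw [Polynomial.eval_eq_sum, Polynomial.eval_eq_sum]
  exact Finset.sum_le_sum fun i _ => Nat.mul_le_mul_left _ (Nat.pow_le_pow_left h i)

/-- `Prog.ops` as a polynomial. -/
noncomputable def Prog.opsPoly : Prog → Polynomial ℕ
  | .seq c d => c.opsPoly + d.opsPoly
  | .ite _ c d => c.opsPoly + d.opsPoly + 1
  | .rep c => Polynomial.X * (c.opsPoly + 1) + 1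
  | _ => 1

theorem Prog.eval_opsPoly (N : ℕ) (c : Prog) : c.opsPoly.eval N = c.ops N := by
  induction c <;> simp_all [opsPoly, ops]

/-- The number of places at which a test program queries the provers. -/
def TProg.getCount : TProg → ℕ
  | .seq c d => c.getCount + d.getCount
  | .ite _ c d => c.getCount + d.getCount
  | .rep c => c.getCount
  | .get _ _ => 1
  | _ => 0

/-- The nesting depth of loops. -/
def TProg.depth : TProg → ℕ
  | .seq c d => max c.depth d.depth
  | .ite _ c d => max c.depth d.depth
  | .rep c => c.depth + 1
  | _ => 0

/-- Each place with a query is reached at most `N` times per enclosing loop. -/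
theorem TProg.gets_le {N : ℕ} (hN : 0 < N) (c : TProg) :
    c.gets N ≤ c.getCount * N ^ c.depth := by
  have key : ∀ a b g h x y : ℕ, x ≤ g * N ^ a → y ≤ h * N ^ b →
      x + y ≤ (g + h) * N ^ max a b := by
    intro a b g h x y hx hy
    have h1 : N ^ a ≤ N ^ max a b := Nat.pow_le_pow_right hN (le_max_left _ _)
    have h2 : N ^ b ≤ N ^ max a b := Nat.pow_le_pow_right hN (le_max_right _ _)
    rw [add_mul]
    exact add_le_add (hx.trans (Nat.mul_le_mul_left _ h1)) (hy.trans (Nat.mul_le_mul_left _ h2))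
  induction c with
  | seq c d h1 h2 => exact key _ _ _ _ _ _ h1 h2
  | ite _ c d h1 h2 => exact key _ _ _ _ _ _ h1 h2
  | rep c h =>
    simp only [gets, getCount, depth]
    calc N * c.gets N ≤ N * (c.getCount * N ^ c.depth) := Nat.mul_le_mul_left _ h
      _ = _ := by ring
  | get m r => simp [gets, getCount, depth]
  | _ => simp [gets]

/-! ### Self-contained programs as parts of larger programs -/

def Test.bound : Test → ℕ
  | .nonempty r => r + 1
  | .top r => r + 1

/-- A bound on the registers of a self-contained program. -/
def Cmd.bound : Cmd → ℕ
  | .push r _ => r + 1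
  | .pop r => r + 1
  | .seq c d => max c.bound d.bound
  | .ite T c d => max T.bound (max c.bound d.bound)
  | .loop T c => max T.bound c.bound
  | _ => 0

theorem Test.holds_congr {T : Test} {K : ℕ} (h : T.bound ≤ K) {s u : State}
    (hu : ∀ i < K, u.reg i = s.reg i) : T.Holds u ↔ T.Holds s := by
  cases T <;> simp only [Test.Holds, Test.bound] at h ⊢ <;> rw [hu _ (by omega)]

/-- A self-contained program runs in the same way in all surroundings. -/
theorem Exec.frame {E E' : Env} {K : ℕ} {c : Cmd} {s s' : State} {t : ℕ} (h : Exec E c s s' t)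
    (hc : c.Internal) (hK : c.bound ≤ K) {u : State} (hu : ∀ i < K, u.reg i = s.reg i) :
    ∃ u', Exec E' c u u' t ∧ (∀ i < K, u'.reg i = s'.reg i) ∧ (∀ i, K ≤ i → u'.reg i = u.reg i) ∧
      u'.coins = u.coins ∧ u'.sent = u.sent := by
  have hset : ∀ (s u : State) (r : ℕ) (v v' : List Bool), r < K → v = v' →
      (∀ i < K, u.reg i = s.reg i) →
      (∀ i < K, (u.set r v).reg i = (s.set r v').reg i) ∧
        ∀ i, K ≤ i → (u.set r v).reg i = u.reg i := by
    rintro s u r v _ hr rfl hu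
    refine ⟨fun i hi => ?_, fun i hi => State.set_reg_ne _ _ (by omega)⟩
    rw [State.set_reg, State.set_reg, hu i hi]
  induction h generalizing u with
  | skip s => exact ⟨u, Exec.skip u, hu, fun _ _ => rfl, rfl, rfl⟩
  | push r b s =>
    have hr : r < K := hK
    obtain ⟨h1, h2⟩ := hset s u r (b :: u.reg r) _ hr (by rw [hu r hr]) hu
    exact ⟨_, Exec.push r b u, h1, h2, rfl, rfl⟩
  | pop r s =>
    have hr : r < K := hK
    obtain ⟨h1, h2⟩ := hset s u r (u.reg r).tail _ hr (by rw [hu r hr]) hu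
    exact ⟨_, Exec.pop r u, h1, h2, rfl, rfl⟩
  | seq _ _ ih ih' =>
    obtain ⟨u1, e1, a1, b1, c1, d1⟩ := ih hc.1 ((le_max_left _ _).trans hK) hu
    obtain ⟨u2, e2, a2, b2, c2, d2⟩ := ih' hc.2 ((le_max_right _ _).trans hK) a1
    exact ⟨u2, e1.seq e2, a2, fun i hi => (b2 i hi).trans (b1 i hi), c2.trans c1, d2.trans d1⟩
  | ite_true hT _ ih =>
    obtain ⟨u1, e1, a1⟩ := ih hc.1 ((le_max_left _ _).trans ((le_max_right _ _).trans hK)) hu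
    exact ⟨u1, Exec.ite_true ((Test.holds_congr ((le_max_left _ _).trans hK) hu).2 hT) e1, a1⟩
  | ite_false hT _ ih =>
    obtain ⟨u1, e1, a1⟩ := ih hc.2 ((le_max_right _ _).trans ((le_max_right _ _).trans hK)) hu
    exact ⟨u1, Exec.ite_false (fun h => hT ((Test.holds_congr ((le_max_left _ _).trans hK) hu).1 h))
      e1, a1⟩
  | loop_true hT _ _ ih ih' =>
    obtain ⟨u1, e1, a1, b1, c1, d1⟩ := ih hc ((le_max_right _ _).trans hK) hu
    obtain ⟨u2, e2, a2, b2, c2, d2⟩ := ih' hc hK a1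
    exact ⟨u2, Exec.loop_true ((Test.holds_congr ((le_max_left _ _).trans hK) hu).2 hT) e1 e2, a2,
      fun i hi => (b2 i hi).trans (b1 i hi), c2.trans c1, d2.trans d1⟩
  | loop_false hT =>
    exact ⟨u, Exec.loop_false (fun h => hT ((Test.holds_congr ((le_max_left _ _).trans hK) hu).1 h)),
      hu, fun _ _ => rfl, rfl, rfl⟩
  | flip r s => exact hc.elim
  | query q r s => exact hc.elim
  | ask i m l r s => exact hc.elim

/-- The registers of a self-contained program grow by at most one bit per step. -/
theorem Exec.length_le {E : Env} {c : Cmd} {s s' : State} {t : ℕ} (h : Exec E c s s' t)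
    (hc : c.Internal) {B : ℕ} (hB : ∀ r, (s.reg r).length ≤ B) (r : ℕ) :
    (s'.reg r).length ≤ B + t := by
  induction h generalizing B r with
  | skip s => exact (hB r).trans (Nat.le_add_right _ _)
  | push r' b s =>
    rw [State.set_reg]
    split_ifs
    · simpa using hB r'
    · exact (hB r).trans (Nat.le_add_right _ _)
  | pop r' s =>
    rw [State.set_reg]
    split_ifs
    · have := hB r'; simp; omega
    · exact (hB r).trans (Nat.le_add_right _ _)
  | seq _ _ ih ih' =>
    rw [← add_assoc]
    exact ih' hc.2 (ih hc.1 hB) r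
  | ite_true _ _ ih => exact (ih hc.1 hB r).trans (by omega)
  | ite_false _ _ ih => exact (ih hc.2 hB r).trans (by omega)
  | loop_true _ _ _ ih ih' => exact (ih' hc (ih hc hB) r).trans (by omega)
  | loop_false _ => exact (hB r).trans (Nat.le_add_right _ _)
  | flip r s => exact hc.elim
  | query q r s => exact hc.elim
  | ask i m l r s => exact hc.elim

/-! ### Setting up the clocks -/

/-- Repeat a program a fixed number of times. -/
def Cmd.times (c : Cmd) : ℕ → Cmd
  | 0 => .skip
  | k + 1 => .seq c (c.times k)

/-- Increase the first `h` clocks. -/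
def Cmd.tick (K : ℕ) : ℕ → Cmd
  | 0 => .skip
  | h + 1 => .seq (tick K h) (.push (sysReg K (2 * h + 1)) true)

/-- System registers of which the first `h` clocks have the value `N`. -/
def clocks (h N : ℕ) : ℕ → List Bool :=
  fun i => if i % 2 = 1 ∧ i < 2 * h then List.replicate N true else []

section Clocks

variable {E : Env} {K : ℕ} {low κ : ℕ → List Bool} {s : State}

theorem Exec.tick (h : ℕ) : Exec E (.tick K h) (embed K low κ s)
    (embed K low (fun i => if i % 2 = 1 ∧ i < 2 * h then true :: κ i else κ i) s) (h + 1) := by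
  induction h with
  | zero => simpa [Cmd.tick] using Exec.skip (E := E) (embed K low κ s)
  | succ h ih =>
    refine ih.seq ((Exec.push _ _ _).congr ?_ rfl)
    rw [embed_set_sys, embed_reg_sys]
    congr 1
    funext i
    rw [Function.update_apply]
    split_ifs <;> first | rfl | omega | skip
    · subst i; rfl

theorem Exec.tick_clocks (h N : ℕ) : Exec E (.tick K h) (embed K low (clocks h N) s)
    (embed K low (clocks h (N + 1)) s) (h + 1) := by
  refine (Exec.tick h).congr ?_ rfl
  congr 1
  funext i
  simp only [clocks]
  split_ifs <;> rfl

theorem Exec.times_tick (h k N : ℕ) : Exec E ((Cmd.tick K h).times k)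
    (embed K low (clocks h N) s) (embed K low (clocks h (N + k)) s) (k * (h + 1) + 1) := by
  induction k generalizing N with
  | zero => simpa [Cmd.times] using Exec.skip (E := E) (embed K low (clocks h N) s)
  | succ k ih =>
    refine ((Exec.tick_clocks h N).seq (ih (N + 1))).congr ?_ (by ring)
    rw [show N + 1 + k = N + (k + 1) by ring]

theorem embed_set_low {i : ℕ} (h : i < K) (v : List Bool) :
    (embed K low κ s).set i v = embed K (Function.update low i v) κ s := by
  simp only [embed, State.set, State.mk.injEq, and_true]
  funext j
  simp only [Function.update_apply]
  split_ifs <;> first | rfl | omega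

theorem embed_reg_low {i : ℕ} (h : i < K) : (embed K low κ s).reg i = low i := if_pos h

/-- Move register `a`, reversed, to data register `r`, and increase the first `h` clocks by `4` for
each bit. -/
def Cmd.pourTick (K h a r : ℕ) : Cmd :=
  .loop (.nonempty a) (.seq (.ite (.top a) (.push (dataReg K r) true) (.push (dataReg K r) false))
    (.seq ((Cmd.tick K h).times 4) (.pop a)))

theorem Exec.pourTick {a : ℕ} (ha : a < K) (h r N : ℕ) (l : List Bool) (hl : low a = l) :
    Exec E (.pourTick K h a r) (embed K low (clocks h N) s)
      (embed K (Function.update low a []) (clocks h (N + 4 * l.length))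
        (s.set r (l.reverse ++ s.reg r))) (l.length * (4 * (h + 1) + 5) + 1) := by
  induction l generalizing low N s with
  | nil =>
    have e : Function.update low a [] = low := by rw [← hl, Function.update_eq_self]
    rw [e]
    simpa [Cmd.pourTick] using Exec.loop_false (E := E) (T := .nonempty a) (s := embed K low (clocks h N) s)
      (by simp [Test.Holds, embed_reg_low ha, hl])
  | cons b l ih =>
    have hbody : Exec E (.seq (.ite (.top a) (.push (dataReg K r) true)
        (.push (dataReg K r) false)) (.seq ((Cmd.tick K h).times 4) (.pop a)))
        (embed K low (clocks h N) s) (embed K (Function.update low a l) (clocks h (N + 4))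
          (s.set r (b :: s.reg r))) (4 * (h + 1) + 4) := by
      refine (Exec.seq (s' := embed K low (clocks h N) (s.set r (b :: s.reg r))) (t := 2) ?_
        ((Exec.times_tick h 4 N).seq (Exec.pop a _))).congr ?_ (by ring)
      · have hp := fun b => Exec.push (E := E) (dataReg K r) b (embed K low (clocks h N) s)
        simp only [embed_set_data, embed_reg_data] at hp
        cases b
        · exact Exec.ite_false (by simp [Test.Holds, embed_reg_low ha, hl]) (hp _)
        · exact Exec.ite_true (by simp [Test.Holds, embed_reg_low ha, hl]) (hp _)
      · rw [embed_set_low ha, embed_reg_low ha, hl, List.tail_cons]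
    have hrest := ih (low := Function.update low a l) (s := s.set r (b :: s.reg r)) (N + 4)
      (Function.update_self ..)
    refine (Exec.loop_true (by simp [Test.Holds, embed_reg_low ha, hl]) hbody hrest).congr ?_ ?_
    · simp only [Function.update_idem, State.set_reg_same, State.set_set, List.length_cons,
        List.reverse_cons, List.append_assoc, List.singleton_append]
      rw [show N + 4 + 4 * l.length = N + 4 * (l.length + 1) by ring]
    · simp only [List.length_cons]; ring

end Clocks

end OracleComplexity


/-! ### Assembly of the verifier. -/

namespace OracleComplexity

/-! ### The verifier -/

/-- An exponent such that, for large `N`, there are less than `N ^ c.queryExp` queries. -/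
@[irreducible] def TProg.queryExp (c : TProg) : ℕ := c.depth + 1

theorem TProg.gets_lt {N : ℕ} (c : TProg) (h : c.getCount < N) : c.gets N < N ^ c.queryExp := by
  have h0 : 0 < N := (Nat.zero_le _).trans_lt h
  refine (c.gets_le h0).trans_lt ?_
  rw [queryExp, pow_succ, mul_comm]
  exact Nat.mul_lt_mul_of_pos_left h (pow_pos h0 _)

def queryExp : ℕ := TProg.test.queryExp

/-- Half of the minimal clock value. -/
def baseSize : ℕ := 200 + TProg.test.getCount

/-- The interaction with the provers, starting from the reversals of the input in register `5` and
of the description of the circuit in register `6`. -/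
def Prog.protocol : Prog :=
  .seq (.seq (.seq (.rev 5 7) (.copy 7 5)) (.seq (.seq (.rev 6 7) (.copy 7 6))
    (.rep (.seq (.push 9 true) (.push 9 true))))) ((round queryExp).repn (queryExp + 6))

/-- Compute the description of the circuit with `c`, and set up the registers of the protocol. -/
def Cmd.prelude (c : Cmd) (K h : ℕ) : Cmd :=
  .seq (.pourTwo 0 (dataReg K 5) (sysReg K 0))
    (.seq (.loop (.nonempty (sysReg K 0)) (.seq (.push 0 true) (.pop (sysReg K 0))))
      (.seq c (.seq ((tick K h).times (2 * baseSize)) (pourTick K h 0 6))))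

/-- The generator `c` keeps the registers up to `c.bound`, and everything else lives above them; the
`+ 1` guarantees register `0` to the generator even if its bound is zero. Register `0` is empty
after the prelude, so without the final push the outcome is rejection. -/
def verifier (c : Cmd) : Cmd :=
  .seq (.prelude c (c.bound + 1) Prog.protocol.height)
    (.seq (Prog.protocol.compile (c.bound + 1) 0)
      (.ite (.nonempty (dataReg (c.bound + 1) 2)) .skip (.push 0 true)))

/-- The initial configuration of the protocol. -/
def State.loaded (x desc ω : List Bool) : State where
  reg := Function.update (Function.update (fun _ => []) 5 x.reverse) 6 desc.reverse
  coins := ω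
  sent := fun _ => []

theorem Exec.unary {E : Env} {s : State} {a b : ℕ} (hab : a ≠ b) :
    Exec E (.loop (.nonempty a) (.seq (.push b true) (.pop a))) s
      ((s.set b (List.replicate (s.reg a).length true ++ s.reg b)).set a [])
      (3 * (s.reg a).length + 1) := by
  generalize hl : s.reg a = l
  induction l generalizing s with
  | nil =>
    have : (s.set b (List.replicate ([] : List Bool).length true ++ s.reg b)).set a [] = s := by
      rw [← hl]; simp [hl]
      simp [← hl]
    rw [this]
    exact Exec.loop_false (by simp [Test.Holds, hl])
  | cons x l ih =>
    have hbody : Exec E (.seq (.push b true) (.pop a)) s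
        ((s.set b (true :: s.reg b)).set a l) 2 := by
      have := (Exec.push (E := E) b true s).seq (Exec.pop a _)
      rwa [State.set_reg_ne _ _ hab, hl] at this
    have h := Exec.loop_true (E := E) (T := .nonempty a) (s := s)
      (by simp [Test.Holds, hl]) hbody
      (ih (s := (s.set b (true :: s.reg b)).set a l) (by simp))
    refine h.congr ?_ ?_
    · rw [State.set_reg_ne _ _ hab.symm, State.set_comm _ hab, State.set_set, State.set_set,
        State.set_reg_same, List.length_cons, List.replicate_succ', List.append_assoc]
      rfl
    · simp only [List.length_cons]; ring

/-- The input is saved and its length written in unary, which is what the generator expects.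
`Exec.frame` transfers the run of the generator from silent surroundings to the present ones. Moving
its output also sets the clocks. -/
theorem Exec.prelude {E : Env} {c : Cmd} {K h t : ℕ} {x ω : List Bool} {s' : State}
    (hc : c.Internal) (hK : c.bound < K)
    (hrun : Exec Env.silent c (State.init (List.replicate x.length true) []) s' t) :
    Exec E (.prelude c K h) (State.init x ω)
      (embed K (Function.update s'.reg 0 []) (clocks h (2 * baseSize + 4 * (s'.reg 0).length))
        (State.loaded x (s'.reg 0) ω))
      ((5 * x.length + 1) + ((3 * x.length + 1) + (t + ((2 * baseSize * (h + 1) + 1) +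
        ((s'.reg 0).length * (4 * (h + 1) + 5) + 1))))) := by
  have hK0 : 0 < K := by omega
  set s₀ : State := ⟨fun _ => [], ω, fun _ => []⟩ with hs₀
  have hclocks : clocks h 0 = fun _ => [] := by
    funext i; simp [clocks]
  have e0 : State.init x ω = embed K (Function.update (fun _ => []) 0 x) (clocks h 0) s₀ := by
    simp only [State.init, embed, hclocks, hs₀, State.mk.injEq, and_true]
    funext i
    rw [Function.update_apply]
    split_ifs <;> first | rfl | omega
  have d0 : dataReg K 5 ≠ 0 := by simp only [dataReg]; omega
  have y0 : sysReg K 0 ≠ 0 := by simp only [sysReg]; omega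
  have hA := Exec.pourTwo (E := E) (s := State.init x ω) (a := 0) (b := dataReg K 5)
    (c := sysReg K 0) d0.symm y0.symm (sysReg_ne_dataReg K 0 5).symm
  have hx : (State.init x ω).reg 0 = x := by simp [State.init]
  rw [hx, e0, embed_reg_data, embed_reg_sys, embed_set_data, embed_set_sys, embed_set_low hK0,
    Function.update_idem, hclocks] at hA
  have hlow : Function.update (fun _ : ℕ => ([] : List Bool)) 0 [] = fun _ => [] :=
    Function.update_eq_self_iff.2 rfl
  rw [hlow] at hA
  simp only [hs₀, List.append_nil] at hA
  rw [← hs₀] at hA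
  have hB := Exec.unary (E := E) (s := embed K (fun _ => [])
    (Function.update (fun _ => []) 0 x.reverse) (s₀.set 5 x.reverse)) y0
  rw [embed_reg_sys, embed_reg_low hK0, Function.update_self,
    embed_set_low hK0, embed_set_sys, Function.update_idem,
    List.length_reverse, List.append_nil, hlow] at hB
  obtain ⟨u, hC, h1, h2, h3, h4⟩ := hrun.frame (E' := E) hc hK.le (u := embed K
    (Function.update (fun _ => []) 0 (List.replicate x.length true)) (fun _ => [])
      (s₀.set 5 x.reverse)) (fun i hi => embed_reg_low hi)
  have hu : u = embed K s'.reg (clocks h 0) (s₀.set 5 x.reverse) := by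
    obtain ⟨ur, uc, us⟩ := u
    simp only [embed, State.mk.injEq]
    refine ⟨?_, h3, h4⟩
    funext i
    by_cases hi : i < K
    · rw [if_pos hi]; exact h1 i hi
    · refine (h2 i (by omega)).trans ?_
      rw [hclocks]
      simp only [embed, if_neg hi]
  rw [hu] at hC
  have hD := Exec.times_tick (E := E) (K := K) (low := s'.reg) (s := s₀.set 5 x.reverse) h
    (2 * baseSize) 0
  rw [Nat.zero_add] at hD
  have hF := Exec.pourTick (E := E) (K := K) (low := s'.reg) (s := s₀.set 5 x.reverse) hK0 h 6
    (2 * baseSize) _ rfl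
  rw [e0, hclocks]
  refine hA.seq (hB.seq (hC.seq (hD.seq (hF.congr ?_ rfl))))
  simp [State.loaded, State.set, hs₀]

/-- The preparation flips no coins, so the first ready configuration does not depend on `ω`, and the
coins can be counted from there. -/
theorem Prog.run_protocol {E : Env} {N : ℕ} (x desc : List Bool) :
    ∃ s : State, s.Ready N x desc ∧ s.reg 2 = [] ∧ ∀ ω,
      protocol.run E N (State.loaded x desc ω) =
        ((round queryExp).run E N)^[N ^ (queryExp + 6)] (s.withCoins ω) := by
  have hrep : ∀ (k : ℕ) (s : State),
      ((Prog.seq (.push 9 true) (.push 9 true)).run E N)^[k] s =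
        s.set 9 (List.replicate (2 * k) true ++ s.reg 9) := by
    intro k
    induction k with
    | zero => simp
    | succ k ih =>
      intro s
      rw [Function.iterate_succ_apply, ih]
      simp only [Prog.run, State.set_reg_same, State.set_set]
      rw [show 2 * (k + 1) = 2 * k + 1 + 1 by ring, List.replicate_succ', List.replicate_succ']
      simp
  set c : Prog := .seq (.seq (.rev 5 7) (.copy 7 5)) (.seq (.seq (.rev 6 7) (.copy 7 6))
    (.rep (.seq (.push 9 true) (.push 9 true)))) with hc
  have hrun : ∀ s : State, c.run E N s = (((((s.set 7 (s.reg 5).reverse).set 5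
      (s.reg 5).reverse).set 7 (s.reg 6).reverse).set 6 (s.reg 6).reverse).set 9
      (List.replicate (2 * N) true ++ s.reg 9)) := by
    intro s
    have : c.run E N s = ((Prog.seq (.push 9 true) (.push 9 true)).run E N)^[N]
        ((Prog.copy 7 6).run E N ((Prog.rev 6 7).run E N ((Prog.copy 7 5).run E N
          ((Prog.rev 5 7).run E N s)))) := rfl
    rw [this, hrep]
    simp [Prog.run, State.set_reg]
  refine ⟨c.run E N (State.loaded x desc []), ⟨?_, ?_, ?_, fun i hi => ?_⟩, ?_, fun ω => ?_⟩
  · simp [hrun, State.set_reg, State.loaded]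
  · simp [hrun, State.set_reg, State.loaded]
  · simp [hrun, State.loaded]
  · have hi' : 14 ≤ i := (Nat.le_add_left _ _).trans hi
    clear hi
    rw [hrun, State.set_reg_ne _ _ (by omega), State.set_reg_ne _ _ (by omega),
      State.set_reg_ne _ _ (by omega), State.set_reg_ne _ _ (by omega),
      State.set_reg_ne _ _ (by omega)]
    simp only [State.loaded]
    rw [Function.update_of_ne (by omega), Function.update_of_ne (by omega)]
  · simp [hrun, State.set_reg, State.loaded]
  · have : (c.run E N (State.loaded x desc [])).withCoins ω = c.run E N (State.loaded x desc ω) := by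
      rw [← Prog.run_withCoins (by simp [hc, Prog.Coinless])]
      rfl
    rw [this, ← Prog.run_repn, Prog.protocol, ← hc]
    generalize (round queryExp).repn (queryExp + 6) = d
    rfl

/-- The rounds never look beyond their own coins. Supplying more coins, as a common polynomial for
time and coins requires, cannot change the outcome. -/
theorem Prog.iterate_round_append {E : Env} {N e : ℕ} (hN : 0 < N) (k : ℕ) (s : State)
    (l : List Bool) (hl : l.length = k * roundCoins N e) :
    ∃ s' : State, ∀ rest, ((round e).run E N)^[k] (s.withCoins (l ++ rest)) = s'.withCoins rest := by
  induction k generalizing s l with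
  | zero =>
    obtain rfl : l = [] := by simpa using hl
    exact ⟨s, fun _ => rfl⟩
  | succ k ih =>
    rw [Nat.succ_mul] at hl
    obtain ⟨s', h⟩ := ih (s.afterRound E N (l.take (roundCoins N e))) (l.drop (roundCoins N e))
      (by simp [hl])
    refine ⟨s', fun rest => ?_⟩
    rw [Function.iterate_succ_apply, ← h rest, ← Prog.run_round_withCoins (e := e) hN _ _ (by simp [hl]),
      ← List.append_assoc, List.take_append_drop]

theorem QCircuit.le_length_encode {n : ℕ} (C : QCircuit n) :
    C.width + 1 + C.gates.length ≤ C.encode.length := by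
  have h : ∀ gs : List (Gate C.width), gs.length ≤ (gs.flatMap Gate.encode).length := by
    intro gs
    induction gs with
    | nil => simp
    | cons g gs ih =>
      have : 1 ≤ g.encode.length := by cases g <;> simp [Gate.encode, encodeNat]
      simp only [List.length_cons, List.flatMap_cons, List.length_append]
      omega
  have := h C.gates
  simp [QCircuit.encode, encodeNat] at this ⊢
  omega

/-- The value of the clocks for a description of length `d`. -/
def clockSize (d : ℕ) : ℕ := 2 * baseSize + 4 * d

/-- A bound on the running time of the verifier. -/
def verifierTime (n t d : ℕ) : ℕ :=
  8 * n + t + 2 * baseSize * (Prog.protocol.height + 1) + d * (4 * (Prog.protocol.height + 1) + 5) +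
    Prog.protocol.ops (clockSize d) *
      (12 * (clockSize d + Prog.protocol.ops (clockSize d)) + 12) + 8

theorem exec_verifier {E : Env} {c : Cmd} {n t : ℕ} {x ω : List Bool} {C : QCircuit n}
    (hx : x.length = n) (hc : c.Internal) {s' : State}
    (hrun : Exec Env.silent c (State.init (List.replicate n true) []) s' t)
    (hs' : s'.reg 0 = C.encode) :
    ∃ s T, Exec E (verifier c) (State.init x ω) s T ∧ T ≤ verifierTime n t C.encode.length ∧
      ((s.reg 0).head? = some true ↔ (Prog.protocol.run E (clockSize C.encode.length)
        (State.loaded x C.encode ω)).reg 2 = []) := by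
  subst hx
  have h1 := Exec.prelude (E := E) (ω := ω) (h := Prog.protocol.height) hc (Nat.lt_succ_self _) hrun
  rw [hs'] at h1
  set K := c.bound + 1 with hK
  set N := clockSize C.encode.length with hN
  have hlen := C.le_length_encode
  have hle := C.le_width
  obtain ⟨T, hT, h2⟩ := Prog.exec_compile E N K (Function.update s'.reg 0 []) (N + Prog.protocol.ops N)
    Prog.protocol 0 (clocks Prog.protocol.height N) (State.loaded x C.encode ω) N
    (by simp [clocks]) (fun i _ hi => ⟨by simp only [clocks]; rw [if_pos (by omega)],
      by simp only [clocks]; rw [if_neg (by omega)]⟩)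
    (fun r => by
      simp only [State.loaded, Function.update_apply]
      split_ifs <;> simp only [List.length_reverse, List.length_nil, hN, clockSize] <;> omega)
    le_rfl
  set f := Prog.protocol.run E N (State.loaded x C.encode ω) with hf
  have h3 : ∃ s T, Exec E (.ite (.nonempty (dataReg K 2)) .skip (.push 0 true))
      (embed K (Function.update s'.reg 0 []) (clocks Prog.protocol.height N) f) s T ∧ T = 2 ∧
      ((s.reg 0).head? = some true ↔ f.reg 2 = []) := by
    have hK0 : 0 < K := by omega
    by_cases h : f.reg 2 = []
    · refine ⟨_, _, Exec.ite_false (by simp [Test.Holds, h]) (Exec.push _ _ _), rfl, ?_⟩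
      simp [h]
    · refine ⟨_, _, Exec.ite_true (by simp [Test.Holds, h]) (Exec.skip _), rfl, ?_⟩
      rw [embed_reg_low hK0]
      simp [h]
  obtain ⟨s, T', h3, rfl, h4⟩ := h3
  refine ⟨s, _, h1.seq (h2.seq h3), ?_, h4⟩
  simp only [verifierTime, ← hN]
  omega

end OracleComplexity


/-! ### Completeness, soundness and running time of the verifier. -/

namespace OracleComplexity

/-! ### Correctness of the verifier -/

section Clock

variable (d : ℕ)

/-- The clock has to be even: amplitudes are scaled by `2 ^ m`, their squares by `2 ^ (2 m)`, and
the latter is the number of sample points. -/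
theorem clockSize_eq : clockSize d = 2 * (baseSize + 2 * d) := by
  rw [clockSize]; ring

/-- The summand `200` in `baseSize` is there for the constant in `soundness_test`; the other summand
serves `gets_test_lt`. -/
theorem le_clockSize : 400 ≤ clockSize d := by
  rw [clockSize, baseSize]; omega

theorem gets_test_lt : TProg.test.gets (clockSize d) < clockSize d ^ queryExp :=
  TProg.gets_lt _ (by rw [clockSize, baseSize]; omega)

/-- The number of coins that the protocol uses. -/
def protocolCoins : ℕ := clockSize d ^ (queryExp + 6) * roundCoins (clockSize d) queryExp

end Clock

section Protocol

variable {E : Env} {n : ℕ} {C : QCircuit n} {x : List Bool}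

theorem Prog.protocol_complete {F : List Bool → List Bool}
    (h0 : ∀ h m, E.reply 0 (h ++ [m]) = F m) (h1 : ∀ h m, E.reply 1 (h ++ [m]) = F m)
    (hT : ∀ r : List Bool, r.length = clockSize C.encode.length →
      TestOK E.oracle (clockSize C.encode.length)
        (fun m => (F m).take (2 * clockSize C.encode.length)) C x r)
    (ω : List Bool) (hω : protocolCoins C.encode.length ≤ ω.length) :
    (protocol.run E (clockSize C.encode.length) (State.loaded x C.encode ω)).reg 2 = [] := by
  obtain ⟨s, hs, h2, h⟩ := Prog.run_protocol (E := E) (N := clockSize C.encode.length) x C.encode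
  rw [h]
  have hN := le_clockSize C.encode.length
  exact Prog.iterate_round_honest (by omega) (by rw [clockSize]; omega) h0 h1 hT _ s hs h2 ω hω

theorem count_add_le {P : List Bool → Prop} {a b : ℕ}
    (h : ∀ l l' : List Bool, l.length = a → P (l ++ l') → P l) :
    count (a + b) P ≤ count a P * 2 ^ b := by
  classical
  rw [count_add, count_eq_card a, Finset.card_filter, Finset.sum_mul]
  refine Finset.sum_le_sum fun ω _ => ?_
  split_ifs with hω
  · rw [one_mul]
    exact count_le b
  · rw [zero_mul, Nat.le_zero, count]
    have : IsEmpty {l : Fin b → Bool // P (List.ofFn ω ++ List.ofFn l)} :=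
      ⟨fun l => hω (h _ _ (by simp) l.2)⟩
    exact Nat.card_of_isEmpty

/-- A round succeeds in catching with probability at least `1 / D` for `D = 2 * N ^ (e + 4)`: the
factor `N ^ 4` comes from the fraction of failing points, `2 * N ^ e` from guessing the query. -/
theorem Prog.protocol_sound (hC : C.acceptProb E.oracle x ≤ 1 / 3) {m : ℕ}
    (hm : protocolCoins C.encode.length ≤ m) :
    3 * count m (fun ω => (protocol.run E (clockSize C.encode.length)
      (State.loaded x C.encode ω)).reg 2 = []) ≤ 2 ^ m := by
  obtain ⟨s, hs, -, h⟩ := Prog.run_protocol (E := E) (N := clockSize C.encode.length) x C.encode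
  simp only [h]
  obtain ⟨b, rfl⟩ := Nat.exists_eq_add_of_le hm
  have hlen := C.le_length_encode
  have hN := le_clockSize C.encode.length
  have hgets := gets_test_lt C.encode.length
  have hNm := clockSize_eq C.encode.length
  rw [protocolCoins]
  have hNd : 4 * C.encode.length ≤ clockSize C.encode.length := by rw [clockSize]; omega
  generalize clockSize C.encode.length = N at *
  generalize queryExp = e at *
  set R := N ^ (e + 6) with hR
  set a := R * roundCoins N e with ha
  have hN0 : 0 < N := by omega
  have h1 := count_add_le (a := a) (b := b)
    (P := fun ω => (((round e).run E N)^[R] (s.withCoins ω)).reg 2 = []) fun l l' hl hP => by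
      obtain ⟨s', h'⟩ := Prog.iterate_round_append (E := E) hN0 R s l hl
      have e' := h' []
      rw [List.append_nil] at e'
      rw [h' l'] at hP
      rw [e']
      exact hP
  have hD : 0 < 2 * N ^ (e + 4) := by positivity
  have h2 := count_survivors (E := E) (x := x) (C := C) (2 * N ^ (e + 4)) hN0
    (fun s hs => le_count_caught hs hC hNm hN (by omega) (by omega) hgets) R s hs
  -- The exponent `e + 6` in the number of rounds gives `R = N ^ 2 * N ^ (e + 4) ≥ 4 * N ^ (e + 4)`,
  -- twice the reciprocal catching probability.
  have h3 : 3 * (2 * N ^ (e + 4) - 1) ^ R ≤ (2 * N ^ (e + 4)) ^ R := by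
    refine three_mul_pow_le hD ?_
    calc 2 * (2 * N ^ (e + 4)) = N ^ (e + 4) * 2 ^ 2 := by ring
      _ ≤ N ^ (e + 4) * N ^ 2 :=
        Nat.mul_le_mul_left _ (Nat.pow_le_pow_left (show 2 ≤ N by omega) 2)
      _ = R := by rw [hR]; ring
  have h4 : 3 * count a (fun ω => (((round e).run E N)^[R] (s.withCoins ω)).reg 2 = []) ≤
      2 ^ a := by
    refine Nat.le_of_mul_le_mul_left ?_ (pow_pos hD R)
    calc _ = 3 * ((2 * N ^ (e + 4)) ^ R * count a (fun ω =>
          (((round e).run E N)^[R] (s.withCoins ω)).reg 2 = [])) := by ring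
      _ ≤ 3 * ((2 * N ^ (e + 4) - 1) ^ R * 2 ^ a) := Nat.mul_le_mul_left _ h2
      _ = 3 * (2 * N ^ (e + 4) - 1) ^ R * 2 ^ a := by ring
      _ ≤ _ := Nat.mul_le_mul_right _ h3
  calc _ ≤ 3 * (count a (fun ω => (((round e).run E N)^[R] (s.withCoins ω)).reg 2 = []) *
        2 ^ b) := Nat.mul_le_mul_left _ h1
    _ = 3 * count a (fun ω => (((round e).run E N)^[R] (s.withCoins ω)).reg 2 = []) *
        2 ^ b := by ring
    _ ≤ 2 ^ a * 2 ^ b := Nat.mul_le_mul_right _ h4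
    _ = 2 ^ (a + b) := (pow_add _ _ _).symm

end Protocol

/-! ### Resource bounds -/

section Bounds

variable (p : Polynomial ℕ)

/-- A bound on the value of the clocks. -/
noncomputable def clockPoly : Polynomial ℕ :=
  4 * (Polynomial.X + p) + Polynomial.C (2 * baseSize)

noncomputable def timePoly : Polynomial ℕ :=
  8 * Polynomial.X + p + Polynomial.C (2 * baseSize * (Prog.protocol.height + 1)) +
    (Polynomial.X + p) * Polynomial.C (4 * (Prog.protocol.height + 1) + 5) +
    Prog.protocol.opsPoly.comp (clockPoly p) *
      (12 * (clockPoly p + Prog.protocol.opsPoly.comp (clockPoly p)) + 12) + 8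

noncomputable def coinPoly : Polynomial ℕ :=
  clockPoly p ^ (queryExp + 6) * (clockPoly p + clockPoly p ^ queryExp)

variable {p} {n t d : ℕ}

theorem clockSize_le (hd : d ≤ n + p.eval n) : clockSize d ≤ (clockPoly p).eval n := by
  simp only [clockSize, clockPoly, Polynomial.eval_add, Polynomial.eval_mul, Polynomial.eval_X,
    Polynomial.eval_C, Polynomial.eval_ofNat]
  omega

theorem verifierTime_le (ht : t ≤ p.eval n) (hd : d ≤ n + p.eval n) :
    verifierTime n t d ≤ (timePoly p).eval n := by
  have h := clockSize_le hd
  have h' : Prog.protocol.ops (clockSize d) ≤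
      Prog.protocol.opsPoly.eval ((clockPoly p).eval n) := by
    rw [← Prog.eval_opsPoly]
    exact eval_mono_nat _ h
  simp only [verifierTime, timePoly, Polynomial.eval_add, Polynomial.eval_mul, Polynomial.eval_X,
    Polynomial.eval_C, Polynomial.eval_ofNat, Polynomial.eval_comp]
  gcongr

theorem rounds_mul_coins_le {N M : ℕ} (e : ℕ) (h : N ≤ M) :
    N ^ (e + 6) * roundCoins N e ≤ M ^ (e + 6) * (M + M ^ e) := by
  have h1 : (N ^ e).size ≤ N ^ e := Nat.size_le.2 Nat.lt_two_pow_self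
  rw [roundCoins]
  gcongr
  exact h1.trans (Nat.pow_le_pow_left h _)

theorem protocolCoins_le (hd : d ≤ n + p.eval n) : protocolCoins d ≤ (coinPoly p).eval n := by
  have h := rounds_mul_coins_le queryExp (clockSize_le hd)
  rwa [protocolCoins, coinPoly, Polynomial.eval_mul, Polynomial.eval_add, Polynomial.eval_pow,
    Polynomial.eval_pow]

end Bounds

theorem BQP_subset_MIP (O : Oracle) : BQP O ⊆ MIP O := by
  rintro L ⟨C, ⟨c, p, hc, hgen⟩, hyes, hno⟩
  -- The description is written bit by bit, so the running time of the generator bounds its length.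
  have hlen : ∀ n, (C n).encode.length ≤ n + p.eval n := by
    intro n
    obtain ⟨s, t, hs, ht, hr⟩ := hgen n
    rw [← hr]
    refine (hs.length_le hc (B := n) (fun r => ?_) 0).trans (by omega)
    simp only [State.init, Function.update_apply]
    split_ifs <;> simp
  have hrun : ∀ (x : List Bool) (P : Fin 2 → Prover) (ω : List Bool),
      ∃ s T, Exec ⟨O, x, 2, P⟩ (verifier c) (State.init x ω) s T ∧
        T ≤ (timePoly p).eval x.length ∧ ((s.reg 0).head? = some true ↔
          (Prog.protocol.run ⟨O, x, 2, P⟩ (clockSize (C x.length).encode.length)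
            (State.loaded x (C x.length).encode ω)).reg 2 = []) := by
    intro x P ω
    obtain ⟨s, t, hs, ht, hr⟩ := hgen x.length
    obtain ⟨u, T, h1, h2, h3⟩ := exec_verifier (E := ⟨O, x, 2, P⟩) (ω := ω) rfl hc hs hr
    exact ⟨u, T, h1, h2.trans (verifierTime_le ht (hlen _)), h3⟩
  have hacc : ∀ (x : List Bool) (P : Fin 2 → Prover) (ω : List Bool),
      Accepts O (verifier c) P x ω ↔
        (Prog.protocol.run ⟨O, x, 2, P⟩ (clockSize (C x.length).encode.length)
          (State.loaded x (C x.length).encode ω)).reg 2 = [] := by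
    intro x P ω
    obtain ⟨s, T, h1, -, h3⟩ := hrun x P ω
    rw [← h3]
    refine ⟨?_, fun h => ⟨s, T, h1, h⟩⟩
    rintro ⟨s', t', h, hs'⟩
    rwa [(h1.det h).1]
  have hprob : ∀ (x : List Bool) (P : Fin 2 → Prover) (m : ℕ),
      acceptProb O (verifier c) P x m = (count m fun ω =>
        (Prog.protocol.run ⟨O, x, 2, P⟩ (clockSize (C x.length).encode.length)
          (State.loaded x (C x.length).encode ω)).reg 2 = [] : ℕ) / 2 ^ m := by
    intro x P m
    simp only [acceptProb, count, hacc]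
  have hcoins : ∀ n, protocolCoins (C n).encode.length ≤ (timePoly p + coinPoly p).eval n := by
    intro n
    rw [Polynomial.eval_add]
    exact (protocolCoins_le (hlen n)).trans (Nat.le_add_left _ _)
  -- One polynomial must bound the time and provide the coins; the sum does both.
  refine ⟨verifier c, 2, timePoly p + coinPoly p, fun x P ω => ?_, ?_, fun x hx P => ?_⟩
  · obtain ⟨s, T, h1, h2, -⟩ := hrun x P (List.ofFn ω)
    refine ⟨s, T, h1, h2.trans ?_⟩
    rw [Polynomial.eval_add]
    exact Nat.le_add_right _ _
  · have hF : ∀ x : List Bool, ∃ F : List Bool → List Bool, x ∈ L.yes →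
        ∀ r : List Bool, r.length = clockSize (C x.length).encode.length →
          TestOK O (clockSize (C x.length).encode.length)
            (fun m => (F m).take (2 * clockSize (C x.length).encode.length)) (C x.length) x r := by
      intro x
      by_cases hx : x ∈ L.yes
      · have := (C x.length).le_length_encode
        obtain ⟨F, h⟩ := completeness_test (O := O)
          (m := baseSize + 2 * (C x.length).encode.length) (C x.length) x (hyes x hx)
          (by rw [baseSize]; omega) (by omega)
        exact ⟨F, fun _ => by rw [clockSize_eq]; exact h⟩
      · exact ⟨fun _ => [], fun h => absurd h hx⟩
    choose F hF using hF
    -- Both honest provers answer the latest message from the same table and ignore the history, so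
    -- every cross-check agrees.
    refine ⟨fun _ x h => F x (h.getLast?.getD []), fun x hx => ?_⟩
    rw [hprob]
    set m := (timePoly p + coinPoly p).eval x.length with hm
    have : 2 ^ m ≤ count m fun ω => (Prog.protocol.run
        ⟨O, x, 2, fun _ x h => F x (h.getLast?.getD [])⟩ (clockSize (C x.length).encode.length)
          (State.loaded x (C x.length).encode ω)).reg 2 = [] := by
      rw [← count_true]
      refine count_mono fun ω hω _ => Prog.protocol_complete (F := F x) ?_ ?_ (hF x hx) ω ?_
      · intro h m
        simp [Env.reply]
      · intro h m
        simp [Env.reply]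
      · rw [hω]
        exact hcoins _
    rw [le_div_iff₀ (by positivity)]
    refine le_trans ?_ (Nat.cast_le.2 this)
    have : (0 : ℝ) < 2 ^ m := by positivity
    push_cast
    linarith
  · rw [hprob, div_le_iff₀ (by positivity)]
    have h := Prog.protocol_sound (E := ⟨O, x, 2, P⟩) (hno x hx) (hcoins x.length)
    have h' := (Nat.cast_le (α := ℝ)).2 h
    push_cast at h'
    linarith

end OracleComplexity


theorem mainTheorem2 (O : OracleComplexity.Oracle) :
    OracleComplexity.BQP O ⊆ OracleComplexity.MIP O :=
  OracleComplexity.BQP_subset_MIP O
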